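/- **Setting.** Let $I=(t_0,t_f)$ be a bounded open interval, $y=(x,u,p)\in\mathbb R^{n_y}:=\mathbb R^{n_x}\times\mathbb R^{n_u}\times\mathbb R^{n_p}$, and $$\mathcal Y^\infty=W^{1,\infty}(I)^{n_x}\times L^\infty(I)^{n_u}\times\mathbb R^{n_p},\qquad \mathcal Z^\infty=\mathcal Y^\infty\times W^{1,\infty}(I)^{n_x}.$$ Let $\mathcal G^3(I)^{n_g}$ be the space of functions $g:I\times\mathbb R^{n_y}\to\mathbb R^{n_g}$ that are three times continuously differentiable in $y$ for a.a. $t$, measurable in $t$ for each $y$, and have finite norm $\|g\|=\sum_{n=0}^3\operatorname{ess\,sup}_{t\in I}\sup_{y}\|\partial_y^n g(t,y)\|$ (functions that agree for a.a. $t$ and all $y$ are identified). Call a function $h(t,v)$, $v=(x,u,p,g)\in\mathbb R^{n_y}\times\mathbb R^{n_g}$, *smooth* if it is measurable in $t$ for each $v$, twice continuously differentiable in $v$ for a.a. $t$, if there is $K$ with $\|\partial_v^s h(t,0)\|\le K$ for a.a. $t$ and $s=0,1,2$, and if for each $R>0$ there is $L(R)$ with $\|\partial_v^s h(t,v_1)-\partial_v^s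 h(t,v_2)\|\le L(R)\|v_1-v_2\|$ for $s=0,1,2$, a.a. $t$ and all $v_1,v_2$ in the closed ball of radius $R$ around $0$. For $y=(x,u,p)\in\mathcal Y^\infty$ write $y(t)=(x(t),u(t),p)$; for $h=h(t,y,g)$ and a component function $g$ let $h[t]=h(t,y(t),g(t,y(t)))$, $g[t]=g(t,y(t))$, with the corresponding notation for partial derivatives, and $\phi[t_f]=\phi(x(t_f),p)$. **Theorem, part 1.** Let $\phi:\mathbb R^{n_x}\times\mathbb R^{n_p}\to\mathbb R$ be twice continuously differentiable and let $\ell$ be smooth and real-valued. Then $$q(x,u,p;g)=\phi(x(t_f),p)+\int_{t_0}^{t_f}\ell\big(t,y(t),g(t,y(t))\big)\,dt$$ is well defined and continuously Fréchet differentiable on $\mathcal Y^\infty\times\mathcal G^3(I)^{n_g}$, and $$\begin{aligned}q'(x,u,p;g)(\delta x,\delta u,\delta p,\delta g)={}&\nabla_x\phi[t_f]^T\delta x(t_f)+\nabla_p\phi[t_f]^T\delta p+\int_{t_0}^{t_f}\Big((\nabla_x\ell[t]+g_x[t]^T\nabla_g\ell[t])^T\delta x(t)\\&+(\nabla_u\ell[t]+g_u[t]^T\nabla_g\ell[t])^T\delta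 u(t)+(\nabla_p\ell[t]+g_p[t]^T\nabla_g\ell[t])^T\delta p+\nabla_g\ell[t]^T\delta g[t]\Big)dt .\end{aligned}$$ **Part 2.** In addition consider the optimal control problem, with component function $g$, $$\min_{(x,u,p)\in\mathcal Y^\infty}\ \varphi(x(t_f),p)+\int_{t_0}^{t_f}l(t,y(t),g(t,y(t)))\,dt\quad\text{s.t.}\quad x'(t)=f(t,y(t),g(t,y(t)))\ \text{a.e. in } I,\quad x(t_0)=x_0,\tag{OCP}$$ where $\varphi$ is twice continuously differentiable, and $l$ (real-valued) and $f$ ($\mathbb R^{n_x}$-valued) are smooth. Let $H(t,y,g,\lambda)=l(t,y,g)+\lambda^Tf(t,y,g)$. The optimality system $\psi(x,u,p,\lambda;g)=0$ consists of the two constraints of (OCP) and $$\begin{aligned}&\lambda'(t)=-(f_x+f_gg_x)[t]^T\lambda(t)-(\nabla_xl+g_x^T\nabla_gl)[t],\qquad \lambda(t_f)=\nabla_x\varphi[t_f],\\&0=(f_u+f_gg_u)[t]^T\lambda(t)+(\nabla_ul+g_u^T\nabla_gl)[t],\\&0=\nabla_p\varphi[t_f]+\int_{t_0}^{t_f}\big((f_p+f_gg_p)[t]^T\lambda(t)+(\nabla_pl+g_p^T\nabla_gl)[t]\big)dt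 .\end{aligned}$$ Let $\bar z=(\bar x,\bar u,\bar p,\bar\lambda)\in\mathcal Z^\infty$ and $\bar g\in\mathcal G^3(I)^{n_g}$ satisfy $\psi(\bar z;\bar g)=0$. Along $(\bar z,\bar g)$ put $A=f_x+f_gg_x$, $B=f_u+f_gg_u$, $C=f_p+f_gg_p$, $d=\nabla_gH$, and for $v,w\in\{x,u,p\}$ $$H_{vw}=\nabla^2_{vw}H+\nabla^2_{vg}H\,g_w+g_v^T\nabla^2_{gw}H+g_v^T\nabla^2_{gg}H\,g_w+\sum_k(\partial_{g_k}H)\,\nabla^2_{vw}g_k,\qquad H_{vg}=\nabla^2_{vg}H+g_v^T\nabla^2_{gg}H$$ (on the right $H$ is differentiated with $y,g,\lambda$ as independent variables; so $H_{vw}[t]$ are the blocks of the second derivative of $y\mapsto H(t,y,\bar g(t,y),\bar\lambda(t))$ at $\bar y(t)$). Assume: (i) the Hessian of $\varphi$ at $(\bar x(t_f),\bar p)$ is positive semidefinite; (ii) there is $\varepsilon>0$ such that $\int_{t_0}^{t_f}\delta y(t)^T(H_{vw}[t])_{v,w\in\{x,u,p\}}\,\delta y(t)\,dt\ge\varepsilon\big(\|\delta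 x\|_{L^2}^2+\|\delta u\|_{L^2}^2+\|\delta p\|^2\big)$ for all $\delta y=(\delta x,\delta u,\delta p)\in W^{1,2}(I)^{n_x}\times L^2(I)^{n_u}\times\mathbb R^{n_p}$ with $\delta x'=A\delta x+B\delta u+C\delta p$ a.e. and $\delta x(t_0)=0$; (iii) $H_{uu}[t]^{-1}$ exists for a.a. $t$ and is essentially bounded. Then there are open neighborhoods $N(\bar g)$ of $\bar g$ and $N(\bar z)$ of $\bar z$ such that for every $g\in N(\bar g)$ there is exactly one $z(g)=(x(g),u(g),p(g),\lambda(g))\in N(\bar z)$ with $\psi(z(g);g)=0$; moreover $z(\bar g)=\bar z$, the map $z$ is continuously Fréchet differentiable on $N(\bar g)$, $(x(g),u(g),p(g))$ is a local solution in $\mathcal Y^\infty$ of (OCP) with component function $g$, and the reduced quantity of interest $$\tilde q(g):=q\big(x(g),u(g),p(g);g\big)$$ is continuously Fréchet differentiable on $N(\bar g)$. For each $\delta g\in\mathcal G^3(I)^{n_g}$, $$\tilde q_g(\bar g)\,\delta g=q'(\bar x,\bar u,\bar p;\bar g)(\delta x,\delta u,\delta p,\delta g),$$ where $(\delta x,\delta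 u,\delta p,\delta\lambda)=z_g(\bar g)\,\delta g\in\mathcal Z^\infty$ is the unique solution in $\mathcal Z^\infty$ of $$\begin{aligned}&\delta x'=A\delta x+B\delta u+C\delta p+f_g[t]\,\delta g[t],\qquad\delta x(t_0)=0,\\&\delta\lambda'=-A^T\delta\lambda-H_{xx}\delta x-H_{xu}\delta u-H_{xp}\delta p-H_{xg}\,\delta g[t]-\delta g_x[t]^Td,\\&\delta\lambda(t_f)=\nabla^2_{xx}\varphi[t_f]\,\delta x(t_f)+\nabla^2_{xp}\varphi[t_f]\,\delta p,\\&H_{ux}\delta x+H_{uu}\delta u+H_{up}\delta p+B^T\delta\lambda=-H_{ug}\,\delta g[t]-\delta g_u[t]^Td,\\&\nabla^2_{px}\varphi[t_f]\,\delta x(t_f)+\nabla^2_{pp}\varphi[t_f]\,\delta p+\int_{t_0}^{t_f}\big(H_{px}\delta x+H_{pu}\delta u+H_{pp}\delta p+C^T\delta\lambda\big)dt=-\int_{t_0}^{t_f}\big(H_{pg}\,\delta g[t]+\delta g_p[t]^Td\big)dt .\end{aligned}$$ -/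

import Mathlib

open MeasureTheory Set Filter Topology
open scoped ENNReal RealInnerProductSpace

noncomputable section

namespace OCPSens

/-- A bounded open time interval `I = (t₀, tf)`. -/
structure TimeInterval where
  /-- initial time -/
  t₀ : ℝ
  /-- final time -/
  tf : ℝ
  lt : t₀ < tf

/-- Lebesgue measure on `I`. -/
abbrev TimeInterval.μ (I : TimeInterval) : Measure ℝ := volume.restrict (Ioo I.t₀ I.tf)

/-- `ℝⁿ` with the Euclidean norm. -/
abbrev E (n : ℕ) := EuclideanSpace ℝ (Fin n)

/-- State-control-parameter triples `y = (x, u, p)`. -/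
abbrev YVec (nx nu np : ℕ) := E nx × E nu × E np

/-! ### Sobolev spaces on `I` -/

/-- `v` is the weak derivative of `x` on the open interval `I`. -/
def IsWeakDeriv (I : TimeInterval) {n : ℕ} (x v : ℝ → E n) : Prop :=
  ∀ η : ℝ → ℝ, ContDiff ℝ ((⊤ : ℕ∞) : WithTop ℕ∞) η → HasCompactSupport η → tsupport η ⊆ Ioo I.t₀ I.tf →
    ∫ t, deriv η t • x t ∂I.μ = -∫ t, η t • v t ∂I.μ

theorem integrable_smul_of_test (I : TimeInterval) {n : ℕ} {η : ℝ → ℝ} (hη : Continuous η)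
    (hc : HasCompactSupport η) {v : ℝ → E n} (hv : Integrable v I.μ) :
    Integrable (fun t => η t • v t) I.μ := by
  obtain ⟨C, hC⟩ := hη.bounded_above_of_compact_support hc
  exact hv.bdd_smul C hη.aestronglyMeasurable (Eventually.of_forall hC)

theorem integrable_extend (I : TimeInterval) {n : ℕ} (x : C(Icc I.t₀ I.tf, E n)) :
    Integrable (IccExtend I.lt.le x) I.μ := by
  have h : Continuous (IccExtend I.lt.le x) := x.continuous.Icc_extend'
  exact (h.integrableOn_Icc (a := I.t₀) (b := I.tf)).mono_set Ioo_subset_Icc_self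

/-- The space `W^{1,p}(I)ⁿ`. An element is a pair `(x, v)` of the continuous representative
`x : [t₀, tf] → ℝⁿ` of a Sobolev function and of its weak derivative `v ∈ L^p(I)ⁿ`; the norm
is `max (sup |x|) ‖v‖_{L^p}`. -/
def sobolev (I : TimeInterval) (p : ℝ≥0∞) [Fact (1 ≤ p)] (n : ℕ) :
    Submodule ℝ (C(Icc I.t₀ I.tf, E n) × Lp (E n) p I.μ) where
  carrier := {z | IsWeakDeriv I (IccExtend I.lt.le z.1) z.2}
  zero_mem' := by
    intro η _ _ _
    have h0 : (fun t => η t • ((0 : Lp (E n) p I.μ) : ℝ → E n) t) =ᵐ[I.μ] fun _ => 0 := by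
      filter_upwards [Lp.coeFn_zero (E n) p I.μ] with t ht
      rw [ht, Pi.zero_apply, smul_zero]
    rw [show ((0 : C(Icc I.t₀ I.tf, E n) × Lp (E n) p I.μ)).2 = 0 from rfl, integral_congr_ae h0]
    simp [IccExtend]
  add_mem' := by
    intro a b ha hb η h1 h2 h3
    have hd := h1.continuous_deriv (by simp)
    have e1 : (fun t => deriv η t • IccExtend I.lt.le (a + b).1 t) = fun t =>
        deriv η t • IccExtend I.lt.le a.1 t + deriv η t • IccExtend I.lt.le b.1 t := by
      funext t; simp [IccExtend]
    have e2 : (fun t => η t • ((a + b).2 : ℝ → E n) t) =ᵐ[I.μ] fun t =>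
        η t • (a.2 : ℝ → E n) t + η t • (b.2 : ℝ → E n) t := by
      filter_upwards [Lp.coeFn_add a.2 b.2] with t ht
      rw [Prod.snd_add, ht, Pi.add_apply, smul_add]
    have hi : ∀ c : Lp (E n) p I.μ, Integrable c I.μ := fun c =>
      (Lp.memLp c).integrable Fact.out
    rw [e1, integral_congr_ae e2,
      integral_add (integrable_smul_of_test I hd h2.deriv (integrable_extend I _))
        (integrable_smul_of_test I hd h2.deriv (integrable_extend I _)),
      integral_add (integrable_smul_of_test I h1.continuous h2 (hi _))
        (integrable_smul_of_test I h1.continuous h2 (hi _)), ha η h1 h2 h3, hb η h1 h2 h3]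
    abel
  smul_mem' := by
    intro c a ha η h1 h2 h3
    have e1 : (fun t => deriv η t • IccExtend I.lt.le (c • a).1 t) = fun t =>
        c • (deriv η t • IccExtend I.lt.le a.1 t) := by
      funext t; exact smul_comm (deriv η t) c (IccExtend I.lt.le a.1 t)
    have e2 : (fun t => η t • ((c • a).2 : ℝ → E n) t) =ᵐ[I.μ] fun t =>
        c • (η t • (a.2 : ℝ → E n) t) := by
      filter_upwards [Lp.coeFn_smul c a.2] with t ht
      rw [Prod.smul_snd, ht, Pi.smul_apply, smul_comm]
    rw [e1, integral_congr_ae e2, integral_smul, integral_smul, ha η h1 h2 h3, smul_neg]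

/-- `W^{1,p}(I)ⁿ` as a type. -/
abbrev W1 (I : TimeInterval) (p : ℝ≥0∞) [Fact (1 ≤ p)] (n : ℕ) : Type := sobolev I p n

namespace W1

variable {I : TimeInterval} {p : ℝ≥0∞} [Fact (1 ≤ p)] {n : ℕ}

/-- The values `x(t)` (extended by constants outside `[t₀, tf]`). -/
def val (x : W1 I p n) : ℝ → E n := IccExtend I.lt.le x.1.1

/-- The weak derivative `x'(t)`. -/
def der (x : W1 I p n) : ℝ → E n := x.1.2

end W1

/-- `L^p(I)ⁿ`. -/
abbrev LSp (I : TimeInterval) (p : ℝ≥0∞) (n : ℕ) := Lp (E n) p I.μ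

/-- `W^{1,p}(I)^{nx} × L^p(I)^{nu} × ℝ^{np}`. -/
abbrev YSp (I : TimeInterval) (p : ℝ≥0∞) [Fact (1 ≤ p)] (nx nu np : ℕ) :=
  W1 I p nx × LSp I p nu × E np

/-- `W^{1,∞}(I)^{nx} × L^∞(I)^{nu} × ℝ^{np} × W^{1,∞}(I)^{nx}`; elements are
`(x, u, p, λ)`. -/
abbrev ZSp (I : TimeInterval) (nx nu np : ℕ) :=
  W1 I ⊤ nx × LSp I ⊤ nu × E np × W1 I ⊤ nx

/-- `y(t) = (x(t), u(t), p)`. -/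
def traj {I : TimeInterval} {p : ℝ≥0∞} [Fact (1 ≤ p)] {nx nu np : ℕ}
    (y : YSp I p nx nu np) (t : ℝ) : YVec nx nu np :=
  (y.1.val t, y.2.1 t, y.2.2)

/-- `(x(tf), p)`. -/
def final {I : TimeInterval} {p : ℝ≥0∞} [Fact (1 ≤ p)] {nx nu np : ℕ}
    (y : YSp I p nx nu np) : E nx × E np :=
  (y.1.val I.tf, y.2.2)

/-- The part `(x, u, p)` of `(x, u, p, λ)`. -/
def ZSp.y {I : TimeInterval} {nx nu np : ℕ} (z : ZSp I nx nu np) : YSp I ⊤ nx nu np :=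
  (z.1, z.2.1, z.2.2.1)

/-- The part `λ` of `(x, u, p, λ)`. -/
def ZSp.lam {I : TimeInterval} {nx nu np : ℕ} (z : ZSp I nx nu np) : W1 I ⊤ nx :=
  z.2.2.2

/-! ### The space of component functions -/

section GSpace

variable {Y F : Type} [NormedAddCommGroup Y] [NormedSpace ℝ Y]
  [NormedAddCommGroup F] [NormedSpace ℝ F]

/-- `∑_{n ≤ s} esssup_{t ∈ I} sup_y ‖∂ⁿg(t, y)/∂yⁿ‖`, with values in `[0, ∞]`. -/
def gNorm (I : TimeInterval) (s : ℕ) (g : ℝ → Y → F) : ℝ≥0∞ :=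
  ∑ n ∈ Finset.range (s + 1), essSup (fun t => ⨆ y, ‖iteratedFDeriv ℝ n (g t) y‖ₑ) I.μ

theorem gNorm_add_le (I : TimeInterval) (s : ℕ) {g h : ℝ → Y → F}
    (hg : ∀ᵐ t ∂I.μ, ContDiff ℝ s (g t)) (hh : ∀ᵐ t ∂I.μ, ContDiff ℝ s (h t)) :
    gNorm I s (g + h) ≤ gNorm I s g + gNorm I s h := by
  unfold gNorm
  rw [← Finset.sum_add_distrib]
  refine Finset.sum_le_sum fun n hn => ?_
  refine le_trans (essSup_mono_ae ?_) (ENNReal.essSup_add_le _ _)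
  filter_upwards [hg, hh] with t h1 h2
  have hns : (n : WithTop ℕ∞) ≤ s := by
    exact_mod_cast Nat.lt_succ_iff.1 (Finset.mem_range.1 hn)
  refine iSup_le fun y => ?_
  rw [Pi.add_apply, iteratedFDeriv_add (h1.of_le hns) (h2.of_le hns), Pi.add_apply, Pi.add_apply]
  have h3 := enorm_add_le (iteratedFDeriv ℝ n (g t) y) (iteratedFDeriv ℝ n (h t) y)
  refine h3.trans (add_le_add ?_ ?_)
  · exact le_iSup (fun y => ‖iteratedFDeriv ℝ n (g t) y‖ₑ) y
  · exact le_iSup (fun y => ‖iteratedFDeriv ℝ n (h t) y‖ₑ) y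

theorem gNorm_smul (I : TimeInterval) (s : ℕ) {g : ℝ → Y → F}
    (hg : ∀ᵐ t ∂I.μ, ContDiff ℝ s (g t)) (c : ℝ) :
    gNorm I s (c • g) = ‖c‖ₑ * gNorm I s g := by
  unfold gNorm
  rw [Finset.mul_sum]
  refine Finset.sum_congr rfl fun n hn => ?_
  rw [← ENNReal.essSup_const_mul]
  refine essSup_congr_ae ?_
  filter_upwards [hg] with t h1
  have hns : (n : WithTop ℕ∞) ≤ s := by
    exact_mod_cast Nat.lt_succ_iff.1 (Finset.mem_range.1 hn)
  rw [ENNReal.mul_iSup]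
  refine iSup_congr fun y => ?_
  rw [Pi.smul_apply, iteratedFDeriv_const_smul_apply (h1.of_le hns).contDiffAt, enorm_smul]

variable (Y F) in
/-- Functions `g : I × Y → F` that are `s` times continuously differentiable in `y` for
a.a. `t`, measurable in `t` for every `y`, and of finite norm. -/
def gFun (I : TimeInterval) (s : ℕ) : Submodule ℝ (ℝ → Y → F) where
  carrier := {g | (∀ᵐ t ∂I.μ, ContDiff ℝ s (g t)) ∧
    (∀ y, AEStronglyMeasurable (fun t => g t y) I.μ) ∧ gNorm I s g < ⊤}
  zero_mem' := by
    refine ⟨Eventually.of_forall fun t => contDiff_const, fun y => aestronglyMeasurable_const, ?_⟩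
    have h := gNorm_smul (Y := Y) (F := F) I s (g := 0)
      (Eventually.of_forall fun t => contDiff_const) 0
    rw [zero_smul] at h
    rw [h]
    simp
  add_mem' := by
    rintro a b ⟨a1, a2, a3⟩ ⟨b1, b2, b3⟩
    refine ⟨?_, fun y => (a2 y).add (b2 y),
      (gNorm_add_le I s a1 b1).trans_lt (ENNReal.add_lt_top.2 ⟨a3, b3⟩)⟩
    filter_upwards [a1, b1] with t h1 h2 using h1.add h2
  smul_mem' := by
    rintro c a ⟨a1, a2, a3⟩
    refine ⟨?_, fun y => (a2 y).const_smul c, ?_⟩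
    · filter_upwards [a1] with t h1 using h1.const_smul c
    · rw [gNorm_smul I s a1]
      exact ENNReal.mul_lt_top enorm_lt_top a3

variable (Y F) in
/-- The type of the functions in `gFun`; it carries only the norm defined below. -/
def GPre (I : TimeInterval) (s : ℕ) : Type := gFun Y F I s

instance (I : TimeInterval) (s : ℕ) : AddCommGroup (GPre Y F I s) :=
  inferInstanceAs (AddCommGroup (gFun Y F I s))

instance (I : TimeInterval) (s : ℕ) : Module ℝ (GPre Y F I s) :=
  inferInstanceAs (Module ℝ (gFun Y F I s))

instance (I : TimeInterval) (s : ℕ) : Norm (GPre Y F I s) :=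
  ⟨fun g => (gNorm I s g.1).toReal⟩

theorem GPre.core (I : TimeInterval) (s : ℕ) : SeminormedSpace.Core ℝ (GPre Y F I s) where
  norm_nonneg _ := ENNReal.toReal_nonneg
  norm_smul c g := by
    change (gNorm I s (c • g.1)).toReal = ‖c‖ * (gNorm I s g.1).toReal
    rw [gNorm_smul I s g.2.1, ENNReal.toReal_mul, toReal_enorm]
  norm_triangle g h := by
    change (gNorm I s (g.1 + h.1)).toReal ≤ (gNorm I s g.1).toReal + (gNorm I s h.1).toReal
    rw [← ENNReal.toReal_add g.2.2.2.ne h.2.2.2.ne]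
    exact ENNReal.toReal_mono (ENNReal.add_lt_top.2 ⟨g.2.2.2, h.2.2.2⟩).ne
      (gNorm_add_le I s g.2.1 h.2.1)

instance (I : TimeInterval) (s : ℕ) : SeminormedAddCommGroup (GPre Y F I s) :=
  SeminormedAddCommGroup.ofCore (GPre.core I s)

instance (I : TimeInterval) (s : ℕ) : NormedSpace ℝ (GPre Y F I s) where
  norm_smul_le c g := ((GPre.core I s).norm_smul c g).le

variable (Y F) in
/-- The normed space `𝒢ˢ(I)` of component functions; functions at distance zero, i.e. that
agree for a.a. `t` and all `y`, are identified. -/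
abbrev GSp (I : TimeInterval) (s : ℕ) : Type := SeparationQuotient (GPre Y F I s)

/-- A representative `(t, y) ↦ g(t, y)`. -/
def GSp.rep {I : TimeInterval} {s : ℕ} (g : GSp Y F I s) : ℝ → Y → F :=
  (Function.surjInv SeparationQuotient.surjective_mk g).1

end GSpace

/-- `𝒢³(I)^{ng}` over the state-control-parameter space. -/
abbrev G3 (I : TimeInterval) (nx nu np ng : ℕ) := GSp (YVec nx nu np) (E ng) I 3

/-! ### Smoothness of the data -/

/-- Smoothness of a function `h(t, v)` with `v = (x, u, p, g)`: measurable in `t`, twice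
continuously differentiable in `v`, with derivatives of order `0, 1, 2` that are bounded at
`v = 0` and Lipschitz on balls, uniformly in `t`. -/
structure Smooth (I : TimeInterval) {V F : Type} [NormedAddCommGroup V] [NormedSpace ℝ V]
    [NormedAddCommGroup F] [NormedSpace ℝ F] (h : ℝ → V → F) : Prop where
  meas : ∀ v, AEStronglyMeasurable (fun t => h t v) I.μ
  contDiff : ∀ᵐ t ∂I.μ, ContDiff ℝ 2 (h t)
  bound : ∃ K : ℝ, ∀ s ≤ 2, ∀ᵐ t ∂I.μ, ‖iteratedFDeriv ℝ s (h t) 0‖ ≤ K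
  lip : ∀ R > 0, ∃ L : ℝ, ∀ s ≤ 2, ∀ᵐ t ∂I.μ,
    ∀ v₁ ∈ Metric.closedBall (0 : V) R, ∀ v₂ ∈ Metric.closedBall (0 : V) R,
      ‖iteratedFDeriv ℝ s (h t) v₁ - iteratedFDeriv ℝ s (h t) v₂‖ ≤ L * ‖v₁ - v₂‖

section Total

variable {Y G F : Type} [NormedAddCommGroup Y] [NormedSpace ℝ Y]
  [NormedAddCommGroup G] [NormedSpace ℝ G] [NormedAddCommGroup F] [NormedSpace ℝ F]

/-- `h_y + h_g g_y` at `(y, g(y))`. -/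
def totD (h : Y × G → F) (g : Y → G) (y : Y) : Y →L[ℝ] F :=
  (fderiv ℝ h (y, g y)).comp ((ContinuousLinearMap.id ℝ Y).prod (fderiv ℝ g y))

/-- `h_g` at `(y, g(y))`. -/
def parG (h : Y × G → F) (g : Y → G) (y : Y) : G →L[ℝ] F :=
  (fderiv ℝ h (y, g y)).comp (ContinuousLinearMap.inr ℝ Y G)

/-- The total second derivative of `y ↦ h(y, g(y))`, i.e.
`h_yy + h_yg g_y + g_yᵀ h_gy + g_yᵀ h_gg g_y + h_g g_yy`, as a bilinear form. -/
def totDD (h : Y × G → F) (g : Y → G) (y : Y) (a b : Y) : F :=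
  fderiv ℝ (fderiv ℝ h) (y, g y) (a, fderiv ℝ g y a) (b, fderiv ℝ g y b)
    + parG h g y (fderiv ℝ (fderiv ℝ g) y a b)

/-- `h_yg + g_yᵀ h_gg` as a bilinear form. -/
def totDG (h : Y × G → F) (g : Y → G) (y : Y) (a : Y) (c : G) : F :=
  fderiv ℝ (fderiv ℝ h) (y, g y) (a, fderiv ℝ g y a) (0, c)

end Total

/-! ### Bolza functionals -/

/-- `φ(x(tf), p) + ∫ ℓ(t, x(t), u(t), p, g(t, x(t), u(t), p)) dt`. -/
def bolza (I : TimeInterval) {nx nu np ng : ℕ} (φ : E nx × E np → ℝ)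
    (l : ℝ → YVec nx nu np × E ng → ℝ) (w : YSp I ⊤ nx nu np × G3 I nx nu np ng) : ℝ :=
  φ (final w.1) + ∫ t, l t (traj w.1 t, w.2.rep t (traj w.1 t)) ∂I.μ

/-- The integrand
`(∇ₓℓ + gₓᵀ∇_gℓ)ᵀδx + (∇ᵤℓ + gᵤᵀ∇_gℓ)ᵀδu + (∇ₚℓ + gₚᵀ∇_gℓ)ᵀδp + ∇_gℓᵀ δg`
of the derivative of `bolza` at `(y, g)`. -/
def bolzaDerivIntegrand {I : TimeInterval} {nx nu np ng : ℕ}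
    (l : ℝ → YVec nx nu np × E ng → ℝ) (y : YSp I ⊤ nx nu np) (g : G3 I nx nu np ng)
    (δy : YSp I ⊤ nx nu np) (δg : G3 I nx nu np ng) (t : ℝ) : ℝ :=
  totD (l t) (g.rep t) (traj y t) (δy.1.val t, 0, 0)
    + totD (l t) (g.rep t) (traj y t) (0, δy.2.1 t, 0)
    + totD (l t) (g.rep t) (traj y t) (0, 0, δy.2.2)
    + parG (l t) (g.rep t) (traj y t) (δg.rep t (traj y t))

/-! ### The optimal control problem -/

/-- The data of the optimal control problem: minimize
`φ(x(tf), p) + ∫ l(t, x, u, p, g(t, x, u, p)) dt` subject to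
`x' = f(t, x, u, p, g(t, x, u, p))` a.e. and `x(t₀) = x₀`. -/
structure OCP (nx nu np ng : ℕ) where
  /-- initial state -/
  x₀ : E nx
  /-- terminal cost -/
  φ : E nx × E np → ℝ
  /-- running cost -/
  l : ℝ → YVec nx nu np × E ng → ℝ
  /-- dynamics -/
  f : ℝ → YVec nx nu np × E ng → E nx

namespace OCP

variable {nx nu np ng : ℕ} (P : OCP nx nu np ng) {I : TimeInterval}

/-- The feasible set of the problem with component function `g`. -/
def feasible (g : G3 I nx nu np ng) : Set (YSp I ⊤ nx nu np) :=
  {y | (∀ᵐ t ∂I.μ, y.1.der t = P.f t (traj y t, g.rep t (traj y t))) ∧ y.1.val I.t₀ = P.x₀}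

/-- `y` is a local minimizer, in `W^{1,∞} × L^∞ × ℝ^{np}`, of the problem with component
function `g`. -/
def IsLocalSolution (g : G3 I nx nu np ng) (y : YSp I ⊤ nx nu np) : Prop :=
  y ∈ P.feasible g ∧ IsLocalMinOn (fun y' => bolza I P.φ P.l (y', g)) (P.feasible g) y

/-- The Hamiltonian `H(t, y, g, λ) = l(t, y, g) + λᵀ f(t, y, g)` as a function of `(y, g)`. -/
def ham (lam : E nx) (t : ℝ) (v : YVec nx nu np × E ng) : ℝ := P.l t v + ⟪lam, P.f t v⟫

/-- The first-order optimality system: state equation, costate equation with terminal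
condition, and stationarity in `u` and in `p`. -/
structure KKT (g : G3 I nx nu np ng) (z : ZSp I nx nu np) : Prop where
  state : ∀ᵐ t ∂I.μ, z.y.1.der t = P.f t (traj z.y t, g.rep t (traj z.y t))
  init : z.y.1.val I.t₀ = P.x₀
  costate : ∀ᵐ t ∂I.μ, ∀ ξ : E nx, ⟪z.lam.der t, ξ⟫ =
    -⟪z.lam.val t, totD (P.f t) (g.rep t) (traj z.y t) (ξ, 0, 0)⟫
      - totD (P.l t) (g.rep t) (traj z.y t) (ξ, 0, 0)
  terminal : ∀ ξ : E nx, ⟪z.lam.val I.tf, ξ⟫ = fderiv ℝ P.φ (final z.y) (ξ, 0)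
  control : ∀ᵐ t ∂I.μ, ∀ υ : E nu, 0 =
    ⟪z.lam.val t, totD (P.f t) (g.rep t) (traj z.y t) (0, υ, 0)⟫
      + totD (P.l t) (g.rep t) (traj z.y t) (0, υ, 0)
  param : ∀ π : E np, 0 = fderiv ℝ P.φ (final z.y) (0, π) +
    ∫ t, (⟪z.lam.val t, totD (P.f t) (g.rep t) (traj z.y t) (0, 0, π)⟫
      + totD (P.l t) (g.rep t) (traj z.y t) (0, 0, π)) ∂I.μ

/-- The linear map of the block matrix `(A B C)` along `(z, g)`:
`A δx + B δu + C δp = (f_y + f_g g_y) (δx, δu, δp)`. -/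
def ABC (g : G3 I nx nu np ng) (z : ZSp I nx nu np) (t : ℝ) : YVec nx nu np →L[ℝ] E nx :=
  totD (P.f t) (g.rep t) (traj z.y t)

/-- The second derivative along `(z, g)` of `y ↦ H(t, y, g(t, y), λ(t))`, as a bilinear form;
its blocks are `H_xx, H_xu, …, H_pp`. -/
def Hyy (g : G3 I nx nu np ng) (z : ZSp I nx nu np) (t : ℝ) (a b : YVec nx nu np) : ℝ :=
  totDD (P.ham (z.lam.val t) t) (g.rep t) (traj z.y t) a b

/-- The bilinear form with blocks `H_xg, H_ug, H_pg` along `(z, g)`. -/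
def Hyg (g : G3 I nx nu np ng) (z : ZSp I nx nu np) (t : ℝ) (a : YVec nx nu np) (c : E ng) : ℝ :=
  totDG (P.ham (z.lam.val t) t) (g.rep t) (traj z.y t) a c

/-- The row vector `dᵀ = H_g = l_g + λᵀ f_g` along `(z, g)`. -/
def dRow (g : G3 I nx nu np ng) (z : ZSp I nx nu np) (t : ℝ) : E ng →L[ℝ] ℝ :=
  parG (P.ham (z.lam.val t) t) (g.rep t) (traj z.y t)

/-- The second-order sufficient condition at `(z, g)`. -/
structure SSOC (g : G3 I nx nu np ng) (z : ZSp I nx nu np) : Prop where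
  terminal : ∀ a : E nx × E np, 0 ≤ fderiv ℝ (fderiv ℝ P.φ) (final z.y) a a
  coercive : ∃ ε > 0, ∀ δ : YSp I 2 nx nu np,
    (∀ᵐ t ∂I.μ, δ.1.der t = P.ABC g z t (traj δ t)) → δ.1.val I.t₀ = 0 →
      ε * ((∫ t, ‖δ.1.val t‖ ^ 2 ∂I.μ) + (∫ t, ‖δ.2.1 t‖ ^ 2 ∂I.μ) + ‖δ.2.2‖ ^ 2)
        ≤ ∫ t, P.Hyy g z t (traj δ t) (traj δ t) ∂I.μ
  inverse : ∃ M > 0, ∀ᵐ t ∂I.μ, ∃ e : E nu ≃L[ℝ] (E nu →L[ℝ] ℝ),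
    (∀ υ υ', e υ υ' = P.Hyy g z t (0, υ, 0) (0, υ', 0)) ∧ ‖(e.symm : (E nu →L[ℝ] ℝ) →L[ℝ] E nu)‖ ≤ M

/-- The linear sensitivity system at `(z, g)` for `δz = (δx, δu, δp, δλ)` with perturbation
`δg`, i.e. the linearization of the optimality system. -/
structure Sensitivity (g : G3 I nx nu np ng) (z : ZSp I nx nu np) (δg : G3 I nx nu np ng)
    (δz : ZSp I nx nu np) : Prop where
  state : ∀ᵐ t ∂I.μ, δz.y.1.der t = P.ABC g z t (traj δz.y t)
    + parG (P.f t) (g.rep t) (traj z.y t) (δg.rep t (traj z.y t))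
  init : δz.y.1.val I.t₀ = 0
  costate : ∀ᵐ t ∂I.μ, ∀ ξ : E nx, ⟪δz.lam.der t, ξ⟫ =
    -⟪δz.lam.val t, P.ABC g z t (ξ, 0, 0)⟫ - P.Hyy g z t (ξ, 0, 0) (traj δz.y t)
      - P.Hyg g z t (ξ, 0, 0) (δg.rep t (traj z.y t))
      - P.dRow g z t (fderiv ℝ (δg.rep t) (traj z.y t) (ξ, 0, 0))
  terminal : ∀ ξ : E nx, ⟪δz.lam.val I.tf, ξ⟫ =
    fderiv ℝ (fderiv ℝ P.φ) (final z.y) (ξ, 0) (final δz.y)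
  control : ∀ᵐ t ∂I.μ, ∀ υ : E nu,
    P.Hyy g z t (0, υ, 0) (traj δz.y t) + ⟪δz.lam.val t, P.ABC g z t (0, υ, 0)⟫ =
      -P.Hyg g z t (0, υ, 0) (δg.rep t (traj z.y t))
        - P.dRow g z t (fderiv ℝ (δg.rep t) (traj z.y t) (0, υ, 0))
  param : ∀ π : E np, fderiv ℝ (fderiv ℝ P.φ) (final z.y) (0, π) (final δz.y)
    + ∫ t, (P.Hyy g z t (0, 0, π) (traj δz.y t)
        + ⟪δz.lam.val t, P.ABC g z t (0, 0, π)⟫) ∂I.μ =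
      -∫ t, (P.Hyg g z t (0, 0, π) (δg.rep t (traj z.y t))
        + P.dRow g z t (fderiv ℝ (δg.rep t) (traj z.y t) (0, 0, π))) ∂I.μ

end OCP

end OCPSens

end

open OCPSens

/-!
The superposition operators of the problem, such as `(y, g) ↦ h(·, y(·), g(·, y(·)))`, are
continuously differentiable as maps from `L^∞` into `L^∞`, while nonlinear ones are not
differentiable from `L²` to `L²`. The map is linear in `g`, and the values, derivatives and
Lipschitz constants of the derivatives of `g(t, ·)` are bounded by `‖g‖`, so that one Taylor
estimate, uniform in `t`, gives both the derivative and its local Lipschitz continuity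
(`NemytskiiFamily.contDiff_op`). Three derivatives of `g` are what makes the same true for `(y, g) ↦ g_y(·, y(·))`. This proves the claims
on the Bolza functional (`contDiff_bolza`, `fderiv_bolza`) and exhibits the optimality system as
the zero set of a continuously differentiable map `kktOp` between Banach spaces
(`contDiff_kktOp`, `kkt_iff_kktOp_eq_zero`). Pointwise formulas for derivatives of maps into `L^∞`
come from difference quotients: convergence in `L^∞` forces convergence a.e. (`fderiv_Linf_ae`).

The derivative of `kktOp` with respect to `z` is the optimality system of a linear-quadratic
problem. Eliminating the state through the linearized state equation leaves a quadratic form in the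
control and the parameter, on the Hilbert space `L² × ℝ^np`; by the second-order condition and the
convexity of the terminal cost it is coercive, and the Lax-Milgram theorem yields a stationary point
(`exists_stationary`), with a costate from the adjoint equation (`exists_costate`). The solution
lies in `L^∞` because the stationarity condition can be solved pointwise for the control by the
bounded inverse of `H_uu` (`exists_linf`). Uniqueness follows by testing with the solution itself
(`eq_zero_of_homogeneous`). So the partial derivative is an isomorphism
(`exists_kktDeriv_equiv`), and the implicit function theorem gives the solution map. The space of
component functions enters only as parameter space, and the theorem is proved without its
completeness (`exists_implicit_function`). Differentiating `ψ(z(g); g) = 0` gives the sensitivity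
system, and the chain rule gives the derivative of the reduced functional.

For local optimality, the cost difference between a feasible point and a solution of the optimality
system equals the increment of the Lagrangian along the segment between them minus its tangent. It
is nonnegative as soon as the second derivative of the Lagrangian is nonnegative on the segment.
That second derivative is the quadratic form of the Hessians, which vary continuously with `(z, g)`
in `L^∞`. The form is coercive on solutions of the linearized state equation, and hence also on the
difference of two feasible points close to the reference point, as it satisfies this equation up to
a relatively small error (`exists_coercive_near`, `exists_residual`). The resulting neighborhood is
uniform in `g` (`exists_ball_bolza_le`).
-/

/-! ### The implicit function theorem -/

section ImplicitFunction

variable {X Z T : Type*} [NormedAddCommGroup X] [NormedSpace ℝ X]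
  [NormedAddCommGroup Z] [NormedSpace ℝ Z] [NormedAddCommGroup T] [NormedSpace ℝ T]

/-- Local form of the implicit function theorem for a map whose partial derivative in `z` at the
base point is the identity. For fixed parameter the map is a perturbation of the identity with
Lipschitz constant `1/2`. The parameter space `X` is not assumed to be complete. -/
theorem exists_implicit_function_of_id [CompleteSpace Z] {Φ : Z × X → Z} (hΦ : ContDiff ℝ 1 Φ)
    {z₀ : Z} {x₀ : X} (h0 : Φ (z₀, x₀) = 0)
    (hid : (fderiv ℝ Φ (z₀, x₀)).comp (.inl ℝ Z X) = ContinuousLinearMap.id ℝ Z)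
    {r : ℝ} (hr : 0 < r) :
    ∃ (Nx : Set X) (Nz : Set Z) (z : X → Z), IsOpen Nx ∧ x₀ ∈ Nx ∧ IsOpen Nz ∧ z₀ ∈ Nz ∧
      Nx ⊆ Metric.ball x₀ r ∧ Nz ⊆ Metric.ball z₀ r ∧ z x₀ = z₀ ∧ ContDiffOn ℝ 1 z Nx ∧
      ∀ x ∈ Nx, z x ∈ Nz ∧ Φ (z x, x) = 0 ∧ ∀ z' ∈ Nz, Φ (z', x) = 0 → z' = z x := by
  have hd : Differentiable ℝ Φ := hΦ.differentiable one_ne_zero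
  have hc : Continuous fun w : Z × X => (fderiv ℝ Φ w).comp (.inl ℝ Z X) :=
    (hΦ.continuous_fderiv one_ne_zero).clm_comp continuous_const
  -- a neighbourhood where the partial derivative in `z` is invertible and close to the identity
  have hnhds : ∀ᶠ w in 𝓝 (z₀, x₀),
      ‖(fderiv ℝ Φ w).comp (.inl ℝ Z X) - ContinuousLinearMap.id ℝ Z‖ ≤ 1 / 2 ∧
        (fderiv ℝ Φ w).comp (.inl ℝ Z X) ∈ range ((↑) : (Z ≃L[ℝ] Z) → Z →L[ℝ] Z) := by
    have h1 := hc.continuousAt (x := (z₀, x₀))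
    rw [ContinuousAt, hid] at h1
    have h2 := h1.eventually (Metric.closedBall_mem_nhds (ContinuousLinearMap.id ℝ Z)
        (show (0 : ℝ) < 1 / 2 by norm_num))
    have h3 := h1.eventually (ContinuousLinearEquiv.nhds (ContinuousLinearEquiv.refl ℝ Z))
    filter_upwards [h2, h3] with w hw hw'
    exact ⟨by simpa [dist_eq_norm] using hw, hw'⟩
  obtain ⟨ρ', hρ', hball'⟩ := Metric.eventually_nhds_iff_ball.1 hnhds
  set ρ := min ρ' r with hρdef
  have hρ : 0 < ρ := lt_min hρ' hr
  have hball : ∀ z ∈ Metric.ball z₀ ρ, ∀ x ∈ Metric.ball x₀ ρ,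
      ‖(fderiv ℝ Φ (z, x)).comp (.inl ℝ Z X) - ContinuousLinearMap.id ℝ Z‖ ≤ 1 / 2 ∧
        (fderiv ℝ Φ (z, x)).comp (.inl ℝ Z X) ∈ range ((↑) : (Z ≃L[ℝ] Z) → Z →L[ℝ] Z) := by
    intro z hz x hx
    refine hball' _ ?_
    rw [← ball_prod_same]
    exact ⟨Metric.ball_subset_ball (min_le_left _ _) hz,
      Metric.ball_subset_ball (min_le_left _ _) hx⟩
  have hpart : ∀ z x, HasFDerivAt (fun z' => Φ (z', x))
      ((fderiv ℝ Φ (z, x)).comp (.inl ℝ Z X)) z := fun z x =>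
    (hd (z, x)).hasFDerivAt.comp z ((hasFDerivAt_id z).prodMk (hasFDerivAt_const x z))
  have happrox : ∀ x ∈ Metric.ball x₀ ρ, ApproximatesLinearOn (fun z => Φ (z, x))
      (ContinuousLinearMap.id ℝ Z) (Metric.ball z₀ ρ) (1 / 2) := by
    intro x hx z₁ h₁ z₂ h₂
    have := (convex_ball z₀ ρ).norm_image_sub_le_of_norm_hasFDerivWithin_le'
      (f := fun z => Φ (z, x)) (φ := ContinuousLinearMap.id ℝ Z) (C := 1 / 2)
      (fun z _ => (hpart z x).hasFDerivWithinAt) (fun z hz => (hball z hz x hx).1) h₂ h₁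
    simpa using this
  have hanti : ∀ x ∈ Metric.ball x₀ ρ, ∀ z₁ ∈ Metric.ball z₀ ρ, ∀ z₂ ∈ Metric.ball z₀ ρ,
      ‖z₁ - z₂‖ ≤ 2 * ‖Φ (z₁, x) - Φ (z₂, x)‖ := by
    intro x hx z₁ h₁ z₂ h₂
    have h := happrox x hx z₁ h₁ z₂ h₂
    simp only [ContinuousLinearMap.id_apply] at h
    have h3 : ‖z₁ - z₂‖ ≤ ‖Φ (z₁, x) - Φ (z₂, x)‖ + ‖Φ (z₁, x) - Φ (z₂, x) - (z₁ - z₂)‖ := by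
      have := norm_sub_le (Φ (z₁, x) - Φ (z₂, x)) (Φ (z₁, x) - Φ (z₂, x) - (z₁ - z₂))
      simpa using this
    have h4 : ((1 / 2 : NNReal) : ℝ) = 1 / 2 := by norm_num
    rw [h4] at h
    linarith
  -- parameters for which the equation is solvable
  set Nx : Set X := Metric.ball x₀ ρ ∩ {x | ‖Φ (z₀, x)‖ < ρ / 4} with hNx
  have hNxo : IsOpen Nx := Metric.isOpen_ball.inter
    (isOpen_lt (hΦ.continuous.comp (by fun_prop)).norm continuous_const)
  have hx₀ : x₀ ∈ Nx := ⟨Metric.mem_ball_self hρ, by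
    simp only [mem_ofPred_eq, h0, norm_zero]; linarith⟩
  have hex : ∀ x ∈ Nx, ∃ z ∈ Metric.ball z₀ ρ, Φ (z, x) = 0 := by
    intro x hx
    -- the identity, with constant `1`, as right inverse of itself: a map that is `1/2`-close to it
    -- covers a ball of radius `(1 - 1/2) ρ / 2 = ρ / 4`
    let inv : (ContinuousLinearMap.id ℝ Z).NonlinearRightInverse :=
      { toFun := id, nnnorm := 1, bound' := fun y => by simp, right_inv' := fun y => rfl }
    have hs := (happrox x hx.1).surjOn_closedBall_of_nonlinearRightInverse inv
      (ε := ρ / 2) (b := z₀) (by linarith) (Metric.closedBall_subset_ball (by linarith))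
    have hm : (0 : Z) ∈ Metric.closedBall (Φ (z₀, x))
        ((((inv.nnnorm : ℝ))⁻¹ - ((1 / 2 : NNReal) : ℝ)) * (ρ / 2)) := by
      have h1 : ((inv.nnnorm : ℝ))⁻¹ - ((1 / 2 : NNReal) : ℝ) = 1 / 2 := by
        simp only [inv]; norm_num
      rw [h1, mem_closedBall_iff_norm, zero_sub, norm_neg]
      have := hx.2
      simp only [mem_ofPred_eq] at this
      linarith
    obtain ⟨z, hz, hz0⟩ := hs hm
    exact ⟨z, Metric.closedBall_subset_ball (by linarith) hz, hz0⟩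
  choose! z hzball hz0 using hex
  have huniq : ∀ x ∈ Nx, ∀ z' ∈ Metric.ball z₀ ρ, Φ (z', x) = 0 → z' = z x := by
    intro x hx z' hz' h
    have := hanti x hx.1 z' hz' (z x) (hzball x hx)
    rw [h, hz0 x hx, sub_zero, norm_zero, mul_zero] at this
    exact sub_eq_zero.1 (norm_le_zero_iff.1 this)
  -- Lipschitz bound for the solution in terms of the residual
  have hlip : ∀ x ∈ Nx, ∀ x' ∈ Nx, ‖z x' - z x‖ ≤ 2 * ‖Φ (z x, x') - Φ (z x, x)‖ := by
    intro x hx x' hx'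
    have := hanti x' hx'.1 (z x') (hzball x' hx') (z x) (hzball x hx)
    rw [hz0 x' hx', zero_sub, norm_neg] at this
    rw [hz0 x hx, sub_zero]
    exact this
  have hcont : ∀ x ∈ Nx, ContinuousAt z x := by
    intro x hx
    rw [ContinuousAt, tendsto_iff_norm_sub_tendsto_zero]
    have h1 : Tendsto (fun x' => 2 * ‖Φ (z x, x') - Φ (z x, x)‖) (𝓝 x) (𝓝 0) := by
      have : Continuous fun x' => 2 * ‖Φ (z x, x') - Φ (z x, x)‖ :=
        continuous_const.mul ((hΦ.continuous.comp (by fun_prop)).sub continuous_const).norm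
      simpa using this.tendsto x
    refine squeeze_zero' (Eventually.of_forall fun _ => norm_nonneg _) ?_ h1
    filter_upwards [hNxo.mem_nhds hx] with x' hx' using hlip x hx x' hx'
  have hderiv : ∀ x ∈ Nx, HasFDerivAt z
      (-(((fderiv ℝ Φ (z x, x)).comp (.inl ℝ Z X)).inverse.comp
        ((fderiv ℝ Φ (z x, x)).comp (.inr ℝ Z X)))) x := by
    intro x hx
    obtain ⟨e, he⟩ := (hball _ (hzball x hx) x hx.1).2
    rw [← he, ContinuousLinearMap.inverse_equiv]
    have hpx : HasFDerivAt (fun x' => Φ (z x, x')) ((fderiv ℝ Φ (z x, x)).comp (.inr ℝ Z X)) x :=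
      (hd (z x, x)).hasFDerivAt.comp x ((hasFDerivAt_const (z x) x).prodMk (hasFDerivAt_id x))
    have hO : (fun x' => z x' - z x) =O[𝓝 x] fun x' => x' - x := by
      refine Asymptotics.IsBigO.trans (Asymptotics.IsBigO.of_bound 2 ?_) hpx.isBigO_sub
      filter_upwards [hNxo.mem_nhds hx] with x' hx' using hlip x hx x' hx'
    have ho := (hd (z x, x)).hasFDerivAt.isLittleO
    have ht : Tendsto (fun x' => (z x', x')) (𝓝 x) (𝓝 (z x, x)) :=
      (hcont x hx).prodMk_nhds continuousAt_id
    have hO2 : ((fun w : Z × X => w - (z x, x)) ∘ fun x' => (z x', x')) =O[𝓝 x]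
        fun x' => x' - x :=
      hO.prod_left (Asymptotics.isBigO_refl (fun x' => x' - x) (𝓝 x))
    have ho2 := (ho.comp_tendsto ht).trans_isBigO hO2
    -- apply `e⁻¹` to `Φ'(z x' - z x, x' - x) = o(x' - x)`
    refine HasFDerivAt.of_isLittleO ?_
    have ho3 := (e.symm : Z →L[ℝ] Z).isBigO_comp
      (fun x' => fderiv ℝ Φ (z x, x) (z x' - z x, x' - x)) (𝓝 x) |>.trans_isLittleO
      (ho2.neg_left.congr' (f₂ := fun x' => fderiv ℝ Φ (z x, x) (z x' - z x, x' - x)) ?_ .rfl)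
    · refine ho3.congr' (Eventually.of_forall fun x' => ?_) .rfl
      have h5 : fderiv ℝ Φ (z x, x) (z x' - z x, x' - x) = e (z x' - z x)
          + (fderiv ℝ Φ (z x, x)) (0, x' - x) := by
        have : e (z x' - z x) = fderiv ℝ Φ (z x, x) (z x' - z x, 0) := by
          rw [← ContinuousLinearEquiv.coe_coe, he]; rfl
        rw [this, ← map_add]; simp
      simp [h5]
    · filter_upwards [hNxo.mem_nhds hx] with x' hx'
      simp [hz0 x hx, hz0 x' hx', -map_sub]
  refine ⟨Nx, Metric.ball z₀ ρ, z, hNxo, hx₀, Metric.isOpen_ball, Metric.mem_ball_self hρ,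
    fun x hx => Metric.ball_subset_ball (min_le_right _ _) hx.1,
    Metric.ball_subset_ball (min_le_right _ _),
    (huniq x₀ hx₀ z₀ (Metric.mem_ball_self hρ) h0).symm, ?_,
    fun x hx => ⟨hzball x hx, hz0 x hx, huniq x hx⟩⟩
  intro x hx
  refine ContDiffAt.contDiffWithinAt ?_
  rw [show (1 : WithTop ℕ∞) = ((0 : ℕ) : WithTop ℕ∞) + 1 by simp, contDiffAt_succ_iff_hasFDerivAt]
  refine ⟨fun x => -(((fderiv ℝ Φ (z x, x)).comp (.inl ℝ Z X)).inverse.comp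
        ((fderiv ℝ Φ (z x, x)).comp (.inr ℝ Z X))), ⟨Nx, hNxo.mem_nhds hx, hderiv⟩, ?_⟩
  rw [Nat.cast_zero, contDiffAt_zero]
  refine ⟨Nx, hNxo.mem_nhds hx, fun x' hx' => ContinuousAt.continuousWithinAt ?_⟩
  have hzx : ContinuousAt (fun x => (z x, x)) x' := (hcont x' hx').prodMk continuousAt_id
  have hf : ContinuousAt (fun x => fderiv ℝ Φ (z x, x)) x' :=
    ContinuousAt.comp (f := fun x => (z x, x)) (hΦ.continuous_fderiv one_ne_zero).continuousAt hzx
  obtain ⟨e, he⟩ := (hball _ (hzball x' hx') x' hx'.1).2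
  have hinv : ContinuousAt ContinuousLinearMap.inverse
      ((fderiv ℝ Φ (z x', x')).comp (.inl ℝ Z X)) := by
    rw [← he]; exact (contDiffAt_map_inverse (n := 0) e).continuousAt
  have hinv' := ContinuousAt.comp (f := fun x => (fderiv ℝ Φ (z x, x)).comp (.inl ℝ Z X)) hinv
    (hf.clm_comp continuousAt_const)
  exact (hinv'.clm_comp (hf.clm_comp continuousAt_const)).neg

/-- **Implicit function theorem** with a continuously differentiable solution, for a parameter
space `X` that need not be complete. Both neighborhoods can be chosen in balls of radius `r`. -/
theorem exists_implicit_function [CompleteSpace Z] {Ψ : Z × X → T} (hΨ : ContDiff ℝ 1 Ψ)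
    {z₀ : Z} {x₀ : X} (h0 : Ψ (z₀, x₀) = 0) (e : Z ≃L[ℝ] T)
    (he : (fderiv ℝ Ψ (z₀, x₀)).comp (.inl ℝ Z X) = e) {r : ℝ} (hr : 0 < r) :
    ∃ (Nx : Set X) (Nz : Set Z) (z : X → Z), IsOpen Nx ∧ x₀ ∈ Nx ∧ IsOpen Nz ∧ z₀ ∈ Nz ∧
      Nx ⊆ Metric.ball x₀ r ∧ Nz ⊆ Metric.ball z₀ r ∧ z x₀ = z₀ ∧ ContDiffOn ℝ 1 z Nx ∧
      ∀ x ∈ Nx, z x ∈ Nz ∧ Ψ (z x, x) = 0 ∧ ∀ z' ∈ Nz, Ψ (z', x) = 0 → z' = z x := by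
  have key := exists_implicit_function_of_id (Φ := fun w => e.symm (Ψ w))
    (e.symm.contDiff.comp hΨ) (z₀ := z₀) (x₀ := x₀) (by simp [h0]) ?_ hr
  · simpa using key
  · have h1 : fderiv ℝ (fun w => e.symm (Ψ w)) (z₀, x₀)
        = (e.symm : T →L[ℝ] Z).comp (fderiv ℝ Ψ (z₀, x₀)) :=
      e.symm.comp_fderiv
    rw [h1, ContinuousLinearMap.comp_assoc, he]
    ext; simp

end ImplicitFunction

/-! ### Essentially bounded functions -/

section LInfinity

variable {α : Type*} [MeasurableSpace α] {μ : Measure α} {E F G : Type*}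
  [NormedAddCommGroup E] [NormedSpace ℝ E] [NormedAddCommGroup F] [NormedSpace ℝ F]

theorem Linf.ae_norm_le (f : Lp E ⊤ μ) : ∀ᵐ t ∂μ, ‖f t‖ ≤ ‖f‖ := by
  filter_upwards [ae_le_eLpNormEssSup (f := f) (μ := μ)] with t ht
  rw [Lp.norm_def, eLpNorm_exponent_top, ← toReal_enorm]
  refine ENNReal.toReal_mono ?_ ht
  rw [← eLpNorm_exponent_top]
  exact Lp.eLpNorm_ne_top f

theorem Linf.norm_le {f : Lp E ⊤ μ} {C : ℝ} (hC : 0 ≤ C) (h : ∀ᵐ t ∂μ, ‖f t‖ ≤ C) : ‖f‖ ≤ C := by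
  rw [Lp.norm_def, eLpNorm_exponent_top]
  refine ENNReal.toReal_le_of_le_ofReal hC ?_
  refine eLpNormEssSup_le_of_ae_enorm_bound ?_
  filter_upwards [h] with t ht
  rw [← ofReal_norm]
  exact ENNReal.ofReal_le_ofReal ht

/-- Measurability of operator-valued functions can be checked on vectors, as the domain is finite
dimensional. -/
theorem aestronglyMeasurable_clm_of_apply [FiniteDimensional ℝ E] {T : α → E →L[ℝ] F}
    (h : ∀ v, AEStronglyMeasurable (fun t => T t v) μ) : AEStronglyMeasurable T μ := by
  let b := Module.finBasis ℝ E
  have hT : T = fun t => ∑ i, ContinuousLinearMap.smulRightL ℝ E F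
      (LinearMap.toContinuousLinearMap (b.coord i)) (T t (b i)) := by
    funext t
    refine ContinuousLinearMap.ext fun v => ?_
    conv_lhs => rw [← b.sum_repr v, map_sum]
    simp
  rw [hT]
  refine Finset.aestronglyMeasurable_fun_sum _ fun i _ => ?_
  exact (ContinuousLinearMap.continuous _).comp_aestronglyMeasurable (h (b i))

/-- Superposition of a Carathéodory function with a measurable function is measurable. -/
theorem aestronglyMeasurable_superposition {k : α → E → F}
    (hm : ∀ v, AEStronglyMeasurable (fun t => k t v) μ) (hc : ∀ᵐ t ∂μ, Continuous (k t))
    {v : α → E} (hv : AEStronglyMeasurable v μ) :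
    AEStronglyMeasurable (fun t => k t (v t)) μ := by
  obtain ⟨w, hw, hvw⟩ := hv
  have hs : ∀ n, AEStronglyMeasurable (fun t => k t (hw.approx n t)) μ := by
    intro n
    have : (fun t => k t (hw.approx n t)) = fun t => ∑ y ∈ (hw.approx n).range,
        ((hw.approx n) ⁻¹' {y}).indicator (fun t => k t y) t := by
      funext t
      rw [Finset.sum_eq_single (hw.approx n t)]
      · simp
      · intro y _ hy
        rw [indicator_of_notMem]
        simpa using hy.symm
      · intro h
        exact absurd ((hw.approx n).mem_range_self t) h
    rw [this]
    refine Finset.aestronglyMeasurable_fun_sum _ fun y _ => ?_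
    exact (hm y).indicator ((hw.approx n).measurableSet_fiber y)
  refine aestronglyMeasurable_of_tendsto_ae atTop hs ?_
  filter_upwards [hc, hvw] with t h1 h2
  rw [h2]
  exact (h1.tendsto _).comp (hw.tendsto_approx t)

/-- The derivative of a Carathéodory function, evaluated along a measurable function, is a
measurable function with values in the continuous linear maps. -/
theorem aestronglyMeasurable_fderiv_superposition [FiniteDimensional ℝ E] {k : α → E → F}
    (hm : ∀ v, AEStronglyMeasurable (fun t => k t v) μ)
    (hd : ∀ᵐ t ∂μ, Differentiable ℝ (k t)) {v : α → E} (hv : AEStronglyMeasurable v μ) :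
    AEStronglyMeasurable (fun t => fderiv ℝ (k t) (v t)) μ := by
  have hc : ∀ᵐ t ∂μ, Continuous (k t) := by
    filter_upwards [hd] with t ht using ht.continuous
  refine aestronglyMeasurable_clm_of_apply fun w => ?_
  -- the directional derivative is the limit of the difference quotients with step `1 / n`
  refine aestronglyMeasurable_of_tendsto_ae (u := atTop)
    (f := fun (n : ℕ) t => (n : ℝ) • (k t (v t + (n : ℝ)⁻¹ • w) - k t (v t)))
    (fun n => AEStronglyMeasurable.const_smul (AEStronglyMeasurable.sub
      (aestronglyMeasurable_superposition hm hc (hv.add aestronglyMeasurable_const))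
      (aestronglyMeasurable_superposition hm hc hv)) (n : ℝ)) ?_
  filter_upwards [hd] with t ht
  refine (ht _).hasFDerivAt.lim w ?_
  simpa using tendsto_natCast_atTop_atTop

end LInfinity

/-! ### Differentiability of superposition operators -/

section Nemytskii

variable {α : Type*} [MeasurableSpace α] {μ : Measure α} {X V F : Type*}
  [NormedAddCommGroup X] [NormedSpace ℝ X] [NormedAddCommGroup V] [NormedSpace ℝ V]
  [NormedAddCommGroup F] [NormedSpace ℝ F]

/-- A linear family `g ↦ e g` of functions `e g : α × V → F` that are continuously differentiable
in the second variable, with values, derivatives and Lipschitz constants of the derivatives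
bounded by a multiple of `‖g‖` on balls of `V`, uniformly in the first variable. -/
structure NemytskiiFamily (μ : Measure α) (e : X → α → V → F) : Prop where
  add : ∀ g g', ∀ᵐ t ∂μ, ∀ v, e (g + g') t v = e g t v + e g' t v
  smul : ∀ (c : ℝ) g, ∀ᵐ t ∂μ, ∀ v, e (c • g) t v = c • e g t v
  meas : ∀ g v, AEStronglyMeasurable (fun t => e g t v) μ
  diff : ∀ g, ∀ᵐ t ∂μ, Differentiable ℝ (e g t)
  bound : ∀ R : ℝ, ∃ K : ℝ, 0 ≤ K ∧ ∀ g, ∀ᵐ t ∂μ, ∀ v, ‖v‖ ≤ R →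
    ‖e g t v‖ ≤ K * ‖g‖ ∧ ‖fderiv ℝ (e g t) v‖ ≤ K * ‖g‖ ∧
      ∀ v', ‖v'‖ ≤ R → ‖fderiv ℝ (e g t) v - fderiv ℝ (e g t) v'‖ ≤ K * ‖g‖ * ‖v - v'‖

namespace NemytskiiFamily

variable {e : X → α → V → F}

theorem memLp (h : NemytskiiFamily μ e) (g : X) (v : Lp V ⊤ μ) :
    MemLp (fun t => e g t (v t)) ⊤ μ := by
  obtain ⟨K, hK, hb⟩ := h.bound ‖v‖
  refine memLp_top_of_bound (aestronglyMeasurable_superposition (h.meas g) ?_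
    (Lp.aestronglyMeasurable v)) (K * ‖g‖) ?_
  · filter_upwards [h.diff g] with t ht using ht.continuous
  · filter_upwards [hb g, Linf.ae_norm_le v] with t h1 h2 using (h1 _ h2).1

/-- The superposition operator `(g, v) ↦ e g (·, v(·))`. -/
noncomputable def op (h : NemytskiiFamily μ e) (w : X × Lp V ⊤ μ) : Lp F ⊤ μ :=
  (h.memLp w.1 w.2).toLp

theorem op_ae (h : NemytskiiFamily μ e) (w : X × Lp V ⊤ μ) :
    ∀ᵐ t ∂μ, h.op w t = e w.1 t (w.2 t) := (h.memLp w.1 w.2).coeFn_toLp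

variable [FiniteDimensional ℝ V]

theorem memLp_deriv (h : NemytskiiFamily μ e) (w δ : X × Lp V ⊤ μ) :
    MemLp (fun t => e δ.1 t (w.2 t) + fderiv ℝ (e w.1 t) (w.2 t) (δ.2 t)) ⊤ μ := by
  obtain ⟨K, hK, hb⟩ := h.bound ‖w.2‖
  refine (h.memLp δ.1 w.2).add (memLp_top_of_bound (C := K * ‖w.1‖ * ‖δ.2‖) ?_ ?_)
  · exact (ContinuousLinearMap.id ℝ (V →L[ℝ] F)).aestronglyMeasurable_comp₂
      (aestronglyMeasurable_fderiv_superposition (h.meas _) (h.diff _)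
        (Lp.aestronglyMeasurable w.2)) (Lp.aestronglyMeasurable δ.2)
  · filter_upwards [hb w.1, Linf.ae_norm_le w.2, Linf.ae_norm_le δ.2] with t h1 h2 h3
    exact (ContinuousLinearMap.le_opNorm _ _).trans
      (mul_le_mul (h1 _ h2).2.1 h3 (norm_nonneg _) (mul_nonneg hK (norm_nonneg _)))

/-- The derivative of the superposition operator. -/
noncomputable def opDeriv (h : NemytskiiFamily μ e) (w : X × Lp V ⊤ μ) :
    X × Lp V ⊤ μ →L[ℝ] Lp F ⊤ μ :=
  LinearMap.mkContinuousOfExistsBound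
    { toFun := fun δ => (h.memLp_deriv w δ).toLp
      map_add' := fun δ δ' => by
        rw [← MemLp.toLp_add, MemLp.toLp_eq_toLp_iff]
        filter_upwards [h.add δ.1 δ'.1, Lp.coeFn_add δ.2 δ'.2] with t h1 h2
        simp only [Prod.fst_add, Prod.snd_add, h1, h2, Pi.add_apply, map_add]
        abel
      map_smul' := fun c δ => by
        rw [RingHom.id_apply, ← MemLp.toLp_const_smul, MemLp.toLp_eq_toLp_iff]
        filter_upwards [h.smul c δ.1, Lp.coeFn_smul c δ.2] with t h1 h2
        simp only [Prod.smul_fst, Prod.smul_snd, h1, h2, Pi.smul_apply, map_smul, smul_add] }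
    (by
      obtain ⟨K, hK, hb⟩ := h.bound ‖w.2‖
      refine ⟨K + K * ‖w.1‖, fun δ => Linf.norm_le (by positivity) ?_⟩
      filter_upwards [(h.memLp_deriv w δ).coeFn_toLp, hb w.1, hb δ.1, Linf.ae_norm_le w.2,
        Linf.ae_norm_le δ.2] with t h1 h2 h3 h4 h5
      simp only [LinearMap.coe_mk, AddHom.coe_mk]
      rw [h1, add_mul]
      refine (norm_add_le _ _).trans (add_le_add ((h3 _ h4).1.trans ?_)
        ((ContinuousLinearMap.le_opNorm _ _).trans (mul_le_mul (h2 _ h4).2.1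
          (h5.trans (norm_snd_le δ)) (norm_nonneg _) (by positivity))))
      exact mul_le_mul_of_nonneg_left (norm_fst_le δ) hK)

theorem opDeriv_ae (h : NemytskiiFamily μ e) (w δ : X × Lp V ⊤ μ) :
    ∀ᵐ t ∂μ, h.opDeriv w δ t = e δ.1 t (w.2 t) + fderiv ℝ (e w.1 t) (w.2 t) (δ.2 t) :=
  (h.memLp_deriv w δ).coeFn_toLp

/-- Differentiability, with a remainder bounded by a multiple of `‖δ‖ ^ 2`. -/
theorem hasFDerivAt_op (h : NemytskiiFamily μ e) (w : X × Lp V ⊤ μ) :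
    HasFDerivAt h.op (h.opDeriv w) w := by
  obtain ⟨K, hK, hb⟩ := h.bound (‖w.2‖ + 1)
  rw [hasFDerivAt_iff_isLittleO_nhds_zero]
  refine Asymptotics.IsBigO.trans_isLittleO (g := fun δ : X × Lp V ⊤ μ => ‖δ‖ ^ 2) ?_
    (Asymptotics.isLittleO_norm_pow_id one_lt_two)
  refine Asymptotics.IsBigO.of_bound (K + K * ‖w.1‖) ?_
  filter_upwards [Metric.ball_mem_nhds (0 : X × Lp V ⊤ μ) one_pos] with δ hδ
  rw [mem_ball_zero_iff] at hδ
  refine Linf.norm_le (by positivity) ?_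
  have hsub := Lp.coeFn_sub (h.op (w + δ) - h.op w) (h.opDeriv w δ)
  have hsub' := Lp.coeFn_sub (h.op (w + δ)) (h.op w)
  filter_upwards [hsub, hsub', h.op_ae (w + δ), h.op_ae w, h.opDeriv_ae w δ, h.add w.1 δ.1,
    hb w.1, hb δ.1, Linf.ae_norm_le w.2, Linf.ae_norm_le δ.2, Lp.coeFn_add w.2 δ.2, h.diff w.1,
    h.diff δ.1] with t h1 h2 h3 h4 h5 h6 h7 h8 h9 h10 h11 h12 h13
  rw [h1, Pi.sub_apply, h2, Pi.sub_apply, h3, h4, h5, Prod.fst_add, Prod.snd_add, h6, h11,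
    Pi.add_apply]
  have hδ2 : ‖δ.2‖ ≤ ‖δ‖ := norm_snd_le δ
  have hδ1 : ‖δ.1‖ ≤ ‖δ‖ := norm_fst_le δ
  have hs : segment ℝ (w.2 t) (w.2 t + δ.2 t) ⊆ Metric.closedBall 0 (‖w.2‖ + 1) := by
    refine (convex_closedBall _ _).segment_subset ?_ ?_ <;> rw [mem_closedBall_zero_iff]
    · linarith
    · exact (norm_add_le _ _).trans (by linarith)
  -- the two parts of the remainder
  have r1 : ‖e δ.1 t (w.2 t + δ.2 t) - e δ.1 t (w.2 t)‖ ≤ K * ‖δ.1‖ * ‖δ.2 t‖ := by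
    have := (convex_segment (w.2 t) (w.2 t + δ.2 t)).norm_image_sub_le_of_norm_fderiv_le
      (f := e δ.1 t) (𝕜 := ℝ) (C := K * ‖δ.1‖) (fun x _ => h13 x)
      (fun x hx => (h8 x (mem_closedBall_zero_iff.1 (hs hx))).2.1)
      (left_mem_segment ℝ _ _) (right_mem_segment ℝ _ _)
    simpa using this
  have r2 : ‖e w.1 t (w.2 t + δ.2 t) - e w.1 t (w.2 t) - fderiv ℝ (e w.1 t) (w.2 t) (δ.2 t)‖
      ≤ K * ‖w.1‖ * ‖δ.2 t‖ * ‖δ.2 t‖ := by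
    have := (convex_segment (w.2 t) (w.2 t + δ.2 t)).norm_image_sub_le_of_norm_fderiv_le'
      (f := e w.1 t) (𝕜 := ℝ) (φ := fderiv ℝ (e w.1 t) (w.2 t)) (C := K * ‖w.1‖ * ‖δ.2 t‖)
      (fun x _ => h12 x) (fun x hx => ?_)
      (left_mem_segment ℝ _ _) (right_mem_segment ℝ _ _)
    · simpa using this
    · refine ((h7 x (mem_closedBall_zero_iff.1 (hs hx))).2.2 (w.2 t) (by linarith)).trans ?_
      refine mul_le_mul_of_nonneg_left ?_ (by positivity)
      rw [segment_eq_image'] at hx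
      obtain ⟨θ, hθ, rfl⟩ := hx
      simp only [add_sub_cancel_left, norm_smul, Real.norm_eq_abs, abs_of_nonneg hθ.1]
      exact mul_le_of_le_one_left (norm_nonneg _) hθ.2
  have r3 : e w.1 t (w.2 t + δ.2 t) + e δ.1 t (w.2 t + δ.2 t) - e w.1 t (w.2 t)
      - (e δ.1 t (w.2 t) + fderiv ℝ (e w.1 t) (w.2 t) (δ.2 t))
      = (e δ.1 t (w.2 t + δ.2 t) - e δ.1 t (w.2 t)) +
        (e w.1 t (w.2 t + δ.2 t) - e w.1 t (w.2 t) - fderiv ℝ (e w.1 t) (w.2 t) (δ.2 t)) := by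
    abel
  have h10' := h10.trans hδ2
  rw [r3, Real.norm_of_nonneg (sq_nonneg ‖δ‖)]
  calc _ ≤ K * ‖δ.1‖ * ‖δ.2 t‖ + K * ‖w.1‖ * ‖δ.2 t‖ * ‖δ.2 t‖ := norm_add_le_of_le r1 r2
    _ ≤ K * ‖δ‖ * ‖δ‖ + K * ‖w.1‖ * ‖δ‖ * ‖δ‖ := by gcongr
    _ = _ := by ring

/-- The derivative is locally Lipschitz continuous. -/
theorem continuous_opDeriv (h : NemytskiiFamily μ e) : Continuous h.opDeriv := by
  rw [continuous_iff_continuousAt]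
  intro w
  obtain ⟨K, hK, hb⟩ := h.bound (‖w.2‖ + 1)
  rw [ContinuousAt, tendsto_iff_norm_sub_tendsto_zero]
  have hlim : Tendsto (fun w' => (K + K * ‖w.1‖ + K) * ‖w' - w‖) (𝓝 w) (𝓝 0) := by
    have : Continuous fun w' => (K + K * ‖w.1‖ + K) * ‖w' - w‖ := by fun_prop
    simpa using this.tendsto w
  refine squeeze_zero' (Eventually.of_forall fun _ => norm_nonneg _) ?_ hlim
  filter_upwards [Metric.ball_mem_nhds w one_pos] with w' hw'
  rw [mem_ball_iff_norm] at hw'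
  refine ContinuousLinearMap.opNorm_le_bound _ (by positivity) fun δ => ?_
  refine Linf.norm_le (by positivity) ?_
  rw [sub_apply]
  filter_upwards [Lp.coeFn_sub (h.opDeriv w' δ) (h.opDeriv w δ), h.opDeriv_ae w' δ,
    h.opDeriv_ae w δ, h.add (w'.1 - w.1) w.1, hb w.1, hb δ.1, hb (w'.1 - w.1),
    Linf.ae_norm_le w.2, Linf.ae_norm_le δ.2, Linf.ae_norm_le (w'.2 - w.2),
    Lp.coeFn_sub w'.2 w.2, h.diff w.1, h.diff δ.1, h.diff (w'.1 - w.1)]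
    with t h1 h2 h3 h4 h5 h6 h7 h8 h9 h10 h11 h12 h13 h14
  rw [sub_add_cancel] at h4
  have h4' : e w'.1 t = fun v => e (w'.1 - w.1) t v + e w.1 t v := funext h4
  rw [h11, Pi.sub_apply] at h10
  have hd1 : ‖w'.1 - w.1‖ ≤ ‖w' - w‖ := norm_fst_le (w' - w)
  have hd2 : ‖w'.2 - w.2‖ ≤ ‖w' - w‖ := norm_snd_le (w' - w)
  have hw't : ‖w'.2 t‖ ≤ ‖w.2‖ + 1 := by
    have := norm_add_le (w'.2 t - w.2 t) (w.2 t)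
    rw [sub_add_cancel] at this
    linarith
  have hwt : ‖w.2 t‖ ≤ ‖w.2‖ + 1 := by linarith
  have hδ2 : ‖δ.2‖ ≤ ‖δ‖ := norm_snd_le δ
  have hδ1 : ‖δ.1‖ ≤ ‖δ‖ := norm_fst_le δ
  have h9' := h9.trans hδ2
  have hfd : fderiv ℝ (e w'.1 t) (w'.2 t)
      = fderiv ℝ (e (w'.1 - w.1) t) (w'.2 t) + fderiv ℝ (e w.1 t) (w'.2 t) := by
    rw [h4']; exact fderiv_fun_add (h14 _) (h12 _)
  rw [h1, Pi.sub_apply, h2, h3, hfd]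
  have r1 : ‖e δ.1 t (w'.2 t) - e δ.1 t (w.2 t)‖ ≤ K * ‖δ‖ * ‖w' - w‖ := by
    have := (convex_closedBall (0 : V) (‖w.2‖ + 1)).norm_image_sub_le_of_norm_fderiv_le
      (f := e δ.1 t) (𝕜 := ℝ) (C := K * ‖δ.1‖) (fun x _ => h13 x)
      (fun x hx => (h6 x (mem_closedBall_zero_iff.1 hx)).2.1)
      (mem_closedBall_zero_iff.2 hwt) (mem_closedBall_zero_iff.2 hw't)
    refine this.trans ?_
    have := h10.trans hd2
    gcongr
  have r2 : ‖(fderiv ℝ (e w.1 t) (w'.2 t) - fderiv ℝ (e w.1 t) (w.2 t)) (δ.2 t)‖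
      ≤ K * ‖w.1‖ * ‖w' - w‖ * ‖δ‖ := by
    refine (ContinuousLinearMap.le_opNorm _ _).trans
      (mul_le_mul (((h5 _ hw't).2.2 _ hwt).trans ?_) h9' (norm_nonneg _) (by positivity))
    have := h10.trans hd2
    gcongr
  have r3 : ‖fderiv ℝ (e (w'.1 - w.1) t) (w'.2 t) (δ.2 t)‖ ≤ K * ‖w' - w‖ * ‖δ‖ := by
    refine (ContinuousLinearMap.le_opNorm _ _).trans
      (mul_le_mul ((h7 _ hw't).2.1.trans ?_) h9' (norm_nonneg _) (by positivity))
    gcongr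
  have heq : e δ.1 t (w'.2 t) + (fderiv ℝ (e (w'.1 - w.1) t) (w'.2 t)
        + fderiv ℝ (e w.1 t) (w'.2 t)) (δ.2 t)
      - (e δ.1 t (w.2 t) + fderiv ℝ (e w.1 t) (w.2 t) (δ.2 t))
      = (e δ.1 t (w'.2 t) - e δ.1 t (w.2 t))
        + (fderiv ℝ (e w.1 t) (w'.2 t) - fderiv ℝ (e w.1 t) (w.2 t)) (δ.2 t)
        + fderiv ℝ (e (w'.1 - w.1) t) (w'.2 t) (δ.2 t) := by
    simp only [add_apply, sub_apply]
    abel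
  rw [heq]
  calc _ ≤ K * ‖δ‖ * ‖w' - w‖ + K * ‖w.1‖ * ‖w' - w‖ * ‖δ‖ + K * ‖w' - w‖ * ‖δ‖ :=
        norm_add_le_of_le (norm_add_le_of_le r1 r2) r3
    _ = _ := by ring

theorem contDiff_op (h : NemytskiiFamily μ e) : ContDiff ℝ 1 h.op :=
  contDiff_one_iff_hasFDerivAt.2 ⟨h.opDeriv, h.continuous_opDeriv, h.hasFDerivAt_op⟩

end NemytskiiFamily

end Nemytskii

/-! ### Component functions and smooth data as Nemytskii families -/

section IteratedDerivatives

variable {V F : Type*} [NormedAddCommGroup V] [NormedSpace ℝ V]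
  [NormedAddCommGroup F] [NormedSpace ℝ F]

theorem norm_iteratedFDeriv_succ_sub (n : ℕ) (f : V → F) (v v' : V) :
    ‖iteratedFDeriv ℝ (n + 1) f v - iteratedFDeriv ℝ (n + 1) f v'‖ =
      ‖iteratedFDeriv ℝ n (fderiv ℝ f) v - iteratedFDeriv ℝ n (fderiv ℝ f) v'‖ := by
  rw [iteratedFDeriv_succ_eq_comp_right, iteratedFDeriv_succ_eq_comp_right]
  rw [← dist_eq_norm, ← dist_eq_norm]
  exact LinearIsometryEquiv.dist_map _ _ _

theorem norm_iteratedFDeriv_zero_sub (f : V → F) (v v' : V) :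
    ‖iteratedFDeriv ℝ 0 f v - iteratedFDeriv ℝ 0 f v'‖ = ‖f v - f v'‖ := by
  rw [iteratedFDeriv_zero_eq_comp, Function.comp_apply, Function.comp_apply, ← map_sub,
    LinearIsometryEquiv.norm_map]

theorem ContDiff.norm_fderiv_sub_le {f : V → F} (hf : ContDiff ℝ 2 f) {C : ℝ}
    (hC : ∀ v, ‖iteratedFDeriv ℝ 2 f v‖ ≤ C) (v v' : V) :
    ‖fderiv ℝ f v - fderiv ℝ f v'‖ ≤ C * ‖v - v'‖ := by
  have hd : Differentiable ℝ (fderiv ℝ f) :=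
    (hf.fderiv_right (m := 1) (by norm_num)).differentiable one_ne_zero
  refine convex_univ.norm_image_sub_le_of_norm_fderiv_le (𝕜 := ℝ) (fun x _ => hd x)
    (fun x _ => ?_) (mem_univ v') (mem_univ v)
  rw [← norm_iteratedFDeriv_one, norm_iteratedFDeriv_fderiv]
  exact hC x

end IteratedDerivatives

section ComponentFunctions

variable {Y F : Type} [NormedAddCommGroup Y] [NormedSpace ℝ Y]
  [NormedAddCommGroup F] [NormedSpace ℝ F] {I : TimeInterval} {s : ℕ}

theorem GPre.ae_norm_iteratedFDeriv_le (g : GPre Y F I s) {n : ℕ} (hn : n ≤ s) :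
    ∀ᵐ t ∂I.μ, ∀ y, ‖iteratedFDeriv ℝ n (g.1 t) y‖ ≤ ‖g‖ := by
  have h1 : essSup (fun t => ⨆ y, ‖iteratedFDeriv ℝ n (g.1 t) y‖ₑ) I.μ ≤ gNorm I s g.1 :=
    Finset.single_le_sum (f := fun n => essSup (fun t => ⨆ y, ‖iteratedFDeriv ℝ n (g.1 t) y‖ₑ) I.μ)
      (fun _ _ => zero_le) (Finset.mem_range.2 (Nat.lt_succ_iff.2 hn))
  filter_upwards [ae_le_essSup (f := fun t => ⨆ y, ‖iteratedFDeriv ℝ n (g.1 t) y‖ₑ) (μ := I.μ)]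
    with t ht y
  have h2 : ‖iteratedFDeriv ℝ n (g.1 t) y‖ₑ ≤ gNorm I s g.1 :=
    ((le_iSup (fun y => ‖iteratedFDeriv ℝ n (g.1 t) y‖ₑ) y).trans ht).trans h1
  rw [← toReal_enorm]
  exact ENNReal.toReal_mono g.2.2.2.ne h2

/-- Component functions that are identified agree for a.a. `t` and all `y`. -/
theorem GPre.ae_eq_of_mk_eq {a b : GPre Y F I s}
    (h : SeparationQuotient.mk a = SeparationQuotient.mk b) :
    ∀ᵐ t ∂I.μ, ∀ y, a.1 t y = b.1 t y := by
  have h0 : ‖a - b‖ = 0 := by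
    rw [← SeparationQuotient.norm_mk, SeparationQuotient.mk_sub, h, sub_self, norm_zero]
  filter_upwards [GPre.ae_norm_iteratedFDeriv_le (a - b) (Nat.zero_le s)] with t ht y
  have h1 := ht y
  rw [h0, norm_iteratedFDeriv_zero] at h1
  exact sub_eq_zero.1 (norm_le_zero_iff.1 h1)

namespace OCPSens.GSp

theorem mk_surjInv (g : GSp Y F I s) :
    SeparationQuotient.mk (Function.surjInv SeparationQuotient.surjective_mk g) = g :=
  Function.surjInv_eq _ g

/-- Representatives are chosen arbitrarily in each class, so that linearity holds only a.e. -/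
theorem rep_add (g g' : GSp Y F I s) :
    ∀ᵐ t ∂I.μ, ∀ y, (g + g').rep t y = g.rep t y + g'.rep t y :=
  GPre.ae_eq_of_mk_eq (a := Function.surjInv SeparationQuotient.surjective_mk (g + g'))
    (b := Function.surjInv SeparationQuotient.surjective_mk g
      + Function.surjInv SeparationQuotient.surjective_mk g')
    (by rw [SeparationQuotient.mk_add, mk_surjInv, mk_surjInv, mk_surjInv])

theorem rep_smul (c : ℝ) (g : GSp Y F I s) :
    ∀ᵐ t ∂I.μ, ∀ y, (c • g).rep t y = c • g.rep t y :=
  GPre.ae_eq_of_mk_eq (a := Function.surjInv SeparationQuotient.surjective_mk (c • g))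
    (b := c • Function.surjInv SeparationQuotient.surjective_mk g)
    (by rw [SeparationQuotient.mk_smul, mk_surjInv, mk_surjInv])

theorem rep_contDiff (g : GSp Y F I s) : ∀ᵐ t ∂I.μ, ContDiff ℝ s (g.rep t) :=
  (Function.surjInv SeparationQuotient.surjective_mk g).2.1

theorem rep_meas (g : GSp Y F I s) (y : Y) : AEStronglyMeasurable (fun t => g.rep t y) I.μ :=
  (Function.surjInv SeparationQuotient.surjective_mk g).2.2.1 y

theorem rep_bound (g : GSp Y F I s) {n : ℕ} (hn : n ≤ s) :
    ∀ᵐ t ∂I.μ, ∀ y, ‖iteratedFDeriv ℝ n (g.rep t) y‖ ≤ ‖g‖ := by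
  have h := GPre.ae_norm_iteratedFDeriv_le
    (Function.surjInv SeparationQuotient.surjective_mk g) hn
  rwa [← SeparationQuotient.norm_mk, mk_surjInv] at h

/-- Evaluation of component functions is a Nemytskii family. -/
theorem nemytskii (hs : 2 ≤ s) :
    NemytskiiFamily I.μ (fun (g : GSp Y F I s) t y => g.rep t y) where
  add := rep_add
  smul := rep_smul
  meas := rep_meas
  diff g := by
    filter_upwards [g.rep_contDiff] with t ht
    exact ht.differentiable (by simp; omega)
  bound R := by
    refine ⟨1, zero_le_one, fun g => ?_⟩
    filter_upwards [g.rep_contDiff, g.rep_bound (n := 0) (by omega),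
      g.rep_bound (n := 1) (by omega), g.rep_bound hs] with t h h0 h1 h2 v _
    rw [one_mul]
    refine ⟨by simpa using h0 v, by simpa using h1 v, fun v' _ => ?_⟩
    exact (h.of_le (by exact_mod_cast hs)).norm_fderiv_sub_le h2 v v'

/-- Evaluation of the derivatives of component functions is a Nemytskii family. -/
theorem nemytskii_fderiv [FiniteDimensional ℝ Y] (hs : 3 ≤ s) :
    NemytskiiFamily I.μ (fun (g : GSp Y F I s) t y => fderiv ℝ (g.rep t) y) where
  add g g' := by
    filter_upwards [rep_add g g', g.rep_contDiff, g'.rep_contDiff] with t h h1 h2 v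
    rw [show (g + g').rep t = fun y => g.rep t y + g'.rep t y from funext h]
    exact fderiv_fun_add ((h1.differentiable (by simp; omega)) v)
      ((h2.differentiable (by simp; omega)) v)
  smul c g := by
    filter_upwards [rep_smul c g, g.rep_contDiff] with t h h1 v
    rw [show (c • g).rep t = fun y => c • g.rep t y from funext h]
    exact fderiv_fun_const_smul ((h1.differentiable (by simp; omega)) v) c
  meas g v := by
    refine aestronglyMeasurable_fderiv_superposition g.rep_meas ?_ aestronglyMeasurable_const
    filter_upwards [g.rep_contDiff] with t ht
    exact ht.differentiable (by simp; omega)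
  diff g := by
    filter_upwards [g.rep_contDiff] with t ht
    exact (ht.fderiv_right (m := 1) (by exact_mod_cast (by omega : 1 + 1 ≤ s))).differentiable
      one_ne_zero
  bound R := by
    refine ⟨1, zero_le_one, fun g => ?_⟩
    filter_upwards [g.rep_contDiff, g.rep_bound (n := 1) (by omega),
      g.rep_bound (n := 2) (by omega), g.rep_bound hs] with t h h0 h1 h2 v _
    rw [one_mul]
    have hf : ContDiff ℝ 2 (fderiv ℝ (g.rep t)) :=
      h.fderiv_right (m := 2) (by exact_mod_cast hs)
    refine ⟨by simpa using h0 v, ?_, fun v' _ => ?_⟩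
    · rw [← norm_iteratedFDeriv_one, norm_iteratedFDeriv_fderiv]
      exact h1 v
    · refine hf.norm_fderiv_sub_le (fun v => ?_) v v'
      rw [norm_iteratedFDeriv_fderiv]
      exact h2 v

end OCPSens.GSp

end ComponentFunctions

section SmoothData

variable {V F : Type} [NormedAddCommGroup V] [NormedSpace ℝ V]
  [NormedAddCommGroup F] [NormedSpace ℝ F] {I : TimeInterval} {h : ℝ → V → F}

namespace OCPSens.Smooth

/-- Uniform bounds for the derivatives of smooth data on balls. -/
theorem exists_bound (hh : Smooth I h) (R : ℝ) : ∃ K : ℝ, 0 ≤ K ∧ ∀ s ≤ 2, ∀ᵐ t ∂I.μ,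
    ∀ v, ‖v‖ ≤ R → ‖iteratedFDeriv ℝ s (h t) v‖ ≤ K ∧ ∀ v', ‖v'‖ ≤ R →
      ‖iteratedFDeriv ℝ s (h t) v - iteratedFDeriv ℝ s (h t) v'‖ ≤ K * ‖v - v'‖ := by
  obtain ⟨K, hK⟩ := hh.bound
  obtain ⟨L, hL⟩ := hh.lip (max R 1) (by positivity)
  refine ⟨|K| + |L| * (max R 1) + |L|, by positivity, fun s hs => ?_⟩
  filter_upwards [hK s hs, hL s hs] with t h1 h2 v hv
  have hv' : v ∈ Metric.closedBall (0 : V) (max R 1) :=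
    mem_closedBall_zero_iff.2 (hv.trans (le_max_left _ _))
  have h0 : (0 : V) ∈ Metric.closedBall (0 : V) (max R 1) :=
    Metric.mem_closedBall_self (by positivity)
  have hmax : 0 ≤ max R 1 := by positivity
  constructor
  · -- compare with the value at `0`
    have h3 := h2 v hv' 0 h0
    have h4 : L * ‖v - 0‖ ≤ |L| * max R 1 := by
      rw [sub_zero]
      exact mul_le_mul (le_abs_self L) (hv.trans (le_max_left _ _)) (norm_nonneg _) (abs_nonneg _)
    have h5 := norm_le_norm_add_norm_sub' (iteratedFDeriv ℝ s (h t) v) (iteratedFDeriv ℝ s (h t) 0)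
    linarith [le_abs_self K, abs_nonneg L]
  · intro v'' hv''
    refine (h2 v hv' v'' (mem_closedBall_zero_iff.2 (hv''.trans (le_max_left _ _)))).trans ?_
    refine mul_le_mul_of_nonneg_right ?_ (norm_nonneg _)
    have : 0 ≤ |L| * max R 1 := by positivity
    linarith [le_abs_self L, abs_nonneg K]

theorem ae_differentiable (hh : Smooth I h) : ∀ᵐ t ∂I.μ, Differentiable ℝ (h t) := by
  filter_upwards [hh.contDiff] with t ht using ht.differentiable two_ne_zero

theorem ae_differentiable_fderiv (hh : Smooth I h) :
    ∀ᵐ t ∂I.μ, Differentiable ℝ (fderiv ℝ (h t)) := by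
  filter_upwards [hh.contDiff] with t ht
  exact (ht.fderiv_right (m := 1) (by norm_num)).differentiable one_ne_zero

/-- Multiples of a smooth function form a Nemytskii family, with parameter space `ℝ`. -/
theorem nemytskii (hh : Smooth I h) : NemytskiiFamily I.μ (fun (c : ℝ) t v => c • h t v) where
  add c c' := Eventually.of_forall fun t v => add_smul c c' _
  smul a c := Eventually.of_forall fun t v => by rw [smul_eq_mul, mul_smul]
  meas c v := (hh.meas v).const_smul c
  diff c := by filter_upwards [hh.ae_differentiable] with t ht using ht.const_smul c
  bound R := by
    obtain ⟨K, hK, hb⟩ := hh.exists_bound R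
    refine ⟨K, hK, fun c => ?_⟩
    filter_upwards [hb 0 (by norm_num), hb 1 (by norm_num), hh.ae_differentiable] with t h0 h1 hd
    intro v hv
    have e : ∀ v, fderiv ℝ (fun v => c • h t v) v = c • fderiv ℝ (h t) v := fun v =>
      fderiv_fun_const_smul (hd v) c
    have h3 := (h0 v hv).1
    have h4 := (h1 v hv).1
    rw [norm_iteratedFDeriv_zero] at h3
    rw [norm_iteratedFDeriv_one] at h4
    refine ⟨?_, ?_, fun v' hv' => ?_⟩
    · rw [norm_smul, mul_comm]; gcongr
    · rw [e, norm_smul, mul_comm]; gcongr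
    · have h5 := (h1 v hv).2 v' hv'
      rw [norm_iteratedFDeriv_succ_sub, norm_iteratedFDeriv_zero_sub] at h5
      rw [e, e, ← smul_sub, norm_smul, mul_comm, mul_right_comm]; gcongr

/-- Multiples of the derivative of a smooth function form a Nemytskii family. -/
theorem nemytskii_fderiv [FiniteDimensional ℝ V] (hh : Smooth I h) :
    NemytskiiFamily I.μ (fun (c : ℝ) t v => c • fderiv ℝ (h t) v) where
  add c c' := Eventually.of_forall fun t v => add_smul c c' _
  smul a c := Eventually.of_forall fun t v => by rw [smul_eq_mul, mul_smul]
  meas c v := (aestronglyMeasurable_fderiv_superposition hh.meas hh.ae_differentiable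
    aestronglyMeasurable_const).const_smul c
  diff c := by filter_upwards [hh.ae_differentiable_fderiv] with t ht using ht.const_smul c
  bound R := by
    obtain ⟨K, hK, hb⟩ := hh.exists_bound R
    refine ⟨K, hK, fun c => ?_⟩
    filter_upwards [hb 1 (by norm_num), hb 2 le_rfl, hh.ae_differentiable_fderiv] with t h0 h1 hd
    intro v hv
    have e : ∀ v, fderiv ℝ (fun v => c • fderiv ℝ (h t) v) v = c • fderiv ℝ (fderiv ℝ (h t)) v :=
      fun v => fderiv_fun_const_smul (hd v) c
    have h3 := (h0 v hv).1
    have h4 := (h1 v hv).1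
    rw [norm_iteratedFDeriv_one] at h3
    rw [← norm_iteratedFDeriv_fderiv, norm_iteratedFDeriv_one] at h4
    refine ⟨?_, ?_, fun v' hv' => ?_⟩
    · rw [norm_smul, mul_comm]; gcongr
    · rw [e, norm_smul, mul_comm]; gcongr
    · have h5 := (h1 v hv).2 v' hv'
      rw [norm_iteratedFDeriv_succ_sub, norm_iteratedFDeriv_succ_sub,
        norm_iteratedFDeriv_zero_sub] at h5
      rw [e, e, ← smul_sub, norm_smul, mul_comm, mul_right_comm]; gcongr

end OCPSens.Smooth

end SmoothData

/-! ### Sobolev functions on an interval -/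

section Primitives

theorem absolutelyContinuousOnInterval_const_add_integral {a b : ℝ} {v : ℝ → ℝ} (c : ℝ)
    (hv : IntervalIntegrable v volume a b) :
    AbsolutelyContinuousOnInterval (fun t => c + ∫ s in a..t, v s) a b := by
  have h1 : AbsolutelyContinuousOnInterval (fun _ : ℝ => c) a b :=
    (LipschitzWith.const c).lipschitzOnWith.absolutelyContinuousOnInterval
  exact h1.add (hv.absolutelyContinuousOnInterval_intervalIntegral left_mem_uIcc)

/-- Product rule for primitives of integrable functions. -/
theorem integral_mul_of_primitive {a b : ℝ} (hab : a ≤ b) {f g v w : ℝ → ℝ}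
    (hv : IntervalIntegrable v volume a b) (hw : IntervalIntegrable w volume a b)
    (hf : ∀ t ∈ Icc a b, f t = f a + ∫ s in a..t, v s)
    (hg : ∀ t ∈ Icc a b, g t = g a + ∫ s in a..t, w s) :
    ∫ t in a..b, (v t * g t + f t * w t) = f b * g b - f a * g a := by
  have hF := absolutelyContinuousOnInterval_const_add_integral (f a) hv
  have hG := absolutelyContinuousOnInterval_const_add_integral (g a) hw
  have h := hF.integral_deriv_mul_eq_sub hG
  rw [← hf b (right_mem_Icc.2 hab), ← hg b (right_mem_Icc.2 hab), ← hf a (left_mem_Icc.2 hab),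
    ← hg a (left_mem_Icc.2 hab)] at h
  rw [← h]
  refine intervalIntegral.integral_congr_ae ?_
  filter_upwards [hv.ae_hasDerivAt_integral, hw.ae_hasDerivAt_integral] with t h1 h2 ht
  have ht' : t ∈ uIcc a b := uIoc_subset_uIcc ht
  have ht'' : t ∈ Icc a b := by rwa [uIcc_of_le hab] at ht'
  have d1 := ((h1 ht' a left_mem_uIcc).const_add (f a)).deriv
  have d2 := ((h2 ht' a left_mem_uIcc).const_add (g a)).deriv
  rw [d1, d2, ← hf t ht'', ← hg t ht'']

end Primitives

namespace OCPSens

section Sobolev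

variable {I : TimeInterval} {n : ℕ}

theorem TimeInterval.intervalIntegrable_iff {E : Type*} [NormedAddCommGroup E] {v : ℝ → E} :
    IntervalIntegrable v volume I.t₀ I.tf ↔ Integrable v I.μ :=
  intervalIntegrable_iff_integrableOn_Ioo_of_le I.lt.le

theorem TimeInterval.integral_eq {E : Type*} [NormedAddCommGroup E] [NormedSpace ℝ E]
    {v : ℝ → E} : ∫ t, v t ∂I.μ = ∫ t in I.t₀..I.tf, v t := by
  rw [intervalIntegral.integral_of_le I.lt.le, integral_Ioc_eq_integral_Ioo]

theorem TimeInterval.intervalIntegrable_of_mem {E : Type*} [NormedAddCommGroup E] {v : ℝ → E}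
    (hv : Integrable v I.μ) {s t : ℝ} (hs : s ∈ Icc I.t₀ I.tf) (ht : t ∈ Icc I.t₀ I.tf) :
    IntervalIntegrable v volume s t := by
  refine (TimeInterval.intervalIntegrable_iff.2 hv).mono_set ?_
  rw [uIcc_of_le I.lt.le]
  exact uIcc_subset_Icc hs ht

theorem TimeInterval.left_mem (I : TimeInterval) : I.t₀ ∈ Icc I.t₀ I.tf := left_mem_Icc.2 I.lt.le

theorem TimeInterval.right_mem (I : TimeInterval) : I.tf ∈ Icc I.t₀ I.tf :=
  right_mem_Icc.2 I.lt.le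

theorem integrable_apply {v : ℝ → E n} (hv : Integrable v I.μ) (i : Fin n) :
    Integrable (fun t => v t i) I.μ :=
  (EuclideanSpace.proj i : E n →L[ℝ] ℝ).integrable_comp hv

theorem integral_apply {v : ℝ → E n} {s t : ℝ} (hv : IntervalIntegrable v volume s t) (i : Fin n) :
    (∫ r in s..t, v r) i = ∫ r in s..t, v r i :=
  ((EuclideanSpace.proj i : E n →L[ℝ] ℝ).intervalIntegral_comp_comm hv).symm

/-- Product rule for the inner product of two vector-valued primitives. -/
theorem integral_inner_of_primitive {x y v w : ℝ → E n}
    (hv : Integrable v I.μ) (hw : Integrable w I.μ)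
    (hx : ∀ t ∈ Icc I.t₀ I.tf, x t = x I.t₀ + ∫ s in I.t₀..t, v s)
    (hy : ∀ t ∈ Icc I.t₀ I.tf, y t = y I.t₀ + ∫ s in I.t₀..t, w s) :
    ∫ t, (⟪v t, y t⟫ + ⟪x t, w t⟫) ∂I.μ = ⟪x I.tf, y I.tf⟫ - ⟪x I.t₀, y I.t₀⟫ := by
  have hxi : ∀ i, ∀ t ∈ Icc I.t₀ I.tf, x t i = x I.t₀ i + ∫ s in I.t₀..t, v s i := by
    intro i t ht
    rw [hx t ht, PiLp.add_apply,
      integral_apply (TimeInterval.intervalIntegrable_of_mem hv I.left_mem ht)]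
  have hyi : ∀ i, ∀ t ∈ Icc I.t₀ I.tf, y t i = y I.t₀ i + ∫ s in I.t₀..t, w s i := by
    intro i t ht
    rw [hy t ht, PiLp.add_apply,
      integral_apply (TimeInterval.intervalIntegrable_of_mem hw I.left_mem ht)]
  have hiv := fun i => TimeInterval.intervalIntegrable_iff.2 (integrable_apply hv i)
  have hiw := fun i => TimeInterval.intervalIntegrable_iff.2 (integrable_apply hw i)
  have hc : ∀ {x v : ℝ → E n}, (∀ i, IntervalIntegrable (fun t => v t i) volume I.t₀ I.tf) →
      (∀ i, ∀ t ∈ Icc I.t₀ I.tf, x t i = x I.t₀ i + ∫ s in I.t₀..t, v s i) → ∀ i,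
      ContinuousOn (fun t => x t i) (uIcc I.t₀ I.tf) := by
    intro x v hv hx i
    refine (absolutelyContinuousOnInterval_const_add_integral (x I.t₀ i)
      (hv i)).continuousOn.congr fun t ht => ?_
    rw [uIcc_of_le I.lt.le] at ht
    exact hx i t ht
  have key := fun i => integral_mul_of_primitive I.lt.le (hiv i) (hiw i) (hxi i) (hyi i)
  have e : ∀ a b c d : E n, ⟪a, b⟫ + ⟪c, d⟫ = ∑ i, (a i * b i + c i * d i) := by
    intro a b c d
    simp only [PiLp.inner_apply, RCLike.inner_apply, conj_trivial, Finset.sum_add_distrib]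
    congr 1 <;> exact Finset.sum_congr rfl fun i _ => mul_comm _ _
  have e' : ∀ a b c d : E n, ⟪a, b⟫ - ⟪c, d⟫ = ∑ i, (a i * b i - c i * d i) := by
    intro a b c d
    simp only [PiLp.inner_apply, RCLike.inner_apply, conj_trivial, Finset.sum_sub_distrib]
    congr 1 <;> exact Finset.sum_congr rfl fun i _ => mul_comm _ _
  simp_rw [TimeInterval.integral_eq, e, e']
  rw [intervalIntegral.integral_finsetSum]
  · exact Finset.sum_congr rfl fun i _ => key i
  · intro i _
    exact ((hiv i).mul_continuousOn (hc hiw hyi i)).add ((hiw i).continuousOn_mul (hc hiv hxi i))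

/-- A primitive of an integrable function has this function as its weak derivative. -/
theorem isWeakDeriv_of_primitive {x v : ℝ → E n} (hv : Integrable v I.μ)
    (hx : ∀ t ∈ Icc I.t₀ I.tf, x t = x I.t₀ + ∫ s in I.t₀..t, v s) : IsWeakDeriv I x v := by
  intro η hη hηc hηs
  have hηd : Continuous (deriv η) := hη.continuous_deriv (by simp)
  have hcont : ContinuousOn x (Icc I.t₀ I.tf) := by
    have h1 := intervalIntegral.continuousOn_primitive_interval'
      (TimeInterval.intervalIntegrable_iff.2 hv) (left_mem_uIcc (a := I.t₀) (b := I.tf))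
    rw [uIcc_of_le I.lt.le] at h1
    exact (continuousOn_const.add h1).congr fun t ht => hx t ht
  have hxi : Integrable x I.μ := hcont.integrableOn_Icc.mono_set Ioo_subset_Icc_self
  have hi1 : Integrable (fun t => deriv η t • x t) I.μ :=
    integrable_smul_of_test I hηd hηc.deriv hxi
  have hi2 : Integrable (fun t => η t • v t) I.μ := integrable_smul_of_test I hη.continuous hηc hv
  have hηa : η I.t₀ = 0 := image_eq_zero_of_notMem_tsupport fun h => (hηs h).1.false
  have hηb : η I.tf = 0 := image_eq_zero_of_notMem_tsupport fun h => (hηs h).2.false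
  rw [eq_neg_iff_add_eq_zero, TimeInterval.integral_eq, TimeInterval.integral_eq]
  have hp1 := fun i => integral_apply (TimeInterval.intervalIntegrable_iff.2 hi1) i
  have hp2 := fun i => integral_apply (TimeInterval.intervalIntegrable_iff.2 hi2) i
  ext i
  rw [PiLp.add_apply, hp1, hp2, PiLp.zero_apply, ← intervalIntegral.integral_add
    (TimeInterval.intervalIntegrable_iff.2 (integrable_apply hi1 i))
    (TimeInterval.intervalIntegrable_iff.2 (integrable_apply hi2 i))]
  simp only [PiLp.smul_apply, smul_eq_mul]
  rw [integral_mul_of_primitive (f := η) (v := deriv η) (g := fun t => x t i)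
    (w := fun t => v t i) I.lt.le (hηd.intervalIntegrable _ _)
    (TimeInterval.intervalIntegrable_iff.2 (integrable_apply hv i)), hηa, hηb]
  · simp
  · intro t _
    rw [intervalIntegral.integral_deriv_eq_sub (fun s _ => hη.differentiable (by simp) s)
      (hηd.intervalIntegrable _ _)]
    ring
  · intro t ht
    simp only
    rw [hx t ht, PiLp.add_apply,
      integral_apply (TimeInterval.intervalIntegrable_of_mem hv I.left_mem ht)]

/-- Du Bois-Reymond lemma: a continuous function with vanishing weak derivative is constant. -/
theorem eq_const_of_isWeakDeriv_zero {w : ℝ → E n} (hc : ContinuousOn w (Icc I.t₀ I.tf))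
    (hw : IsWeakDeriv I w 0) : ∃ c, ∀ t ∈ Icc I.t₀ I.tf, w t = c := by
  have hlt := I.lt
  have hwi : Integrable w I.μ := hc.integrableOn_Icc.mono_set Ioo_subset_Icc_self
  -- a test function with integral one; the constant is the corresponding mean of `w`
  let β : ContDiffBump ((I.t₀ + I.tf) / 2) :=
    ⟨(I.tf - I.t₀) / 8, (I.tf - I.t₀) / 4, by linarith, by linarith⟩
  set η₀ : ℝ → ℝ := β.normed volume with hη₀
  have h0d : ContDiff ℝ ((⊤ : ℕ∞) : WithTop ℕ∞) η₀ := β.contDiff_normed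
  have h0c : HasCompactSupport η₀ := β.hasCompactSupport_normed
  have h0s : tsupport η₀ ⊆ Ioo I.t₀ I.tf := by
    rw [hη₀, β.tsupport_normed_eq, Real.closedBall_eq_Icc]
    intro t ht
    simp only [β] at ht
    constructor <;> linarith [ht.1, ht.2]
  have h0i : ∫ t, η₀ t = 1 := β.integral_normed
  set c : E n := ∫ t, η₀ t • w t ∂I.μ with hcdef
  have key : ∀ θ : ℝ → ℝ, ContDiff ℝ ((⊤ : ℕ∞) : WithTop ℕ∞) θ → HasCompactSupport θ →
      tsupport θ ⊆ Ioo I.t₀ I.tf →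
      ∫ t, θ t • (Ioo I.t₀ I.tf).indicator (fun t => w t - c) t = 0 := by
    intro θ hθ hθc hθs
    -- the test function is a primitive of `θ - (∫ θ) η₀`, which has mean value zero
    set ζ : ℝ → ℝ := fun t => θ t - (∫ s, θ s) * η₀ t with hζ
    have hζd : ContDiff ℝ ((⊤ : ℕ∞) : WithTop ℕ∞) ζ := hθ.sub (contDiff_const.mul h0d)
    have hθi : Integrable θ := hθ.continuous.integrable_of_hasCompactSupport hθc
    have h0int : Integrable η₀ := h0d.continuous.integrable_of_hasCompactSupport h0c
    have hζi : Integrable ζ := hθi.sub (h0int.const_mul _)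
    have hζ0 : ∫ t, ζ t = 0 := by
      rw [hζ, integral_sub hθi (h0int.const_mul _), integral_const_mul, h0i]; ring
    set K : Set ℝ := tsupport θ ∪ tsupport η₀ with hK
    have hKc : IsCompact K := hθc.isCompact.union h0c.isCompact
    have hKs : K ⊆ Ioo I.t₀ I.tf := union_subset hθs h0s
    have hKne : K.Nonempty := by
      by_contra hne
      rw [not_nonempty_iff_eq_empty] at hne
      have : η₀ = 0 := by
        rw [← tsupport_eq_empty_iff]
        exact subset_empty_iff.1 (hne ▸ subset_union_right)
      rw [this] at h0i
      simp at h0i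
    obtain ⟨p, hp⟩ := hKc.exists_isLeast hKne
    obtain ⟨q, hq⟩ := hKc.exists_isGreatest hKne
    have hζK : ∀ t, t ∉ K → ζ t = 0 := by
      intro t ht
      have h1 : θ t = 0 := image_eq_zero_of_notMem_tsupport fun h => ht (Or.inl h)
      have h2 : η₀ t = 0 := image_eq_zero_of_notMem_tsupport fun h => ht (Or.inr h)
      simp [hζ, h1, h2]
    set η : ℝ → ℝ := fun t => ∫ s in I.t₀..t, ζ s with hη
    have hηd : ∀ t, HasDerivAt η (ζ t) t := fun t =>
      intervalIntegral.integral_hasDerivAt_right (hζd.continuous.intervalIntegrable _ _)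
        (hζd.continuous.stronglyMeasurableAtFilter _ _) hζd.continuous.continuousAt
    have hηderiv : deriv η = ζ := funext fun t => (hηd t).deriv
    have hηs : ContDiff ℝ ((⊤ : ℕ∞) : WithTop ℕ∞) η := by
      rw [contDiff_infty_iff_deriv, hηderiv]
      exact ⟨fun t => (hηd t).differentiableAt, hζd⟩
    have hη0 : ∀ t, t ∉ Icc p q → η t = 0 := by
      intro t ht
      rw [mem_Icc, not_and_or, not_le, not_le] at ht
      rcases ht with ht | ht
      · simp only [hη]
        refine (intervalIntegral.integral_congr (g := fun _ => 0) fun s hs => ?_).trans (by simp)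
        refine hζK s fun hsK => ?_
        have h1 : s ≤ max I.t₀ t := hs.2
        have h2 := hp.2 hsK
        have h3 := (hKs hsK).1
        rcases le_max_iff.1 h1 with h | h <;> linarith
      · have hz : ∀ s, s ∉ Ioc I.t₀ t → ζ s = 0 := by
          intro s hs
          refine hζK s fun hsK => hs ⟨(hKs hsK).1, ?_⟩
          exact (hq.2 hsK).trans ht.le
        have htle : I.t₀ ≤ t := (hKs hq.1).1.le.trans ht.le
        simp only [hη]
        rw [intervalIntegral.integral_of_le htle,
          setIntegral_eq_integral_of_forall_compl_eq_zero hz, hζ0]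
    have hηts : tsupport η ⊆ Icc p q :=
      closure_minimal (fun t ht => by_contra fun h => ht (hη0 t h)) isClosed_Icc
    have hpq : Icc p q ⊆ Ioo I.t₀ I.tf := fun t ht =>
      ⟨(hKs hp.1).1.trans_le ht.1, ht.2.trans_lt (hKs hq.1).2⟩
    have h1 := hw η hηs (isCompact_Icc.of_isClosed_subset (isClosed_tsupport η) hηts)
      (hηts.trans hpq)
    rw [hηderiv] at h1
    simp only [Pi.zero_apply, smul_zero, integral_zero, neg_zero] at h1
    have hi1 := integrable_smul_of_test I hθ.continuous hθc hwi
    have hi2 := integrable_smul_of_test I h0d.continuous h0c hwi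
    have h2 : ∫ t, ζ t • w t ∂I.μ = ∫ t, θ t • w t ∂I.μ - (∫ s, θ s) • c := by
      rw [hcdef, ← integral_smul, ← integral_sub hi1 (hi2.fun_smul _)]
      refine integral_congr_ae (Eventually.of_forall fun t => ?_)
      simp only [hζ, sub_smul, mul_smul]
    have h3 : ∫ s, θ s = ∫ s, θ s ∂I.μ := by
      rw [setIntegral_eq_integral_of_forall_compl_eq_zero]
      exact fun t ht => image_eq_zero_of_notMem_tsupport fun h => ht (hθs h)
    have h4 : ∀ t, θ t • (Ioo I.t₀ I.tf).indicator (fun t => w t - c) t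
        = (Ioo I.t₀ I.tf).indicator (fun t => θ t • (w t - c)) t := by
      intro t
      by_cases ht : t ∈ Ioo I.t₀ I.tf
      · rw [indicator_of_mem ht, indicator_of_mem ht]
      · rw [indicator_of_notMem ht, indicator_of_notMem ht, smul_zero]
    simp_rw [h4]
    rw [integral_indicator measurableSet_Ioo]
    have h5 : ∫ t in Ioo I.t₀ I.tf, θ t • (w t - c) =
        ∫ t, θ t • w t ∂I.μ - (∫ s, θ s ∂I.μ) • c := by
      simp_rw [smul_sub]
      rw [integral_sub hi1 (hθi.restrict.smul_const c), integral_smul_const]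
    rw [h5, ← h3, ← h2, h1]
  have hloc : LocallyIntegrableOn ((Ioo I.t₀ I.tf).indicator (fun t => w t - c))
      (Ioo I.t₀ I.tf) := by
    refine IntegrableOn.locallyIntegrableOn ?_
    refine ((hwi.sub (integrable_const c))).congr ?_
    filter_upwards [ae_restrict_mem measurableSet_Ioo] with t ht
    rw [indicator_of_mem ht]; rfl
  have hae := isOpen_Ioo.ae_eq_zero_of_integral_contDiff_smul_eq_zero hloc key
  have hae' : w =ᵐ[volume.restrict (Ioo I.t₀ I.tf)] fun _ => c := by
    rw [Filter.EventuallyEq, ae_restrict_iff' measurableSet_Ioo]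
    filter_upwards [hae] with t h ht
    have := h ht
    rw [indicator_of_mem ht] at this
    exact sub_eq_zero.1 this
  refine ⟨c, ?_⟩
  have heq : EqOn w (fun _ => c) (Ioo I.t₀ I.tf) :=
    Measure.eqOn_open_of_ae_eq hae' isOpen_Ioo (hc.mono Ioo_subset_Icc_self) continuousOn_const
  have hcl := heq.of_subset_closure hc continuousOn_const Ioo_subset_Icc_self
    (by rw [closure_Ioo I.lt.ne])
  exact fun t ht => hcl ht

/-- A continuous function with an integrable weak derivative is a primitive of it. -/
theorem eq_primitive_of_isWeakDeriv {x v : ℝ → E n} (hc : ContinuousOn x (Icc I.t₀ I.tf))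
    (hv : Integrable v I.μ) (h : IsWeakDeriv I x v) :
    ∀ t ∈ Icc I.t₀ I.tf, x t = x I.t₀ + ∫ s in I.t₀..t, v s := by
  set P : ℝ → E n := fun t => ∫ s in I.t₀..t, v s with hP
  have hPc : ContinuousOn P (Icc I.t₀ I.tf) := by
    have h1 := intervalIntegral.continuousOn_primitive_interval'
      (TimeInterval.intervalIntegrable_iff.2 hv) (left_mem_uIcc (a := I.t₀) (b := I.tf))
    rwa [uIcc_of_le I.lt.le] at h1
  have hPw : IsWeakDeriv I P v := isWeakDeriv_of_primitive hv fun t _ => by simp [hP]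
  have hw : IsWeakDeriv I (fun t => x t - P t) 0 := by
    intro η h1 h2 h3
    have hd := h1.continuous_deriv (by simp)
    have hi : ∀ {y : ℝ → E n}, ContinuousOn y (Icc I.t₀ I.tf) →
        Integrable (fun t => deriv η t • y t) I.μ := fun hy =>
      integrable_smul_of_test I hd h2.deriv (hy.integrableOn_Icc.mono_set Ioo_subset_Icc_self)
    simp_rw [smul_sub]
    rw [integral_sub (hi hc) (hi hPc), h η h1 h2 h3, hPw η h1 h2 h3]
    simp
  obtain ⟨c, hcc⟩ := eq_const_of_isWeakDeriv_zero (hc.sub hPc) hw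
  intro t ht
  have e1 := hcc t ht
  have e2 := hcc I.t₀ I.left_mem
  simp only [hP, Pi.sub_apply, intervalIntegral.integral_same, sub_zero] at e1 e2
  rw [e2, ← e1]; abel

end Sobolev

end OCPSens

/-! ### Sobolev functions as primitives -/

section LpInclusion

variable {α : Type*} [MeasurableSpace α] {μ : Measure α} [IsFiniteMeasure μ] {E : Type*}
  [NormedAddCommGroup E] [NormedSpace ℝ E] {p q : ℝ≥0∞} [Fact (1 ≤ p)] [Fact (1 ≤ q)]

theorem Lp.memLp_of_le (hqp : q ≤ p) (f : Lp E p μ) : MemLp f q μ :=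
  (Lp.memLp f).mono_exponent hqp

/-- The inclusion `L^p ⊆ L^q`, `q ≤ p`, for a finite measure. -/
noncomputable def Lp.incl (hqp : q ≤ p) : Lp E p μ →L[ℝ] Lp E q μ :=
  LinearMap.mkContinuousOfExistsBound
    { toFun := fun f => (Lp.memLp_of_le hqp f).toLp
      map_add' := fun f g => by
        rw [← MemLp.toLp_add, MemLp.toLp_eq_toLp_iff]
        exact Lp.coeFn_add f g
      map_smul' := fun c f => by
        rw [RingHom.id_apply, ← MemLp.toLp_const_smul, MemLp.toLp_eq_toLp_iff]
        exact Lp.coeFn_smul c f }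
    (by
      refine ⟨(μ univ ^ (1 / q.toReal - 1 / p.toReal)).toReal, fun f => ?_⟩
      refine (Lp.norm_toLp _ (Lp.memLp_of_le hqp f)).trans_le ?_
      rw [Lp.norm_def, mul_comm, ← ENNReal.toReal_mul]
      have hexp : 0 ≤ 1 / q.toReal - 1 / p.toReal := by
        rw [sub_nonneg]
        by_cases hp : p = ⊤
        · simp [hp]
        · have hq0 : 0 < q.toReal := ENNReal.toReal_pos
            (zero_lt_one.trans_le (Fact.out : 1 ≤ q)).ne' (ne_top_of_le_ne_top hp hqp)
          exact one_div_le_one_div_of_le hq0 (ENNReal.toReal_mono hp hqp)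
      exact ENNReal.toReal_mono (ENNReal.mul_ne_top (Lp.eLpNorm_ne_top f)
        (ENNReal.rpow_ne_top_of_nonneg hexp (measure_ne_top μ _)))
        (eLpNorm_le_eLpNorm_mul_rpow_measure_univ hqp (Lp.aestronglyMeasurable f)))

theorem Lp.incl_ae (hqp : q ≤ p) (f : Lp E p μ) : Lp.incl hqp f =ᵐ[μ] f :=
  MemLp.coeFn_toLp (Lp.memLp_of_le hqp f)

end LpInclusion

namespace OCPSens

section Sobolev

variable {I : TimeInterval} {n : ℕ}

theorem Lp.integrable {E : Type*} [NormedAddCommGroup E] {p : ℝ≥0∞} [Fact (1 ≤ p)]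
    (f : Lp E p I.μ) : Integrable f I.μ := (Lp.memLp f).integrable Fact.out

theorem TimeInterval.μ_eq (I : TimeInterval) : I.μ = volume.restrict (Ioc I.t₀ I.tf) :=
  Measure.restrict_congr_set Ioo_ae_eq_Ioc

theorem TimeInterval.ae_iff {q : ℝ → Prop} :
    (∀ᵐ t ∂I.μ, q t) ↔ ∀ᵐ t, t ∈ Ioc I.t₀ I.tf → q t := by
  rw [TimeInterval.μ_eq, ae_restrict_iff' measurableSet_Ioc]

theorem continuous_integral {v : ℝ → E n} (hv : Integrable v I.μ) :
    Continuous fun t : Icc I.t₀ I.tf => ∫ s in I.t₀..(t : ℝ), v s := by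
  have h1 := intervalIntegral.continuousOn_primitive_interval'
    (TimeInterval.intervalIntegrable_iff.2 hv) (left_mem_uIcc (a := I.t₀) (b := I.tf))
  rw [uIcc_of_le I.lt.le] at h1
  exact h1.comp_continuous continuous_subtype_val fun t => t.2

theorem integral_congr_of_ae {E : Type*} [NormedAddCommGroup E] [NormedSpace ℝ E] {v w : ℝ → E}
    (h : v =ᵐ[I.μ] w) {t : ℝ} (ht : t ∈ Icc I.t₀ I.tf) :
    ∫ s in I.t₀..t, v s = ∫ s in I.t₀..t, w s := by
  refine intervalIntegral.integral_congr_ae_restrict ?_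
  have hsub : uIoc I.t₀ t ⊆ Ioc I.t₀ I.tf := by
    rw [uIoc_of_le ht.1]; exact Ioc_subset_Ioc_right ht.2
  refine ae_mono (Measure.restrict_mono_set volume hsub) ?_
  rw [← TimeInterval.μ_eq]
  exact h

/-- Integration from `t₀`, as a map from `L¹` to the continuous functions. -/
noncomputable def prim (I : TimeInterval) (n : ℕ) :
    Lp (E n) 1 I.μ →L[ℝ] C(Icc I.t₀ I.tf, E n) :=
  LinearMap.mkContinuous
    { toFun := fun v => ⟨fun t => ∫ s in I.t₀..(t : ℝ), v s, continuous_integral (Lp.integrable v)⟩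
      map_add' := fun v w => by
        ext1 t
        have hv := TimeInterval.intervalIntegrable_of_mem (Lp.integrable v) I.left_mem t.2
        have hw := TimeInterval.intervalIntegrable_of_mem (Lp.integrable w) I.left_mem t.2
        exact (integral_congr_of_ae (Lp.coeFn_add v w) t.2).trans
          (intervalIntegral.integral_add hv hw)
      map_smul' := fun c v => by
        ext1 t
        exact (integral_congr_of_ae (Lp.coeFn_smul c v) t.2).trans
          (intervalIntegral.integral_smul c _) }
    1 (fun v => by
      rw [one_mul, ContinuousMap.norm_le _ (norm_nonneg _)]
      intro t
      change ‖∫ s in I.t₀..(t : ℝ), v s‖ ≤ ‖v‖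
      rw [L1.norm_eq_integral_norm, intervalIntegral.integral_of_le t.2.1]
      refine (norm_integral_le_integral_norm _).trans ?_
      have h : Integrable (fun s => ‖v s‖) (volume.restrict (Ioc I.t₀ I.tf)) := by
        rw [← TimeInterval.μ_eq]
        exact (Lp.integrable v).norm
      rw [TimeInterval.integral_eq, intervalIntegral.integral_of_le I.lt.le]
      exact setIntegral_mono_set h (Eventually.of_forall fun _ => norm_nonneg _)
        (Ioc_subset_Ioc_right t.2.2).eventuallyLE)

theorem prim_apply (v : Lp (E n) 1 I.μ) (t : Icc I.t₀ I.tf) :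
    prim I n v t = ∫ s in I.t₀..(t : ℝ), v s := rfl

theorem memLp_extend (x : C(Icc I.t₀ I.tf, E n)) : MemLp (IccExtend I.lt.le x) ⊤ I.μ :=
  memLp_top_of_bound (integrable_extend I x).1 ‖x‖
    (Eventually.of_forall fun _ => x.norm_coe_le_norm _)

/-- Continuous functions on `[t₀, tf]` as elements of `L^∞`. -/
noncomputable def contL (I : TimeInterval) (n : ℕ) :
    C(Icc I.t₀ I.tf, E n) →L[ℝ] Lp (E n) ⊤ I.μ :=
  LinearMap.mkContinuous
    { toFun := fun x => (memLp_extend x).toLp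
      map_add' := fun x y => by
        rw [← MemLp.toLp_add, MemLp.toLp_eq_toLp_iff]
        exact Eventually.of_forall fun _ => rfl
      map_smul' := fun c x => by
        rw [RingHom.id_apply, ← MemLp.toLp_const_smul, MemLp.toLp_eq_toLp_iff]
        exact Eventually.of_forall fun _ => rfl }
    1 (fun x => by
      rw [one_mul]
      refine Linf.norm_le (norm_nonneg _) ?_
      filter_upwards [(memLp_extend x).coeFn_toLp] with t ht
      simp only [LinearMap.coe_mk, AddHom.coe_mk]
      rw [ht]
      exact x.norm_coe_le_norm _)

theorem contL_ae (x : C(Icc I.t₀ I.tf, E n)) : contL I n x =ᵐ[I.μ] IccExtend I.lt.le x :=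
  MemLp.coeFn_toLp (memLp_extend x)

section W1

variable {p : ℝ≥0∞} [Fact (1 ≤ p)]

/-- Membership in the Sobolev space is the integral identity `x(t) = x(t₀) + ∫_{t₀}^t v`, a closed
condition without test functions. -/
theorem mem_sobolev_iff {z : C(Icc I.t₀ I.tf, E n) × Lp (E n) p I.μ} :
    z ∈ sobolev I p n ↔
      z.1 = ContinuousMap.const _ (z.1 ⟨I.t₀, I.left_mem⟩) + prim I n (Lp.incl Fact.out z.2) := by
  have hv := Lp.integrable z.2
  have hc : ContinuousOn (IccExtend I.lt.le z.1) (Icc I.t₀ I.tf) :=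
    (z.1.continuous.Icc_extend').continuousOn
  have hval : ∀ t (ht : t ∈ Icc I.t₀ I.tf), IccExtend I.lt.le z.1 t = z.1 ⟨t, ht⟩ := fun t ht =>
    IccExtend_of_mem I.lt.le _ ht
  constructor
  · intro h
    ext1 t
    have h1 := eq_primitive_of_isWeakDeriv hc hv h t t.2
    rw [hval t t.2, hval _ I.left_mem] at h1
    rw [ContinuousMap.add_apply, ContinuousMap.const_apply, prim_apply, ← Subtype.coe_eta t t.2, h1,
      integral_congr_of_ae (Lp.incl_ae Fact.out z.2) t.2]
  · intro h
    refine isWeakDeriv_of_primitive hv fun t ht => ?_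
    rw [hval t ht, hval _ I.left_mem]
    have h1 := DFunLike.congr_fun h ⟨t, ht⟩
    rw [h1, ContinuousMap.add_apply, ContinuousMap.const_apply, prim_apply,
      integral_congr_of_ae (Lp.incl_ae Fact.out z.2) ht]

instance : CompleteSpace (W1 I p n) := by
  have hclosed : IsClosed (sobolev I p n : Set (C(Icc I.t₀ I.tf, E n) × Lp (E n) p I.μ)) := by
    have : (sobolev I p n : Set (C(Icc I.t₀ I.tf, E n) × Lp (E n) p I.μ)) =
        {z | z.1 = ContinuousMap.const _ (z.1 ⟨I.t₀, I.left_mem⟩)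
          + prim I n (Lp.incl Fact.out z.2)} := by
      ext z; exact mem_sobolev_iff
    rw [this]
    refine isClosed_eq continuous_fst (Continuous.add ?_ (by fun_prop))
    exact ContinuousMap.continuous_const'.comp ((continuous_eval_const _).comp
      continuous_fst)
  exact hclosed.completeSpace_coe

namespace W1

/-- The Sobolev function with initial value `a` and weak derivative `v`. -/
noncomputable def ofDer (a : E n) (v : Lp (E n) p I.μ) : W1 I p n :=
  ⟨(ContinuousMap.const _ a + prim I n (Lp.incl Fact.out v), v), by
    rw [mem_sobolev_iff]
    ext1 t
    simp [prim_apply]⟩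

/-- The continuous representative, as a continuous linear map. -/
noncomputable def valL (I : TimeInterval) (p : ℝ≥0∞) [Fact (1 ≤ p)] (n : ℕ) :
    W1 I p n →L[ℝ] C(Icc I.t₀ I.tf, E n) :=
  (ContinuousLinearMap.fst ℝ _ _).comp (sobolev I p n).subtypeL

/-- The weak derivative, as a continuous linear map. -/
noncomputable def derL (I : TimeInterval) (p : ℝ≥0∞) [Fact (1 ≤ p)] (n : ℕ) :
    W1 I p n →L[ℝ] Lp (E n) p I.μ :=
  (ContinuousLinearMap.snd ℝ _ _).comp (sobolev I p n).subtypeL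

theorem val_eq (x : W1 I p n) : x.val = IccExtend I.lt.le (valL I p n x) := rfl

theorem der_eq (x : W1 I p n) : x.der = derL I p n x := rfl

theorem val_of_mem (x : W1 I p n) {t : ℝ} (ht : t ∈ Icc I.t₀ I.tf) :
    x.val t = valL I p n x ⟨t, ht⟩ := IccExtend_of_mem I.lt.le _ ht

/-- Point evaluation on `[t₀, tf]`. -/
noncomputable def evalL (p : ℝ≥0∞) [Fact (1 ≤ p)] (n : ℕ) {t : ℝ} (ht : t ∈ Icc I.t₀ I.tf) :
    W1 I p n →L[ℝ] E n :=
  (ContinuousMap.evalCLM ℝ ⟨t, ht⟩).comp (valL I p n)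

theorem evalL_apply (x : W1 I p n) {t : ℝ} (ht : t ∈ Icc I.t₀ I.tf) : evalL p n ht x = x.val t :=
  (val_of_mem x ht).symm

theorem contL_valL_ae (x : W1 I p n) : contL I n (valL I p n x) =ᵐ[I.μ] x.val := contL_ae _

theorem integrable_der (x : W1 I p n) : Integrable x.der I.μ := Lp.integrable _

theorem val_eq_primitive (x : W1 I p n) :
    ∀ t ∈ Icc I.t₀ I.tf, x.val t = x.val I.t₀ + ∫ s in I.t₀..t, x.der s :=
  eq_primitive_of_isWeakDeriv (x.1.1.continuous.Icc_extend').continuousOn x.integrable_der x.2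

theorem valL_eq (x : W1 I p n) :
    valL I p n x = ContinuousMap.const _ (x.val I.t₀) +
      prim I n (Lp.incl Fact.out (derL I p n x)) := by
  rw [val_of_mem x I.left_mem]
  exact mem_sobolev_iff.1 x.2

theorem ext_of_init {x y : W1 I p n} (h0 : x.val I.t₀ = y.val I.t₀) (h : x.der =ᵐ[I.μ] y.der) :
    x = y := by
  have h2 : derL I p n x = derL I p n y := Lp.ext h
  have h1 : valL I p n x = valL I p n y := by rw [valL_eq, valL_eq, h0, h2]
  exact Subtype.ext (Prod.ext h1 h2)

theorem valL_ofDer (a : E n) (v : Lp (E n) p I.μ) :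
    valL I p n (ofDer a v) = ContinuousMap.const _ a + prim I n (Lp.incl Fact.out v) := rfl

theorem ofDer_init (a : E n) (v : Lp (E n) p I.μ) : (ofDer a v).val I.t₀ = a := by
  rw [val_of_mem _ I.left_mem, valL_ofDer]
  simp [prim_apply]

/-- Product rule for Sobolev functions. -/
theorem integral_inner {q : ℝ≥0∞} [Fact (1 ≤ q)] (x : W1 I p n) (y : W1 I q n) :
    ∫ t, (⟪x.der t, y.val t⟫ + ⟪x.val t, y.der t⟫) ∂I.μ =
      ⟪x.val I.tf, y.val I.tf⟫ - ⟪x.val I.t₀, y.val I.t₀⟫ :=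
  integral_inner_of_primitive x.integrable_der y.integrable_der x.val_eq_primitive
    y.val_eq_primitive

end W1

end W1

/-! ### Linear differential equations with essentially bounded coefficients -/

section LinearODE

/-- The factor `1 - x` of the unit `1 - x ^ m` commutes with the other factor, the geometric sum. -/
theorem isUnit_one_sub_of_norm_pow_lt_one {R : Type*} [NormedRing R] [CompleteSpace R] {x : R}
    {m : ℕ} (h : ‖x ^ m‖ < 1) : IsUnit (1 - x) := by
  have hu : IsUnit (1 - x ^ m) := isUnit_one_sub_of_norm_lt_one h
  rw [← mul_neg_geom_sum] at hu
  have hcomm : Commute (1 - x) (∑ i ∈ Finset.range m, x ^ i) := by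
    refine Commute.sum_right _ _ _ fun i _ => ?_
    exact ((Commute.one_left _).sub_left (Commute.refl _)).pow_right i
  exact (hcomm.isUnit_mul_iff.1 hu).1

/-- The Volterra operator `x ↦ ∫_{t₀}^t A x`. -/
noncomputable def volterra (A : Lp (E n →L[ℝ] E n) ⊤ I.μ) :
    C(Icc I.t₀ I.tf, E n) →L[ℝ] C(Icc I.t₀ I.tf, E n) :=
  (prim I n).comp ((Lp.incl le_top).comp
    (((ContinuousLinearMap.id ℝ (E n →L[ℝ] E n)).holderL I.μ ⊤ ⊤ ⊤ A).comp (contL I n)))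

theorem holderL_ae {E₁ E₂ E₃ : Type*} [NormedAddCommGroup E₁] [NormedSpace ℝ E₁]
    [NormedAddCommGroup E₂] [NormedSpace ℝ E₂] [NormedAddCommGroup E₃] [NormedSpace ℝ E₃]
    {α : Type*} [MeasurableSpace α] {μ : Measure α} (B : E₁ →L[ℝ] E₂ →L[ℝ] E₃)
    {p q r : ℝ≥0∞} [Fact (1 ≤ p)] [Fact (1 ≤ q)] [Fact (1 ≤ r)] [ENNReal.HolderTriple p q r]
    (f : Lp E₁ p μ) (g : Lp E₂ q μ) :
    ∀ᵐ t ∂μ, B.holderL μ p q r f g t = B (f t) (g t) :=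
  B.coeFn_holder (r := r) f g

theorem volterra_apply (A : Lp (E n →L[ℝ] E n) ⊤ I.μ) (x : C(Icc I.t₀ I.tf, E n))
    (t : Icc I.t₀ I.tf) :
    volterra A x t = ∫ s in I.t₀..(t : ℝ), A s (IccExtend I.lt.le x s) := by
  change prim I n _ t = _
  rw [prim_apply]
  refine integral_congr_of_ae ?_ t.2
  filter_upwards [Lp.incl_ae (le_top : (1 : ℝ≥0∞) ≤ ⊤) ((ContinuousLinearMap.id ℝ
    (E n →L[ℝ] E n)).holderL I.μ ⊤ ⊤ ⊤ A (contL I n x)), holderL_ae (ContinuousLinearMap.id ℝ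
    (E n →L[ℝ] E n)) (r := ⊤) A (contL I n x), contL_ae x] with s h1 h2 h3
  exact (h1.trans h2).trans (by rw [h3]; rfl)

/-- The iterates of a Volterra operator decay factorially. -/
theorem norm_volterra_pow_apply_le (A : Lp (E n →L[ℝ] E n) ⊤ I.μ) (m : ℕ)
    (x : C(Icc I.t₀ I.tf, E n)) (t : Icc I.t₀ I.tf) :
    ‖(volterra A ^ m) x t‖ ≤ (‖A‖ * (t - I.t₀)) ^ m / m.factorial * ‖x‖ := by
  induction m generalizing t with
  | zero => simpa using x.norm_coe_le_norm t
  | succ m ih =>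
    rw [pow_succ', mul_apply_eq_comp, volterra_apply]
    set y := (volterra A ^ m) x with hy
    set g : ℝ → ℝ := fun s => ‖A‖ * ((‖A‖ * (s - I.t₀)) ^ m / m.factorial * ‖x‖) with hg
    have hgc : Continuous g := by fun_prop
    have h1 : ‖∫ s in I.t₀..(t : ℝ), A s (IccExtend I.lt.le y s)‖ ≤ ∫ s in I.t₀..(t : ℝ), g s := by
      refine intervalIntegral.norm_integral_le_of_norm_le t.2.1 ?_ (hgc.intervalIntegrable _ _)
      have h2 := Linf.ae_norm_le A
      rw [TimeInterval.ae_iff] at h2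
      filter_upwards [h2] with s hs hs'
      have hs2 : s ∈ Ioc I.t₀ I.tf := ⟨hs'.1, hs'.2.trans t.2.2⟩
      have h3 := ih ⟨s, hs2.1.le, hs2.2⟩
      rw [IccExtend_of_mem I.lt.le _ ⟨hs2.1.le, hs2.2⟩]
      exact (ContinuousLinearMap.le_opNorm _ _).trans
        (mul_le_mul (hs hs2) h3 (norm_nonneg _) (norm_nonneg _))
    refine h1.trans (le_of_eq ?_)
    have hd : ∀ s, HasDerivAt (fun s => (‖A‖ * (s - I.t₀)) ^ (m + 1) / (m + 1).factorial * ‖x‖)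
        (g s) s := by
      intro s
      have h4 := (((((hasDerivAt_id s).sub_const I.t₀).const_mul ‖A‖).pow (m + 1)).div_const
        ((m + 1).factorial : ℝ)).mul_const ‖x‖
      refine h4.congr_deriv ?_
      simp only [hg, Nat.factorial_succ, Nat.cast_mul, add_tsub_cancel_right, id]
      have : (m.factorial : ℝ) ≠ 0 := by positivity
      have : ((m + 1 : ℕ) : ℝ) ≠ 0 := by positivity
      field_simp
    rw [intervalIntegral.integral_eq_sub_of_hasDerivAt (fun s _ => hd s)
      (hgc.intervalIntegrable _ _)]
    simp

/-- `1 - K` is invertible for a Volterra operator `K`, because some power of `K` is a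
contraction. -/
theorem isUnit_one_sub_volterra (A : Lp (E n →L[ℝ] E n) ⊤ I.μ) : IsUnit (1 - volterra A) := by
  have hlim := FloorSemiring.tendsto_pow_div_factorial_atTop (‖A‖ * (I.tf - I.t₀))
  obtain ⟨m, hm⟩ := (hlim.eventually (gt_mem_nhds one_pos)).exists
  have hnn : 0 ≤ ‖A‖ * (I.tf - I.t₀) := mul_nonneg (norm_nonneg _) (sub_nonneg.2 I.lt.le)
  have hnorm : ‖volterra A ^ m‖ < 1 := by
    refine lt_of_le_of_lt (ContinuousLinearMap.opNorm_le_bound _ (by positivity) fun x => ?_) hm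
    rw [ContinuousMap.norm_le _ (by positivity)]
    intro t
    refine (norm_volterra_pow_apply_le A m x t).trans ?_
    have h0 : 0 ≤ (t : ℝ) - I.t₀ := sub_nonneg.2 t.2.1
    have h1 : (t : ℝ) ≤ I.tf := t.2.2
    gcongr
  exact isUnit_one_sub_of_norm_pow_lt_one
    (R := C(Icc I.t₀ I.tf, E n) →L[ℝ] C(Icc I.t₀ I.tf, E n)) hnorm

/-- The solution operator `b ↦ x` of the integral equation `x = b + ∫_{t₀}^t A x`. -/
noncomputable def resolvent (A : Lp (E n →L[ℝ] E n) ⊤ I.μ) :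
    C(Icc I.t₀ I.tf, E n) →L[ℝ] C(Icc I.t₀ I.tf, E n) := Ring.inverse (1 - volterra A)

theorem resolvent_eq (A : Lp (E n →L[ℝ] E n) ⊤ I.μ) (b : C(Icc I.t₀ I.tf, E n)) :
    resolvent A b = b + volterra A (resolvent A b) := by
  have h := DFunLike.congr_fun (Ring.mul_inverse_cancel _ (isUnit_one_sub_volterra A)) b
  rw [mul_apply_eq_comp] at h
  change resolvent A b - volterra A (resolvent A b) = b at h
  rw [← sub_eq_iff_eq_add]
  exact h

theorem eq_resolvent {A : Lp (E n →L[ℝ] E n) ⊤ I.μ} {b x : C(Icc I.t₀ I.tf, E n)}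
    (hx : x = b + volterra A x) : x = resolvent A b := by
  have h := DFunLike.congr_fun (Ring.inverse_mul_cancel _ (isUnit_one_sub_volterra A)) x
  rw [mul_apply_eq_comp] at h
  change resolvent A (x - volterra A x) = x at h
  rw [← h, sub_eq_iff_eq_add.2 hx]

variable {p : ℝ≥0∞} [Fact (1 ≤ p)]

/-- The solution in `W^{1,p}` of `x' = A x + r`, `x(t₀) = a`: the primitive of `A b + r`, where `b`
solves the integral equation. -/
noncomputable def odeSol (A : Lp (E n →L[ℝ] E n) ⊤ I.μ) (a : E n) (r : Lp (E n) p I.μ) :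
    W1 I p n :=
  W1.ofDer a (Lp.incl le_top ((ContinuousLinearMap.id ℝ (E n →L[ℝ] E n)).holderL I.μ ⊤ ⊤ ⊤ A
    (contL I n (resolvent A (ContinuousMap.const _ a + prim I n (Lp.incl Fact.out r))))) + r)

theorem Lp.incl_incl {α : Type*} [MeasurableSpace α] {μ : Measure α} [IsFiniteMeasure μ]
    {E : Type*} [NormedAddCommGroup E] [NormedSpace ℝ E] {p q r : ℝ≥0∞} [Fact (1 ≤ p)]
    [Fact (1 ≤ q)] [Fact (1 ≤ r)] (h1 : q ≤ p) (h2 : r ≤ q) (f : Lp E p μ) :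
    Lp.incl h2 (Lp.incl h1 f) = Lp.incl (h2.trans h1) f :=
  Lp.ext (((Lp.incl_ae h2 _).trans (Lp.incl_ae h1 f)).trans (Lp.incl_ae _ f).symm)

theorem valL_odeSol (A : Lp (E n →L[ℝ] E n) ⊤ I.μ) (a : E n) (r : Lp (E n) p I.μ) :
    W1.valL I p n (odeSol A a r) =
      resolvent A (ContinuousMap.const _ a + prim I n (Lp.incl Fact.out r)) := by
  rw [odeSol, W1.valL_ofDer, map_add, map_add, Lp.incl_incl]
  conv_rhs => rw [resolvent_eq]
  rw [add_comm (prim I n _), ← add_assoc]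
  rfl

theorem odeSol_init (A : Lp (E n →L[ℝ] E n) ⊤ I.μ) (a : E n) (r : Lp (E n) p I.μ) :
    (odeSol A a r).val I.t₀ = a := W1.ofDer_init _ _

theorem odeSol_der (A : Lp (E n →L[ℝ] E n) ⊤ I.μ) (a : E n) (r : Lp (E n) p I.μ) :
    ∀ᵐ t ∂I.μ, (odeSol A a r).der t = A t ((odeSol A a r).val t) + r t := by
  set b := resolvent A (ContinuousMap.const _ a + prim I n (Lp.incl Fact.out r)) with hb
  set w := (ContinuousLinearMap.id ℝ (E n →L[ℝ] E n)).holderL I.μ ⊤ ⊤ ⊤ A (contL I n b) with hw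
  filter_upwards [Lp.coeFn_add (Lp.incl (le_top : p ≤ ⊤) w) r, Lp.incl_ae (le_top : p ≤ ⊤) w,
    holderL_ae (ContinuousLinearMap.id ℝ (E n →L[ℝ] E n)) (r := ⊤) A (contL I n b), contL_ae b]
    with t h1 h2 h3 h4
  have h5 : (odeSol A a r).der t = (Lp.incl (le_top : p ≤ ⊤) w + r) t := rfl
  have h6 : (odeSol A a r).val t = IccExtend I.lt.le b t := by
    rw [W1.val_eq, valL_odeSol]
  rw [h5, h1, Pi.add_apply, h2, hw, h3, h4, h6]
  rfl

/-- Uniqueness for linear differential equations. -/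
theorem eq_odeSol {A : Lp (E n →L[ℝ] E n) ⊤ I.μ} {r : Lp (E n) p I.μ} {x : W1 I p n}
    (hx : ∀ᵐ t ∂I.μ, x.der t = A t (x.val t) + r t) : x = odeSol A (x.val I.t₀) r := by
  have h1 : W1.valL I p n x = W1.valL I p n (odeSol A (x.val I.t₀) r) := by
    rw [valL_odeSol]
    refine eq_resolvent ?_
    have h2 : Lp.incl (Fact.out : 1 ≤ p) (W1.derL I p n x) = Lp.incl le_top
        ((ContinuousLinearMap.id ℝ (E n →L[ℝ] E n)).holderL I.μ ⊤ ⊤ ⊤ A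
          (contL I n (W1.valL I p n x))) + Lp.incl Fact.out r := by
      refine Lp.ext ?_
      filter_upwards [hx, Lp.incl_ae (Fact.out : 1 ≤ p) (W1.derL I p n x),
        Lp.incl_ae (Fact.out : 1 ≤ p) r, Lp.incl_ae (le_top : (1 : ℝ≥0∞) ≤ ⊤)
          ((ContinuousLinearMap.id ℝ (E n →L[ℝ] E n)).holderL I.μ ⊤ ⊤ ⊤ A
          (contL I n (W1.valL I p n x))), Lp.coeFn_add (Lp.incl (le_top : (1 : ℝ≥0∞) ≤ ⊤)
        ((ContinuousLinearMap.id ℝ (E n →L[ℝ] E n)).holderL I.μ ⊤ ⊤ ⊤ A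
          (contL I n (W1.valL I p n x)))) (Lp.incl Fact.out r),
        holderL_ae (ContinuousLinearMap.id ℝ (E n →L[ℝ] E n)) (r := ⊤) A
          (contL I n (W1.valL I p n x)), W1.contL_valL_ae x] with t h1 h2 h3 h4 h5 h6 h7
      rw [h2, h5, Pi.add_apply, h3, h4, h6, h7, ← W1.der_eq, h1]
      rfl
    conv_lhs => rw [W1.valL_eq, h2, map_add, add_comm (prim I n _), ← add_assoc]
    rfl
  refine W1.ext_of_init (odeSol_init _ _ _).symm ?_
  filter_upwards [hx, odeSol_der A (x.val I.t₀) r] with t h2 h3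
  have h4 : x.val t = (odeSol A (x.val I.t₀) r).val t := by
    rw [W1.val_eq (odeSol A (x.val I.t₀) r), ← h1, ← W1.val_eq]
  rw [h2, h3, ← h4]

/-- A quantitative form of uniqueness for linear differential equations. -/
theorem exists_norm_valL_le (A : Lp (E n →L[ℝ] E n) ⊤ I.μ) : ∃ C : ℝ, 0 ≤ C ∧
    ∀ (x : W1 I p n) (r : Lp (E n) p I.μ), x.val I.t₀ = 0 →
      (∀ᵐ t ∂I.μ, x.der t = A t (x.val t) + r t) → ‖W1.valL I p n x‖ ≤ C * ‖r‖ := by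
  refine ⟨‖resolvent A‖ * ‖(prim I n).comp (Lp.incl (Fact.out : 1 ≤ p))‖, by positivity,
    fun x r h0 hx => ?_⟩
  rw [eq_odeSol hx, valL_odeSol, h0, mul_assoc]
  have h : ContinuousMap.const (Icc I.t₀ I.tf) (0 : E n) = 0 := rfl
  rw [h, zero_add]
  refine (ContinuousLinearMap.le_opNorm _ _).trans (mul_le_mul_of_nonneg_left ?_ (norm_nonneg _))
  exact ContinuousLinearMap.le_opNorm ((prim I n).comp (Lp.incl (Fact.out : 1 ≤ p))) r

end LinearODE

end Sobolev

end OCPSens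

/-! ### Composite superposition operators and their derivatives -/

section PointwiseDerivative

variable {α : Type*} [MeasurableSpace α] {μ : Measure α} {W F F' : Type*}
  [NormedAddCommGroup W] [NormedSpace ℝ W] [NormedAddCommGroup F] [NormedSpace ℝ F]
  [NormedAddCommGroup F'] [NormedSpace ℝ F']

/-- The derivative of a map into `L^∞` is a.e. the limit of pointwise difference quotients. -/
theorem ae_tendsto_fderiv_Linf {Φ : W → Lp F ⊤ μ} {w : W} (hΦ : DifferentiableAt ℝ Φ w) (δ : W)
    {f : ℝ → α → F} (hf : ∀ s : ℝ, ∀ᵐ t ∂μ, Φ (w + s • δ) t = f s t) :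
    ∀ᵐ t ∂μ, Tendsto (fun n : ℕ => (n : ℝ) • (f (n : ℝ)⁻¹ t - f 0 t)) atTop
      (𝓝 (fderiv ℝ Φ w δ t)) := by
  have hlim := hΦ.hasFDerivAt.lim (c := fun n : ℕ => (n : ℝ)) δ (l := atTop)
    (by simpa using tendsto_natCast_atTop_atTop)
  set u : ℕ → Lp F ⊤ μ := fun n => (n : ℝ) • (Φ (w + (n : ℝ)⁻¹ • δ) - Φ w) with hu
  have h0 := hf 0
  rw [zero_smul, add_zero] at h0
  have hall : ∀ᵐ t ∂μ, ∀ n, u n t = (n : ℝ) • (f (n : ℝ)⁻¹ t - f 0 t) ∧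
      ‖u n t - fderiv ℝ Φ w δ t‖ ≤ ‖u n - fderiv ℝ Φ w δ‖ := by
    rw [ae_all_iff]
    intro n
    filter_upwards [h0, hf (n : ℝ)⁻¹, Lp.coeFn_smul (n : ℝ) (Φ (w + (n : ℝ)⁻¹ • δ) - Φ w),
      Lp.coeFn_sub (Φ (w + (n : ℝ)⁻¹ • δ)) (Φ w), Linf.ae_norm_le (u n - fderiv ℝ Φ w δ),
      Lp.coeFn_sub (u n) (fderiv ℝ Φ w δ)] with t h1 h2 h3 h4 h5 h6
    refine ⟨?_, ?_⟩
    · rw [hu]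
      simp only
      rw [h3, Pi.smul_apply, h4, Pi.sub_apply, h1, h2]
    · rwa [h6] at h5
  filter_upwards [hall] with t ht
  rw [tendsto_iff_norm_sub_tendsto_zero] at hlim ⊢
  refine squeeze_zero (fun _ => norm_nonneg _) (fun n => ?_) hlim
  rw [← (ht n).1]
  exact (ht n).2

/-- A pointwise derivative identifies the derivative of a map into `L^∞`. -/
theorem fderiv_Linf_ae {Φ : W → Lp F ⊤ μ} {w : W} (hΦ : DifferentiableAt ℝ Φ w) (δ : W)
    {f : ℝ → α → F} (hf : ∀ s : ℝ, ∀ᵐ t ∂μ, Φ (w + s • δ) t = f s t) {f' : α → F}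
    (hd : ∀ᵐ t ∂μ, HasDerivAt (fun s => f s t) (f' t) 0) :
    ∀ᵐ t ∂μ, fderiv ℝ Φ w δ t = f' t := by
  filter_upwards [ae_tendsto_fderiv_Linf hΦ δ hf, hd] with t h1 h2
  have h3 := h2.hasFDerivAt.lim (c := fun n : ℕ => (n : ℝ)) 1 (l := atTop)
    (by simpa using tendsto_natCast_atTop_atTop)
  refine tendsto_nhds_unique h1 ?_
  simpa using h3

/-- Variant of `fderiv_Linf_ae` for operator-valued functions, with one null set for all
arguments `ξ`. -/
theorem fderiv_Linf_apply_ae {Φ : W → Lp (F →L[ℝ] F') ⊤ μ} {w : W} (hΦ : DifferentiableAt ℝ Φ w)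
    (δ : W) {f : ℝ → α → F → F'} (hf : ∀ s : ℝ, ∀ᵐ t ∂μ, ∀ ξ, Φ (w + s • δ) t ξ = f s t ξ)
    {f' : α → F → F'} (hd : ∀ᵐ t ∂μ, ∀ ξ, HasDerivAt (fun s => f s t ξ) (f' t ξ) 0) :
    ∀ᵐ t ∂μ, ∀ ξ, fderiv ℝ Φ w δ t ξ = f' t ξ := by
  have hn : ∀ᵐ t ∂μ, ∀ n : ℕ, ∀ ξ, Φ (w + (n : ℝ)⁻¹ • δ) t ξ = f (n : ℝ)⁻¹ t ξ :=
    ae_all_iff.2 fun n => hf _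
  filter_upwards [ae_tendsto_fderiv_Linf hΦ δ (f := fun s t => Φ (w + s • δ) t)
    (fun s => Eventually.of_forall fun _ => rfl), hd, hn, hf 0] with t h1 h2 h3 h4 ξ
  have h5 := (h2 ξ).hasFDerivAt.lim (c := fun n : ℕ => (n : ℝ)) 1 (l := atTop)
    (by simpa using tendsto_natCast_atTop_atTop)
  have h6 := ((ContinuousLinearMap.apply ℝ F' ξ).continuous.tendsto _).comp h1
  refine tendsto_nhds_unique h6 ?_
  refine Tendsto.congr (fun n => ?_) (by simpa using h5)
  simp only [Function.comp_apply, ContinuousLinearMap.apply_apply, smul_apply, sub_apply]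
  rw [h3 n ξ, h4 ξ]

end PointwiseDerivative

namespace OCPSens

section TotalDerivative

variable {Y G F : Type} [NormedAddCommGroup Y] [NormedSpace ℝ Y]
  [NormedAddCommGroup G] [NormedSpace ℝ G] [NormedAddCommGroup F] [NormedSpace ℝ F]

theorem totD_apply (h : Y × G → F) (g : Y → G) (y ξ : Y) :
    totD h g y ξ = fderiv ℝ h (y, g y) (ξ, fderiv ℝ g y ξ) := rfl

theorem parG_apply (h : Y × G → F) (g : Y → G) (y : Y) (c : G) :
    parG h g y c = fderiv ℝ h (y, g y) (0, c) := rfl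

theorem hasFDerivAt_fderiv_of_contDiff {h : Y → F} (hh : ContDiff ℝ 2 h) (v : Y) :
    HasFDerivAt (fderiv ℝ h) (fderiv ℝ (fderiv ℝ h) v) v :=
  ((hh.fderiv_right (m := 1) (by norm_num)).differentiable one_ne_zero v).hasFDerivAt

theorem fderiv_fderiv_comm {h : Y → F} (hh : ContDiff ℝ 2 h) (v a b : Y) :
    fderiv ℝ (fderiv ℝ h) v a b = fderiv ℝ (fderiv ℝ h) v b a :=
  (hh.contDiffAt.isSymmSndFDerivAt (by simp)).eq a b

theorem totDD_comm {h : Y × G → F} {g : Y → G} (hh : ContDiff ℝ 2 h) (hg : ContDiff ℝ 2 g)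
    (y a b : Y) : totDD h g y a b = totDD h g y b a := by
  simp only [totDD]
  rw [fderiv_fderiv_comm hh, fderiv_fderiv_comm hg y a b]

/-- The derivative of `h(y, g(y))` in the direction of a joint variation of `y` and `g`. -/
theorem hasDerivAt_comp_variation {h : Y × G → F} {g γ : Y → G} (hh : Differentiable ℝ h)
    (hg : Differentiable ℝ g) (hγ : Differentiable ℝ γ) (y η : Y) :
    HasDerivAt (fun s : ℝ => h (y + s • η, g (y + s • η) + s • γ (y + s • η)))
      (totD h g y η + parG h g y (γ y)) 0 := by
  have hy : HasDerivAt (fun s : ℝ => y + s • η) η 0 := by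
    simpa using ((hasDerivAt_id (0 : ℝ)).smul_const η).const_add y
  have hg1 : HasDerivAt (fun s : ℝ => g (y + s • η)) (fderiv ℝ g y η) 0 :=
    HasFDerivAt.comp_hasDerivAt_of_eq 0 (hg y).hasFDerivAt hy (by simp)
  have hγ1 : HasDerivAt (fun s : ℝ => γ (y + s • η)) (fderiv ℝ γ y η) 0 :=
    HasFDerivAt.comp_hasDerivAt_of_eq 0 (hγ y).hasFDerivAt hy (by simp)
  have hγ2 : HasDerivAt (fun s : ℝ => s • γ (y + s • η)) (γ y) 0 := by
    simpa using (hasDerivAt_id (0 : ℝ)).fun_smul hγ1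
  have hv := hy.prodMk (hg1.fun_add hγ2)
  have := HasFDerivAt.comp_hasDerivAt_of_eq 0 (hh (y, g y)).hasFDerivAt hv (by simp)
  refine this.congr_deriv ?_
  rw [totD_apply, parG_apply, ← map_add]
  simp

/-- The derivative of `totD h g y` in the direction of a joint variation of `y` and `g`. -/
theorem hasDerivAt_totD_variation {h : Y × G → F} {g γ : Y → G} (hh : ContDiff ℝ 2 h)
    (hg : ContDiff ℝ 2 g) (hγ : ContDiff ℝ 2 γ) (y η ξ : Y) :
    HasDerivAt (fun s : ℝ => totD h (fun x => g x + s • γ x) (y + s • η) ξ)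
      (totDD h g y ξ η + totDG h g y ξ (γ y) + parG h g y (fderiv ℝ γ y ξ)) 0 := by
  have hgd := hg.differentiable two_ne_zero
  have hγd := hγ.differentiable two_ne_zero
  have hy : HasDerivAt (fun s : ℝ => y + s • η) η 0 := by
    simpa using ((hasDerivAt_id (0 : ℝ)).smul_const η).const_add y
  have hg1 : HasDerivAt (fun s : ℝ => g (y + s • η)) (fderiv ℝ g y η) 0 :=
    HasFDerivAt.comp_hasDerivAt_of_eq 0 (hgd y).hasFDerivAt hy (by simp)
  have hγ1 : HasDerivAt (fun s : ℝ => γ (y + s • η)) (fderiv ℝ γ y η) 0 :=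
    HasFDerivAt.comp_hasDerivAt_of_eq 0 (hγd y).hasFDerivAt hy (by simp)
  have hγ2 : HasDerivAt (fun s : ℝ => s • γ (y + s • η)) (γ y) 0 := by
    simpa using (hasDerivAt_id (0 : ℝ)).fun_smul hγ1
  have hv := hy.prodMk (hg1.fun_add hγ2)
  have hc := HasFDerivAt.comp_hasDerivAt_of_eq 0 (hasFDerivAt_fderiv_of_contDiff hh (y, g y)) hv
    (by simp)
  have hg3 : HasDerivAt (fun s : ℝ => fderiv ℝ g (y + s • η) ξ)
      (fderiv ℝ (fderiv ℝ g) y η ξ) 0 := by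
    have := HasFDerivAt.comp_hasDerivAt_of_eq 0 (hasFDerivAt_fderiv_of_contDiff hg y) hy (by simp)
    simpa using this.clm_apply (hasDerivAt_const 0 ξ)
  have hγ3 : HasDerivAt (fun s : ℝ => s • fderiv ℝ γ (y + s • η) ξ) (fderiv ℝ γ y ξ) 0 := by
    have h1 := HasFDerivAt.comp_hasDerivAt_of_eq 0 (hasFDerivAt_fderiv_of_contDiff hγ y) hy
      (by simp)
    have h2 := h1.clm_apply (hasDerivAt_const 0 ξ)
    simpa using (hasDerivAt_id (0 : ℝ)).fun_smul h2
  have hu := (hasDerivAt_const (0 : ℝ) ξ).prodMk (hg3.fun_add hγ3)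
  have hfin := hc.clm_apply hu
  have e : (fun s : ℝ => totD h (fun x => g x + s • γ x) (y + s • η) ξ) = fun s : ℝ =>
      (fderiv ℝ h (y + s • η, g (y + s • η) + s • γ (y + s • η)))
        (ξ, fderiv ℝ g (y + s • η) ξ + s • fderiv ℝ γ (y + s • η) ξ) := by
    funext s
    rw [totD_apply, fderiv_fun_add (hgd _) ((hγd _).fun_const_smul s),
      fderiv_fun_const_smul (hγd _)]
    rfl
  rw [e]
  refine hfin.congr_deriv ?_
  simp only [totDD, totDG, parG_apply, Pi.add_apply, Function.comp_apply, zero_smul, add_zero]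
  have e1 : (η, fderiv ℝ g y η + γ y) = ((η, fderiv ℝ g y η) : Y × G) + (0, γ y) := by simp
  have e2 : (0, fderiv ℝ (fderiv ℝ g) y η ξ + fderiv ℝ γ y ξ)
      = ((0, fderiv ℝ (fderiv ℝ g) y η ξ) : Y × G) + (0, fderiv ℝ γ y ξ) := by simp
  -- the chain rule differentiates in the first slot, while `totDD` and `totDG` have the direction
  -- in the second one
  rw [fderiv_fderiv_comm hh _ (ξ, _), fderiv_fderiv_comm hh _ (ξ, _) (0, _),
    fderiv_fderiv_comm hg y ξ η, e1, e2, map_add, map_add, add_apply]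
  abel

end TotalDerivative

section CompositeOperators

variable {Y G F : Type} [NormedAddCommGroup Y] [NormedSpace ℝ Y] [FiniteDimensional ℝ Y]
  [NormedAddCommGroup G] [NormedSpace ℝ G] [FiniteDimensional ℝ G]
  [NormedAddCommGroup F] [NormedSpace ℝ F] {I : TimeInterval} {h : ℝ → Y × G → F}

theorem compLpL_ae {E₁ E₂ : Type*} [NormedAddCommGroup E₁] [NormedSpace ℝ E₁]
    [NormedAddCommGroup E₂] [NormedSpace ℝ E₂] {α : Type*} [MeasurableSpace α] {μ : Measure α}
    {p : ℝ≥0∞} [Fact (1 ≤ p)] (L : E₁ →L[ℝ] E₂) (f : Lp E₁ p μ) :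
    ∀ᵐ t ∂μ, L.compLpL p μ f t = L (f t) := L.coeFn_compLpL f

/-- `(y, g) ↦ (y(·), g(·, y(·)))`. -/
noncomputable def graphOp (w : Lp Y ⊤ I.μ × GSp Y G I 3) : Lp (Y × G) ⊤ I.μ :=
  (ContinuousLinearMap.inl ℝ Y G).compLpL ⊤ I.μ w.1 +
    (ContinuousLinearMap.inr ℝ Y G).compLpL ⊤ I.μ ((GSp.nemytskii (by norm_num)).op (w.2, w.1))

theorem graphOp_ae (w : Lp Y ⊤ I.μ × GSp Y G I 3) :
    ∀ᵐ t ∂I.μ, graphOp w t = (w.1 t, w.2.rep t (w.1 t)) := by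
  filter_upwards [Lp.coeFn_add ((ContinuousLinearMap.inl ℝ Y G).compLpL ⊤ I.μ w.1)
    ((ContinuousLinearMap.inr ℝ Y G).compLpL ⊤ I.μ ((GSp.nemytskii (by norm_num)).op (w.2, w.1))),
    compLpL_ae (ContinuousLinearMap.inl ℝ Y G) w.1,
    compLpL_ae (ContinuousLinearMap.inr ℝ Y G) ((GSp.nemytskii (by norm_num)).op (w.2, w.1)),
    (GSp.nemytskii (Y := Y) (F := G) (I := I) (s := 3) (by norm_num)).op_ae (w.2, w.1)]
    with t h1 h2 h3 h4
  rw [graphOp, h1, Pi.add_apply, h2, h3, h4]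
  simp

theorem contDiff_graphOp : ContDiff ℝ 1 (graphOp (Y := Y) (G := G) (I := I)) :=
  ((ContinuousLinearMap.contDiff _).comp contDiff_fst).add ((ContinuousLinearMap.contDiff _).comp
    ((GSp.nemytskii (by norm_num)).contDiff_op.comp (contDiff_snd.prodMk contDiff_fst)))

/-- `(y, g) ↦ h(·, y(·), g(·, y(·)))`. -/
noncomputable def compOp (hh : Smooth I h) (w : Lp Y ⊤ I.μ × GSp Y G I 3) : Lp F ⊤ I.μ :=
  hh.nemytskii.op (1, graphOp w)

theorem compOp_ae (hh : Smooth I h) (w : Lp Y ⊤ I.μ × GSp Y G I 3) :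
    ∀ᵐ t ∂I.μ, compOp hh w t = h t (w.1 t, w.2.rep t (w.1 t)) := by
  filter_upwards [hh.nemytskii.op_ae (1, graphOp w), graphOp_ae w] with t h1 h2
  rw [compOp, h1, h2, one_smul]

theorem contDiff_compOp (hh : Smooth I h) : ContDiff ℝ 1 (compOp hh) :=
  hh.nemytskii.contDiff_op.comp (contDiff_const.prodMk contDiff_graphOp)

/-- `(y, g) ↦ (h_y + h_g g_y)(·, y(·))`. -/
noncomputable def totDOp (hh : Smooth I h) (w : Lp Y ⊤ I.μ × GSp Y G I 3) :
    Lp (Y →L[ℝ] F) ⊤ I.μ :=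
  ((ContinuousLinearMap.compL ℝ Y (Y × G) F).flip (.inl ℝ Y G)).compLpL ⊤ I.μ
      (hh.nemytskii_fderiv.op (1, graphOp w)) +
    (ContinuousLinearMap.compL ℝ Y G F).holderL I.μ ⊤ ⊤ ⊤
      (((ContinuousLinearMap.compL ℝ G (Y × G) F).flip (.inr ℝ Y G)).compLpL ⊤ I.μ
        (hh.nemytskii_fderiv.op (1, graphOp w)))
      ((GSp.nemytskii_fderiv le_rfl).op (w.2, w.1))

theorem totDOp_ae (hh : Smooth I h) (w : Lp Y ⊤ I.μ × GSp Y G I 3) :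
    ∀ᵐ t ∂I.μ, totDOp hh w t = totD (h t) (w.2.rep t) (w.1 t) := by
  set D := hh.nemytskii_fderiv.op (1, graphOp w) with hD
  set Γ := (GSp.nemytskii_fderiv (Y := Y) (F := G) (I := I) (s := 3) le_rfl).op (w.2, w.1) with hΓ
  set D₁ := ((ContinuousLinearMap.compL ℝ Y (Y × G) F).flip (.inl ℝ Y G)).compLpL ⊤ I.μ D with hD₁
  set D₂ := ((ContinuousLinearMap.compL ℝ G (Y × G) F).flip (.inr ℝ Y G)).compLpL ⊤ I.μ D with hD₂
  filter_upwards [Lp.coeFn_add D₁ ((ContinuousLinearMap.compL ℝ Y G F).holderL I.μ ⊤ ⊤ ⊤ D₂ Γ),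
    compLpL_ae ((ContinuousLinearMap.compL ℝ Y (Y × G) F).flip (.inl ℝ Y G)) D,
    compLpL_ae ((ContinuousLinearMap.compL ℝ G (Y × G) F).flip (.inr ℝ Y G)) D,
    holderL_ae (ContinuousLinearMap.compL ℝ Y G F) (r := ⊤) D₂ Γ,
    hh.nemytskii_fderiv.op_ae (1, graphOp w), graphOp_ae w,
    (GSp.nemytskii_fderiv (Y := Y) (F := G) (I := I) (s := 3) le_rfl).op_ae (w.2, w.1)]
    with t h1 h2 h3 h4 h5 h6 h7
  have h8 : totDOp hh w t =
      (D₁ + (ContinuousLinearMap.compL ℝ Y G F).holderL I.μ ⊤ ⊤ ⊤ D₂ Γ) t := rfl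
  rw [h8, h1, Pi.add_apply, h4, hD₁, hD₂, h2, h3, hD, hΓ, h5, h6, h7, one_smul]
  refine ContinuousLinearMap.ext fun ξ => ?_
  simp only [add_apply, ContinuousLinearMap.flip_apply,
    ContinuousLinearMap.compL_apply, ContinuousLinearMap.comp_apply, totD_apply, ← map_add]
  simp

theorem contDiff_totDOp (hh : Smooth I h) : ContDiff ℝ 1 (totDOp hh) := by
  have hD : ContDiff ℝ 1 fun w : Lp Y ⊤ I.μ × GSp Y G I 3 =>
      hh.nemytskii_fderiv.op (1, graphOp w) :=
    hh.nemytskii_fderiv.contDiff_op.comp (contDiff_const.prodMk contDiff_graphOp)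
  have hΓ : ContDiff ℝ 1 fun w : Lp Y ⊤ I.μ × GSp Y G I 3 =>
      (GSp.nemytskii_fderiv (Y := Y) (F := G) (I := I) (s := 3) le_rfl).op (w.2, w.1) :=
    (GSp.nemytskii_fderiv le_rfl).contDiff_op.comp (contDiff_snd.prodMk contDiff_fst)
  refine ((ContinuousLinearMap.contDiff _).comp hD).add ?_
  exact ((ContinuousLinearMap.contDiff _).comp
    ((ContinuousLinearMap.contDiff _).comp hD)).clm_apply hΓ

/-- Along a line in `Y × 𝒢`, the representatives of the component functions are affine. -/
theorem rep_line_ae (w δ : Lp Y ⊤ I.μ × GSp Y G I 3) (s : ℝ) : ∀ᵐ t ∂I.μ,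
    (w + s • δ).1 t = w.1 t + s • δ.1 t ∧
      (w + s • δ).2.rep t = fun x => w.2.rep t x + s • δ.2.rep t x := by
  filter_upwards [Lp.coeFn_add w.1 (s • δ.1), Lp.coeFn_smul s δ.1, GSp.rep_add w.2 (s • δ.2),
    GSp.rep_smul s δ.2] with t h1 h2 h3 h4
  refine ⟨?_, ?_⟩
  · rw [Prod.fst_add, Prod.smul_fst, h1, Pi.add_apply, h2, Pi.smul_apply]
  · funext x
    rw [Prod.snd_add, Prod.smul_snd, h3, h4]

theorem fderiv_compOp_ae (hh : Smooth I h) (w δ : Lp Y ⊤ I.μ × GSp Y G I 3) :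
    ∀ᵐ t ∂I.μ, fderiv ℝ (compOp hh) w δ t =
      totD (h t) (w.2.rep t) (w.1 t) (δ.1 t) +
        parG (h t) (w.2.rep t) (w.1 t) (δ.2.rep t (w.1 t)) := by
  refine fderiv_Linf_ae ((contDiff_compOp hh).differentiable one_ne_zero w) δ
    (f := fun s t => h t (w.1 t + s • δ.1 t,
      w.2.rep t (w.1 t + s • δ.1 t) + s • δ.2.rep t (w.1 t + s • δ.1 t))) (fun s => ?_) ?_
  · filter_upwards [compOp_ae hh (w + s • δ), rep_line_ae w δ s] with t h1 h2
    rw [h1, h2.1, h2.2]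
  · filter_upwards [hh.ae_differentiable, w.2.rep_contDiff, δ.2.rep_contDiff] with t h1 h2 h3
    exact hasDerivAt_comp_variation h1 (h2.differentiable (by simp))
      (h3.differentiable (by simp)) _ _

end CompositeOperators

end OCPSens

namespace OCPSens

/-! ### Trajectories, final values and integrals as bounded linear maps -/

section LinearMaps

variable {I : TimeInterval} {nx nu np : ℕ}

/-- The integral over `I` on `L^∞`. -/
noncomputable def intL (I : TimeInterval) (F : Type*) [NormedAddCommGroup F] [NormedSpace ℝ F]
    [CompleteSpace F] : Lp F ⊤ I.μ →L[ℝ] F :=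
  L1.integralCLM.comp (Lp.incl le_top)

theorem intL_apply {F : Type*} [NormedAddCommGroup F] [NormedSpace ℝ F]
    [CompleteSpace F] (f : Lp F ⊤ I.μ) : intL I F f = ∫ t, f t ∂I.μ := by
  change L1.integralCLM (Lp.incl (le_top : (1 : ℝ≥0∞) ≤ ⊤) f) = _
  rw [← L1.integral_eq, L1.integral_eq_integral]
  exact integral_congr_ae (Lp.incl_ae le_top f)

/-- The Riesz identification `v ↦ ⟪v, ·⟫`. -/
noncomputable def rieszL (n : ℕ) : E n →L[ℝ] E n →L[ℝ] ℝ :=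
  (innerₗ (E n)).mkContinuous₂ 1 fun x y => by
    simpa using norm_inner_le_norm (𝕜 := ℝ) x y

theorem rieszL_apply {n : ℕ} (v w : E n) : rieszL n v w = ⟪v, w⟫ := rfl

variable {p : ℝ≥0∞} [Fact (1 ≤ p)]

/-- The map `(x, u, p) ↦ (x(·), u(·), p)` into `L^p`. -/
noncomputable def trajL (I : TimeInterval) (p : ℝ≥0∞) [Fact (1 ≤ p)] (nx nu np : ℕ) :
    YSp I p nx nu np →L[ℝ] Lp (YVec nx nu np) p I.μ :=
  ((ContinuousLinearMap.inl ℝ (E nx) (E nu × E np)).compLpL p I.μ).comp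
      ((Lp.incl le_top).comp ((contL I nx).comp
        ((W1.valL I p nx).comp (ContinuousLinearMap.fst ℝ _ _)))) +
    ((((ContinuousLinearMap.inr ℝ (E nx) (E nu × E np)).comp
        (ContinuousLinearMap.inl ℝ (E nu) (E np))).compLpL p I.μ).comp
        ((ContinuousLinearMap.fst ℝ _ _).comp (ContinuousLinearMap.snd ℝ _ _)) +
      (((ContinuousLinearMap.inr ℝ (E nx) (E nu × E np)).comp
        (ContinuousLinearMap.inr ℝ (E nu) (E np))).compLpL p I.μ).comp
        ((Lp.constL p I.μ ℝ).comp
          ((ContinuousLinearMap.snd ℝ _ _).comp (ContinuousLinearMap.snd ℝ _ _))))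

theorem trajL_ae (y : YSp I p nx nu np) : trajL I p nx nu np y =ᵐ[I.μ] traj y := by
  set c : Lp (E nx) ⊤ I.μ := contL I nx (W1.valL I p nx y.1) with hc
  set L₁ := ContinuousLinearMap.inl ℝ (E nx) (E nu × E np)
  set L₂ := (ContinuousLinearMap.inr ℝ (E nx) (E nu × E np)).comp
        (ContinuousLinearMap.inl ℝ (E nu) (E np))
  set L₃ := (ContinuousLinearMap.inr ℝ (E nx) (E nu × E np)).comp
        (ContinuousLinearMap.inr ℝ (E nu) (E np))
  set π : Lp (E np) p I.μ := Lp.const p I.μ y.2.2 with hπ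
  have h0 : trajL I p nx nu np y = L₁.compLpL p I.μ (Lp.incl le_top c) +
    (L₂.compLpL p I.μ y.2.1 + L₃.compLpL p I.μ π) := rfl
  filter_upwards [Lp.coeFn_add (L₁.compLpL p I.μ (Lp.incl le_top c))
    (L₂.compLpL p I.μ y.2.1 + L₃.compLpL p I.μ π),
    Lp.coeFn_add (L₂.compLpL p I.μ y.2.1) (L₃.compLpL p I.μ π),
    compLpL_ae L₁ (Lp.incl (le_top : p ≤ ⊤) c), compLpL_ae L₂ y.2.1, compLpL_ae L₃ π,
    Lp.incl_ae (le_top : p ≤ ⊤) c, W1.contL_valL_ae y.1, Lp.coeFn_const p I.μ y.2.2]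
    with t h1 h2 h3 h4 h5 h6 h7 h8
  rw [h0, h1, Pi.add_apply, h2, Pi.add_apply, h3, h4, h5, h6, hc, h7, hπ, h8]
  simp [traj, L₁, L₂, L₃]

/-- The map `(x, u, p) ↦ (x(tf), p)`. -/
noncomputable def finalL (I : TimeInterval) (p : ℝ≥0∞) [Fact (1 ≤ p)] (nx nu np : ℕ) :
    YSp I p nx nu np →L[ℝ] E nx × E np :=
  ((W1.evalL p nx I.right_mem).comp (ContinuousLinearMap.fst ℝ _ _)).prod
    ((ContinuousLinearMap.snd ℝ _ _).comp (ContinuousLinearMap.snd ℝ _ _))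

theorem finalL_apply (y : YSp I p nx nu np) : finalL I p nx nu np y = final y :=
  Prod.ext (W1.evalL_apply y.1 I.right_mem) rfl

end LinearMaps

/-! ### Bolza functionals -/

section Bolza

variable {I : TimeInterval} {nx nu np ng : ℕ} {φ : E nx × E np → ℝ}
  {l : ℝ → YVec nx nu np × E ng → ℝ}

theorem compOp_traj_ae {F : Type} [NormedAddCommGroup F] [NormedSpace ℝ F]
    {h : ℝ → YVec nx nu np × E ng → F} (hh : Smooth I h)
    (y : YSp I ⊤ nx nu np) (g : G3 I nx nu np ng) :
    ∀ᵐ t ∂I.μ, compOp hh (trajL I ⊤ nx nu np y, g) t = h t (traj y t, g.rep t (traj y t)) := by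
  filter_upwards [compOp_ae hh (trajL I ⊤ nx nu np y, g), trajL_ae y] with t h1 h2
  rw [h1, h2]

theorem integrable_running (hl : Smooth I l) (y : YSp I ⊤ nx nu np) (g : G3 I nx nu np ng) :
    Integrable (fun t => l t (traj y t, g.rep t (traj y t))) I.μ :=
  (Lp.integrable _).congr (compOp_traj_ae hl y g)

/-- `(y, g) ↦ (y(·), g)`, as a bounded linear map. -/
noncomputable def trajG (I : TimeInterval) (nx nu np ng : ℕ) :
    YSp I ⊤ nx nu np × G3 I nx nu np ng →L[ℝ] Lp (YVec nx nu np) ⊤ I.μ × G3 I nx nu np ng :=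
  (trajL I ⊤ nx nu np).prodMap (ContinuousLinearMap.id ℝ _)

/-- `(y, g) ↦ (x(tf), p)`, as a bounded linear map. -/
noncomputable def finalG (I : TimeInterval) (nx nu np ng : ℕ) :
    YSp I ⊤ nx nu np × G3 I nx nu np ng →L[ℝ] E nx × E np :=
  (finalL I ⊤ nx nu np).comp (ContinuousLinearMap.fst ℝ _ _)

theorem bolza_eq (hl : Smooth I l) : bolza (ng := ng) I φ l = fun w =>
    φ (finalG I nx nu np ng w) + intL I ℝ (compOp hl (trajG I nx nu np ng w)) := by
  funext w
  have h1 : trajG I nx nu np ng w = (trajL I ⊤ nx nu np w.1, w.2) := rfl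
  have h2 : finalG I nx nu np ng w = final w.1 := finalL_apply w.1
  rw [intL_apply, h1, h2, integral_congr_ae (compOp_traj_ae hl w.1 w.2)]
  rfl

theorem contDiff_add_comp {W A B C : Type*} [NormedAddCommGroup W] [NormedSpace ℝ W]
    [NormedAddCommGroup A] [NormedSpace ℝ A] [NormedAddCommGroup B] [NormedSpace ℝ B]
    [NormedAddCommGroup C] [NormedSpace ℝ C] {f : A → ℝ} {Φ : B → C} (hf : ContDiff ℝ 1 f)
    (hΦ : ContDiff ℝ 1 Φ) (L₁ : W →L[ℝ] A) (L₂ : W →L[ℝ] B) (J : C →L[ℝ] ℝ) :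
    ContDiff ℝ 1 fun w => f (L₁ w) + J (Φ (L₂ w)) :=
  (hf.comp L₁.contDiff).add (J.contDiff.comp (hΦ.comp L₂.contDiff))

theorem fderiv_add_comp {W A B C : Type*} [NormedAddCommGroup W] [NormedSpace ℝ W]
    [NormedAddCommGroup A] [NormedSpace ℝ A] [NormedAddCommGroup B] [NormedSpace ℝ B]
    [NormedAddCommGroup C] [NormedSpace ℝ C] {f : A → ℝ} {Φ : B → C} (hf : ContDiff ℝ 1 f)
    (hΦ : ContDiff ℝ 1 Φ) (L₁ : W →L[ℝ] A) (L₂ : W →L[ℝ] B) (J : C →L[ℝ] ℝ) (w δ : W) :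
    fderiv ℝ (fun w => f (L₁ w) + J (Φ (L₂ w))) w δ =
      fderiv ℝ f (L₁ w) (L₁ δ) + J (fderiv ℝ Φ (L₂ w) (L₂ δ)) := by
  have h1 : HasFDerivAt (fun w => f (L₁ w)) ((fderiv ℝ f (L₁ w)).comp L₁) w :=
    HasFDerivAt.comp w (hf.differentiable one_ne_zero _).hasFDerivAt L₁.hasFDerivAt
  have h2 : HasFDerivAt (fun w => Φ (L₂ w)) ((fderiv ℝ Φ (L₂ w)).comp L₂) w :=
    HasFDerivAt.comp w (hΦ.differentiable one_ne_zero _).hasFDerivAt L₂.hasFDerivAt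
  have h3 := h1.add (J.hasFDerivAt.comp w h2)
  exact congrArg (fun L : W →L[ℝ] ℝ => L δ) h3.fderiv

theorem contDiff_bolza (hφ : ContDiff ℝ 2 φ) (hl : Smooth I l) :
    ContDiff ℝ 1 (bolza (ng := ng) I φ l) := by
  rw [bolza_eq hl]
  exact contDiff_add_comp (W := YSp I ⊤ nx nu np × G3 I nx nu np ng) (A := E nx × E np)
    (B := Lp (YVec nx nu np) ⊤ I.μ × G3 I nx nu np ng)
    (hφ.of_le (show (1 : WithTop ℕ∞) ≤ 2 by norm_num)) (contDiff_compOp hl) _ _ _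

theorem bolzaDerivIntegrand_eq (y : YSp I ⊤ nx nu np) (g : G3 I nx nu np ng)
    (δy : YSp I ⊤ nx nu np) (δg : G3 I nx nu np ng) (t : ℝ) :
    bolzaDerivIntegrand l y g δy δg t = totD (l t) (g.rep t) (traj y t) (traj δy t)
      + parG (l t) (g.rep t) (traj y t) (δg.rep t (traj y t)) := by
  rw [bolzaDerivIntegrand, ← map_add, ← map_add]
  simp [traj]

theorem fderiv_compOp_traj_ae {F : Type} [NormedAddCommGroup F] [NormedSpace ℝ F]
    {h : ℝ → YVec nx nu np × E ng → F} (hh : Smooth I h)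
    (y δy : YSp I ⊤ nx nu np) (g δg : G3 I nx nu np ng) :
    ∀ᵐ t ∂I.μ, fderiv ℝ (compOp hh) (trajL I ⊤ nx nu np y, g) (trajL I ⊤ nx nu np δy, δg) t =
      totD (h t) (g.rep t) (traj y t) (traj δy t)
        + parG (h t) (g.rep t) (traj y t) (δg.rep t (traj y t)) := by
  filter_upwards [fderiv_compOp_ae hh (trajL I ⊤ nx nu np y, g) (trajL I ⊤ nx nu np δy, δg),
    trajL_ae y, trajL_ae δy] with t h1 h2 h3
  rw [h1, h2, h3]

theorem fderiv_bolza (hφ : ContDiff ℝ 2 φ) (hl : Smooth I l) (y δy : YSp I ⊤ nx nu np)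
    (g δg : G3 I nx nu np ng) :
    Integrable (bolzaDerivIntegrand l y g δy δg) I.μ ∧
      fderiv ℝ (bolza I φ l) (y, g) (δy, δg) =
        fderiv ℝ φ (final y) (final δy) + ∫ t, bolzaDerivIntegrand l y g δy δg t ∂I.μ := by
  have hae : fderiv ℝ (compOp hl) (trajL I ⊤ nx nu np y, g) (trajL I ⊤ nx nu np δy, δg)
      =ᵐ[I.μ] bolzaDerivIntegrand l y g δy δg := by
    filter_upwards [fderiv_compOp_traj_ae hl y δy g δg] with t ht
    rw [ht, bolzaDerivIntegrand_eq]
  refine ⟨(Lp.integrable _).congr hae, ?_⟩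
  have h := fderiv_add_comp (W := YSp I ⊤ nx nu np × G3 I nx nu np ng) (A := E nx × E np)
    (B := Lp (YVec nx nu np) ⊤ I.μ × G3 I nx nu np ng)
    (hφ.of_le (show (1 : WithTop ℕ∞) ≤ 2 by norm_num)) (contDiff_compOp hl)
    (finalG I nx nu np ng) (trajG I nx nu np ng) (intL I ℝ) (y, g) (δy, δg)
  rw [bolza_eq hl, h, ← integral_congr_ae hae, ← intL_apply, ← finalL_apply, ← finalL_apply]
  rfl

end Bolza

/-! ### The Hamiltonian -/

section Hamiltonian

variable {nx nu np ng : ℕ} {P : OCP nx nu np ng}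

theorem hasFDerivAt_add_inner {V : Type} [NormedAddCommGroup V] [NormedSpace ℝ V] {n : ℕ}
    {h : V → ℝ} {k : V → E n} {v : V} (hh : DifferentiableAt ℝ h v)
    (hk : DifferentiableAt ℝ k v) (c : E n) :
    HasFDerivAt (fun v => h v + ⟪c, k v⟫)
      (fderiv ℝ h v + (rieszL n c).comp (fderiv ℝ k v)) v :=
  hh.hasFDerivAt.add ((rieszL n c).hasFDerivAt.comp v hk.hasFDerivAt)

theorem fderiv_add_inner_apply {V : Type} [NormedAddCommGroup V] [NormedSpace ℝ V] {n : ℕ}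
    {h : V → ℝ} {k : V → E n} {v : V} (hh : DifferentiableAt ℝ h v)
    (hk : DifferentiableAt ℝ k v) (c : E n) (a : V) :
    fderiv ℝ (fun v => h v + ⟪c, k v⟫) v a = fderiv ℝ h v a + ⟪c, fderiv ℝ k v a⟫ := by
  rw [(hasFDerivAt_add_inner hh hk c).fderiv]
  rfl

theorem fderiv_fderiv_add_inner {V : Type} [NormedAddCommGroup V] [NormedSpace ℝ V] {n : ℕ}
    {h : V → ℝ} {k : V → E n} (hh : ContDiff ℝ 2 h) (hk : ContDiff ℝ 2 k) (c : E n) (v a b : V) :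
    fderiv ℝ (fderiv ℝ (fun v => h v + ⟪c, k v⟫)) v a b =
      fderiv ℝ (fderiv ℝ h) v a b + ⟪c, fderiv ℝ (fderiv ℝ k) v a b⟫ := by
  have h1 : fderiv ℝ (fun v => h v + ⟪c, k v⟫) = fun v =>
      fderiv ℝ h v + (rieszL n c).comp (fderiv ℝ k v) := funext fun v =>
    (hasFDerivAt_add_inner (hh.differentiable two_ne_zero v)
      (hk.differentiable two_ne_zero v) c).fderiv
  have h2 := (hasFDerivAt_fderiv_of_contDiff hh v).add
    (((ContinuousLinearMap.compL ℝ V (E n) ℝ) (rieszL n c)).hasFDerivAt.comp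
      v (hasFDerivAt_fderiv_of_contDiff hk v))
  rw [h1]
  exact (congrArg (fun L : V →L[ℝ] V →L[ℝ] ℝ => L a b) h2.fderiv)

namespace OCP

variable {lam : E nx} {t : ℝ} {g : YVec nx nu np → E ng} {y : YVec nx nu np}

theorem fderiv_ham (hl : ContDiff ℝ 2 (P.l t)) (hf : ContDiff ℝ 2 (P.f t))
    (v a : YVec nx nu np × E ng) :
    fderiv ℝ (P.ham lam t) v a = fderiv ℝ (P.l t) v a + ⟪lam, fderiv ℝ (P.f t) v a⟫ :=
  fderiv_add_inner_apply (hl.differentiable two_ne_zero v) (hf.differentiable two_ne_zero v) lam a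

theorem parG_ham (hl : ContDiff ℝ 2 (P.l t)) (hf : ContDiff ℝ 2 (P.f t)) (c : E ng) :
    parG (P.ham lam t) g y c = parG (P.l t) g y c + ⟪lam, parG (P.f t) g y c⟫ :=
  fderiv_ham hl hf _ _

theorem fderiv_fderiv_ham (hl : ContDiff ℝ 2 (P.l t)) (hf : ContDiff ℝ 2 (P.f t))
    (v a b : YVec nx nu np × E ng) :
    fderiv ℝ (fderiv ℝ (P.ham lam t)) v a b = fderiv ℝ (fderiv ℝ (P.l t)) v a b
      + ⟪lam, fderiv ℝ (fderiv ℝ (P.f t)) v a b⟫ :=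
  fderiv_fderiv_add_inner hl hf lam v a b

theorem totDD_ham (hl : ContDiff ℝ 2 (P.l t)) (hf : ContDiff ℝ 2 (P.f t)) (a b : YVec nx nu np) :
    totDD (P.ham lam t) g y a b = totDD (P.l t) g y a b + ⟪lam, totDD (P.f t) g y a b⟫ := by
  simp only [totDD]
  rw [fderiv_fderiv_ham hl hf, parG_ham hl hf, inner_add_right]
  ring

theorem totDG_ham (hl : ContDiff ℝ 2 (P.l t)) (hf : ContDiff ℝ 2 (P.f t)) (a : YVec nx nu np)
    (c : E ng) :
    totDG (P.ham lam t) g y a c = totDG (P.l t) g y a c + ⟪lam, totDG (P.f t) g y a c⟫ :=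
  fderiv_fderiv_ham hl hf _ _ _

end OCP

end Hamiltonian

/-! ### The optimality system as a nonlinear equation in Banach spaces -/

section KKTOperator

variable {I : TimeInterval} {nx nu np ng : ℕ} {P : OCP nx nu np ng}

/-- The part `(x, u, p)` of `(x, u, p, λ)` as a bounded linear map. -/
noncomputable def ZSp.yL (I : TimeInterval) (nx nu np : ℕ) :
    ZSp I nx nu np →L[ℝ] YSp I ⊤ nx nu np :=
  (ContinuousLinearMap.fst ℝ _ _).prod
    (((ContinuousLinearMap.fst ℝ _ _).comp (ContinuousLinearMap.snd ℝ _ _)).prod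
      ((ContinuousLinearMap.fst ℝ _ _).comp ((ContinuousLinearMap.snd ℝ _ _).comp
        (ContinuousLinearMap.snd ℝ _ _))))

/-- The part `λ` of `(x, u, p, λ)` as a bounded linear map. -/
noncomputable def ZSp.lamL (I : TimeInterval) (nx nu np : ℕ) : ZSp I nx nu np →L[ℝ] W1 I ⊤ nx :=
  (ContinuousLinearMap.snd ℝ _ _).comp ((ContinuousLinearMap.snd ℝ _ _).comp
    (ContinuousLinearMap.snd ℝ _ _))

/-- The map `(z, g) ↦ (y(·), g)`. -/
noncomputable def trajZ (I : TimeInterval) (nx nu np ng : ℕ) :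
    ZSp I nx nu np × G3 I nx nu np ng →L[ℝ] Lp (YVec nx nu np) ⊤ I.μ × G3 I nx nu np ng :=
  ((trajL I ⊤ nx nu np).comp (ZSp.yL I nx nu np)).prodMap (ContinuousLinearMap.id ℝ _)

/-- The costate as an `L^∞` function with values in the dual space. -/
noncomputable def costateL (I : TimeInterval) (nx nu np : ℕ) :
    ZSp I nx nu np →L[ℝ] Lp (E nx →L[ℝ] ℝ) ⊤ I.μ :=
  ((rieszL nx).compLpL ⊤ I.μ).comp ((contL I nx).comp
    ((W1.valL I ⊤ nx).comp (ZSp.lamL I nx nu np)))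

theorem costateL_ae (z : ZSp I nx nu np) :
    ∀ᵐ t ∂I.μ, costateL I nx nu np z t = rieszL nx (z.lam.val t) := by
  filter_upwards [compLpL_ae (rieszL nx) (contL I nx (W1.valL I ⊤ nx z.lam)),
    W1.contL_valL_ae z.lam] with t h1 h2
  exact h1.trans (by rw [h2])

/-- `(z, g) ↦ λ` as a bounded linear map into `L^∞`, with values in the dual space. -/
noncomputable def costateG (I : TimeInterval) (nx nu np ng : ℕ) :
    ZSp I nx nu np × G3 I nx nu np ng →L[ℝ] Lp (E nx →L[ℝ] ℝ) ⊤ I.μ :=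
  (costateL I nx nu np).comp (ContinuousLinearMap.fst ℝ _ _)

namespace OCP

/-- The total derivative of the Hamiltonian, `(z, g) ↦ H_y + H_g g_y` along `(z, g)`. -/
noncomputable def hamOp (hl : Smooth I P.l) (hf : Smooth I P.f)
    (w : ZSp I nx nu np × G3 I nx nu np ng) : Lp (YVec nx nu np →L[ℝ] ℝ) ⊤ I.μ :=
  (ContinuousLinearMap.compL ℝ (YVec nx nu np) (E nx) ℝ).holderL I.μ ⊤ ⊤ ⊤
      (costateL I nx nu np w.1) (totDOp hf (trajZ I nx nu np ng w))
    + totDOp hl (trajZ I nx nu np ng w)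

theorem contDiff_hamOp (hl : Smooth I P.l) (hf : Smooth I P.f) : ContDiff ℝ 1 (hamOp hl hf) := by
  refine ContDiff.add ?_ ((contDiff_totDOp hl).comp (ContinuousLinearMap.contDiff _))
  have h0 : ContDiff ℝ 1 (costateG I nx nu np ng) :=
    ContinuousLinearMap.contDiff (E := ZSp I nx nu np × G3 I nx nu np ng)
      (F := Lp (E nx →L[ℝ] ℝ) ⊤ I.μ) _
  have h1 : ContDiff ℝ 1 fun w : ZSp I nx nu np × G3 I nx nu np ng =>
      (ContinuousLinearMap.compL ℝ (YVec nx nu np) (E nx) ℝ).holderL I.μ ⊤ ⊤ ⊤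
        (costateL I nx nu np w.1) :=
    ((ContinuousLinearMap.compL ℝ (YVec nx nu np) (E nx) ℝ).holderL I.μ ⊤ ⊤ ⊤).contDiff.comp
      h0
  refine h1.clm_apply ?_
  exact (contDiff_totDOp hf).comp (ContinuousLinearMap.contDiff _)

/-- The values of `hamOp` are the linear forms in the costate, control and parameter equations. -/
theorem hamOp_ae (hl : Smooth I P.l) (hf : Smooth I P.f) (z : ZSp I nx nu np)
    (g : G3 I nx nu np ng) : ∀ᵐ t ∂I.μ, ∀ ξ, hamOp hl hf (z, g) t ξ =
      ⟪z.lam.val t, totD (P.f t) (g.rep t) (traj z.y t) ξ⟫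
        + totD (P.l t) (g.rep t) (traj z.y t) ξ := by
  filter_upwards [Lp.coeFn_add ((ContinuousLinearMap.compL ℝ (YVec nx nu np) (E nx) ℝ).holderL
      I.μ ⊤ ⊤ ⊤ (costateL I nx nu np z) (totDOp hf (trajZ I nx nu np ng (z, g))))
      (totDOp hl (trajZ I nx nu np ng (z, g))),
    holderL_ae (ContinuousLinearMap.compL ℝ (YVec nx nu np) (E nx) ℝ) (r := ⊤)
      (costateL I nx nu np z) (totDOp hf (trajZ I nx nu np ng (z, g))),
    costateL_ae z, totDOp_ae hf (trajZ I nx nu np ng (z, g)),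
    totDOp_ae hl (trajZ I nx nu np ng (z, g)), trajL_ae z.y] with t h1 h2 h3 h4 h5 h6 ξ
  have h7 := h4.trans (congrArg (totD (P.f t) (g.rep t)) h6)
  have h8 := h5.trans (congrArg (totD (P.l t) (g.rep t)) h6)
  exact (DFunLike.congr_fun h1 ξ).trans (congrArg₂ (· + ·)
    ((DFunLike.congr_fun h2 ξ).trans (congrArg₂
      (fun (l : E nx →L[ℝ] ℝ) (D : YVec nx nu np →L[ℝ] E nx) => l (D ξ)) h3 h7))
      (DFunLike.congr_fun h8 ξ))

/-- The derivative of `hamOp`: the terms of the sensitivity system. -/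
theorem fderiv_hamOp_ae (hl : Smooth I P.l) (hf : Smooth I P.f) (z δz : ZSp I nx nu np)
    (g δg : G3 I nx nu np ng) : ∀ᵐ t ∂I.μ, ∀ ξ, fderiv ℝ (hamOp hl hf) (z, g) (δz, δg) t ξ =
      P.Hyy g z t ξ (traj δz.y t) + P.Hyg g z t ξ (δg.rep t (traj z.y t))
        + P.dRow g z t (fderiv ℝ (δg.rep t) (traj z.y t) ξ)
        + ⟪δz.lam.val t, P.ABC g z t ξ⟫ := by
  set w := trajZ I nx nu np ng (z, g) with hw
  set δ := trajZ I nx nu np ng (δz, δg) with hδ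
  refine fderiv_Linf_apply_ae ((contDiff_hamOp hl hf).differentiable one_ne_zero (z, g)) (δz, δg)
    (f := fun s t ξ => ⟪z.lam.val t + s • δz.lam.val t,
      totD (P.f t) (fun x => g.rep t x + s • δg.rep t x) (traj z.y t + s • traj δz.y t) ξ⟫ +
      totD (P.l t) (fun x => g.rep t x + s • δg.rep t x) (traj z.y t + s • traj δz.y t) ξ)
    (fun s => ?_) ?_
  · have hlin : trajL I ⊤ nx nu np (z + s • δz).y =
        trajL I ⊤ nx nu np z.y + s • trajL I ⊤ nx nu np δz.y :=
      (map_add (trajL I ⊤ nx nu np) z.y (s • δz.y)).trans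
        (congrArg (_ + ·) (map_smul (trajL I ⊤ nx nu np) s δz.y))
    filter_upwards [hamOp_ae hl hf (z + s • δz) (g + s • δg), rep_line_ae w δ s,
      trajL_ae (z + s • δz).y, trajL_ae z.y, trajL_ae δz.y] with t h1 h2 h3 h4 h5 ξ
    have h6 : traj (z + s • δz).y t = traj z.y t + s • traj δz.y t :=
      h3.symm.trans ((congrArg (fun f : Lp (YVec nx nu np) ⊤ I.μ => f t) hlin).trans
        (h2.1.trans (congrArg₂ (fun a b => a + s • b) h4 h5)))
    have h7 : (g + s • δg).rep t = fun x => g.rep t x + s • δg.rep t x := h2.2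
    have h8 : (z + s • δz).lam.val t = z.lam.val t + s • δz.lam.val t := rfl
    have := h1 ξ
    rw [h6, h7, h8] at this
    exact this
  · filter_upwards [hl.contDiff, hf.contDiff, g.rep_contDiff, δg.rep_contDiff] with t h1 h2 h3 h4 ξ
    have hg2 : ContDiff ℝ 2 (g.rep t) := h3.of_le (by norm_num)
    have hδ2 : ContDiff ℝ 2 (δg.rep t) := h4.of_le (by norm_num)
    have d1 := hasDerivAt_totD_variation h1 hg2 hδ2 (traj z.y t) (traj δz.y t) ξ
    have d2 := hasDerivAt_totD_variation h2 hg2 hδ2 (traj z.y t) (traj δz.y t) ξ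
    have d3 : HasDerivAt (fun s : ℝ => z.lam.val t + s • δz.lam.val t) (δz.lam.val t) 0 := by
      simpa using ((hasDerivAt_id (0 : ℝ)).smul_const (δz.lam.val t)).const_add (z.lam.val t)
    refine ((d3.inner ℝ d2).add d1).congr_deriv ?_
    simp only [Hyy, Hyg, dRow, ABC, totDD_ham h1 h2, totDG_ham h1 h2, parG_ham h1 h2, zero_smul,
      add_zero, inner_add_right]
    ring

end OCP

end KKTOperator

end OCPSens

namespace OCPSens

section KKTEquation

variable {I : TimeInterval} {nx nu np ng : ℕ} {P : OCP nx nu np ng}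

/-- The image space of the optimality system: the residuals of the state equation, the initial
condition, the costate equation, the terminal condition and the stationarity conditions in the
control and in the parameter. Residuals of equations between gradients are kept in the dual. -/
abbrev KKTSp (I : TimeInterval) (nx nu np : ℕ) : Type :=
  Lp (E nx) ⊤ I.μ × E nx × Lp (E nx →L[ℝ] ℝ) ⊤ I.μ × (E nx →L[ℝ] ℝ) ×
    Lp (E nu →L[ℝ] ℝ) ⊤ I.μ × (E np →L[ℝ] ℝ)

/-- The space of the terms of the optimality system that are nonlinear in `(z, g)`: the right-hand
side of the state equation, the total derivative of the Hamiltonian, and `φ'`. -/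
abbrev NonlinSp (I : TimeInterval) (nx nu np : ℕ) : Type :=
  Lp (E nx) ⊤ I.μ × Lp (YVec nx nu np →L[ℝ] ℝ) ⊤ I.μ × (E nx × E np →L[ℝ] ℝ)

/-- Inclusion of the states into the triples `(x, u, p)`. -/
noncomputable def inX (nx nu np : ℕ) : E nx →L[ℝ] YVec nx nu np := ContinuousLinearMap.inl ℝ _ _

/-- Inclusion of the controls into the triples `(x, u, p)`. -/
noncomputable def inU (nx nu np : ℕ) : E nu →L[ℝ] YVec nx nu np :=
  (ContinuousLinearMap.inr ℝ _ _).comp (ContinuousLinearMap.inl ℝ _ _)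

/-- Inclusion of the parameters into the triples `(x, u, p)`. -/
noncomputable def inP (nx nu np : ℕ) : E np →L[ℝ] YVec nx nu np :=
  (ContinuousLinearMap.inr ℝ _ _).comp (ContinuousLinearMap.inr ℝ _ _)

theorem inX_apply (ξ : E nx) : inX nx nu np ξ = (ξ, 0, 0) := rfl

theorem inU_apply (υ : E nu) : inU nx nu np υ = (0, υ, 0) := rfl

theorem inP_apply (π : E np) : inP nx nu np π = (0, 0, π) := rfl

/-- Restriction of linear forms along a linear map. -/
noncomputable def restrictForm {V W : Type*} [NormedAddCommGroup V] [NormedSpace ℝ V]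
    [NormedAddCommGroup W] [NormedSpace ℝ W] (L : V →L[ℝ] W) : (W →L[ℝ] ℝ) →L[ℝ] V →L[ℝ] ℝ :=
  (ContinuousLinearMap.compL ℝ V W ℝ).flip L

theorem restrictForm_apply {V W : Type*} [NormedAddCommGroup V] [NormedSpace ℝ V]
    [NormedAddCommGroup W] [NormedSpace ℝ W] (L : V →L[ℝ] W) (q : W →L[ℝ] ℝ) (v : V) :
    restrictForm L q v = q (L v) := rfl

section Assembly

variable {Z W A X H Q B₁ B₃ T₃ T₄ T₅ T₆ : Type*}
  [NormedAddCommGroup Z] [NormedSpace ℝ Z] [NormedAddCommGroup W] [NormedSpace ℝ W]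
  [NormedAddCommGroup A] [NormedSpace ℝ A] [NormedAddCommGroup X] [NormedSpace ℝ X]
  [NormedAddCommGroup H] [NormedSpace ℝ H] [NormedAddCommGroup Q] [NormedSpace ℝ Q]
  [NormedAddCommGroup B₁] [NormedSpace ℝ B₁] [NormedAddCommGroup B₃] [NormedSpace ℝ B₃]
  [NormedAddCommGroup T₃] [NormedSpace ℝ T₃] [NormedAddCommGroup T₄] [NormedSpace ℝ T₄]
  [NormedAddCommGroup T₅] [NormedSpace ℝ T₅] [NormedAddCommGroup T₆] [NormedSpace ℝ T₆]

/-- The block form of the linear part of the optimality system. -/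
noncomputable def linBlock (L₁ : Z →L[ℝ] A) (L₂ : Z →L[ℝ] X) (L₃ : Z →L[ℝ] T₃) (L₄ : Z →L[ℝ] T₄) :
    Z →L[ℝ] A × X × T₃ × T₄ × T₅ × T₆ :=
  L₁.prod (L₂.prod (L₃.prod (L₄.prod 0)))

/-- The block form of the dependence of the optimality system on its nonlinear terms. -/
noncomputable def mixBlock (X : Type*) [NormedAddCommGroup X] [NormedSpace ℝ X] (A : Type*)
    [NormedAddCommGroup A] [NormedSpace ℝ A] (K₃ : H →L[ℝ] T₃) (K₄ : Q →L[ℝ] T₄)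
    (K₅ : H →L[ℝ] T₅) (K₆ : H →L[ℝ] T₆) (K₆' : Q →L[ℝ] T₆) :
    A × H × Q →L[ℝ] A × X × T₃ × T₄ × T₅ × T₆ :=
  let h : A × H × Q →L[ℝ] H :=
    (ContinuousLinearMap.fst ℝ H Q).comp (ContinuousLinearMap.snd ℝ A (H × Q))
  let q : A × H × Q →L[ℝ] Q :=
    (ContinuousLinearMap.snd ℝ H Q).comp (ContinuousLinearMap.snd ℝ A (H × Q))
  (-(ContinuousLinearMap.fst ℝ A (H × Q))).prod ((0 : A × H × Q →L[ℝ] X).prod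
    ((K₃.comp h).prod ((-(K₄.comp q)).prod ((K₅.comp h).prod (K₆'.comp q + K₆.comp h)))))

theorem contDiff_triple {N₁ : B₁ → A} {N₂ : W → H} {N₃ : B₃ → Q} (h₁ : ContDiff ℝ 1 N₁)
    (h₂ : ContDiff ℝ 1 N₂) (h₃ : ContDiff ℝ 1 N₃) (M₁ : W →L[ℝ] B₁) (M₃ : W →L[ℝ] B₃) :
    ContDiff ℝ 1 fun w => (N₁ (M₁ w), N₂ w, N₃ (M₃ w)) :=
  (h₁.comp M₁.contDiff).prodMk (h₂.prodMk (h₃.comp M₃.contDiff))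

theorem fderiv_triple {N₁ : B₁ → A} {N₂ : W → H} {N₃ : B₃ → Q} (h₁ : ContDiff ℝ 1 N₁)
    (h₂ : ContDiff ℝ 1 N₂) (h₃ : ContDiff ℝ 1 N₃) (M₁ : W →L[ℝ] B₁) (M₃ : W →L[ℝ] B₃) (w δ : W) :
    fderiv ℝ (fun w => (N₁ (M₁ w), N₂ w, N₃ (M₃ w))) w δ =
      (fderiv ℝ N₁ (M₁ w) (M₁ δ), fderiv ℝ N₂ w δ, fderiv ℝ N₃ (M₃ w) (M₃ δ)) := by
  have h := (HasFDerivAt.comp w (h₁.differentiable one_ne_zero (M₁ w)).hasFDerivAt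
    M₁.hasFDerivAt).prodMk ((h₂.differentiable one_ne_zero w).hasFDerivAt.prodMk
      (HasFDerivAt.comp w (h₃.differentiable one_ne_zero (M₃ w)).hasFDerivAt M₃.hasFDerivAt))
  exact congrArg (fun L : W →L[ℝ] A × H × Q => L δ) h.fderiv

theorem contDiff_clm_fst_add_clm_comp_sub {N : Z × X → H} (hN : ContDiff ℝ 1 N) (L : Z →L[ℝ] A)
    (K : H →L[ℝ] A) (c : A) : ContDiff ℝ 1 fun w => L w.1 + K (N w) - c :=
  ((L.contDiff.comp contDiff_fst).add (K.contDiff.comp hN)).sub contDiff_const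

/-- `L ∘ fst + K ∘ N'(w)`, the derivative of `w ↦ L w.1 + K (N w)`. -/
noncomputable def derivBlock (N : Z × X → H) (L : Z →L[ℝ] A) (K : H →L[ℝ] A) (w : Z × X) :
    Z × X →L[ℝ] A :=
  L.comp (ContinuousLinearMap.fst ℝ Z X) + K.comp (fderiv ℝ N w)

theorem hasFDerivAt_clm_fst_add_clm_comp_sub {N : Z × X → H} (hN : ContDiff ℝ 1 N)
    (L : Z →L[ℝ] A) (K : H →L[ℝ] A) (c : A) (w : Z × X) :
    HasFDerivAt (fun w => L w.1 + K (N w) - c) (derivBlock N L K w) w :=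
  (((L.hasFDerivAt (x := w.1)).comp w hasFDerivAt_fst).add
    ((K.hasFDerivAt (x := N w)).comp w (hN.differentiable one_ne_zero w).hasFDerivAt)).sub_const c

end Assembly

theorem intL_form_apply {V : Type*} [NormedAddCommGroup V] [NormedSpace ℝ V]
    (h : Lp (V →L[ℝ] ℝ) ⊤ I.μ) (v : V) : intL I (V →L[ℝ] ℝ) h v = ∫ t, h t v ∂I.μ := by
  rw [intL_apply, ContinuousLinearMap.integral_apply (Lp.integrable _)]

theorem completeSpace_clm (V W : Type*) [NormedAddCommGroup V] [NormedSpace ℝ V]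
    [NormedAddCommGroup W] [NormedSpace ℝ W] [CompleteSpace W] : CompleteSpace (V →L[ℝ] W) :=
  inferInstance

/-- Completeness of the dual space, as a shortcut for instance search. -/
theorem completeSpace_dual (nx nu np : ℕ) : CompleteSpace (YVec nx nu np →L[ℝ] ℝ) :=
  completeSpace_clm _ _

attribute [local instance] completeSpace_dual

/-- The linear part `(x', x(t₀), λ', λ(tf), 0, 0)` of the optimality system. -/
noncomputable def kktLin (I : TimeInterval) (nx nu np : ℕ) :
    ZSp I nx nu np →L[ℝ] KKTSp I nx nu np :=
  linBlock (Z := ZSp I nx nu np) ((W1.derL I ⊤ nx).comp (ContinuousLinearMap.fst ℝ _ _))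
    ((W1.evalL ⊤ nx I.left_mem).comp (ContinuousLinearMap.fst ℝ _ _))
    (((rieszL nx).compLpL ⊤ I.μ).comp ((W1.derL I ⊤ nx).comp (ZSp.lamL I nx nu np)))
    ((rieszL nx).comp ((W1.evalL ⊤ nx I.right_mem).comp (ZSp.lamL I nx nu np)))

/-- The way in which the nonlinear terms enter the optimality system. -/
noncomputable def kktMix (I : TimeInterval) (nx nu np : ℕ) :
    NonlinSp I nx nu np →L[ℝ] KKTSp I nx nu np :=
  mixBlock (E nx) (Lp (E nx) ⊤ I.μ) ((restrictForm (inX nx nu np)).compLpL ⊤ I.μ)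
    (restrictForm (ContinuousLinearMap.inl ℝ (E nx) (E np)))
    ((restrictForm (inU nx nu np)).compLpL ⊤ I.μ)
    ((restrictForm (inP nx nu np)).comp (intL I (YVec nx nu np →L[ℝ] ℝ)))
    (restrictForm (ContinuousLinearMap.inr ℝ (E nx) (E np)))

/-- Componentwise form of an equation in the image space of the optimality system. -/
theorem kktLin_add_kktMix_eq_iff (z : ZSp I nx nu np) (a : Lp (E nx) ⊤ I.μ)
    (h : Lp (YVec nx nu np →L[ℝ] ℝ) ⊤ I.μ) (q : E nx × E np →L[ℝ] ℝ) (τ : KKTSp I nx nu np) :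
    kktLin I nx nu np z + kktMix I nx nu np (a, h, q) = τ ↔
      (∀ᵐ t ∂I.μ, z.y.1.der t = a t + τ.1 t) ∧ z.y.1.val I.t₀ = τ.2.1 ∧
      (∀ᵐ t ∂I.μ, ∀ ξ, ⟪z.lam.der t, ξ⟫ = -h t (ξ, 0, 0) + τ.2.2.1 t ξ) ∧
      (∀ ξ, ⟪z.lam.val I.tf, ξ⟫ = q (ξ, 0) + τ.2.2.2.1 ξ) ∧
      (∀ᵐ t ∂I.μ, ∀ υ, h t (0, υ, 0) = τ.2.2.2.2.1 t υ) ∧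
      ∀ π, q (0, π) + ∫ t, h t (0, 0, π) ∂I.μ = τ.2.2.2.2.2 π := by
  obtain ⟨τ₁, τ₂, τ₃, τ₄, τ₅, τ₆⟩ := τ
  have hl : kktLin I nx nu np z = (W1.derL I ⊤ nx z.y.1, W1.evalL ⊤ nx I.left_mem z.y.1,
    (rieszL nx).compLpL ⊤ I.μ (W1.derL I ⊤ nx z.lam),
    rieszL nx (W1.evalL ⊤ nx I.right_mem z.lam), 0, 0) := rfl
  have hm : kktMix I nx nu np (a, h, q) = (-a, 0,
    (restrictForm (inX nx nu np)).compLpL ⊤ I.μ h,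
    -restrictForm (ContinuousLinearMap.inl ℝ (E nx) (E np)) q,
    (restrictForm (inU nx nu np)).compLpL ⊤ I.μ h,
    restrictForm (ContinuousLinearMap.inr ℝ (E nx) (E np)) q +
      restrictForm (inP nx nu np) (intL I (YVec nx nu np →L[ℝ] ℝ) h)) := rfl
  rw [hl, hm]
  simp only [Prod.mk_add_mk, Prod.mk.injEq, add_zero, zero_add]
  refine and_congr ?_ (and_congr ?_ (and_congr ?_ (and_congr ?_ (and_congr ?_ ?_))))
  · rw [← sub_eq_add_neg, sub_eq_iff_eq_add', Lp.ext_iff]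
    have h1 := Lp.coeFn_add a τ₁
    constructor
    · intro h2
      filter_upwards [h1, h2] with t h1 h2
      exact h2.trans h1
    · intro h2
      filter_upwards [h1, h2] with t h1 h2
      exact h2.trans h1.symm
  · rw [W1.evalL_apply]
  · rw [Lp.ext_iff]
    have h1 := Lp.coeFn_add ((rieszL nx).compLpL ⊤ I.μ (W1.derL I ⊤ nx z.lam))
      ((restrictForm (inX nx nu np)).compLpL ⊤ I.μ h)
    have h2 := compLpL_ae (rieszL nx) (W1.derL I ⊤ nx z.lam)
    have h3 := compLpL_ae (restrictForm (inX nx nu np)) h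
    constructor
    · intro h4
      filter_upwards [h1, h2, h3, h4] with t h1 h2 h3 h4 ξ
      have h5 := congrArg (fun L : E nx →L[ℝ] ℝ => L ξ) (h4.symm.trans h1)
      simp only [Pi.add_apply, h2, h3, add_apply, rieszL_apply,
        restrictForm_apply, inX_apply] at h5
      rw [h5, W1.der_eq]
      ring
    · intro h4
      filter_upwards [h1, h2, h3, h4] with t h1 h2 h3 h4
      ext ξ
      have h5 := h4 ξ
      rw [h1]
      simp only [Pi.add_apply, h2, h3, add_apply, rieszL_apply,
        restrictForm_apply, inX_apply]
      rw [W1.der_eq] at h5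
      linarith
  · rw [W1.evalL_apply, ContinuousLinearMap.ext_iff]
    refine forall_congr' fun ξ => ?_
    rw [← sub_eq_add_neg, sub_apply, rieszL_apply, restrictForm_apply,
      sub_eq_iff_eq_add']
    rfl
  · rw [Lp.ext_iff]
    have h3 := compLpL_ae (restrictForm (inU nx nu np)) h
    constructor
    · intro h4
      filter_upwards [h3, h4] with t h3 h4 υ
      rw [← h4, h3, restrictForm_apply, inU_apply]
    · intro h4
      filter_upwards [h3, h4] with t h3 h4
      ext υ
      rw [← h4 υ, h3, restrictForm_apply, inU_apply]
  · have h1 : ∀ π, (restrictForm (ContinuousLinearMap.inr ℝ (E nx) (E np)) q +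
        restrictForm (inP nx nu np) (intL I (YVec nx nu np →L[ℝ] ℝ) h)) π =
        q (0, π) + ∫ t, h t (0, 0, π) ∂I.μ := fun π =>
      congrArg (q (0, π) + ·) (intL_form_apply h (0, 0, π))
    exact ContinuousLinearMap.ext_iff.trans (forall_congr' fun π => by rw [h1])

/-- `(z, g) ↦ (x(tf), p)`, as a bounded linear map. -/
noncomputable def finalZ (I : TimeInterval) (nx nu np ng : ℕ) :
    ZSp I nx nu np × G3 I nx nu np ng →L[ℝ] E nx × E np :=
  ((finalL I ⊤ nx nu np).comp (ZSp.yL I nx nu np)).comp (ContinuousLinearMap.fst ℝ _ _)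

namespace OCP

/-- The nonlinear terms of the optimality system. -/
noncomputable def nonlin (hl : Smooth I P.l) (hf : Smooth I P.f)
    (w : ZSp I nx nu np × G3 I nx nu np ng) : NonlinSp I nx nu np :=
  (compOp hf (trajZ I nx nu np ng w), hamOp hl hf w, fderiv ℝ P.φ (finalZ I nx nu np ng w))

theorem contDiff_nonlin (hφ : ContDiff ℝ 2 P.φ) (hl : Smooth I P.l) (hf : Smooth I P.f) :
    ContDiff ℝ 1 (nonlin hl hf) :=
  contDiff_triple (W := ZSp I nx nu np × G3 I nx nu np ng) (A := Lp (E nx) ⊤ I.μ)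
    (H := Lp (YVec nx nu np →L[ℝ] ℝ) ⊤ I.μ) (Q := E nx × E np →L[ℝ] ℝ)
    (B₁ := Lp (YVec nx nu np) ⊤ I.μ × G3 I nx nu np ng) (B₃ := E nx × E np)
    (contDiff_compOp hf) (contDiff_hamOp hl hf) (hφ.fderiv_right (by norm_num)) _ _

theorem fderiv_nonlin (hφ : ContDiff ℝ 2 P.φ) (hl : Smooth I P.l) (hf : Smooth I P.f)
    (z δz : ZSp I nx nu np) (g δg : G3 I nx nu np ng) :
    fderiv ℝ (nonlin hl hf) (z, g) (δz, δg) =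
      (fderiv ℝ (compOp hf) (trajL I ⊤ nx nu np z.y, g) (trajL I ⊤ nx nu np δz.y, δg),
        fderiv ℝ (hamOp hl hf) (z, g) (δz, δg),
        fderiv ℝ (fderiv ℝ P.φ) (final z.y) (final δz.y)) := by
  have h := fderiv_triple (W := ZSp I nx nu np × G3 I nx nu np ng) (A := Lp (E nx) ⊤ I.μ)
    (H := Lp (YVec nx nu np →L[ℝ] ℝ) ⊤ I.μ) (Q := E nx × E np →L[ℝ] ℝ)
    (B₁ := Lp (YVec nx nu np) ⊤ I.μ × G3 I nx nu np ng) (B₃ := E nx × E np)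
    (contDiff_compOp hf) (contDiff_hamOp hl hf) (hφ.fderiv_right (m := 1) (by norm_num))
    (trajZ I nx nu np ng) (finalZ I nx nu np ng) (z, g) (δz, δg)
  have h5 : finalZ I nx nu np ng (z, g) = final z.y := finalL_apply z.y
  have h6 : finalZ I nx nu np ng (δz, δg) = final δz.y := finalL_apply δz.y
  exact h.trans (congrArg (fun b => (_, _, b))
    (congrArg₂ (fun a b => fderiv ℝ (fderiv ℝ P.φ) a b) h5 h6))

/-- The optimality system as a map between Banach spaces. -/
noncomputable def kktOp (hl : Smooth I P.l) (hf : Smooth I P.f)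
    (w : ZSp I nx nu np × G3 I nx nu np ng) : KKTSp I nx nu np :=
  kktLin I nx nu np w.1 + kktMix I nx nu np (nonlin hl hf w) - (0, P.x₀, 0, 0, 0, 0)

/-- The derivative of the optimality system. -/
noncomputable def kktDeriv (hl : Smooth I P.l) (hf : Smooth I P.f)
    (w : ZSp I nx nu np × G3 I nx nu np ng) :
    ZSp I nx nu np × G3 I nx nu np ng →L[ℝ] KKTSp I nx nu np :=
  derivBlock (Z := ZSp I nx nu np) (X := G3 I nx nu np ng) (nonlin hl hf)
    (kktLin I nx nu np) (kktMix I nx nu np) w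

theorem kktDeriv_apply (hl : Smooth I P.l) (hf : Smooth I P.f)
    (w : ZSp I nx nu np × G3 I nx nu np ng) (δz : ZSp I nx nu np) (δg : G3 I nx nu np ng) :
    kktDeriv hl hf w (δz, δg) = kktLin I nx nu np δz +
      kktMix I nx nu np (fderiv ℝ (nonlin hl hf) w (δz, δg)) := rfl

theorem contDiff_kktOp (hφ : ContDiff ℝ 2 P.φ) (hl : Smooth I P.l) (hf : Smooth I P.f) :
    ContDiff ℝ 1 (kktOp hl hf) :=
  contDiff_clm_fst_add_clm_comp_sub (Z := ZSp I nx nu np) (X := G3 I nx nu np ng)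
    (H := NonlinSp I nx nu np) (A := KKTSp I nx nu np) (contDiff_nonlin hφ hl hf)
    (kktLin I nx nu np) (kktMix I nx nu np) _

theorem hasFDerivAt_kktOp (hφ : ContDiff ℝ 2 P.φ) (hl : Smooth I P.l) (hf : Smooth I P.f)
    (w : ZSp I nx nu np × G3 I nx nu np ng) :
    HasFDerivAt (kktOp hl hf) (kktDeriv hl hf w) w :=
  hasFDerivAt_clm_fst_add_clm_comp_sub (Z := ZSp I nx nu np) (X := G3 I nx nu np ng)
    (H := NonlinSp I nx nu np) (A := KKTSp I nx nu np) (contDiff_nonlin hφ hl hf)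
    (kktLin I nx nu np) (kktMix I nx nu np) _ w

end OCP

end KKTEquation

end OCPSens

namespace OCPSens

/-- The norm of `W^{1,p}`, as a shortcut for instance search. -/
noncomputable abbrev W1.instNormed (I : TimeInterval) (p : ℝ≥0∞) [Fact (1 ≤ p)] (n : ℕ) :
    NormedAddCommGroup (W1 I p n) := inferInstance

/-- The normed space `W^{1,p}`, as a shortcut for instance search. -/
noncomputable abbrev W1.instNormedSp (I : TimeInterval) (p : ℝ≥0∞) [Fact (1 ≤ p)] (n : ℕ) :
    NormedSpace ℝ (W1 I p n) := inferInstance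

attribute [local instance] W1.instNormed W1.instNormedSp

/-! ### Optimality and sensitivity systems as operator equations -/

section KKTSystem

variable {I : TimeInterval} {nx nu np ng : ℕ} {P : OCP nx nu np ng}

theorem apply_zero_mk {Z X F : Type*} [NormedAddCommGroup Z] [NormedSpace ℝ Z]
    [NormedAddCommGroup X] [NormedSpace ℝ X] [NormedAddCommGroup F] [NormedSpace ℝ F]
    (T : Z × X →L[ℝ] F) (z : Z) (x : X) : T (0, x) = T (z, x) - T (z, 0) := by
  rw [← map_sub, Prod.mk_sub_mk, sub_self, sub_zero]

namespace OCP

/-- The optimality system is the equation `kktOp = 0`. -/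
theorem kkt_iff_kktOp_eq_zero (hl : Smooth I P.l) (hf : Smooth I P.f) (z : ZSp I nx nu np)
    (g : G3 I nx nu np ng) : P.KKT g z ↔ kktOp hl hf (z, g) = 0 := by
  have hN : nonlin hl hf (z, g) = (compOp hf (trajL I ⊤ nx nu np z.y, g), hamOp hl hf (z, g),
      fderiv ℝ P.φ (final z.y)) := by
    rw [← finalL_apply]
    rfl
  have hH := hamOp_ae hl hf z g
  have hF := compOp_traj_ae hf z.y g
  have h01 : ∀ᵐ t ∂I.μ, (0 : Lp (E nx) ⊤ I.μ) t = 0 := Lp.coeFn_zero _ _ _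
  have h03 : ∀ᵐ t ∂I.μ, (0 : Lp (E nx →L[ℝ] ℝ) ⊤ I.μ) t = 0 := Lp.coeFn_zero _ _ _
  have h05 : ∀ᵐ t ∂I.μ, (0 : Lp (E nu →L[ℝ] ℝ) ⊤ I.μ) t = 0 := Lp.coeFn_zero _ _ _
  have hI : ∀ π : E np, ∫ t, hamOp hl hf (z, g) t (0, 0, π) ∂I.μ =
      ∫ t, (⟪z.lam.val t, totD (P.f t) (g.rep t) (traj z.y t) (0, 0, π)⟫
        + totD (P.l t) (g.rep t) (traj z.y t) (0, 0, π)) ∂I.μ := fun π =>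
    integral_congr_ae (hH.mono fun t ht => ht _)
  rw [kktOp, sub_eq_zero, hN]
  refine Iff.trans ?_ (kktLin_add_kktMix_eq_iff z _ _ _ _).symm
  constructor
  · intro h
    refine ⟨?_, h.init, ?_, fun ξ => ?_, ?_, fun π => ?_⟩
    · filter_upwards [h.state, hF, h01] with t h1 h2 h3
      rw [h1, h2, h3, add_zero]
    · filter_upwards [h.costate, hH, h03] with t h1 h2 h3 ξ
      rw [h1, h2, h3, zero_apply]
      ring
    · rw [h.terminal]
      exact (add_zero _).symm
    · filter_upwards [h.control, hH, h05] with t h1 h2 h3 υ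
      rw [h2, ← h1, h3, zero_apply]
    · rw [hI, ← h.param]
      rfl
  · rintro ⟨h1, h2, h3, h4, h5, h6⟩
    refine ⟨?_, h2, ?_, fun ξ => ?_, ?_, fun π => ?_⟩
    · filter_upwards [h1, hF, h01] with t h1 h2 h3
      rw [h1, h2, h3, add_zero]
    · filter_upwards [h3, hH, h03] with t h1 h2 h3 ξ
      rw [h1, h2, h3, zero_apply]
      ring
    · rw [h4]
      exact add_zero _
    · filter_upwards [h5, hH, h05] with t h1 h2 h3 υ
      rw [← h2, h1, h3, zero_apply]
    · rw [← hI, h6]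
      rfl

end OCP

theorem GSp.rep_zero {Y F : Type} [NormedAddCommGroup Y] [NormedSpace ℝ Y]
    [NormedAddCommGroup F] [NormedSpace ℝ F] {s : ℕ} :
    ∀ᵐ t ∂I.μ, (0 : GSp Y F I s).rep t = 0 := by
  filter_upwards [GSp.rep_smul 0 (0 : GSp Y F I s)] with t ht
  rw [zero_smul] at ht
  funext y
  rw [ht, zero_smul, Pi.zero_apply]

namespace OCP

theorem fderiv_hamOp_left_ae (hl : Smooth I P.l) (hf : Smooth I P.f) (z δz : ZSp I nx nu np)
    (g : G3 I nx nu np ng) : ∀ᵐ t ∂I.μ, ∀ ξ, fderiv ℝ (hamOp hl hf) (z, g) (δz, 0) t ξ =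
      P.Hyy g z t ξ (traj δz.y t) + ⟪δz.lam.val t, P.ABC g z t ξ⟫ := by
  filter_upwards [fderiv_hamOp_ae hl hf z δz g 0,
    GSp.rep_zero (I := I) (Y := YVec nx nu np) (F := E ng) (s := 3)] with t h1 h2 ξ
  have h3 : fderiv ℝ (0 : YVec nx nu np → E ng) (traj z.y t) = 0 := by rw [fderiv_zero]; rfl
  have h4 : ((0 : YVec nx nu np), (0 : E ng)) = 0 := rfl
  rw [h1, h2, h3, Pi.zero_apply, zero_apply, map_zero, Hyg, totDG, h4, map_zero]
  ring

theorem fderiv_compOp_traj_left_ae {F : Type} [NormedAddCommGroup F] [NormedSpace ℝ F]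
    {h : ℝ → YVec nx nu np × E ng → F} (hh : Smooth I h) (y δy : YSp I ⊤ nx nu np)
    (g : G3 I nx nu np ng) : ∀ᵐ t ∂I.μ,
      fderiv ℝ (compOp hh) (trajL I ⊤ nx nu np y, g) (trajL I ⊤ nx nu np δy, 0) t =
        totD (h t) (g.rep t) (traj y t) (traj δy t) := by
  filter_upwards [fderiv_compOp_traj_ae hh y δy g 0,
    GSp.rep_zero (I := I) (Y := YVec nx nu np) (F := E ng) (s := 3)] with t h1 h2
  have h3 : parG (h t) (g.rep t) (traj y t) ((0 : G3 I nx nu np ng).rep t (traj y t)) = 0 :=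
    (congrArg _ (congrFun h2 _)).trans (map_zero _)
  exact h1.trans ((congrArg (_ + ·) h3).trans (add_zero _))

theorem fderiv_compOp_left_ae (hf : Smooth I P.f) (z δz : ZSp I nx nu np)
    (g : G3 I nx nu np ng) : ∀ᵐ t ∂I.μ,
      fderiv ℝ (compOp hf) (trajL I ⊤ nx nu np z.y, g) (trajL I ⊤ nx nu np δz.y, 0) t =
      P.ABC g z t (traj δz.y t) :=
  fderiv_compOp_traj_left_ae hf z.y δz.y g

theorem fderiv_hamOp_right_ae (hl : Smooth I P.l) (hf : Smooth I P.f) (z : ZSp I nx nu np)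
    (g δg : G3 I nx nu np ng) : ∀ᵐ t ∂I.μ, ∀ ξ, fderiv ℝ (hamOp hl hf) (z, g) (0, δg) t ξ =
      P.Hyg g z t ξ (δg.rep t (traj z.y t))
        + P.dRow g z t (fderiv ℝ (δg.rep t) (traj z.y t) ξ) := by
  have h0 := apply_zero_mk (fderiv ℝ (hamOp hl hf) (z, g)) z δg
  filter_upwards [fderiv_hamOp_ae hl hf z z g δg, fderiv_hamOp_left_ae hl hf z z g,
    Lp.coeFn_sub (fderiv ℝ (hamOp hl hf) (z, g) (z, δg))
      (fderiv ℝ (hamOp hl hf) (z, g) (z, 0))] with t h1 h2 h3 ξ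
  rw [h0]
  refine (DFunLike.congr_fun h3 ξ).trans ((congrArg₂ (· - ·) (h1 ξ) (h2 ξ)).trans ?_)
  ring

/-- The linearized optimality system with a general right-hand side, in components. -/
theorem kktDeriv_left_eq_iff (hφ : ContDiff ℝ 2 P.φ) (hl : Smooth I P.l) (hf : Smooth I P.f)
    (z δz : ZSp I nx nu np) (g : G3 I nx nu np ng) (τ : KKTSp I nx nu np) :
    kktDeriv hl hf (z, g) (δz, 0) = τ ↔
      (∀ᵐ t ∂I.μ, δz.y.1.der t = P.ABC g z t (traj δz.y t) + τ.1 t) ∧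
      δz.y.1.val I.t₀ = τ.2.1 ∧
      (∀ᵐ t ∂I.μ, ∀ ξ, ⟪δz.lam.der t, ξ⟫ = -(P.Hyy g z t (ξ, 0, 0) (traj δz.y t) +
        ⟪δz.lam.val t, P.ABC g z t (ξ, 0, 0)⟫) + τ.2.2.1 t ξ) ∧
      (∀ ξ, ⟪δz.lam.val I.tf, ξ⟫ =
        fderiv ℝ (fderiv ℝ P.φ) (final z.y) (final δz.y) (ξ, 0) + τ.2.2.2.1 ξ) ∧
      (∀ᵐ t ∂I.μ, ∀ υ, P.Hyy g z t (0, υ, 0) (traj δz.y t) +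
        ⟪δz.lam.val t, P.ABC g z t (0, υ, 0)⟫ = τ.2.2.2.2.1 t υ) ∧
      ∀ π, fderiv ℝ (fderiv ℝ P.φ) (final z.y) (final δz.y) (0, π) +
        ∫ t, (P.Hyy g z t (0, 0, π) (traj δz.y t) +
          ⟪δz.lam.val t, P.ABC g z t (0, 0, π)⟫) ∂I.μ = τ.2.2.2.2.2 π := by
  have hH := fderiv_hamOp_left_ae hl hf z δz g
  have hF := fderiv_compOp_left_ae hf z δz g
  rw [kktDeriv_apply, fderiv_nonlin hφ, kktLin_add_kktMix_eq_iff]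
  refine and_congr ?_ (and_congr Iff.rfl (and_congr ?_ (and_congr Iff.rfl (and_congr ?_ ?_))))
  · refine eventually_congr (hF.mono fun t ht => ?_)
    rw [ht]
  · refine eventually_congr (hH.mono fun t ht => ?_)
    simp only [ht]
  · refine eventually_congr (hH.mono fun t ht => ?_)
    simp only [ht]
  · refine forall_congr' fun π => ?_
    rw [integral_congr_ae (hH.mono fun t ht => ht _)]

/-- The sensitivity system is the linearization of the optimality system. -/
theorem sensitivity_iff (hφ : ContDiff ℝ 2 P.φ) (hl : Smooth I P.l) (hf : Smooth I P.f)
    (z δz : ZSp I nx nu np) (g δg : G3 I nx nu np ng) :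
    P.Sensitivity g z δg δz ↔ kktDeriv hl hf (z, g) (δz, δg) = 0 := by
  have hz := fderiv_hamOp_left_ae hl hf z δz g
  have hg := fderiv_hamOp_right_ae hl hf z g δg
  have hH : ∀ᵐ t ∂I.μ, ∀ ξ, fderiv ℝ (hamOp hl hf) (z, g) (δz, δg) t ξ =
      (P.Hyy g z t ξ (traj δz.y t) + ⟪δz.lam.val t, P.ABC g z t ξ⟫) +
      (P.Hyg g z t ξ (δg.rep t (traj z.y t))
        + P.dRow g z t (fderiv ℝ (δg.rep t) (traj z.y t) ξ)) := by
    filter_upwards [fderiv_hamOp_ae hl hf z δz g δg] with t ht ξ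
    rw [ht]
    ring
  have hF := fderiv_compOp_traj_ae hf z.y δz.y g δg
  have h01 : ∀ᵐ t ∂I.μ, (0 : Lp (E nx) ⊤ I.μ) t = 0 := Lp.coeFn_zero _ _ _
  have h03 : ∀ᵐ t ∂I.μ, (0 : Lp (E nx →L[ℝ] ℝ) ⊤ I.μ) t = 0 := Lp.coeFn_zero _ _ _
  have h05 : ∀ᵐ t ∂I.μ, (0 : Lp (E nu →L[ℝ] ℝ) ⊤ I.μ) t = 0 := Lp.coeFn_zero _ _ _
  have hint : ∀ (h : Lp (YVec nx nu np →L[ℝ] ℝ) ⊤ I.μ) ξ, Integrable (fun t => h t ξ) I.μ :=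
    fun h ξ => (Lp.integrable h).apply_continuousLinearMap ξ
  have hI : ∀ π : E np, ∫ t, fderiv ℝ (hamOp hl hf) (z, g) (δz, δg) t (0, 0, π) ∂I.μ =
      ∫ t, (P.Hyy g z t (0, 0, π) (traj δz.y t)
        + ⟪δz.lam.val t, P.ABC g z t (0, 0, π)⟫) ∂I.μ +
      ∫ t, (P.Hyg g z t (0, 0, π) (δg.rep t (traj z.y t))
        + P.dRow g z t (fderiv ℝ (δg.rep t) (traj z.y t) (0, 0, π))) ∂I.μ := fun π => by
    rw [integral_congr_ae (hH.mono fun t ht => ht (0, 0, π))]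
    exact integral_add ((hint _ _).congr (hz.mono fun t ht => ht _))
      ((hint _ _).congr (hg.mono fun t ht => ht _))
  have hs : ∀ a, fderiv ℝ (fderiv ℝ P.φ) (final z.y) (final δz.y) a =
      fderiv ℝ (fderiv ℝ P.φ) (final z.y) a (final δz.y) := fun a => fderiv_fderiv_comm hφ _ _ _
  rw [kktDeriv_apply, fderiv_nonlin hφ]
  refine Iff.trans ?_ (kktLin_add_kktMix_eq_iff δz _ _ _ (0, 0, 0, 0, 0, 0)).symm
  simp only [hs, hI]
  constructor
  · intro h
    refine ⟨?_, h.init, ?_, fun ξ => ?_, ?_, fun π => ?_⟩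
    · filter_upwards [h.state, hF, h01] with t h1 h2 h3
      rw [h1, h2, h3, add_zero]
      rfl
    · filter_upwards [h.costate, hH, h03] with t h1 h2 h3 ξ
      rw [h1, h2, h3, zero_apply]
      ring
    · rw [h.terminal]
      exact (add_zero _).symm
    · filter_upwards [h.control, hH, h05] with t h1 h2 h3 υ
      rw [h2, h1, h3, zero_apply]
      ring
    · rw [← add_assoc, h.param]
      exact neg_add_cancel _
  · rintro ⟨h1, h2, h3, h4, h5, h6⟩
    refine ⟨?_, h2, ?_, fun ξ => ?_, ?_, fun π => ?_⟩
    · filter_upwards [h1, hF, h01] with t h1 h2 h3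
      rw [h1, h2, h3, add_zero]
      rfl
    · filter_upwards [h3, hH, h03] with t h1 h2 h3 ξ
      rw [h1, h2, h3, zero_apply]
      ring
    · rw [h4]
      exact add_zero _
    · filter_upwards [h5, hH, h05] with t h1 h2 h3 υ
      have := h1 υ
      rw [h2, h3, zero_apply] at this
      linarith
    · have := h6 π
      rw [← add_assoc] at this
      exact eq_neg_of_add_eq_zero_left this

end OCP

end KKTSystem

/-! ### The Hessian of the Hamiltonian as an essentially bounded function -/

section Hessian

/-- A countable dense set of vectors provides one null set for the operator norm. -/
theorem ae_clm_norm_le_of_forall {α E F : Type*} [MeasurableSpace α] {μ : Measure α}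
    [NormedAddCommGroup E] [NormedSpace ℝ E] [TopologicalSpace.SeparableSpace E]
    [NormedAddCommGroup F] [NormedSpace ℝ F] {T : α → E →L[ℝ] F} {C : ℝ} (hC : 0 ≤ C)
    (h : ∀ v, ∀ᵐ t ∂μ, ‖T t v‖ ≤ C * ‖v‖) : ∀ᵐ t ∂μ, ‖T t‖ ≤ C := by
  have h1 : ∀ᵐ t ∂μ, ∀ n, ‖T t (TopologicalSpace.denseSeq E n)‖ ≤
      C * ‖TopologicalSpace.denseSeq E n‖ := ae_all_iff.2 fun n => h _
  filter_upwards [h1] with t ht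
  refine ContinuousLinearMap.opNorm_le_bound _ hC fun v => ?_
  have h2 : IsClosed {v | ‖T t v‖ ≤ C * ‖v‖} :=
    isClosed_le (T t).continuous.norm (continuous_const.mul continuous_norm)
  have h3 := h2.closure_subset_iff.2 (Set.range_subset_iff.2 ht)
  rw [(TopologicalSpace.denseRange_denseSeq E).closure_range] at h3
  exact h3 (mem_univ v)

/-- If the columns `M(t) b` are given by a bounded linear map `T` into `L^∞`, then
`‖M(t)‖ ≤ ‖T‖` for a.a. `t`. -/
theorem ae_clm_norm_le_of_apply {α E F : Type*} [MeasurableSpace α] {μ : Measure α}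
    [NormedAddCommGroup E] [NormedSpace ℝ E] [TopologicalSpace.SeparableSpace E]
    [NormedAddCommGroup F] [NormedSpace ℝ F] {M : α → E →L[ℝ] F} (T : E →L[ℝ] Lp F ⊤ μ)
    (h : ∀ b, ∀ᵐ t ∂μ, M t b = T b t) : ∀ᵐ t ∂μ, ‖M t‖ ≤ ‖T‖ := by
  refine ae_clm_norm_le_of_forall (norm_nonneg T) fun b => ?_
  filter_upwards [h b, Linf.ae_norm_le (T b)] with t h1 h2
  exact (congrArg norm h1).trans_le (h2.trans (T.le_opNorm b))

theorem ae_clm_norm_sub_le_of_apply {α E F : Type*} [MeasurableSpace α] {μ : Measure α}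
    [NormedAddCommGroup E] [NormedSpace ℝ E] [TopologicalSpace.SeparableSpace E]
    [NormedAddCommGroup F] [NormedSpace ℝ F] {M M' : α → E →L[ℝ] F} {T T' : E →L[ℝ] Lp F ⊤ μ}
    (h : ∀ b, ∀ᵐ t ∂μ, M t b = T b t) (h' : ∀ b, ∀ᵐ t ∂μ, M' t b = T' b t) :
    ∀ᵐ t ∂μ, ‖M t - M' t‖ ≤ ‖T - T'‖ := by
  refine ae_clm_norm_le_of_apply (T - T') fun b => ?_
  filter_upwards [h b, h' b, Lp.coeFn_sub (T b) (T' b)] with t h1 h2 h3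
  exact (congrArg₂ (· - ·) h1 h2).trans h3.symm

/-- The directional derivatives of a map on a product space in the directions `(A b, 0)`. -/
noncomputable def columns {V Z X F : Type*} [NormedAddCommGroup V] [NormedSpace ℝ V]
    [NormedAddCommGroup Z] [NormedSpace ℝ Z] [NormedAddCommGroup X] [NormedSpace ℝ X]
    [NormedAddCommGroup F] [NormedSpace ℝ F] (N : Z × X → F) (A : V →L[ℝ] Z) (w : Z × X) :
    V →L[ℝ] F :=
  (fderiv ℝ N w).comp ((ContinuousLinearMap.inl ℝ Z X).comp A)

theorem continuous_columns {V Z X F : Type*} [NormedAddCommGroup V] [NormedSpace ℝ V]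
    [NormedAddCommGroup Z] [NormedSpace ℝ Z] [NormedAddCommGroup X] [NormedSpace ℝ X]
    [NormedAddCommGroup F] [NormedSpace ℝ F] {N : Z × X → F} (hN : ContDiff ℝ 1 N)
    (A : V →L[ℝ] Z) : Continuous (columns N A) :=
  (hN.continuous_fderiv one_ne_zero).clm_comp continuous_const

variable {I : TimeInterval} {nx nu np ng : ℕ} {P : OCP nx nu np ng}

/-- The constant functions in `W^{1,∞}`. -/
noncomputable def W1.constL (I : TimeInterval) (n : ℕ) : E n →L[ℝ] W1 I ⊤ n :=
  ((ContinuousLinearMap.const ℝ (Icc I.t₀ I.tf)).prod (0 : E n →L[ℝ] Lp (E n) ⊤ I.μ)).codRestrict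
    (sobolev I ⊤ n) fun a => by
      rw [mem_sobolev_iff]
      ext1 t
      simp

/-- Constant triples `(x, u, p)`, with zero costate. -/
noncomputable def constZ (I : TimeInterval) (nx nu np : ℕ) : YVec nx nu np →L[ℝ] ZSp I nx nu np :=
  ((W1.constL I nx).comp (ContinuousLinearMap.fst ℝ _ _)).prod
    (((Lp.constL ⊤ I.μ ℝ).comp
      ((ContinuousLinearMap.fst ℝ _ _).comp (ContinuousLinearMap.snd ℝ _ _))).prod
    (((ContinuousLinearMap.snd ℝ _ _).comp (ContinuousLinearMap.snd ℝ _ _)).prod 0))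

theorem traj_constZ_ae (b : YVec nx nu np) : ∀ᵐ t ∂I.μ, traj (constZ I nx nu np b).y t = b := by
  filter_upwards [Lp.coeFn_const ⊤ I.μ b.2.1] with t ht
  exact Prod.ext rfl (Prod.ext ht rfl)

/-- `totDD` as a bounded bilinear map. -/
noncomputable def totDDL {Y G F : Type} [NormedAddCommGroup Y] [NormedSpace ℝ Y]
    [NormedAddCommGroup G] [NormedSpace ℝ G] [NormedAddCommGroup F] [NormedSpace ℝ F]
    (h : Y × G → F) (g : Y → G) (y : Y) : Y →L[ℝ] Y →L[ℝ] F :=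
  (fderiv ℝ (fderiv ℝ h) (y, g y)).bilinearComp
      ((ContinuousLinearMap.id ℝ Y).prod (fderiv ℝ g y))
      ((ContinuousLinearMap.id ℝ Y).prod (fderiv ℝ g y))
    + (ContinuousLinearMap.compL ℝ Y G F (parG h g y)).comp (fderiv ℝ (fderiv ℝ g) y)

namespace OCP

/-- `Hyy` as a bounded bilinear form. -/
noncomputable def HyyL (P : OCP nx nu np ng) (g : G3 I nx nu np ng) (z : ZSp I nx nu np) (t : ℝ) :
    YVec nx nu np →L[ℝ] YVec nx nu np →L[ℝ] ℝ :=
  totDDL (P.ham (z.lam.val t) t) (g.rep t) (traj z.y t)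

theorem Hyy_comm_ae (hl : Smooth I P.l) (hf : Smooth I P.f) (g : G3 I nx nu np ng)
    (z : ZSp I nx nu np) : ∀ᵐ t ∂I.μ, ∀ a b, P.Hyy g z t a b = P.Hyy g z t b a := by
  filter_upwards [hl.contDiff, hf.contDiff, g.rep_contDiff] with t h1 h2 h3 a b
  have hg2 : ContDiff ℝ 2 (g.rep t) := h3.of_le (by norm_num)
  rw [Hyy, Hyy, totDD_ham h1 h2, totDD_ham h1 h2, totDD_comm h1 hg2, totDD_comm h2 hg2]

/-- The derivatives of `hamOp` in the constant directions. -/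
noncomputable def hessCol (hl : Smooth I P.l) (hf : Smooth I P.f)
    (w : ZSp I nx nu np × G3 I nx nu np ng) :
    YVec nx nu np →L[ℝ] Lp (YVec nx nu np →L[ℝ] ℝ) ⊤ I.μ :=
  columns (hamOp hl hf) (constZ I nx nu np) w

theorem continuous_hessCol (hl : Smooth I P.l) (hf : Smooth I P.f) : Continuous (hessCol hl hf) :=
  continuous_columns (contDiff_hamOp hl hf) (constZ I nx nu np)

/-- The Hessian in a constant direction is a directional derivative of `hamOp`. This transfers
measurability, boundedness and continuity from the derivative of `hamOp` to the Hessian. -/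
theorem HyyL_apply_ae (hl : Smooth I P.l) (hf : Smooth I P.f) (g : G3 I nx nu np ng)
    (z : ZSp I nx nu np) (b : YVec nx nu np) :
    ∀ᵐ t ∂I.μ, P.HyyL g z t b = hessCol hl hf (z, g) b t := by
  filter_upwards [fderiv_hamOp_left_ae hl hf z (constZ I nx nu np b) g, traj_constZ_ae (I := I) b,
    Hyy_comm_ae hl hf g z] with t h1 h2 h3
  refine ContinuousLinearMap.ext fun a => ?_
  have h4 : (constZ I nx nu np b).lam.val t = 0 := by
    simp [constZ, ZSp.lam, W1.val, IccExtend]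
  have h5 := h1 a
  rw [h2, h4, inner_zero_left, add_zero] at h5
  exact (h3 b a).trans h5.symm

theorem aestronglyMeasurable_HyyL (hl : Smooth I P.l) (hf : Smooth I P.f) (g : G3 I nx nu np ng)
    (z : ZSp I nx nu np) : AEStronglyMeasurable (P.HyyL g z) I.μ :=
  aestronglyMeasurable_clm_of_apply fun b =>
    (Lp.aestronglyMeasurable (hessCol hl hf (z, g) b)).congr
      ((HyyL_apply_ae hl hf g z b).mono fun _ h => h.symm)

/-- `Hyy` as an essentially bounded function. -/
noncomputable def hessOp (hl : Smooth I P.l) (hf : Smooth I P.f)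
    (w : ZSp I nx nu np × G3 I nx nu np ng) :
    Lp (YVec nx nu np →L[ℝ] YVec nx nu np →L[ℝ] ℝ) ⊤ I.μ :=
  MemLp.toLp (P.HyyL w.2 w.1) (memLp_top_of_bound (aestronglyMeasurable_HyyL hl hf w.2 w.1)
    ‖hessCol hl hf w‖ (ae_clm_norm_le_of_apply _ (HyyL_apply_ae hl hf w.2 w.1)))

theorem hessOp_ae (hl : Smooth I P.l) (hf : Smooth I P.f)
    (w : ZSp I nx nu np × G3 I nx nu np ng) : hessOp hl hf w =ᵐ[I.μ] P.HyyL w.2 w.1 :=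
  MemLp.coeFn_toLp _

theorem norm_hessOp_sub_le (hl : Smooth I P.l) (hf : Smooth I P.f)
    (w w' : ZSp I nx nu np × G3 I nx nu np ng) :
    ‖hessOp hl hf w - hessOp hl hf w'‖ ≤ ‖hessCol hl hf w - hessCol hl hf w'‖ := by
  refine Linf.norm_le (ContinuousLinearMap.opNorm_nonneg _) ?_
  filter_upwards [Lp.coeFn_sub (hessOp hl hf w) (hessOp hl hf w'), hessOp_ae hl hf w,
    hessOp_ae hl hf w', ae_clm_norm_sub_le_of_apply (HyyL_apply_ae hl hf w.2 w.1)
      (HyyL_apply_ae hl hf w'.2 w'.1)] with t e1 e2 e3 e4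
  exact (congrArg norm (e1.trans (congrArg₂ (· - ·) e2 e3))).trans_le e4

end OCP

end Hessian

end OCPSens

/-! ### The adjoint differential equation -/

namespace OCPSens

attribute [local instance] W1.instNormed W1.instNormedSp

section Backward

variable {I : TimeInterval} {n : ℕ} {p : ℝ≥0∞} [Fact (1 ≤ p)]

/-- The vector that represents a linear form. -/
noncomputable def rieszInv (n : ℕ) : (E n →L[ℝ] ℝ) →L[ℝ] E n :=
  LinearMap.toContinuousLinearMap
    { toFun := fun q => (InnerProductSpace.toDual ℝ (E n)).symm q
      map_add' := fun q q' => map_add _ q q'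
      map_smul' := fun c q => by simp }

theorem inner_rieszInv (q : E n →L[ℝ] ℝ) (v : E n) : ⟪rieszInv n q, v⟫ = q v :=
  InnerProductSpace.toDual_symm_apply

/-- Transposition of linear maps, as a bounded linear map. -/
noncomputable def transposeL (n : ℕ) : (E n →L[ℝ] E n) →L[ℝ] E n →L[ℝ] E n :=
  (ContinuousLinearMap.compL ℝ (E n) (E n →L[ℝ] ℝ) (E n) (rieszInv n)).comp
    (((ContinuousLinearMap.compL ℝ (E n) (E n →L[ℝ] ℝ) (E n →L[ℝ] ℝ)).flip (rieszL n)).comp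
      (ContinuousLinearMap.compL ℝ (E n) (E n) ℝ).flip)

theorem inner_transposeL (A : E n →L[ℝ] E n) (v w : E n) : ⟪transposeL n A v, w⟫ = ⟪v, A w⟫ :=
  inner_rieszInv ((rieszL n v).comp A) w

/-- The coefficient `-Aᵀ` of the adjoint equation. -/
noncomputable def negTranspose (A : Lp (E n →L[ℝ] E n) ⊤ I.μ) : Lp (E n →L[ℝ] E n) ⊤ I.μ :=
  (-transposeL n).compLpL ⊤ I.μ A

theorem inner_negTranspose_ae (A : Lp (E n →L[ℝ] E n) ⊤ I.μ) :
    ∀ᵐ t ∂I.μ, ∀ v w, ⟪negTranspose A t v, w⟫ = -⟪v, A t w⟫ := by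
  filter_upwards [compLpL_ae (-transposeL n) A] with t ht v w
  rw [negTranspose, ht, ← inner_transposeL, ← inner_neg_left]
  rfl

/-- A solution of the adjoint equation that vanishes at `tf` vanishes at `t₀`. -/
theorem terminal_eq_zero (A : Lp (E n →L[ℝ] E n) ⊤ I.μ) {lam : W1 I p n}
    (h : ∀ᵐ t ∂I.μ, lam.der t = negTranspose A t (lam.val t)) (hf : lam.val I.tf = 0) :
    lam.val I.t₀ = 0 := by
  -- the product with the solution of `x' = A x`, `x(t₀) = λ(t₀)`, is constant
  set x : W1 I ⊤ n := odeSol A (lam.val I.t₀) 0 with hx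
  have h1 := W1.integral_inner lam x
  have h2 : ∫ t, (⟪lam.der t, x.val t⟫ + ⟪lam.val t, x.der t⟫) ∂I.μ = 0 := by
    refine integral_eq_zero_of_ae ?_
    filter_upwards [h, odeSol_der A (lam.val I.t₀) (0 : Lp (E n) ⊤ I.μ), inner_negTranspose_ae A,
      Lp.coeFn_zero (E n) ⊤ I.μ] with t h3 h4 h5 h6
    rw [h3, h5, hx, h4, h6, Pi.zero_apply, add_zero, neg_add_cancel, Pi.zero_apply]
  rw [h2, hf, inner_zero_left, zero_sub, hx, odeSol_init, eq_comm, neg_eq_zero] at h1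
  exact inner_self_eq_zero.1 h1

/-- Uniqueness for the adjoint equation with a terminal condition. -/
theorem eq_zero_of_adjoint (A : Lp (E n →L[ℝ] E n) ⊤ I.μ) {lam : W1 I p n}
    (h : ∀ᵐ t ∂I.μ, lam.der t = negTranspose A t (lam.val t)) (hf : lam.val I.tf = 0) :
    lam = 0 := by
  have h0 := terminal_eq_zero A h hf
  have h1 : ∀ᵐ t ∂I.μ, lam.der t = negTranspose A t (lam.val t) + (0 : Lp (E n) p I.μ) t := by
    filter_upwards [h, Lp.coeFn_zero (E n) p I.μ] with t h2 h3
    rw [h2, h3, Pi.zero_apply, add_zero]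
  have h2 : ∀ᵐ t ∂I.μ, (0 : W1 I p n).der t =
      negTranspose A t ((0 : W1 I p n).val t) + (0 : Lp (E n) p I.μ) t := by
    have h5 : (0 : W1 I p n).val = 0 := by
      funext t
      rfl
    filter_upwards [Lp.coeFn_zero (E n) p I.μ] with t h3
    have h4 : (0 : W1 I p n).der t = (0 : Lp (E n) p I.μ) t := rfl
    rw [h4, h3, h5, Pi.zero_apply, map_zero, add_zero]
  rw [eq_odeSol h1, eq_odeSol h2, h0]
  rfl

/-- Solvability of the adjoint equation with a terminal condition: the map from the initial to the
terminal value is injective, hence surjective. -/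
theorem exists_adjoint (A : Lp (E n →L[ℝ] E n) ⊤ I.μ) (r : Lp (E n →L[ℝ] ℝ) p I.μ)
    (b : E n →L[ℝ] ℝ) : ∃ lam : W1 I p n,
      (∀ᵐ t ∂I.μ, ∀ ξ, ⟪lam.der t, ξ⟫ = -⟪lam.val t, A t ξ⟫ + r t ξ) ∧
      ∀ ξ, ⟪lam.val I.tf, ξ⟫ = b ξ := by
  set A' := negTranspose A with hA'
  set R : Lp (E n) p I.μ := (rieszInv n).compLpL p I.μ r with hR
  let Φ : E n →ₗ[ℝ] E n :=
    ((ContinuousMap.evalCLM ℝ (⟨I.tf, I.right_mem⟩ : Icc I.t₀ I.tf)).comp ((resolvent A').comp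
      (ContinuousLinearMap.const ℝ (Icc I.t₀ I.tf)))).toLinearMap
  have hΦ : ∀ c (r : Lp (E n) p I.μ), (odeSol A' c r).val I.tf =
      Φ c + (odeSol A' 0 r).val I.tf := fun c r => by
    have h0 : ContinuousMap.const (Icc I.t₀ I.tf) (0 : E n) = 0 := rfl
    rw [W1.val_of_mem _ I.right_mem, W1.val_of_mem _ I.right_mem, valL_odeSol, valL_odeSol, map_add,
      h0, zero_add]
    rfl
  have hΦ0 : ∀ c, (odeSol A' c (0 : Lp (E n) p I.μ)).val I.tf = Φ c := fun c => by
    have h0 : ContinuousMap.const (Icc I.t₀ I.tf) (0 : E n) = 0 := rfl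
    rw [hΦ, W1.val_of_mem (odeSol A' 0 _) I.right_mem, valL_odeSol, h0, map_zero, map_zero,
      zero_add, map_zero]
    exact add_zero _
  have hinj : Function.Injective Φ := by
    refine (injective_iff_map_eq_zero Φ).2 fun c hc => ?_
    have h1 := terminal_eq_zero A (lam := odeSol A' c (0 : Lp (E n) p I.μ)) (by
      filter_upwards [odeSol_der A' c (0 : Lp (E n) p I.μ), Lp.coeFn_zero (E n) p I.μ] with t h2 h3
      rw [h2, h3, Pi.zero_apply, add_zero]) ((hΦ0 c).trans hc)
    rwa [odeSol_init] at h1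
  obtain ⟨c, hc⟩ := LinearMap.injective_iff_surjective.1 hinj
    (rieszInv n b - (odeSol A' 0 R).val I.tf)
  refine ⟨odeSol A' c R, ?_, fun ξ => ?_⟩
  · filter_upwards [odeSol_der A' c R, inner_negTranspose_ae A, compLpL_ae (rieszInv n) r]
      with t h1 h2 h3 ξ
    rw [h1, inner_add_left, h2, hR, h3, inner_rieszInv]
  · rw [hΦ, hc, sub_add_cancel, inner_rieszInv]

/-- The inclusion `W^{1,∞} ⊆ W^{1,p}`. -/
noncomputable def W1.incl (p : ℝ≥0∞) [Fact (1 ≤ p)] (x : W1 I ⊤ n) : W1 I p n :=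
  ⟨(W1.valL I ⊤ n x, Lp.incl le_top (W1.derL I ⊤ n x)), by
    rw [mem_sobolev_iff]
    have h := W1.valL_eq x
    rw [W1.val_of_mem x I.left_mem] at h
    rw [Lp.incl_incl]
    exact h⟩

theorem W1.incl_der (x : W1 I ⊤ n) : (W1.incl p x).der =ᵐ[I.μ] x.der := Lp.incl_ae le_top _

/-- A Sobolev function with an essentially bounded derivative belongs to `W^{1,∞}`. -/
theorem W1.exists_top_of_bound (x : W1 I p n) {C : ℝ} (h : ∀ᵐ t ∂I.μ, ‖x.der t‖ ≤ C) :
    ∃ x' : W1 I ⊤ n, x'.val = x.val ∧ x'.der =ᵐ[I.μ] x.der := by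
  have hm : MemLp x.der ⊤ I.μ := memLp_top_of_bound (Lp.aestronglyMeasurable _) C h
  refine ⟨⟨(W1.valL I p n x, hm.toLp), ?_⟩, rfl, hm.coeFn_toLp⟩
  rw [mem_sobolev_iff]
  have h := W1.valL_eq x
  rw [W1.val_of_mem x I.left_mem] at h
  have h2 : Lp.incl (Fact.out : (1 : ℝ≥0∞) ≤ ⊤) hm.toLp =
      Lp.incl (Fact.out : 1 ≤ p) (W1.derL I p n x) :=
    Lp.ext (((Lp.incl_ae _ _).trans hm.coeFn_toLp).trans (Lp.incl_ae _ _).symm)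
  rw [h2]
  exact h

theorem W1.exists_norm_val_le (x : W1 I p n) : ∃ C, 0 ≤ C ∧ ∀ t, ‖x.val t‖ ≤ C :=
  ⟨‖W1.valL I p n x‖, norm_nonneg _, fun _ => (W1.valL I p n x).norm_coe_le_norm _⟩

end Backward

end OCPSens

/-! ### Linear-quadratic optimality systems -/

namespace OCPSens

attribute [local instance] W1.instNormed W1.instNormedSp

section LinearQuadratic

variable {I : TimeInterval} {nx nu np : ℕ}

/-- Restriction of linear maps on triples `(x, u, p)` along a linear map. -/
noncomputable def restrictMap {V W : Type*} [NormedAddCommGroup V] [NormedSpace ℝ V]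
    [NormedAddCommGroup W] [NormedSpace ℝ W] (n : ℕ) (L : V →L[ℝ] W) :
    (W →L[ℝ] E n) →L[ℝ] V →L[ℝ] E n :=
  (ContinuousLinearMap.compL ℝ V W (E n)).flip L

/-- The coefficient `A` of `(A B C)`. -/
noncomputable def stateCoeff (K : Lp (YVec nx nu np →L[ℝ] E nx) ⊤ I.μ) :
    Lp (E nx →L[ℝ] E nx) ⊤ I.μ :=
  (restrictMap nx (inX nx nu np)).compLpL ⊤ I.μ K

theorem stateCoeff_ae (K : Lp (YVec nx nu np →L[ℝ] E nx) ⊤ I.μ) :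
    ∀ᵐ t ∂I.μ, ∀ ξ, stateCoeff K t ξ = K t (ξ, 0, 0) := by
  filter_upwards [compLpL_ae (restrictMap nx (inX nx nu np)) K] with t ht ξ
  rw [stateCoeff, ht]
  rfl

theorem add_apply_ae {V W : Type*} [NormedAddCommGroup V] [NormedSpace ℝ V]
    [NormedAddCommGroup W] [NormedSpace ℝ W] {p : ℝ≥0∞} (f g : Lp (V →L[ℝ] W) p I.μ) :
    ∀ᵐ t ∂I.μ, ∀ ξ, (f + g) t ξ = f t ξ + g t ξ := by
  filter_upwards [Lp.coeFn_add f g] with t h ξ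
  exact DFunLike.congr_fun h ξ

theorem sub_apply_ae {V W : Type*} [NormedAddCommGroup V] [NormedSpace ℝ V]
    [NormedAddCommGroup W] [NormedSpace ℝ W] {p : ℝ≥0∞} (f g : Lp (V →L[ℝ] W) p I.μ) :
    ∀ᵐ t ∂I.μ, ∀ ξ, (f - g) t ξ = f t ξ - g t ξ := by
  filter_upwards [Lp.coeFn_sub f g] with t h ξ
  exact DFunLike.congr_fun h ξ

theorem map_triple {W : Type*} [NormedAddCommGroup W] [NormedSpace ℝ W]
    (L : YVec nx nu np →L[ℝ] W) (a : E nx) (b : E nu) (c : E np) :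
    L (a, b, c) = L (a, 0, 0) + L (0, b, c) := by
  rw [← map_add]
  simp

theorem map_triple_zero {W : Type*} [NormedAddCommGroup W] [NormedSpace ℝ W]
    (L : YVec nx nu np →L[ℝ] W) (b : E nu) (c : E np) :
    L (0, b, c) = L (0, b, 0) + L (0, 0, c) := by
  rw [← map_add]
  simp

/-- `t ↦ ⟪λ(t), K(t) ·⟫`. -/
noncomputable def costateForm {p : ℝ≥0∞} [Fact (1 ≤ p)]
    (K : Lp (YVec nx nu np →L[ℝ] E nx) ⊤ I.μ) (lam : W1 I p nx) :
    Lp (YVec nx nu np →L[ℝ] ℝ) ⊤ I.μ :=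
  (ContinuousLinearMap.compL ℝ (YVec nx nu np) (E nx) ℝ).holderL I.μ ⊤ ⊤ ⊤
    ((rieszL nx).compLpL ⊤ I.μ (contL I nx (W1.valL I p nx lam))) K

theorem costateForm_ae {p : ℝ≥0∞} [Fact (1 ≤ p)] (K : Lp (YVec nx nu np →L[ℝ] E nx) ⊤ I.μ)
    (lam : W1 I p nx) : ∀ᵐ t ∂I.μ, ∀ ξ, costateForm K lam t ξ = ⟪lam.val t, K t ξ⟫ := by
  filter_upwards [holderL_ae (ContinuousLinearMap.compL ℝ (YVec nx nu np) (E nx) ℝ) (r := ⊤)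
    ((rieszL nx).compLpL ⊤ I.μ (contL I nx (W1.valL I p nx lam))) K,
    compLpL_ae (rieszL nx) (contL I nx (W1.valL I p nx lam)), W1.contL_valL_ae lam]
    with t h1 h2 h3 ξ
  exact (DFunLike.congr_fun h1 ξ).trans
    (congrArg (fun l : E nx →L[ℝ] ℝ => l (K t ξ)) (h2.trans (congrArg (rieszL nx) h3)))

/-- Duality between the linearized state equation and the costate equation. -/
theorem inner_terminal_eq {p q r : ℝ≥0∞} [Fact (1 ≤ p)] [Fact (1 ≤ q)]
    {K : Lp (YVec nx nu np →L[ℝ] E nx) ⊤ I.μ} {h : Lp (YVec nx nu np →L[ℝ] ℝ) r I.μ}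
    {lam : W1 I p nx} {x : W1 I q nx} {η : ℝ → YVec nx nu np}
    (hlam : ∀ᵐ t ∂I.μ, ∀ ξ, ⟪lam.der t, ξ⟫ = -(h t (ξ, 0, 0) + ⟪lam.val t, K t (ξ, 0, 0)⟫))
    (hx : ∀ᵐ t ∂I.μ, x.der t = K t (x.val t, 0, 0) + K t (η t)) (hx0 : x.val I.t₀ = 0) :
    ⟪lam.val I.tf, x.val I.tf⟫ =
      ∫ t, (⟪lam.val t, K t (η t)⟫ - h t (x.val t, 0, 0)) ∂I.μ := by
  have h1 := W1.integral_inner lam x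
  rw [hx0, inner_zero_right, sub_zero] at h1
  rw [← h1]
  refine integral_congr_ae ?_
  filter_upwards [hlam, hx] with t h2 h3
  rw [h2, h3, inner_add_right]
  ring

/-- The Hilbert space of controls and parameters; `WithLp 2` gives the product its Euclidean
norm. -/
abbrev CtrlSp (I : TimeInterval) (nu np : ℕ) : Type := WithLp 2 (Lp (E nu) 2 I.μ × E np)

/-- The control component. -/
noncomputable def ctrlU (I : TimeInterval) (nu np : ℕ) : CtrlSp I nu np →L[ℝ] Lp (E nu) 2 I.μ :=
  (ContinuousLinearMap.fst ℝ _ _).comp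
    (WithLp.prodContinuousLinearEquiv 2 ℝ (Lp (E nu) 2 I.μ) (E np)).toContinuousLinearMap

/-- The parameter component. -/
noncomputable def ctrlP (I : TimeInterval) (nu np : ℕ) : CtrlSp I nu np →L[ℝ] E np :=
  (ContinuousLinearMap.snd ℝ _ _).comp
    (WithLp.prodContinuousLinearEquiv 2 ℝ (Lp (E nu) 2 I.μ) (E np)).toContinuousLinearMap

/-- `(u, p) ↦ (0, u(·), p)`. -/
noncomputable def ctrlTraj (I : TimeInterval) (nx nu np : ℕ) :
    CtrlSp I nu np →L[ℝ] Lp (YVec nx nu np) 2 I.μ :=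
  ((inU nx nu np).compLpL 2 I.μ).comp (ctrlU I nu np) +
    ((inP nx nu np).compLpL 2 I.μ).comp ((Lp.constL 2 I.μ ℝ).comp (ctrlP I nu np))

theorem ctrlTraj_ae (w : CtrlSp I nu np) :
    ∀ᵐ t ∂I.μ, ctrlTraj I nx nu np w t = (0, ctrlU I nu np w t, ctrlP I nu np w) := by
  filter_upwards [Lp.coeFn_add ((inU nx nu np).compLpL 2 I.μ (ctrlU I nu np w))
      ((inP nx nu np).compLpL 2 I.μ (Lp.const 2 I.μ (ctrlP I nu np w))),
    compLpL_ae (inU nx nu np) (ctrlU I nu np w),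
    compLpL_ae (inP nx nu np) (Lp.const 2 I.μ (ctrlP I nu np w)),
    Lp.coeFn_const 2 I.μ (ctrlP I nu np w)] with t h1 h2 h3 h4
  have h5 : ctrlTraj I nx nu np w = (inU nx nu np).compLpL 2 I.μ (ctrlU I nu np w) +
    (inP nx nu np).compLpL 2 I.μ (Lp.const 2 I.μ (ctrlP I nu np w)) := rfl
  rw [h5, h1, Pi.add_apply, h2, h3, h4, inU_apply, inP_apply]
  simp

/-- The inhomogeneity `B u + C p` of the linearized state equation. -/
noncomputable def ctrlRhs (K : Lp (YVec nx nu np →L[ℝ] E nx) ⊤ I.μ) :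
    CtrlSp I nu np →L[ℝ] Lp (E nx) 2 I.μ :=
  ((ContinuousLinearMap.id ℝ (YVec nx nu np →L[ℝ] E nx)).holderL I.μ ⊤ 2 2 K).comp
    (ctrlTraj I nx nu np)

theorem ctrlRhs_ae (K : Lp (YVec nx nu np →L[ℝ] E nx) ⊤ I.μ) (w : CtrlSp I nu np) :
    ∀ᵐ t ∂I.μ, ctrlRhs K w t = K t (0, ctrlU I nu np w t, ctrlP I nu np w) := by
  filter_upwards [holderL_ae (ContinuousLinearMap.id ℝ (YVec nx nu np →L[ℝ] E nx)) (r := 2) K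
    (ctrlTraj I nx nu np w), ctrlTraj_ae (nx := nx) w] with t h1 h2
  rw [← h2]
  exact h1

/-- The solution of the linearized state equation with zero initial value. -/
noncomputable def linState (K : Lp (YVec nx nu np →L[ℝ] E nx) ⊤ I.μ) (w : CtrlSp I nu np) :
    W1 I 2 nx := odeSol (stateCoeff K) 0 (ctrlRhs K w)

theorem linState_der (K : Lp (YVec nx nu np →L[ℝ] E nx) ⊤ I.μ) (w : CtrlSp I nu np) :
    ∀ᵐ t ∂I.μ, (linState K w).der t = K t ((linState K w).val t, 0, 0) +
      K t (0, ctrlU I nu np w t, ctrlP I nu np w) := by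
  filter_upwards [odeSol_der (stateCoeff K) 0 (ctrlRhs K w), stateCoeff_ae K, ctrlRhs_ae K w]
    with t h1 h2 h3
  rw [linState, h1, h2, h3]

/-- The values of the solution of the linearized state equation. -/
noncomputable def linStateL (K : Lp (YVec nx nu np →L[ℝ] E nx) ⊤ I.μ) :
    CtrlSp I nu np →L[ℝ] C(Icc I.t₀ I.tf, E nx) :=
  (resolvent (stateCoeff K)).comp ((prim I nx).comp
    ((Lp.incl one_le_two).comp (ctrlRhs K)))

theorem valL_linState (K : Lp (YVec nx nu np →L[ℝ] E nx) ⊤ I.μ) (w : CtrlSp I nu np) :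
    W1.valL I 2 nx (linState K w) = linStateL K w := by
  have h0 : ContinuousMap.const (Icc I.t₀ I.tf) (0 : E nx) = 0 := rfl
  rw [linState, valL_odeSol, h0, zero_add]
  rfl

/-- The triple formed by the solution of the linearized state equation, the control and the
parameter. -/
noncomputable def linY (K : Lp (YVec nx nu np →L[ℝ] E nx) ⊤ I.μ) (w : CtrlSp I nu np) :
    YSp I 2 nx nu np := (linState K w, ctrlU I nu np w, ctrlP I nu np w)

theorem linY_der (K : Lp (YVec nx nu np →L[ℝ] E nx) ⊤ I.μ) (w : CtrlSp I nu np) :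
    ∀ᵐ t ∂I.μ, (linY K w).1.der t = K t (traj (linY K w) t) := by
  filter_upwards [linState_der K w] with t h1
  exact h1.trans (map_triple (K t) _ _ _).symm

/-- The trajectory of `linY`, as a bounded linear map. -/
noncomputable def linTraj (K : Lp (YVec nx nu np →L[ℝ] E nx) ⊤ I.μ) :
    CtrlSp I nu np →L[ℝ] Lp (YVec nx nu np) 2 I.μ :=
  ((inX nx nu np).compLpL 2 I.μ).comp ((Lp.incl le_top).comp ((contL I nx).comp (linStateL K))) +
    ctrlTraj I nx nu np

theorem linTraj_ae (K : Lp (YVec nx nu np →L[ℝ] E nx) ⊤ I.μ) (w : CtrlSp I nu np) :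
    ∀ᵐ t ∂I.μ, linTraj K w t = traj (linY K w) t := by
  filter_upwards [Lp.coeFn_add ((inX nx nu np).compLpL 2 I.μ (Lp.incl (le_top : (2 : ℝ≥0∞) ≤ ⊤)
      (contL I nx (W1.valL I 2 nx (linState K w))))) (ctrlTraj I nx nu np w),
    compLpL_ae (inX nx nu np) (Lp.incl (le_top : (2 : ℝ≥0∞) ≤ ⊤)
      (contL I nx (W1.valL I 2 nx (linState K w)))),
    Lp.incl_ae (le_top : (2 : ℝ≥0∞) ≤ ⊤) (contL I nx (W1.valL I 2 nx (linState K w))),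
    W1.contL_valL_ae (linState K w), ctrlTraj_ae (nx := nx) w] with t h1 h2 h3 h4 h5
  have h6 : linTraj K w = (inX nx nu np).compLpL 2 I.μ (Lp.incl (le_top : (2 : ℝ≥0∞) ≤ ⊤)
      (contL I nx (linStateL K w))) + ctrlTraj I nx nu np w := rfl
  rw [h6, ← valL_linState, h1, Pi.add_apply, h2, h3, h4, h5, inX_apply]
  simp [traj, linY]

/-- The final values of `linY`, as a bounded linear map. -/
noncomputable def linFinal (K : Lp (YVec nx nu np →L[ℝ] E nx) ⊤ I.μ) :
    CtrlSp I nu np →L[ℝ] E nx × E np :=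
  ((ContinuousMap.evalCLM ℝ (⟨I.tf, I.right_mem⟩ : Icc I.t₀ I.tf)).comp (linStateL K)).prod
    (ctrlP I nu np)

theorem linFinal_apply (K : Lp (YVec nx nu np →L[ℝ] E nx) ⊤ I.μ) (w : CtrlSp I nu np) :
    linFinal K w = final (linY K w) := by
  refine Prod.ext ?_ rfl
  change linStateL K w ⟨I.tf, I.right_mem⟩ = (linState K w).val I.tf
  rw [W1.val_of_mem _ I.right_mem, valL_linState]

/-- The pairing of square integrable functions with square integrable linear forms. -/
noncomputable def pairL (I : TimeInterval) (V : Type) [NormedAddCommGroup V] [NormedSpace ℝ V] :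
    Lp (V →L[ℝ] ℝ) 2 I.μ →L[ℝ] Lp V 2 I.μ →L[ℝ] ℝ :=
  (ContinuousLinearMap.compL ℝ (Lp V 2 I.μ) (Lp ℝ 1 I.μ) ℝ L1.integralCLM).comp
    ((ContinuousLinearMap.id ℝ (V →L[ℝ] ℝ)).holderL I.μ 2 2 1)

theorem pairL_ae {V : Type} [NormedAddCommGroup V] [NormedSpace ℝ V]
    (h : Lp (V →L[ℝ] ℝ) 2 I.μ) (f : Lp V 2 I.μ) :
    (ContinuousLinearMap.id ℝ (V →L[ℝ] ℝ)).holderL I.μ 2 2 1 h f =ᵐ[I.μ] fun t => h t (f t) :=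
  holderL_ae (ContinuousLinearMap.id ℝ (V →L[ℝ] ℝ)) (r := 1) h f

theorem pairL_apply {V : Type} [NormedAddCommGroup V] [NormedSpace ℝ V]
    (h : Lp (V →L[ℝ] ℝ) 2 I.μ) (f : Lp V 2 I.μ) : pairL I V h f = ∫ t, h t (f t) ∂I.μ := by
  rw [← integral_congr_ae (pairL_ae h f), ← L1.integral_eq_integral, L1.integral_eq]
  rfl

theorem integrable_pair {V : Type} [NormedAddCommGroup V] [NormedSpace ℝ V]
    (h : Lp (V →L[ℝ] ℝ) 2 I.μ) (f : Lp V 2 I.μ) : Integrable (fun t => h t (f t)) I.μ :=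
  (Lp.integrable _).congr (pairL_ae h f)

set_option maxHeartbeats 1000000 in
/-- Existence of a costate (multiplier rule): a linear functional on trajectories that vanishes on
all solutions of the linearized state equation is represented by a solution of the adjoint
equation. -/
theorem exists_costate (K : Lp (YVec nx nu np →L[ℝ] E nx) ⊤ I.μ)
    (h : Lp (YVec nx nu np →L[ℝ] ℝ) 2 I.μ) (q : E nx × E np →L[ℝ] ℝ)
    (hs : ∀ w : CtrlSp I nu np, pairL I _ h (linTraj K w) + q (linFinal K w) = 0) :
    ∃ lam : W1 I 2 nx,
      (∀ᵐ t ∂I.μ, ∀ ξ, ⟪lam.der t, ξ⟫ = -(h t (ξ, 0, 0) + ⟪lam.val t, K t (ξ, 0, 0)⟫)) ∧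
      (∀ ξ, ⟪lam.val I.tf, ξ⟫ = q (ξ, 0)) ∧
      (∀ᵐ t ∂I.μ, ∀ υ, h t (0, υ, 0) + ⟪lam.val t, K t (0, υ, 0)⟫ = 0) ∧
      ∀ π, q (0, π) + ∫ t, (h t (0, 0, π) + ⟪lam.val t, K t (0, 0, π)⟫) ∂I.μ = 0 := by
  obtain ⟨lam, h1, h2⟩ := exists_adjoint (stateCoeff K)
    (-(restrictForm (inX nx nu np)).compLpL 2 I.μ h)
    (restrictForm (ContinuousLinearMap.inl ℝ (E nx) (E np)) q)
  have h3 : ∀ᵐ t ∂I.μ, ∀ ξ,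
      ⟪lam.der t, ξ⟫ = -(h t (ξ, 0, 0) + ⟪lam.val t, K t (ξ, 0, 0)⟫) := by
    filter_upwards [h1, stateCoeff_ae K, compLpL_ae (restrictForm (inX nx nu np)) h,
      Lp.coeFn_neg ((restrictForm (inX nx nu np)).compLpL 2 I.μ h)] with t h4 h5 h6 h7 ξ
    have h8 : (-(restrictForm (inX nx nu np)).compLpL 2 I.μ h) t ξ = -h t (ξ, 0, 0) :=
      (DFunLike.congr_fun h7 ξ).trans (congrArg Neg.neg (DFunLike.congr_fun h6 ξ))
    exact (h4 ξ).trans ((congrArg₂ (fun a b => -⟪lam.val t, a⟫ + b) (h5 ξ) h8).trans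
      (neg_add_rev _ _).symm)
  have h4 : ∀ ξ, ⟪lam.val I.tf, ξ⟫ = q (ξ, 0) := h2
  -- the residual of the stationarity conditions, as a linear form on `(x, u, p)`
  set s : Lp (YVec nx nu np →L[ℝ] ℝ) 2 I.μ := h + Lp.incl le_top (costateForm K lam) with hs'
  have hsae : ∀ᵐ t ∂I.μ, ∀ ξ, s t ξ = h t ξ + ⟪lam.val t, K t ξ⟫ := by
    filter_upwards [add_apply_ae h (Lp.incl (le_top : (2 : ℝ≥0∞) ≤ ⊤) (costateForm K lam)),
      Lp.incl_ae (le_top : (2 : ℝ≥0∞) ≤ ⊤) (costateForm K lam), costateForm_ae K lam]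
      with t h5 h6 h7 ξ
    exact (h5 ξ).trans (congrArg (h t ξ + ·) ((DFunLike.congr_fun h6 ξ).trans (h7 ξ)))
  clear_value s
  have key : ∀ w : CtrlSp I nu np, pairL I _ s (ctrlTraj I nx nu np w) +
      q (0, ctrlP I nu np w) = 0 := by
    intro w
    have h5 := inner_terminal_eq h3 (linState_der K w) (odeSol_init _ _ _)
    have h6 := hs w
    have h7 : q (linFinal K w) = ⟪lam.val I.tf, (linState K w).val I.tf⟫ +
        q (0, ctrlP I nu np w) := by
      rw [h4, ← map_add, linFinal_apply, Prod.mk_add_mk, add_zero, zero_add]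
      rfl
    have h8 : pairL I _ s (ctrlTraj I nx nu np w) - pairL I _ h (linTraj K w) =
        ∫ t, (⟪lam.val t, K t (0, ctrlU I nu np w t, ctrlP I nu np w)⟫ -
          h t ((linState K w).val t, 0, 0)) ∂I.μ := by
      rw [pairL_apply, pairL_apply, ← integral_sub (integrable_pair _ _) (integrable_pair _ _)]
      refine integral_congr_ae ?_
      filter_upwards [hsae, ctrlTraj_ae (nx := nx) w, linTraj_ae K w] with t h9 h10 h11
      have e1 := (congrArg (s t) h10).trans (h9 _)
      have e2 := (congrArg (h t) h11).trans (map_triple (h t) _ _ _)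
      have e3 : ∀ a b c : ℝ, a + b - (c + a) = b - c := fun a b c => by ring
      exact (congrArg₂ (· - ·) e1 e2).trans (e3 _ _ _)
    rw [h7, h5, ← h8] at h6
    linarith
  refine ⟨lam, h3, h4, ?_, fun π => ?_⟩
  · -- test with the control that represents the residual
    set ρ : Lp (E nu →L[ℝ] ℝ) 2 I.μ := (restrictForm (inU nx nu np)).compLpL 2 I.μ s with hρ
    set v : Lp (E nu) 2 I.μ := (rieszInv nu).compLpL 2 I.μ ρ with hv
    have hρv : ∀ᵐ t ∂I.μ, ∀ υ, s t (0, υ, 0) = ⟪v t, υ⟫ := by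
      filter_upwards [compLpL_ae (restrictForm (inU nx nu np)) s, compLpL_ae (rieszInv nu) ρ]
        with t h8 h9 υ
      exact (DFunLike.congr_fun h8 υ).symm.trans ((inner_rieszInv (ρ t) υ).symm.trans
        (congrArg (fun a => ⟪a, υ⟫) h9.symm))
    clear_value v
    have h5 := key (WithLp.toLp 2 (v, 0))
    have hU : ctrlU I nu np (WithLp.toLp 2 (v, 0)) = v := rfl
    have hP : ctrlP I nu np (WithLp.toLp 2 (v, 0)) = 0 := rfl
    have h6 : pairL I _ s (ctrlTraj I nx nu np (WithLp.toLp 2 (v, 0))) = ⟪v, v⟫ := by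
      rw [pairL_apply, L2.inner_def]
      refine integral_congr_ae ?_
      filter_upwards [ctrlTraj_ae (nx := nx) (WithLp.toLp 2 (v, (0 : E np))), hρv]
        with t h7 h8
      exact (congrArg (s t) h7).trans (h8 (v t))
    rw [h6, hP] at h5
    have h00 : ((0 : E nx), (0 : E np)) = 0 := rfl
    rw [h00, map_zero, add_zero] at h5
    have hv0 : v = 0 := inner_self_eq_zero.1 h5
    filter_upwards [hsae, hρv, Lp.coeFn_zero (E nu) 2 I.μ] with t h7 h8 h9 υ
    rw [hv0, h9] at h8
    exact (h7 _).symm.trans ((h8 υ).trans (inner_zero_left _))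
  · have h5 := key (WithLp.toLp 2 (0, π))
    have hU : ctrlU I nu np (WithLp.toLp 2 (0, π)) = 0 := rfl
    have hP : ctrlP I nu np (WithLp.toLp 2 (0, π)) = π := rfl
    have h6 : pairL I _ s (ctrlTraj I nx nu np (WithLp.toLp 2 (0, π))) =
        ∫ t, (h t (0, 0, π) + ⟪lam.val t, K t (0, 0, π)⟫) ∂I.μ := by
      rw [pairL_apply]
      refine integral_congr_ae ?_
      filter_upwards [ctrlTraj_ae (nx := nx) (WithLp.toLp 2 ((0 : Lp (E nu) 2 I.μ), π)), hsae,
        Lp.coeFn_zero (E nu) 2 I.μ] with t h7 h8 h9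
      exact (congrArg (s t) (h7.trans (congrArg (fun a => ((0, a, π) : YVec nx nu np)) h9))).trans
        (h8 _)
    rw [h6, hP] at h5
    rw [add_comm]
    exact h5

end LinearQuadratic

end OCPSens

namespace OCPSens

attribute [local instance] W1.instNormed W1.instNormedSp

/-! ### Stationary points and regularity for linear-quadratic problems -/

section LinearQuadraticSystem

variable {I : TimeInterval} {nx nu np : ℕ}

/-- The data of a linear-quadratic optimality system: the coefficient `K = (A B C)` of the state
equation, the Hessian `M` of the running cost and the Hessian `Q` of the terminal cost. -/
structure LQData (I : TimeInterval) (nx nu np : ℕ) where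
  /-- coefficient of the state equation -/
  K : Lp (YVec nx nu np →L[ℝ] E nx) ⊤ I.μ
  /-- Hessian of the running cost -/
  M : Lp (YVec nx nu np →L[ℝ] YVec nx nu np →L[ℝ] ℝ) ⊤ I.μ
  /-- Hessian of the terminal cost -/
  Q : (E nx × E np) →L[ℝ] (E nx × E np) →L[ℝ] ℝ
  M_comm : ∀ᵐ t ∂I.μ, ∀ a b, M t a b = M t b a
  Q_nonneg : ∀ a, 0 ≤ Q a a
  coercive : ∃ ε > 0, ∀ δ : YSp I 2 nx nu np,
    (∀ᵐ t ∂I.μ, δ.1.der t = K t (traj δ t)) → δ.1.val I.t₀ = 0 →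
      ε * ((∫ t, ‖δ.1.val t‖ ^ 2 ∂I.μ) + (∫ t, ‖δ.2.1 t‖ ^ 2 ∂I.μ) + ‖δ.2.2‖ ^ 2)
        ≤ ∫ t, M t (traj δ t) (traj δ t) ∂I.μ
  inverse : ∃ C > 0, ∀ᵐ t ∂I.μ, ∃ e : E nu ≃L[ℝ] (E nu →L[ℝ] ℝ),
    (∀ υ υ', e υ υ' = M t (0, υ, 0) (0, υ', 0)) ∧
      ‖(e.symm : (E nu →L[ℝ] ℝ) →L[ℝ] E nu)‖ ≤ C

theorem id_holderL_ae {V W : Type*} [NormedAddCommGroup V] [NormedSpace ℝ V]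
    [NormedAddCommGroup W] [NormedSpace ℝ W] (f : Lp (V →L[ℝ] W) ⊤ I.μ) (g : Lp V 2 I.μ) :
    ∀ᵐ t ∂I.μ, (ContinuousLinearMap.id ℝ (V →L[ℝ] W)).holderL I.μ ⊤ 2 2 f g t = f t (g t) :=
  holderL_ae (ContinuousLinearMap.id ℝ (V →L[ℝ] W)) (r := 2) f g

namespace LQData

variable (D : LQData I nx nu np)

/-- Application of the Hessian of the running cost to a square integrable function. -/
noncomputable def hess : Lp (YVec nx nu np) 2 I.μ →L[ℝ] Lp (YVec nx nu np →L[ℝ] ℝ) 2 I.μ :=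
  (ContinuousLinearMap.id ℝ (YVec nx nu np →L[ℝ] YVec nx nu np →L[ℝ] ℝ)).holderL I.μ ⊤ 2 2 D.M

theorem hess_ae (f : Lp (YVec nx nu np) 2 I.μ) : ∀ᵐ t ∂I.μ, D.hess f t = D.M t (f t) :=
  id_holderL_ae D.M f

/-- The quadratic form of the problem, reduced to the control and the parameter. -/
noncomputable def bilin : CtrlSp I nu np →L[ℝ] CtrlSp I nu np →L[ℝ] ℝ :=
  (pairL I (YVec nx nu np)).bilinearComp (D.hess.comp (linTraj D.K)) (linTraj D.K) +
    D.Q.bilinearComp (linFinal D.K) (linFinal D.K)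

theorem bilin_apply (w w' : CtrlSp I nu np) :
    D.bilin w w' = pairL I _ (D.hess (linTraj D.K w)) (linTraj D.K w') +
      D.Q (linFinal D.K w) (linFinal D.K w') := rfl

theorem norm_sq_ctrl (w : CtrlSp I nu np) :
    ‖w‖ ^ 2 = ∫ t, ‖ctrlU I nu np w t‖ ^ 2 ∂I.μ + ‖ctrlP I nu np w‖ ^ 2 := by
  have h1 : ‖ctrlU I nu np w‖ ^ 2 = ∫ t, ‖ctrlU I nu np w t‖ ^ 2 ∂I.μ := by
    rw [← real_inner_self_eq_norm_sq, L2.inner_def]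
    exact integral_congr_ae (Eventually.of_forall fun t => real_inner_self_eq_norm_sq _)
  rw [WithLp.prod_norm_sq_eq_of_L2, ← h1]
  rfl

/-- The state only adds to the left side of the coercivity condition, and `Q` to the right side. -/
theorem isCoercive_bilin : IsCoercive D.bilin := by
  obtain ⟨ε, hε, h⟩ := D.coercive
  refine ⟨ε, hε, fun w => ?_⟩
  have h1 := h (linY D.K w) (linY_der D.K w) (odeSol_init _ _ _)
  have h2 : pairL I _ (D.hess (linTraj D.K w)) (linTraj D.K w) =
      ∫ t, D.M t (traj (linY D.K w) t) (traj (linY D.K w) t) ∂I.μ := by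
    rw [pairL_apply]
    refine integral_congr_ae ?_
    filter_upwards [D.hess_ae (linTraj D.K w), linTraj_ae D.K w] with t h3 h4
    rw [h3, h4]
  have h3 : 0 ≤ ∫ t, ‖(linY D.K w).1.val t‖ ^ 2 ∂I.μ :=
    integral_nonneg fun t => sq_nonneg _
  rw [bilin_apply, h2, mul_assoc, ← sq, norm_sq_ctrl]
  refine le_trans ?_ (h1.trans (le_add_of_nonneg_right (D.Q_nonneg _)))
  refine mul_le_mul_of_nonneg_left ?_ hε.le
  change _ ≤ _ + ∫ t, ‖ctrlU I nu np w t‖ ^ 2 ∂I.μ + ‖ctrlP I nu np w‖ ^ 2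
  linarith

/-- Solvability of the reduced linear-quadratic problem. -/
theorem exists_stationary (h : Lp (YVec nx nu np →L[ℝ] ℝ) 2 I.μ) (q : E nx × E np →L[ℝ] ℝ) :
    ∃ w : CtrlSp I nu np, ∀ w', pairL I _ (D.hess (linTraj D.K w) + h) (linTraj D.K w') +
      (D.Q (linFinal D.K w) + q) (linFinal D.K w') = 0 := by
  set F : CtrlSp I nu np →L[ℝ] ℝ :=
    -((pairL I _ h).comp (linTraj D.K) + q.comp (linFinal D.K)) with hF
  refine ⟨D.isCoercive_bilin.continuousLinearEquivOfBilin.symm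
    ((InnerProductSpace.toDual ℝ (CtrlSp I nu np)).symm F), fun w' => ?_⟩
  set w := D.isCoercive_bilin.continuousLinearEquivOfBilin.symm
    ((InnerProductSpace.toDual ℝ (CtrlSp I nu np)).symm F) with hw
  have h1 := D.isCoercive_bilin.continuousLinearEquivOfBilin_apply w w'
  rw [hw, ContinuousLinearEquiv.apply_symm_apply, InnerProductSpace.toDual_symm_apply, ← hw,
    bilin_apply] at h1
  have h2 : F w' = -(pairL I _ h (linTraj D.K w') + q (linFinal D.K w')) := rfl
  rw [h2] at h1
  have h3 : pairL I _ (D.hess (linTraj D.K w) + h) (linTraj D.K w') =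
      pairL I _ (D.hess (linTraj D.K w)) (linTraj D.K w') + pairL I _ h (linTraj D.K w') :=
    ContinuousLinearMap.map_add₂ _ _ _ _
  have h4 : (D.Q (linFinal D.K w) + q) (linFinal D.K w') =
      D.Q (linFinal D.K w) (linFinal D.K w') + q (linFinal D.K w') := rfl
  rw [h3, h4]
  linarith

/-- The norm of a vector is bounded by that of the linear form it represents. -/
theorem norm_le_of_inner_le {n : ℕ} {v : E n} {B : ℝ} (hB : 0 ≤ B)
    (h : ∀ ξ, ⟪v, ξ⟫ ≤ B * ‖ξ‖) : ‖v‖ ≤ B := by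
  have h1 := h v
  rw [real_inner_self_eq_norm_sq, sq] at h1
  by_contra! h2
  exact absurd h1 (not_le.2 (mul_lt_mul_of_pos_right h2 (hB.trans_lt h2)))

theorem norm_inU (υ : E nu) : ‖((0, υ, 0) : YVec nx nu np)‖ = ‖υ‖ := by
  simp [Prod.norm_mk]

theorem norm_inX (ξ : E nx) : ‖((ξ, 0, 0) : YVec nx nu np)‖ = ‖ξ‖ := by
  simp [Prod.norm_mk]

/-- Pointwise bound for the control from the stationarity condition. -/
theorem norm_control_le {M : YVec nx nu np →L[ℝ] YVec nx nu np →L[ℝ] ℝ}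
    {K : YVec nx nu np →L[ℝ] E nx} {τ : E nu →L[ℝ] ℝ} {e : E nu ≃L[ℝ] (E nu →L[ℝ] ℝ)}
    {C m k r Cx Cl : ℝ} (hm : ‖M‖ ≤ m) (hk : ‖K‖ ≤ k) (hr : ‖τ‖ ≤ r)
    (he : ∀ υ υ', e υ υ' = M (0, υ, 0) (0, υ', 0))
    (hes : ‖(e.symm : (E nu →L[ℝ] ℝ) →L[ℝ] E nu)‖ ≤ C) (hM : ∀ a b, M a b = M b a)
    {x lam : E nx} {u : E nu} {p : E np} (hx : ‖x‖ ≤ Cx) (hl : ‖lam‖ ≤ Cl)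
    (hu : ∀ υ, M (0, υ, 0) (x, u, p) + ⟪lam, K (0, υ, 0)⟫ = τ υ) :
    ‖u‖ ≤ C * (r + Cl * k + m * (Cx + ‖p‖)) := by
  have hm0 := M.opNorm_nonneg.trans hm
  have hk0 := K.opNorm_nonneg.trans hk
  have hr0 := τ.opNorm_nonneg.trans hr
  have hx0 := (norm_nonneg _).trans hx
  have hl0 := (norm_nonneg _).trans hl
  -- the stationarity condition, solved for the `uu`-block applied to `u`
  have h6 : ‖e u‖ ≤ r + Cl * k + m * (Cx + ‖p‖) := by
    refine ContinuousLinearMap.opNorm_le_bound _ (by positivity) fun υ => ?_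
    have h7 : ((x, u, p) : YVec nx nu np) = (0, u, 0) + (x, 0, p) := by simp
    have h8 : e u υ = τ υ - ⟪lam, K (0, υ, 0)⟫ - M (0, υ, 0) (x, 0, p) := by
      rw [he, ← hu υ, h7, map_add, hM (0, u, 0)]
      ring
    have h9 : ‖τ υ‖ ≤ r * ‖υ‖ := τ.le_of_opNorm_le hr υ
    have h10 : ‖⟪lam, K (0, υ, 0)⟫‖ ≤ Cl * (k * ‖υ‖) := by
      refine (norm_inner_le_norm _ _).trans (mul_le_mul hl ?_ (norm_nonneg _) hl0)
      have := K.le_of_opNorm_le hk (0, υ, 0)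
      rwa [norm_inU] at this
    have h11 : ‖M (0, υ, 0) (x, 0, p)‖ ≤ m * ‖υ‖ * (Cx + ‖p‖) := by
      have h12 := M.le_of_opNorm_le hm (0, υ, 0)
      rw [norm_inU] at h12
      refine ((M (0, υ, 0)).le_of_opNorm_le h12 _).trans
        (mul_le_mul_of_nonneg_left ?_ (by positivity))
      refine max_le (hx.trans (le_add_of_nonneg_right (norm_nonneg p))) (max_le ?_ ?_)
      · rw [norm_zero]
        positivity
      · exact le_add_of_nonneg_left hx0
    rw [h8]
    refine (norm_sub_le _ _).trans ((add_le_add ((norm_sub_le _ _).trans (add_le_add h9 h10))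
      h11).trans_eq ?_)
    ring
  have h7 : u = (e.symm : (E nu →L[ℝ] ℝ) →L[ℝ] E nu) (e u) := (e.symm_apply_apply u).symm
  rw [h7]
  exact ContinuousLinearMap.le_of_opNorm_le_of_le _ hes h6

/-- Pointwise bound for the derivative of the costate from the costate equation. -/
theorem norm_costate_der_le {M : YVec nx nu np →L[ℝ] YVec nx nu np →L[ℝ] ℝ}
    {K : YVec nx nu np →L[ℝ] E nx} {τ : E nx →L[ℝ] ℝ} {m k r N Cl : ℝ} (hm : ‖M‖ ≤ m)
    (hk : ‖K‖ ≤ k) (hr : ‖τ‖ ≤ r) {v : YVec nx nu np} {lam μ : E nx} (hv : ‖v‖ ≤ N)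
    (hl : ‖lam‖ ≤ Cl) (h : ∀ ξ, ⟪μ, ξ⟫ = -(M (ξ, 0, 0) v + ⟪lam, K (ξ, 0, 0)⟫) + τ ξ) :
    ‖μ‖ ≤ m * N + Cl * k + r := by
  have hm0 := M.opNorm_nonneg.trans hm
  have hk0 := K.opNorm_nonneg.trans hk
  have hr0 := τ.opNorm_nonneg.trans hr
  have hv0 := (norm_nonneg _).trans hv
  have hl0 := (norm_nonneg _).trans hl
  refine norm_le_of_inner_le (by positivity) fun ξ => ?_
  rw [h]
  have h6 : ‖M (ξ, 0, 0) v‖ ≤ m * ‖ξ‖ * N := by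
    have h12 := M.le_of_opNorm_le hm (ξ, 0, 0)
    rw [norm_inX] at h12
    exact ContinuousLinearMap.le_of_opNorm_le_of_le _ h12 hv
  have h7 : ‖⟪lam, K (ξ, 0, 0)⟫‖ ≤ Cl * (k * ‖ξ‖) := by
    refine (norm_inner_le_norm _ _).trans (mul_le_mul hl ?_ (norm_nonneg _) hl0)
    have := K.le_of_opNorm_le hk (ξ, 0, 0)
    rwa [norm_inX] at this
  have h8 : ‖τ ξ‖ ≤ r * ‖ξ‖ := τ.le_of_opNorm_le hr ξ
  rw [Real.norm_eq_abs, abs_le] at h6 h7 h8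
  linarith [h6.1, h7.1, h8.2]

/-- Square integrable solutions with essentially bounded data are essentially bounded: the
control by the invertibility of the `uu`-block, the state and the costate by their differential
equations. -/
theorem exists_linf (τ₁ : Lp (E nx) ⊤ I.μ) (τ₃ : Lp (E nx →L[ℝ] ℝ) ⊤ I.μ)
    (τ₅ : Lp (E nu →L[ℝ] ℝ) ⊤ I.μ) (y : YSp I 2 nx nu np) (lam : W1 I 2 nx)
    (hx : ∀ᵐ t ∂I.μ, y.1.der t = D.K t (traj y t) + τ₁ t)
    (hlam : ∀ᵐ t ∂I.μ, ∀ ξ, ⟪lam.der t, ξ⟫ = -(D.M t (ξ, 0, 0) (traj y t) +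
      ⟪lam.val t, D.K t (ξ, 0, 0)⟫) + τ₃ t ξ)
    (hu : ∀ᵐ t ∂I.μ, ∀ υ, D.M t (0, υ, 0) (traj y t) + ⟪lam.val t, D.K t (0, υ, 0)⟫ = τ₅ t υ) :
    ∃ z : ZSp I nx nu np, z.y.1.val = y.1.val ∧ z.y.1.der =ᵐ[I.μ] y.1.der ∧
      z.y.2.1 =ᵐ[I.μ] y.2.1 ∧ z.y.2.2 = y.2.2 ∧ z.lam.val = lam.val ∧
      z.lam.der =ᵐ[I.μ] lam.der := by
  obtain ⟨C, hC, hinv⟩ := D.inverse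
  obtain ⟨Cx, hCx0, hCx⟩ := y.1.exists_norm_val_le
  obtain ⟨Cl, hCl0, hCl⟩ := lam.exists_norm_val_le
  set R := ‖τ₅‖ + Cl * ‖D.K‖ + ‖D.M‖ * (Cx + ‖y.2.2‖) with hR
  have hR0 : 0 ≤ R := by positivity
  have hub : ∀ᵐ t ∂I.μ, ‖y.2.1 t‖ ≤ C * R := by
    filter_upwards [hinv, hu, D.M_comm, Linf.ae_norm_le τ₅, Linf.ae_norm_le D.K,
      Linf.ae_norm_le D.M] with t ⟨e, he, hes⟩ h1 h2 h3 h4 h5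
    exact norm_control_le h5 h4 h3 he hes h2 (hCx t) (hCl t) h1
  set N := Cx + C * R + ‖y.2.2‖ with hN
  have hN0 : 0 ≤ N := by positivity
  have hT : ∀ᵐ t ∂I.μ, ‖traj y t‖ ≤ N := by
    filter_upwards [hub] with t ht
    have h1 : 0 ≤ C * R := by positivity
    have h2 := norm_nonneg y.2.2
    refine max_le ((hCx t).trans ?_) (max_le (ht.trans ?_) ?_)
    · linarith
    · linarith
    · change ‖y.2.2‖ ≤ N
      linarith
  obtain ⟨x', hx1, hx2⟩ := W1.exists_top_of_bound y.1 (C := ‖D.K‖ * N + ‖τ₁‖) (by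
    filter_upwards [hx, hT, Linf.ae_norm_le D.K, Linf.ae_norm_le τ₁] with t h1 h2 h3 h4
    rw [h1]
    exact (norm_add_le _ _).trans (add_le_add (ContinuousLinearMap.le_of_opNorm_le_of_le _ h3 h2)
      h4))
  obtain ⟨l', hl1, hl2⟩ := W1.exists_top_of_bound lam
    (C := ‖D.M‖ * N + Cl * ‖D.K‖ + ‖τ₃‖) (by
    filter_upwards [hlam, hT, Linf.ae_norm_le D.K, Linf.ae_norm_le τ₃, Linf.ae_norm_le D.M]
      with t h1 h2 h3 h4 h5
    exact norm_costate_der_le h5 h3 h4 h2 (hCl t) h1)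
  have hm : MemLp y.2.1 ⊤ I.μ := memLp_top_of_bound (Lp.aestronglyMeasurable _) _ hub
  exact ⟨(x', hm.toLp, y.2.2, l'), hx1, hx2, hm.coeFn_toLp, rfl, hl1, hl2⟩

end LQData

end LinearQuadraticSystem

end OCPSens

namespace OCPSens

attribute [local instance] W1.instNormed W1.instNormedSp

/-! ### Unique solvability of linear-quadratic optimality systems -/

section LinearQuadraticSolution

variable {I : TimeInterval} {nx nu np : ℕ}

namespace LQData

variable (D : LQData I nx nu np)

set_option maxHeartbeats 1000000 in
/-- Solvability of the linear-quadratic optimality system with square integrable controls. A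
particular solution of the state equation reduces the problem to one with a homogeneous state
equation, whose stationary point is given by `exists_stationary`. -/
theorem exists_weak_solution (τ₁ : Lp (E nx) ⊤ I.μ) (τ₂ : E nx)
    (τ₃ : Lp (E nx →L[ℝ] ℝ) ⊤ I.μ) (τ₄ : E nx →L[ℝ] ℝ) (τ₅ : Lp (E nu →L[ℝ] ℝ) ⊤ I.μ)
    (τ₆ : E np →L[ℝ] ℝ) : ∃ (y : YSp I 2 nx nu np) (lam : W1 I 2 nx),
      (∀ᵐ t ∂I.μ, y.1.der t = D.K t (traj y t) + τ₁ t) ∧ y.1.val I.t₀ = τ₂ ∧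
      (∀ᵐ t ∂I.μ, ∀ ξ, ⟪lam.der t, ξ⟫ = -(D.M t (ξ, 0, 0) (traj y t) +
        ⟪lam.val t, D.K t (ξ, 0, 0)⟫) + τ₃ t ξ) ∧
      (∀ ξ, ⟪lam.val I.tf, ξ⟫ = D.Q (final y) (ξ, 0) + τ₄ ξ) ∧
      (∀ᵐ t ∂I.μ, ∀ υ, D.M t (0, υ, 0) (traj y t) + ⟪lam.val t, D.K t (0, υ, 0)⟫ = τ₅ t υ) ∧
      ∀ π, D.Q (final y) (0, π) + ∫ t, (D.M t (0, 0, π) (traj y t) +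
        ⟪lam.val t, D.K t (0, 0, π)⟫) ∂I.μ = τ₆ π := by
  -- a particular solution of the state equation
  set x₁ : W1 I 2 nx := odeSol (stateCoeff D.K) τ₂ (Lp.incl le_top τ₁) with hx₁
  set Y₁ : Lp (YVec nx nu np) 2 I.μ := (inX nx nu np).compLpL 2 I.μ
    (Lp.incl le_top (contL I nx (W1.valL I 2 nx x₁))) with hY₁
  have hY₁ae : ∀ᵐ t ∂I.μ, Y₁ t = (x₁.val t, 0, 0) := by
    filter_upwards [compLpL_ae (inX nx nu np) (Lp.incl (le_top : (2 : ℝ≥0∞) ≤ ⊤)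
      (contL I nx (W1.valL I 2 nx x₁))), Lp.incl_ae (le_top : (2 : ℝ≥0∞) ≤ ⊤)
      (contL I nx (W1.valL I 2 nx x₁)), W1.contL_valL_ae x₁] with t h1 h2 h3
    rw [hY₁, h1, h2, h3, inX_apply]
  -- the inhomogeneities of the costate equation and of the stationarity condition
  set c : Lp (YVec nx nu np →L[ℝ] ℝ) ⊤ I.μ :=
    (restrictForm (ContinuousLinearMap.fst ℝ (E nx) (E nu × E np))).compLpL ⊤ I.μ τ₃ +
    (restrictForm ((ContinuousLinearMap.fst ℝ (E nu) (E np)).comp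
      (ContinuousLinearMap.snd ℝ (E nx) (E nu × E np)))).compLpL ⊤ I.μ τ₅ with hc
  have hcae : ∀ᵐ t ∂I.μ, ∀ ξ : YVec nx nu np, c t ξ = τ₃ t ξ.1 + τ₅ t ξ.2.1 := by
    filter_upwards [add_apply_ae
      ((restrictForm (ContinuousLinearMap.fst ℝ (E nx) (E nu × E np))).compLpL ⊤ I.μ τ₃)
      ((restrictForm ((ContinuousLinearMap.fst ℝ (E nu) (E np)).comp
        (ContinuousLinearMap.snd ℝ (E nx) (E nu × E np)))).compLpL ⊤ I.μ τ₅),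
      compLpL_ae (restrictForm (ContinuousLinearMap.fst ℝ (E nx) (E nu × E np))) τ₃,
      compLpL_ae (restrictForm ((ContinuousLinearMap.fst ℝ (E nu) (E np)).comp
        (ContinuousLinearMap.snd ℝ (E nx) (E nu × E np)))) τ₅] with t h1 h2 h3 ξ
    exact (h1 ξ).trans (congrArg₂ (· + ·) (DFunLike.congr_fun h2 ξ) (DFunLike.congr_fun h3 ξ))
  clear_value c
  set h₁ : Lp (YVec nx nu np →L[ℝ] ℝ) 2 I.μ := D.hess Y₁ - Lp.incl le_top c with hh₁
  set q₁ : E nx × E np →L[ℝ] ℝ := D.Q (x₁.val I.tf, 0) +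
    restrictForm (ContinuousLinearMap.fst ℝ (E nx) (E np)) τ₄ -
    restrictForm (ContinuousLinearMap.snd ℝ (E nx) (E np)) τ₆ with hq₁
  obtain ⟨w, hw⟩ := D.exists_stationary h₁ q₁
  obtain ⟨lam, l1, l2, l3, l4⟩ := exists_costate D.K _ _ hw
  set y : YSp I 2 nx nu np := (x₁ + linState D.K w, ctrlU I nu np w, ctrlP I nu np w) with hy
  have hval : ∀ t, y.1.val t = x₁.val t + (linState D.K w).val t := fun t => rfl
  have htraj : ∀ t, traj y t = traj (linY D.K w) t + (x₁.val t, 0, 0) := fun t => by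
    refine Prod.ext (add_comm _ _) (Prod.ext ?_ ?_)
    · exact (add_zero _).symm
    · exact (add_zero _).symm
  have hfin : final y = final (linY D.K w) + (x₁.val I.tf, 0) :=
    Prod.ext (add_comm _ _) (add_zero _).symm
  have hae : ∀ᵐ t ∂I.μ, ∀ ξ, (D.hess (linTraj D.K w) + h₁) t ξ =
      D.M t ξ (traj y t) - τ₃ t ξ.1 - τ₅ t ξ.2.1 := by
    filter_upwards [add_apply_ae (D.hess (linTraj D.K w)) h₁,
      sub_apply_ae (D.hess Y₁) (Lp.incl (le_top : (2 : ℝ≥0∞) ≤ ⊤) c),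
      Lp.incl_ae (le_top : (2 : ℝ≥0∞) ≤ ⊤) c, hcae, hY₁ae, D.hess_ae (linTraj D.K w), D.hess_ae Y₁,
      linTraj_ae D.K w, D.M_comm] with t e1 e2 e3 e4 e5 e6 e7 e8 e9 ξ
    have f1 := (DFunLike.congr_fun (e6.trans (congrArg (D.M t) e8)) ξ).trans (e9 ξ _).symm
    have f2 := (DFunLike.congr_fun (e7.trans (congrArg (D.M t) e5)) ξ).trans (e9 ξ _).symm
    have f3 := (DFunLike.congr_fun e3 ξ).trans (e4 ξ)
    have f4 := (congrArg (D.M t ξ) (htraj t)).trans (map_add (D.M t ξ) _ _)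
    have f5 : ∀ a b c d : ℝ, a + (b - (c + d)) = a + b - c - d := fun a b c d => by ring
    refine (e1 ξ).trans ((congrArg₂ (· + ·) f1 ((e2 ξ).trans (congrArg₂ (· - ·) f2 f3))).trans ?_)
    rw [f4]
    exact f5 _ _ _ _
  have hq : ∀ a, (D.Q (linFinal D.K w) + q₁) a = D.Q (final y) a + τ₄ a.1 - τ₆ a.2 := fun a => by
    rw [hq₁, hfin, linFinal_apply, map_add]
    simp only [add_apply, sub_apply, restrictForm_apply, ContinuousLinearMap.coe_fst',
      ContinuousLinearMap.coe_snd']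
    ring
  refine ⟨y, lam, ?_, ?_, ?_, fun ξ => ?_, ?_, fun π => ?_⟩
  · filter_upwards [odeSol_der (stateCoeff D.K) τ₂ (Lp.incl (le_top : (2 : ℝ≥0∞) ≤ ⊤) τ₁),
      stateCoeff_ae D.K, Lp.incl_ae (le_top : (2 : ℝ≥0∞) ≤ ⊤) τ₁, linY_der D.K w,
      Lp.coeFn_add (W1.derL I 2 nx x₁) (W1.derL I 2 nx (linState D.K w))] with t e1 e2 e3 e4 e5
    have e6 : y.1.der t = x₁.der t + (linY D.K w).1.der t := e5
    rw [e6, e4, hx₁, e1, e2, e3, htraj, map_add]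
    abel
  · rw [hval, hx₁, odeSol_init, linState, odeSol_init, add_zero]
  · filter_upwards [l1, hae] with t e1 e2 ξ
    have e3 : (D.hess (linTraj D.K w) + h₁) t (ξ, 0, 0) = D.M t (ξ, 0, 0) (traj y t) - τ₃ t ξ :=
      (e2 _).trans ((congrArg (_ - ·) (map_zero (τ₅ t))).trans (sub_zero _))
    rw [e1, e3]
    ring
  · rw [l2, hq, map_zero, sub_zero]
  · filter_upwards [l3, hae] with t e1 e2 υ
    have e3 : (D.hess (linTraj D.K w) + h₁) t (0, υ, 0) =
        D.M t (0, υ, 0) (traj y t) - 0 - τ₅ t υ :=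
      (e2 _).trans (congrArg (fun a => D.M t (0, υ, 0) (traj y t) - a - τ₅ t υ) (map_zero (τ₃ t)))
    have e4 := e1 υ
    rw [e3] at e4
    linarith only [e4]
  · have e1 := l4 π
    have e2 : ∫ t, ((D.hess (linTraj D.K w) + h₁) t (0, 0, π) +
        ⟪lam.val t, D.K t (0, 0, π)⟫) ∂I.μ = ∫ t, (D.M t (0, 0, π) (traj y t) +
        ⟪lam.val t, D.K t (0, 0, π)⟫) ∂I.μ := by
      refine integral_congr_ae ?_
      filter_upwards [hae] with t e3
      have e4 : (D.hess (linTraj D.K w) + h₁) t (0, 0, π) =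
          D.M t (0, 0, π) (traj y t) - 0 - 0 :=
        (e3 _).trans (congrArg₂ (fun a b => D.M t (0, 0, π) (traj y t) - a - b) (map_zero (τ₃ t))
          (map_zero (τ₅ t)))
      rw [e4, sub_zero, sub_zero]
    rw [e2, hq, map_zero] at e1
    linarith

/-- Solvability of the linear-quadratic optimality system, with essentially bounded solutions. -/
theorem exists_solution (τ₁ : Lp (E nx) ⊤ I.μ) (τ₂ : E nx)
    (τ₃ : Lp (E nx →L[ℝ] ℝ) ⊤ I.μ) (τ₄ : E nx →L[ℝ] ℝ) (τ₅ : Lp (E nu →L[ℝ] ℝ) ⊤ I.μ)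
    (τ₆ : E np →L[ℝ] ℝ) : ∃ z : ZSp I nx nu np,
      (∀ᵐ t ∂I.μ, z.y.1.der t = D.K t (traj z.y t) + τ₁ t) ∧ z.y.1.val I.t₀ = τ₂ ∧
      (∀ᵐ t ∂I.μ, ∀ ξ, ⟪z.lam.der t, ξ⟫ = -(D.M t (ξ, 0, 0) (traj z.y t) +
        ⟪z.lam.val t, D.K t (ξ, 0, 0)⟫) + τ₃ t ξ) ∧
      (∀ ξ, ⟪z.lam.val I.tf, ξ⟫ = D.Q (final z.y) (ξ, 0) + τ₄ ξ) ∧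
      (∀ᵐ t ∂I.μ, ∀ υ, D.M t (0, υ, 0) (traj z.y t) + ⟪z.lam.val t, D.K t (0, υ, 0)⟫ = τ₅ t υ) ∧
      ∀ π, D.Q (final z.y) (0, π) + ∫ t, (D.M t (0, 0, π) (traj z.y t) +
        ⟪z.lam.val t, D.K t (0, 0, π)⟫) ∂I.μ = τ₆ π := by
  obtain ⟨y, lam, h1, h2, h3, h4, h5, h6⟩ := D.exists_weak_solution τ₁ τ₂ τ₃ τ₄ τ₅ τ₆
  obtain ⟨z, z1, z2, z3, z4, z5, z6⟩ := D.exists_linf τ₁ τ₃ τ₅ y lam h1 h3 h5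
  have ht : ∀ᵐ t ∂I.μ, traj z.y t = traj y t := by
    filter_upwards [z3] with t e1
    rw [traj, traj, z1, e1, z4]
  have hf : final z.y = final y := by rw [final, final, z1, z4]
  refine ⟨z, ?_, ?_, ?_, ?_, ?_, fun π => ?_⟩
  · filter_upwards [h1, z2, ht] with t e1 e2 e3
    rw [e2, e1, e3]
  · rw [z1, h2]
  · filter_upwards [h3, z6, ht] with t e1 e2 e3
    rw [z5, e2, e3]
    exact e1
  · rw [z5, hf]
    exact h4
  · filter_upwards [h5, ht] with t e1 e3
    rw [z5, e3]
    exact e1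
  · rw [← h6, hf, z5]
    congr 1
    refine integral_congr_ae ?_
    filter_upwards [ht] with t e3
    rw [e3]

set_option maxHeartbeats 1000000 in
/-- Uniqueness for the linear-quadratic optimality system: by duality, the quadratic form vanishes
at a solution of the homogeneous system. -/
theorem eq_zero_of_homogeneous {z : ZSp I nx nu np}
    (h1 : ∀ᵐ t ∂I.μ, z.y.1.der t = D.K t (traj z.y t)) (h2 : z.y.1.val I.t₀ = 0)
    (h3 : ∀ᵐ t ∂I.μ, ∀ ξ, ⟪z.lam.der t, ξ⟫ = -(D.M t (ξ, 0, 0) (traj z.y t) +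
        ⟪z.lam.val t, D.K t (ξ, 0, 0)⟫))
    (h4 : ∀ ξ, ⟪z.lam.val I.tf, ξ⟫ = D.Q (final z.y) (ξ, 0))
    (h5 : ∀ᵐ t ∂I.μ, ∀ υ, D.M t (0, υ, 0) (traj z.y t) + ⟪z.lam.val t, D.K t (0, υ, 0)⟫ = 0)
    (h6 : ∀ π, D.Q (final z.y) (0, π) + ∫ t, (D.M t (0, 0, π) (traj z.y t) +
        ⟪z.lam.val t, D.K t (0, 0, π)⟫) ∂I.μ = 0) : z = 0 := by
  set y := z.y with hy
  have hx : ∀ᵐ t ∂I.μ, y.1.der t = D.K t (y.1.val t, 0, 0) + D.K t (0, y.2.1 t, y.2.2) := by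
    filter_upwards [h1] with t e1
    exact e1.trans (map_triple (D.K t) _ _ _)
  set Y : Lp (YVec nx nu np) 2 I.μ := Lp.incl le_top (trajL I ⊤ nx nu np y) with hY
  have hYae : ∀ᵐ t ∂I.μ, Y t = traj y t :=
    (Lp.incl_ae (le_top : (2 : ℝ≥0∞) ≤ ⊤) (trajL I ⊤ nx nu np y)).trans (trajL_ae y)
  have hMae : ∀ᵐ t ∂I.μ, ∀ ξ, D.hess Y t ξ = D.M t ξ (traj y t) := by
    filter_upwards [D.hess_ae Y, hYae, D.M_comm] with t e1 e2 e3 ξ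
    exact (DFunLike.congr_fun (e1.trans (congrArg (D.M t) e2)) ξ).trans (e3 _ _)
  have h3' : ∀ᵐ t ∂I.μ, ∀ ξ, ⟪z.lam.der t, ξ⟫ = -(D.hess Y t (ξ, 0, 0) +
        ⟪z.lam.val t, D.K t (ξ, 0, 0)⟫) := by
    filter_upwards [h3, hMae] with t e1 e2 ξ
    rw [e1, e2]
  -- the derivative of `⟪λ, x⟫`, integrated
  have d := inner_terminal_eq h3' hx h2
  -- the integrand of the duality relation, rewritten with the stationarity condition
  set s : Lp (YVec nx nu np →L[ℝ] ℝ) 2 I.μ :=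
    D.hess Y + Lp.incl le_top (costateForm D.K z.lam) with hs
  have hsae : ∀ᵐ t ∂I.μ, ∀ ξ, s t ξ = D.M t ξ (traj y t) + ⟪z.lam.val t, D.K t ξ⟫ := by
    filter_upwards [add_apply_ae (D.hess Y) (Lp.incl (le_top : (2 : ℝ≥0∞) ≤ ⊤)
      (costateForm D.K z.lam)), Lp.incl_ae (le_top : (2 : ℝ≥0∞) ≤ ⊤) (costateForm D.K z.lam),
      costateForm_ae D.K z.lam, hMae] with t e1 e2 e3 e4 ξ
    exact (e1 ξ).trans (congrArg₂ (· + ·) (e4 ξ) ((DFunLike.congr_fun e2 ξ).trans (e3 ξ)))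
  clear_value s
  have hsint : Integrable (fun t => s t (0, 0, y.2.2)) I.μ :=
    (Lp.integrable s).apply_continuousLinearMap _
  have hMint : Integrable (fun t => D.M t (traj y t) (traj y t)) I.μ := by
    refine (integrable_pair (D.hess Y) Y).congr ?_
    filter_upwards [hMae, hYae] with t e1 e2
    rw [e1, e2]
  have e0 : ∫ t, (⟪z.lam.val t, D.K t (0, y.2.1 t, y.2.2)⟫ - D.hess Y t (y.1.val t, 0, 0)) ∂I.μ =
      ∫ t, s t (0, 0, y.2.2) ∂I.μ - ∫ t, D.M t (traj y t) (traj y t) ∂I.μ := by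
    rw [← integral_sub hsint hMint]
    refine integral_congr_ae ?_
    filter_upwards [hsae, hMae, h5] with t e1 e2 e3
    have e5 : ⟪z.lam.val t, D.K t (0, y.2.1 t, y.2.2)⟫ =
        ⟪z.lam.val t, D.K t (0, y.2.1 t, 0)⟫ + ⟪z.lam.val t, D.K t (0, 0, y.2.2)⟫ :=
      (congrArg _ (map_triple_zero (D.K t) _ _)).trans (inner_add_right _ _ _)
    have e6 : D.M t (traj y t) (traj y t) = D.M t (y.1.val t, 0, 0) (traj y t) +
        (D.M t (0, y.2.1 t, 0) (traj y t) + D.M t (0, 0, y.2.2) (traj y t)) :=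
      (map_triple ((D.M t).flip (traj y t)) _ _ _).trans
        (congrArg (_ + ·) (map_triple_zero ((D.M t).flip (traj y t)) _ _))
    have e7 := e3 (y.2.1 t)
    have e8 := e1 (0, 0, y.2.2)
    have e9 := e2 (y.1.val t, 0, 0)
    linear_combination e5 - e9 - e8 + e6 + e7
  have e1 : ∫ t, s t (0, 0, y.2.2) ∂I.μ = -D.Q (final y) (0, y.2.2) := by
    rw [integral_congr_ae (hsae.mono fun t ht => ht _)]
    linarith [h6 y.2.2]
  have e2 : D.Q (final y) (final y) = D.Q (final y) (y.1.val I.tf, 0) +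
      D.Q (final y) (0, y.2.2) := by
    rw [← map_add]
    simp [final]
  have e3 : ∫ t, D.M t (traj y t) (traj y t) ∂I.μ = -D.Q (final y) (final y) := by
    rw [e0, e1, h4] at d
    linarith
  -- by coercivity the control and the parameter vanish, hence so do the state and the costate
  obtain ⟨ε, hε, hc⟩ := D.coercive
  set δ : YSp I 2 nx nu np := (W1.incl 2 y.1, Lp.incl le_top y.2.1, y.2.2) with hδ
  have hδt : ∀ᵐ t ∂I.μ, traj δ t = traj y t := by
    filter_upwards [Lp.incl_ae (le_top : (2 : ℝ≥0∞) ≤ ⊤) y.2.1] with t e4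
    exact Prod.ext rfl (Prod.ext e4 rfl)
  have c1 := hc δ (by
    filter_upwards [W1.incl_der (p := 2) y.1, h1, hδt] with t e4 e5 e6
    rw [e6, ← e5]
    exact e4) h2
  have c2 : ∫ t, D.M t (traj δ t) (traj δ t) ∂I.μ ≤ 0 := by
    rw [integral_congr_ae (g := fun t => D.M t (traj y t) (traj y t))
      (hδt.mono fun t ht => by simp only [ht]), e3]
    linarith [D.Q_nonneg (final y)]
  have c3 : 0 ≤ ∫ t, ‖δ.1.val t‖ ^ 2 ∂I.μ := integral_nonneg fun t => sq_nonneg _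
  have c4 : 0 ≤ ∫ t, ‖δ.2.1 t‖ ^ 2 ∂I.μ := integral_nonneg fun t => sq_nonneg _
  have c5 : (∫ t, ‖δ.1.val t‖ ^ 2 ∂I.μ) + (∫ t, ‖δ.2.1 t‖ ^ 2 ∂I.μ) + ‖δ.2.2‖ ^ 2 ≤ 0 := by
    by_contra! hcon
    exact absurd (c1.trans c2) (not_le.2 (mul_pos hε hcon))
  have p0 : y.2.2 = 0 := by
    have : ‖y.2.2‖ ^ 2 ≤ 0 := by
      change ‖δ.2.2‖ ^ 2 ≤ 0
      linarith [sq_nonneg ‖δ.2.2‖]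
    exact norm_eq_zero.1 (pow_eq_zero_iff two_ne_zero |>.1 (le_antisymm this (sq_nonneg _)))
  have u0 : y.2.1 = 0 := by
    have hi : ⟪δ.2.1, δ.2.1⟫ = 0 := by
      rw [L2.inner_def, integral_congr_ae (Eventually.of_forall fun t =>
        real_inner_self_eq_norm_sq (δ.2.1 t))]
      linarith [sq_nonneg ‖δ.2.2‖]
    have h0 : δ.2.1 = 0 := inner_self_eq_zero.1 hi
    refine Lp.ext ?_
    filter_upwards [Lp.incl_ae (le_top : (2 : ℝ≥0∞) ≤ ⊤) y.2.1, Lp.coeFn_zero (E nu) 2 I.μ,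
      Lp.coeFn_zero (E nu) ⊤ I.μ] with t e4 e5 e6
    have e7 : Lp.incl (le_top : (2 : ℝ≥0∞) ≤ ⊤) y.2.1 = 0 := h0
    rw [e6, ← e4, e7, e5]
  have x0 : y.1 = 0 := by
    have hode : ∀ᵐ t ∂I.μ, y.1.der t =
        stateCoeff D.K t (y.1.val t) + (0 : Lp (E nx) ⊤ I.μ) t := by
      filter_upwards [hx, stateCoeff_ae D.K, Lp.coeFn_zero (E nx) ⊤ I.μ,
        Lp.coeFn_zero (E nu) ⊤ I.μ] with t e4 e5 e6 e7
      have e8 : ((0, y.2.1 t, y.2.2) : YVec nx nu np) = 0 := by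
        rw [u0, p0, e7]
        rfl
      rw [e4, e5, e6, e8, map_zero]
      rfl
    have hode0 : ∀ᵐ t ∂I.μ, (0 : W1 I ⊤ nx).der t =
        stateCoeff D.K t ((0 : W1 I ⊤ nx).val t) + (0 : Lp (E nx) ⊤ I.μ) t := by
      filter_upwards [Lp.coeFn_zero (E nx) ⊤ I.μ] with t e6
      have e7 : (0 : W1 I ⊤ nx).der t = (0 : Lp (E nx) ⊤ I.μ) t := rfl
      have e8 : (0 : W1 I ⊤ nx).val t = 0 := rfl
      rw [e7, e8, e6, map_zero]
      exact (add_zero _).symm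
    rw [eq_odeSol hode, eq_odeSol hode0, h2]
    rfl
  have hT0 : ∀ᵐ t ∂I.μ, traj y t = 0 := by
    filter_upwards [Lp.coeFn_zero (E nu) ⊤ I.μ] with t e4
    rw [traj, u0, p0, x0, e4]
    rfl
  have l0 : z.lam = 0 := by
    refine eq_zero_of_adjoint (stateCoeff D.K) ?_ ?_
    · filter_upwards [h3, hT0, stateCoeff_ae D.K, inner_negTranspose_ae (stateCoeff D.K)]
        with t e4 e5 e6 e7
      refine ext_inner_right ℝ fun ξ => ?_
      have e8 : D.M t (ξ, 0, 0) (traj y t) = 0 := (congrArg _ e5).trans (map_zero _)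
      rw [e4, e7, e8, e6, zero_add]
    · refine ext_inner_right ℝ fun ξ => ?_
      have : final y = 0 := by
        rw [final, p0, x0]
        rfl
      rw [h4, this, map_zero, inner_zero_left]
      rfl
  exact Prod.ext x0 (Prod.ext u0 (Prod.ext p0 l0))

end LQData

end LinearQuadraticSolution

end OCPSens

namespace OCPSens

attribute [local instance] W1.instNormed W1.instNormedSp

/-! ### Solvability of the linearized optimality system -/

section SecondOrder

variable {I : TimeInterval} {nx nu np ng : ℕ} {P : OCP nx nu np ng}

namespace OCP

/-- The coefficients `(A B C)` as values of `totDOp`. -/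
theorem totDOp_ABC_ae (hf : Smooth I P.f) (g : G3 I nx nu np ng) (z : ZSp I nx nu np) :
    ∀ᵐ t ∂I.μ, totDOp hf (trajL I ⊤ nx nu np z.y, g) t = P.ABC g z t := by
  filter_upwards [totDOp_ae hf (trajL I ⊤ nx nu np z.y, g), trajL_ae z.y] with t h1 h2
  rw [h1, h2]
  rfl

/-- The linear-quadratic problem given by the second-order expansion of the optimal control
problem at a point satisfying the second-order sufficient condition. -/
noncomputable def lqData (hl : Smooth I P.l) (hf : Smooth I P.f)
    {g : G3 I nx nu np ng} {z : ZSp I nx nu np} (hS : P.SSOC g z) : LQData I nx nu np where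
  K := totDOp hf (trajL I ⊤ nx nu np z.y, g)
  M := hessOp hl hf (z, g)
  Q := fderiv ℝ (fderiv ℝ P.φ) (final z.y)
  M_comm := by
    filter_upwards [hessOp_ae hl hf (z, g), Hyy_comm_ae hl hf g z] with t h1 h2 a b
    rw [h1]
    exact h2 a b
  Q_nonneg := hS.terminal
  coercive := by
    obtain ⟨ε, hε, h⟩ := hS.coercive
    refine ⟨ε, hε, fun δ h1 h2 => ?_⟩
    refine (h δ ?_ h2).trans (integral_congr_ae ?_).le
    · filter_upwards [h1, totDOp_ABC_ae hf g z] with t e1 e2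
      rw [e1, e2]
    · filter_upwards [hessOp_ae hl hf (z, g)] with t e1
      rw [e1]
      rfl
  inverse := by
    obtain ⟨C, hC, h⟩ := hS.inverse
    refine ⟨C, hC, ?_⟩
    filter_upwards [h, hessOp_ae hl hf (z, g)] with t e1 e2
    obtain ⟨e, h1, h2⟩ := e1
    refine ⟨e, fun υ υ' => ?_, h2⟩
    rw [h1, e2]
    rfl

/-- The linearized optimality system, as a system with the coefficients of `lqData`. -/
theorem kktDeriv_left_eq_iff_lqData (hφ : ContDiff ℝ 2 P.φ) (hl : Smooth I P.l)
    (hf : Smooth I P.f) {g : G3 I nx nu np ng} {z : ZSp I nx nu np} (hS : P.SSOC g z)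
    (δz : ZSp I nx nu np) (τ : KKTSp I nx nu np) :
    kktDeriv hl hf (z, g) (δz, 0) = τ ↔
      (∀ᵐ t ∂I.μ, δz.y.1.der t = (lqData hl hf hS).K t (traj δz.y t) + τ.1 t) ∧
      δz.y.1.val I.t₀ = τ.2.1 ∧
      (∀ᵐ t ∂I.μ, ∀ ξ, ⟪δz.lam.der t, ξ⟫ =
        -((lqData hl hf hS).M t (ξ, 0, 0) (traj δz.y t) +
        ⟪δz.lam.val t, (lqData hl hf hS).K t (ξ, 0, 0)⟫) + τ.2.2.1 t ξ) ∧
      (∀ ξ, ⟪δz.lam.val I.tf, ξ⟫ =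
        (lqData hl hf hS).Q (final δz.y) (ξ, 0) + τ.2.2.2.1 ξ) ∧
      (∀ᵐ t ∂I.μ, ∀ υ, (lqData hl hf hS).M t (0, υ, 0) (traj δz.y t) +
        ⟪δz.lam.val t, (lqData hl hf hS).K t (0, υ, 0)⟫ = τ.2.2.2.2.1 t υ) ∧
      ∀ π, (lqData hl hf hS).Q (final δz.y) (0, π) +
        ∫ t, ((lqData hl hf hS).M t (0, 0, π) (traj δz.y t) +
          ⟪δz.lam.val t, (lqData hl hf hS).K t (0, 0, π)⟫) ∂I.μ = τ.2.2.2.2.2 π := by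
  have hK : ∀ᵐ t ∂I.μ, (lqData hl hf hS).K t = P.ABC g z t := totDOp_ABC_ae hf g z
  have hM : ∀ᵐ t ∂I.μ, ∀ a b, (lqData hl hf hS).M t a b = P.Hyy g z t a b := by
    filter_upwards [hessOp_ae hl hf (z, g)] with t e1 a b
    rw [lqData, e1]
    rfl
  rw [kktDeriv_left_eq_iff hφ]
  refine and_congr ?_ (and_congr Iff.rfl (and_congr ?_ (and_congr Iff.rfl (and_congr ?_ ?_))))
  · refine eventually_congr (hK.mono fun t ht => ?_)
    rw [ht]
  · refine eventually_congr ((hK.and hM).mono fun t ht => ?_)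
    simp only [ht.1, ht.2]
  · refine eventually_congr ((hK.and hM).mono fun t ht => ?_)
    simp only [ht.1, ht.2]
  · refine forall_congr' fun π => ?_
    have h : ∫ t, (P.Hyy g z t (0, 0, π) (traj δz.y t) +
          ⟪δz.lam.val t, P.ABC g z t (0, 0, π)⟫) ∂I.μ =
        ∫ t, ((lqData hl hf hS).M t (0, 0, π) (traj δz.y t) +
          ⟪δz.lam.val t, (lqData hl hf hS).K t (0, 0, π)⟫) ∂I.μ :=
      integral_congr_ae ((hK.and hM).mono fun t ht => by simp only [ht.1, ht.2])
    rw [h]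
    rfl

theorem completeSpace_KKTSp : CompleteSpace (KKTSp I nx nu np) := by
  have h1 : CompleteSpace (E nx →L[ℝ] ℝ) := inferInstance
  have h2 : CompleteSpace (E nu →L[ℝ] ℝ) := inferInstance
  have h3 : CompleteSpace (E np →L[ℝ] ℝ) := inferInstance
  have h4 : CompleteSpace (Lp (E nx →L[ℝ] ℝ) ⊤ I.μ) := inferInstance
  have h5 : CompleteSpace (Lp (E nu →L[ℝ] ℝ) ⊤ I.μ) := inferInstance
  have h6 : CompleteSpace (Lp (E nx) ⊤ I.μ) := inferInstance
  have h7 : CompleteSpace (Lp (E nu →L[ℝ] ℝ) ⊤ I.μ × (E np →L[ℝ] ℝ)) := CompleteSpace.prod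
  have h8 : CompleteSpace ((E nx →L[ℝ] ℝ) × Lp (E nu →L[ℝ] ℝ) ⊤ I.μ × (E np →L[ℝ] ℝ)) :=
    CompleteSpace.prod
  have h9 : CompleteSpace (Lp (E nx →L[ℝ] ℝ) ⊤ I.μ × (E nx →L[ℝ] ℝ) ×
    Lp (E nu →L[ℝ] ℝ) ⊤ I.μ × (E np →L[ℝ] ℝ)) := CompleteSpace.prod
  have h10 : CompleteSpace (E nx × Lp (E nx →L[ℝ] ℝ) ⊤ I.μ × (E nx →L[ℝ] ℝ) ×
    Lp (E nu →L[ℝ] ℝ) ⊤ I.μ × (E np →L[ℝ] ℝ)) := CompleteSpace.prod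
  exact CompleteSpace.prod

theorem completeSpace_ZSp : CompleteSpace (ZSp I nx nu np) := by
  have h4 : CompleteSpace (W1 I ⊤ nx) := inferInstance
  have h7 : CompleteSpace (E np × W1 I ⊤ nx) := CompleteSpace.prod
  have h8 : CompleteSpace (LSp I ⊤ nu × E np × W1 I ⊤ nx) := CompleteSpace.prod
  exact CompleteSpace.prod

/-- Under the second-order sufficient condition the linearized optimality system is uniquely
solvable for every right-hand side. -/
theorem exists_kktDeriv_equiv (hφ : ContDiff ℝ 2 P.φ) (hl : Smooth I P.l) (hf : Smooth I P.f)
    {g : G3 I nx nu np ng} {z : ZSp I nx nu np} (hS : P.SSOC g z) :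
    ∃ e : ZSp I nx nu np ≃L[ℝ] KKTSp I nx nu np, ∀ δz, e δz = kktDeriv hl hf (z, g) (δz, 0) := by
  let T : ZSp I nx nu np →L[ℝ] KKTSp I nx nu np :=
    (kktDeriv hl hf (z, g)).comp (ContinuousLinearMap.inl ℝ _ _)
  have hT : ∀ δz, T δz = kktDeriv hl hf (z, g) (δz, 0) := fun _ => rfl
  have hker : T.ker = ⊥ := by
    rw [LinearMap.ker_eq_bot']
    intro δz h
    obtain ⟨h1, h2, h3, h4, h5, h6⟩ :=
      (kktDeriv_left_eq_iff_lqData hφ hl hf hS δz 0).1 ((hT δz).symm.trans h)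
    have h01 : ∀ᵐ t ∂I.μ, (0 : Lp (E nx) ⊤ I.μ) t = 0 := Lp.coeFn_zero _ _ _
    have h03 : ∀ᵐ t ∂I.μ, (0 : Lp (E nx →L[ℝ] ℝ) ⊤ I.μ) t = 0 := Lp.coeFn_zero _ _ _
    have h05 : ∀ᵐ t ∂I.μ, (0 : Lp (E nu →L[ℝ] ℝ) ⊤ I.μ) t = 0 := Lp.coeFn_zero _ _ _
    refine (lqData hl hf hS).eq_zero_of_homogeneous ?_ h2 ?_ ?_ ?_ h6
    · filter_upwards [h1, h01] with t e1 e2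
      rw [e1]
      exact (congrArg _ e2).trans (add_zero _)
    · filter_upwards [h3, h03] with t e1 e2 ξ
      rw [e1]
      exact (congrArg _ (congrArg (fun T : E nx →L[ℝ] ℝ => T ξ) e2)).trans (add_zero _)
    · intro ξ
      exact (h4 ξ).trans (add_zero _)
    · filter_upwards [h5, h05] with t e1 e2 υ
      rw [e1]
      exact congrArg (fun T : E nu →L[ℝ] ℝ => T υ) e2
  have hrange : T.range = ⊤ := by
    rw [LinearMap.range_eq_top]
    rintro τ
    obtain ⟨δz, h⟩ := (lqData hl hf hS).exists_solution τ.1 τ.2.1 τ.2.2.1 τ.2.2.2.1 τ.2.2.2.2.1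
      τ.2.2.2.2.2
    exact ⟨δz, (kktDeriv_left_eq_iff_lqData hφ hl hf hS δz τ).2 h⟩
  have := completeSpace_KKTSp (I := I) (nx := nx) (nu := nu) (np := np)
  have := completeSpace_ZSp (I := I) (nx := nx) (nu := nu) (np := np)
  -- the inverse is bounded by the open mapping theorem
  exact ⟨ContinuousLinearEquiv.ofBijective T hker hrange, fun δz => rfl⟩

end OCP

end SecondOrder

end OCPSens

namespace OCPSens

/-! ### Coercivity along perturbed trajectories -/

attribute [local instance] W1.instNormed W1.instNormedSp

/-- A bilinear form that is coercive at `v₀` is coercive at all `v` with small relative distance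
to `v₀`. -/
theorem coercive_of_near {V : Type*} [NormedAddCommGroup V] [NormedSpace ℝ V]
    (B : V →L[ℝ] V →L[ℝ] ℝ) {ε θ : ℝ} {v v₀ : V} (hB : ε * ‖v₀‖ ^ 2 ≤ B v₀ v₀) (hε : 0 ≤ ε)
    (hθ' : θ ≤ 1 / 2) (hθB : 20 * θ * ‖B‖ ≤ ε) (h : ‖v - v₀‖ ≤ θ * ‖v‖) :
    ε / 8 * ‖v‖ ^ 2 ≤ B v v := by
  have hv := norm_nonneg v
  have h1 : θ * ‖v‖ ≤ 1 / 2 * ‖v‖ := mul_le_mul_of_nonneg_right hθ' hv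
  have h2 : ‖v‖ / 2 ≤ ‖v₀‖ := by
    have := norm_le_norm_add_norm_sub' v v₀
    linarith
  have h3 : ‖v₀‖ ≤ 3 / 2 * ‖v‖ := by
    have := norm_le_norm_add_norm_sub v v₀
    linarith
  have h4 : ε * (‖v‖ / 2) ^ 2 ≤ ε * ‖v₀‖ ^ 2 := by gcongr
  have e1 : B v v = B v₀ v₀ + B (v - v₀) v + B v₀ (v - v₀) := by
    simp only [map_sub, sub_apply]
    ring
  have h5 : ‖B (v - v₀) v‖ ≤ ‖B‖ * (θ * ‖v‖) * ‖v‖ :=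
    (B.le_opNorm₂ _ _).trans (by gcongr)
  have h6 : ‖B v₀ (v - v₀)‖ ≤ ‖B‖ * (3 / 2 * ‖v‖) * (θ * ‖v‖) :=
    (B.le_opNorm₂ _ _).trans (by gcongr)
  -- the two cross terms sum to at most `(5 / 2) θ ‖B‖ ‖v‖²`, which is `ε / 8 ‖v‖²` by `hθB`, and the
  -- main term is at least `ε / 4 ‖v‖²`
  have h7 := neg_le_of_abs_le h5
  have h8 := neg_le_of_abs_le h6
  have h9 : 20 * θ * ‖B‖ * ‖v‖ ^ 2 ≤ ε * ‖v‖ ^ 2 := by gcongr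
  nlinarith

/-- A bilinear form that is coercive along a linear map is coercive near the range of the map. -/
theorem exists_coercive_of_near {V W : Type*} [NormedAddCommGroup V] [NormedSpace ℝ V]
    [NormedAddCommGroup W] [NormedSpace ℝ W] (B : V →L[ℝ] V →L[ℝ] ℝ) (L : W →L[ℝ] V) {c : ℝ}
    (hc : 0 < c) (hcoer : ∀ w, c * ‖w‖ * ‖w‖ ≤ B (L w) (L w)) :
    ∃ ε > 0, ∃ η > 0, ∀ v w, ‖v - L w‖ ≤ η * ‖v‖ → ε * ‖v‖ ^ 2 ≤ B v v := by
  set ε := c / (‖L‖ ^ 2 + 1) with hε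
  have hε0 : 0 < ε := by positivity
  have hBL : ∀ w, ε * ‖L w‖ ^ 2 ≤ B (L w) (L w) := fun w => by
    refine le_trans ?_ (hcoer w)
    have h2 : ‖L w‖ ^ 2 ≤ (‖L‖ ^ 2 + 1) * ‖w‖ ^ 2 := by
      have h3 := pow_le_pow_left₀ (norm_nonneg _) (L.le_opNorm w) 2
      nlinarith [sq_nonneg ‖w‖]
    calc ε * ‖L w‖ ^ 2 ≤ ε * ((‖L‖ ^ 2 + 1) * ‖w‖ ^ 2) := by gcongr
      _ = c * ‖w‖ * ‖w‖ := by rw [hε]; field_simp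
  set η := min (1 / 2) (ε / (20 * ‖B‖ + 1)) with hη
  have hη0 : 0 < η := lt_min (by norm_num) (by positivity)
  have hη2 : 20 * η * ‖B‖ ≤ ε := by
    have h1 : η ≤ ε / (20 * ‖B‖ + 1) := min_le_right _ _
    rw [le_div_iff₀ (by positivity)] at h1
    nlinarith
  exact ⟨ε / 8, by positivity, η, hη0, fun v w h =>
    coercive_of_near B (hBL w) hε0.le (min_le_left _ _) hη2 h⟩

section Perturbation

variable {I : TimeInterval} {nx nu np : ℕ}

/-- The space of pairs of square integrable trajectories and final values. -/
abbrev TrajSp (I : TimeInterval) (nx nu np : ℕ) : Type :=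
  Lp (YVec nx nu np) 2 I.μ × (E nx × E np)

/-- Trajectory and final values of `y`, as a bounded linear map. -/
noncomputable def trajFinal (I : TimeInterval) (nx nu np : ℕ) :
    YSp I ⊤ nx nu np →L[ℝ] TrajSp I nx nu np :=
  ((Lp.incl le_top).comp (trajL I ⊤ nx nu np)).prod (finalL I ⊤ nx nu np)

/-- Trajectory and final values of a triple `(x, 0, 0)`, as a bounded linear map. -/
noncomputable def stateExt (I : TimeInterval) (nx nu np : ℕ) :
    C(Icc I.t₀ I.tf, E nx) →L[ℝ] TrajSp I nx nu np :=
  (((inX nx nu np).compLpL 2 I.μ).comp ((Lp.incl le_top).comp (contL I nx))).prod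
    ((ContinuousLinearMap.inl ℝ (E nx) (E np)).comp
      (ContinuousMap.evalCLM ℝ (⟨I.tf, I.right_mem⟩ : Icc I.t₀ I.tf)))

/-- The control and the parameter of `y`. -/
noncomputable def ctrlOf (y : YSp I ⊤ nx nu np) : CtrlSp I nu np :=
  WithLp.toLp 2 (Lp.incl le_top y.2.1, y.2.2)

/-- The action of essentially bounded Hessians on square integrable functions. -/
noncomputable def hessL (I : TimeInterval) (V : Type) [NormedAddCommGroup V] [NormedSpace ℝ V] :
    Lp (V →L[ℝ] V →L[ℝ] ℝ) ⊤ I.μ →L[ℝ] Lp V 2 I.μ →L[ℝ] Lp (V →L[ℝ] ℝ) 2 I.μ :=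
  (ContinuousLinearMap.id ℝ (V →L[ℝ] V →L[ℝ] ℝ)).holderL I.μ ⊤ 2 2

/-- `∫ M(w, w) dt + Q(b, b)` for `(w, b)` in `TrajSp`, as a bilinear form. -/
noncomputable def quadForm (I : TimeInterval) (nx nu np : ℕ)
    (M : Lp (YVec nx nu np →L[ℝ] YVec nx nu np →L[ℝ] ℝ) ⊤ I.μ)
    (Q : (E nx × E np) →L[ℝ] (E nx × E np) →L[ℝ] ℝ) :
    TrajSp I nx nu np →L[ℝ] TrajSp I nx nu np →L[ℝ] ℝ :=
  (pairL I (YVec nx nu np)).bilinearComp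
      ((hessL I (YVec nx nu np) M).comp (ContinuousLinearMap.fst ℝ _ _))
      (ContinuousLinearMap.fst ℝ _ _) +
    Q.bilinearComp (ContinuousLinearMap.snd ℝ _ _) (ContinuousLinearMap.snd ℝ _ _)

theorem quadForm_apply (M : Lp (YVec nx nu np →L[ℝ] YVec nx nu np →L[ℝ] ℝ) ⊤ I.μ)
    (Q : (E nx × E np) →L[ℝ] (E nx × E np) →L[ℝ] ℝ) (v w : TrajSp I nx nu np) :
    quadForm I nx nu np M Q v w =
      pairL I (YVec nx nu np) (hessL I (YVec nx nu np) M v.1) w.1 + Q v.2 w.2 := rfl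

theorem trajFinal_sub_eq (K : Lp (YVec nx nu np →L[ℝ] E nx) ⊤ I.μ) (y : YSp I ⊤ nx nu np) :
    trajFinal I nx nu np y - ((linTraj K).prod (linFinal K)) (ctrlOf y) =
      stateExt I nx nu np (W1.valL I 2 nx (W1.incl 2 y.1 - linState K (ctrlOf y))) := by
  set e := W1.incl 2 y.1 - linState K (ctrlOf y) with he
  have hv : W1.valL I 2 nx e = W1.valL I ⊤ nx y.1 - W1.valL I 2 nx (linState K (ctrlOf y)) :=
    map_sub _ _ _
  refine Prod.ext ?_ (Prod.ext ?_ ?_)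
  · change Lp.incl le_top (trajL I ⊤ nx nu np y) - linTraj K (ctrlOf y) =
      (inX nx nu np).compLpL 2 I.μ (Lp.incl le_top (contL I nx (W1.valL I 2 nx e)))
    have e1 : (inX nx nu np).compLpL 2 I.μ (Lp.incl le_top (contL I nx (W1.valL I 2 nx e))) =
        (inX nx nu np).compLpL 2 I.μ (Lp.incl le_top (contL I nx (W1.valL I ⊤ nx y.1))) -
        (inX nx nu np).compLpL 2 I.μ (Lp.incl le_top (contL I nx (linStateL K (ctrlOf y)))) := by
      rw [hv, map_sub, map_sub, map_sub, valL_linState]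
    have e2 : Lp.incl (le_top : (2 : ℝ≥0∞) ≤ ⊤) (trajL I ⊤ nx nu np y) =
        (inX nx nu np).compLpL 2 I.μ (Lp.incl le_top (contL I nx (W1.valL I ⊤ nx y.1))) +
        ctrlTraj I nx nu np (ctrlOf y) := by
      refine Lp.ext ?_
      filter_upwards [Lp.incl_ae (le_top : (2 : ℝ≥0∞) ≤ ⊤) (trajL I ⊤ nx nu np y), trajL_ae y,
        Lp.coeFn_add ((inX nx nu np).compLpL 2 I.μ
          (Lp.incl (le_top : (2 : ℝ≥0∞) ≤ ⊤) (contL I nx (W1.valL I ⊤ nx y.1))))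
          (ctrlTraj I nx nu np (ctrlOf y)),
        compLpL_ae (inX nx nu np)
          (Lp.incl (le_top : (2 : ℝ≥0∞) ≤ ⊤) (contL I nx (W1.valL I ⊤ nx y.1))),
        Lp.incl_ae (le_top : (2 : ℝ≥0∞) ≤ ⊤) (contL I nx (W1.valL I ⊤ nx y.1)),
        W1.contL_valL_ae y.1, ctrlTraj_ae (nx := nx) (ctrlOf y),
        Lp.incl_ae (le_top : (2 : ℝ≥0∞) ≤ ⊤) y.2.1] with t h1 h2 h3 h4 h5 h6 h7 h8
      have h9 : ctrlU I nu np (ctrlOf y) t = y.2.1 t := h8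
      have h10 : ctrlP I nu np (ctrlOf y) = y.2.2 := rfl
      rw [h1, h2, h3, Pi.add_apply, h4, h5, h6, h7, h9, h10, inX_apply]
      simp [traj]
    have e3 : linTraj K (ctrlOf y) =
        (inX nx nu np).compLpL 2 I.μ (Lp.incl le_top (contL I nx (linStateL K (ctrlOf y)))) +
        ctrlTraj I nx nu np (ctrlOf y) := rfl
    rw [e1, e2, e3, add_sub_add_right_eq_sub]
  · change (finalL I ⊤ nx nu np y).1 - linStateL K (ctrlOf y) ⟨I.tf, I.right_mem⟩ =
      W1.valL I 2 nx e ⟨I.tf, I.right_mem⟩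
    rw [hv, valL_linState, finalL_apply, final, W1.val_of_mem _ I.right_mem]
    rfl
  · exact sub_self y.2.2

/-- A trajectory satisfying the linearized state equation up to `r` is close to a solution of this
equation. -/
theorem exists_norm_trajFinal_sub_le (K : Lp (YVec nx nu np →L[ℝ] E nx) ⊤ I.μ) :
    ∃ C, 0 ≤ C ∧ ∀ (y : YSp I ⊤ nx nu np) (r : Lp (E nx) 2 I.μ), y.1.val I.t₀ = 0 →
      (∀ᵐ t ∂I.μ, y.1.der t = K t (traj y t) + r t) →
      ‖trajFinal I nx nu np y - ((linTraj K).prod (linFinal K)) (ctrlOf y)‖ ≤ C * ‖r‖ := by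
  obtain ⟨C, hC, h⟩ := exists_norm_valL_le (p := 2) (stateCoeff K)
  refine ⟨‖stateExt I nx nu np‖ * C, by positivity, fun y r h0 hy => ?_⟩
  rw [trajFinal_sub_eq, mul_assoc]
  refine (ContinuousLinearMap.le_opNorm _ _).trans (mul_le_mul_of_nonneg_left ?_ (norm_nonneg _))
  have h1 : ∀ t, (W1.incl 2 y.1 - linState K (ctrlOf y)).val t =
      y.1.val t - (linState K (ctrlOf y)).val t := fun t => rfl
  refine h _ r ?_ ?_
  · rw [h1, h0, linState, odeSol_init, sub_zero]
  · filter_upwards [hy, linState_der K (ctrlOf y), W1.incl_der (p := 2) y.1, stateCoeff_ae K,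
      Lp.coeFn_sub (W1.derL I 2 nx (W1.incl 2 y.1)) (W1.derL I 2 nx (linState K (ctrlOf y))),
      Lp.incl_ae (le_top : (2 : ℝ≥0∞) ≤ ⊤) y.2.1] with t e1 e2 e3 e4 e5 e6
    have e7 : (W1.incl 2 y.1 - linState K (ctrlOf y)).der t =
      (W1.incl 2 y.1).der t - (linState K (ctrlOf y)).der t := e5
    have e8 : ctrlU I nu np (ctrlOf y) t = y.2.1 t := e6
    have e9 : ctrlP I nu np (ctrlOf y) = y.2.2 := rfl
    have e10 : traj y t = (y.1.val t, 0, 0) + ((0, y.2.1 t, y.2.2) : YVec nx nu np) := by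
      simp [traj]
    have e11 : ((y.1.val t - (linState K (ctrlOf y)).val t, 0, 0) : YVec nx nu np) =
        (y.1.val t, 0, 0) - ((linState K (ctrlOf y)).val t, 0, 0) := by
      simp
    rw [e7, e3, e1, e2, e4, h1, e8, e9, e10, e11, map_add, map_sub]
    abel

namespace LQData

variable (D : LQData I nx nu np)

/-- The quadratic form of the problem is coercive on trajectories that satisfy the linearized state
equation up to a relatively small error. -/
theorem exists_coercive_near : ∃ ε > 0, ∃ θ > 0, ∀ (y : YSp I ⊤ nx nu np) (r : Lp (E nx) 2 I.μ),
    y.1.val I.t₀ = 0 → (∀ᵐ t ∂I.μ, y.1.der t = D.K t (traj y t) + r t) →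
    ‖r‖ ≤ θ * ‖trajFinal I nx nu np y‖ → ε * ‖trajFinal I nx nu np y‖ ^ 2 ≤
      quadForm I nx nu np D.M D.Q (trajFinal I nx nu np y) (trajFinal I nx nu np y) := by
  obtain ⟨c, hc, hcoer⟩ := D.isCoercive_bilin
  obtain ⟨C, hC, hr⟩ := exists_norm_trajFinal_sub_le D.K
  obtain ⟨ε, hε, η, hη, h⟩ := exists_coercive_of_near (V := TrajSp I nx nu np)
    (quadForm I nx nu np D.M D.Q) ((linTraj D.K).prod (linFinal D.K)) hc hcoer
  refine ⟨ε, hε, η / (C + 1), by positivity, fun y r h0 hy hrle => ?_⟩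
  refine h _ (ctrlOf y) ((hr y r h0 hy).trans ?_)
  have h1 : C * ‖r‖ ≤ C * (η / (C + 1) * ‖trajFinal I nx nu np y‖) :=
    mul_le_mul_of_nonneg_left hrle hC
  refine h1.trans ?_
  rw [← mul_assoc]
  refine mul_le_mul_of_nonneg_right ?_ (norm_nonneg _)
  rw [mul_div_assoc', div_le_iff₀ (by positivity)]
  nlinarith

end LQData

end Perturbation

end OCPSens

namespace OCPSens

/-! ### The Lagrangian along line segments -/

attribute [local instance] W1.instNormed W1.instNormedSp

section LineDerivatives

/-- A function with nonnegative second derivative lies above its tangent. -/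
theorem deriv_zero_le_sub_of_second_deriv_nonneg {F F' F'' : ℝ → ℝ}
    (h : ∀ s, HasDerivAt F (F' s) s) (h' : ∀ s, HasDerivAt F' (F'' s) s)
    (h'' : ∀ s ∈ Icc (0 : ℝ) 1, 0 ≤ F'' s) : F' 0 ≤ F 1 - F 0 := by
  obtain ⟨c, hc, e⟩ := exists_hasDerivAt_eq_slope F F' zero_lt_one
    (fun s _ => (h s).continuousAt.continuousWithinAt) fun s _ => h s
  obtain ⟨d, hd, e'⟩ := exists_hasDerivAt_eq_slope F' F'' hc.1
    (fun s _ => (h' s).continuousAt.continuousWithinAt) fun s _ => h' s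
  have h1 := h'' d ⟨hd.1.le, hd.2.le.trans hc.2.le⟩
  rw [e', sub_zero, le_div_iff₀ hc.1] at h1
  rw [sub_zero, div_one] at e
  linarith

variable {A B C X : Type*} [NormedAddCommGroup A] [NormedSpace ℝ A] [NormedAddCommGroup B]
  [NormedSpace ℝ B] [NormedAddCommGroup C] [NormedSpace ℝ C] [NormedAddCommGroup X]
  [NormedSpace ℝ X]

theorem hasDerivAt_line {F : A → B} (hF : Differentiable ℝ F) (a b : A) (s : ℝ) :
    HasDerivAt (fun s : ℝ => F (a + s • b)) (fderiv ℝ F (a + s • b) b) s := by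
  have h : HasDerivAt (fun s : ℝ => a + s • b) b s := by
    simpa using ((hasDerivAt_id s).smul_const b).const_add a
  exact (hF _).hasFDerivAt.comp_hasDerivAt s h

theorem hasDerivAt_line_left {F : A × X → B} (hF : Differentiable ℝ F) (a b : A) (x : X) (s : ℝ) :
    HasDerivAt (fun s : ℝ => F (a + s • b, x)) (fderiv ℝ F (a + s • b, x) (b, 0)) s := by
  have h := hasDerivAt_line hF (a, x) (b, 0) s
  simpa using h

theorem hasDerivAt_clm_line_left {F : A × X → B} (hF : Differentiable ℝ F) (J : B →L[ℝ] C)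
    (a b : A) (x : X) (s : ℝ) : HasDerivAt (fun s : ℝ => J (F (a + s • b, x)))
      (J (fderiv ℝ F (a + s • b, x) (b, 0))) s :=
  J.hasFDerivAt.comp_hasDerivAt s (hasDerivAt_line_left hF a b x s)

theorem hasDerivAt_fderiv_line {f : A → ℝ} (hf : ContDiff ℝ 2 f) (a b : A) (s : ℝ) :
    HasDerivAt (fun s : ℝ => fderiv ℝ f (a + s • b) b)
      (fderiv ℝ (fderiv ℝ f) (a + s • b) b b) s := by
  have h := hasDerivAt_line ((hf.fderiv_right (m := 1) (by norm_num)).differentiable one_ne_zero)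
    a b s
  exact ((ContinuousLinearMap.apply ℝ ℝ b).hasFDerivAt.comp_hasDerivAt s h)

/-- Mean value inequality along a segment, relative to a linear approximation. -/
theorem norm_sub_sub_le_of_line {F : A × X → B} (hF : Differentiable ℝ F) (J : B →L[ℝ] C)
    (a b : A) (x : X) (c : C) {κ : ℝ}
    (h : ∀ s ∈ Icc (0 : ℝ) 1, ‖J (fderiv ℝ F (a + s • b, x) (b, 0)) - c‖ ≤ κ) :
    ‖J (F (a + b, x)) - J (F (a, x)) - c‖ ≤ κ := by
  have h1 : ∀ s : ℝ, HasDerivAt (fun s : ℝ => J (F (a + s • b, x)) - s • c)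
      (J (fderiv ℝ F (a + s • b, x) (b, 0)) - c) s := fun s => by
    have h2 := (hasDerivAt_id s).smul_const c
    rw [one_smul] at h2
    exact (hasDerivAt_clm_line_left hF J a b x s).sub h2
  have h3 := norm_image_sub_le_of_norm_deriv_le_segment_01'
    (fun s _ => (h1 s).hasDerivWithinAt) (fun s hs => h s ⟨hs.1, hs.2.le⟩)
  have h4 : J (F (a + (1 : ℝ) • b, x)) - (1 : ℝ) • c - (J (F (a + (0 : ℝ) • b, x)) - (0 : ℝ) • c) =
      J (F (a + b, x)) - J (F (a, x)) - c := by
    rw [one_smul, one_smul, zero_smul, zero_smul, add_zero, sub_zero]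
    abel
  rwa [h4] at h3

end LineDerivatives

section Lagrangian

variable {I : TimeInterval} {nx nu np ng : ℕ} {P : OCP nx nu np ng}

/-- The inclusion `y ↦ (y, 0)`. -/
noncomputable def inY (I : TimeInterval) (nx nu np : ℕ) :
    YSp I ⊤ nx nu np →L[ℝ] ZSp I nx nu np :=
  (ContinuousLinearMap.fst ℝ _ _).prod
    (((ContinuousLinearMap.fst ℝ _ _).comp (ContinuousLinearMap.snd ℝ _ _)).prod
      (((ContinuousLinearMap.snd ℝ _ _).comp (ContinuousLinearMap.snd ℝ _ _)).prod 0))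

theorem add_smul_inY_y (z : ZSp I nx nu np) (w : YSp I ⊤ nx nu np) (s : ℝ) :
    (z + s • inY I nx nu np w).y = z.y + s • w := rfl

theorem add_smul_inY_lam_val (z : ZSp I nx nu np) (w : YSp I ⊤ nx nu np) (s t : ℝ) :
    (z + s • inY I nx nu np w).lam.val t = z.lam.val t := by
  have h : (z + s • inY I nx nu np w).lam = z.lam + s • (0 : W1 I ⊤ nx) := rfl
  rw [h, smul_zero, add_zero]

/-- `v ↦ ∫ ⟪λ, v⟫ dt`. -/
noncomputable def costatePair (z : ZSp I nx nu np) : Lp (E nx) ⊤ I.μ →L[ℝ] ℝ :=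
  (intL I ℝ).comp ((ContinuousLinearMap.id ℝ (E nx →L[ℝ] ℝ)).holderL I.μ ⊤ ⊤ ⊤
    (costateL I nx nu np z))

theorem costatePair_ae (z : ZSp I nx nu np) (v : Lp (E nx) ⊤ I.μ) :
    ∀ᵐ t ∂I.μ, (ContinuousLinearMap.id ℝ (E nx →L[ℝ] ℝ)).holderL I.μ ⊤ ⊤ ⊤
      (costateL I nx nu np z) v t = ⟪z.lam.val t, v t⟫ := by
  filter_upwards [holderL_ae (ContinuousLinearMap.id ℝ (E nx →L[ℝ] ℝ)) (r := ⊤)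
    (costateL I nx nu np z) v, costateL_ae z] with t h1 h2
  rw [h1, h2]
  rfl

/-- `h ↦ ∫ h(t) w(t) dt`, for the trajectory `w(t)` of `w`. -/
noncomputable def trajPair (w : YSp I ⊤ nx nu np) : Lp (YVec nx nu np →L[ℝ] ℝ) ⊤ I.μ →L[ℝ] ℝ :=
  (intL I ℝ).comp (((ContinuousLinearMap.id ℝ (YVec nx nu np →L[ℝ] ℝ)).holderL I.μ ⊤ ⊤ ⊤).flip
    (trajL I ⊤ nx nu np w))

theorem trajPair_ae (w : YSp I ⊤ nx nu np) (h : Lp (YVec nx nu np →L[ℝ] ℝ) ⊤ I.μ) :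
    ∀ᵐ t ∂I.μ, (ContinuousLinearMap.id ℝ (YVec nx nu np →L[ℝ] ℝ)).holderL I.μ ⊤ ⊤ ⊤ h
      (trajL I ⊤ nx nu np w) t = h t (traj w t) := by
  filter_upwards [holderL_ae (ContinuousLinearMap.id ℝ (YVec nx nu np →L[ℝ] ℝ)) (r := ⊤) h
    (trajL I ⊤ nx nu np w), trajL_ae w] with t h1 h2
  rw [h1, h2]
  rfl

theorem trajPair_apply (w : YSp I ⊤ nx nu np) (h : Lp (YVec nx nu np →L[ℝ] ℝ) ⊤ I.μ) :
    trajPair w h = ∫ t, h t (traj w t) ∂I.μ :=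
  (intL_apply _).trans (integral_congr_ae (trajPair_ae w h))

namespace OCP

/-- The Lagrangian with costate `λ` along the line through `z.y` with direction `w`, up to the term
that is linear in `x'`. -/
noncomputable def lagr (hl : Smooth I P.l) (hf : Smooth I P.f) (z : ZSp I nx nu np)
    (g : G3 I nx nu np ng) (w : YSp I ⊤ nx nu np) (s : ℝ) : ℝ :=
  P.φ (final z.y + s • final w)
    + intL I ℝ (compOp hl (trajL I ⊤ nx nu np z.y + s • trajL I ⊤ nx nu np w, g))
    + costatePair z (compOp hf (trajL I ⊤ nx nu np z.y + s • trajL I ⊤ nx nu np w, g))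

/-- The derivative of `lagr`. -/
noncomputable def lagrDeriv (hl : Smooth I P.l) (hf : Smooth I P.f) (z : ZSp I nx nu np)
    (g : G3 I nx nu np ng) (w : YSp I ⊤ nx nu np) (s : ℝ) : ℝ :=
  fderiv ℝ P.φ (final z.y + s • final w) (final w)
    + trajPair w (hamOp hl hf (z + s • inY I nx nu np w, g))

/-- The pairing of the linearized cost and the linearized dynamics with the costate of `z'`. -/
theorem intL_add_costatePair (hl : Smooth I P.l) (hf : Smooth I P.f) {z z' : ZSp I nx nu np}
    (h : ∀ t, z'.lam.val t = z.lam.val t) (g : G3 I nx nu np ng) (w : YSp I ⊤ nx nu np) :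
    intL I ℝ (fderiv ℝ (compOp hl) (trajL I ⊤ nx nu np z'.y, g) (trajL I ⊤ nx nu np w, 0)) +
      costatePair z (fderiv ℝ (compOp hf) (trajL I ⊤ nx nu np z'.y, g)
        (trajL I ⊤ nx nu np w, 0)) = trajPair w (hamOp hl hf (z', g)) := by
  refine (map_add (intL I ℝ) _ _).symm.trans (congrArg (intL I ℝ) (Lp.ext ?_))
  refine (Lp.coeFn_add _ _).trans ?_
  filter_upwards [costatePair_ae z (fderiv ℝ (compOp hf) (trajL I ⊤ nx nu np z'.y, g)
      (trajL I ⊤ nx nu np w, 0)), trajPair_ae w (hamOp hl hf (z', g)),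
    fderiv_compOp_traj_left_ae hl z'.y w g, fderiv_compOp_traj_left_ae hf z'.y w g,
    hamOp_ae hl hf z' g] with t e2 e3 e4 e5 e6
  refine Eq.trans ?_ (e3.trans (e6 _)).symm
  exact (congrArg₂ (· + ·) e4 (e2.trans (congrArg₂ (fun a b => ⟪a, b⟫) (h t).symm e5))).trans
    (add_comm _ _)

theorem hasDerivAt_lagr (hφ : ContDiff ℝ 2 P.φ) (hl : Smooth I P.l) (hf : Smooth I P.f)
    (z : ZSp I nx nu np) (g : G3 I nx nu np ng) (w : YSp I ⊤ nx nu np) (s : ℝ) :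
    HasDerivAt (lagr hl hf z g w) (lagrDeriv hl hf z g w s) s := by
  have h1 := hasDerivAt_line (hφ.differentiable two_ne_zero) (final z.y) (final w) s
  have h2 := hasDerivAt_clm_line_left (A := Lp (YVec nx nu np) ⊤ I.μ) (X := G3 I nx nu np ng)
    ((contDiff_compOp hl).differentiable one_ne_zero) (intL I ℝ) (trajL I ⊤ nx nu np z.y)
    (trajL I ⊤ nx nu np w) g s
  have h3 := hasDerivAt_clm_line_left (A := Lp (YVec nx nu np) ⊤ I.μ) (X := G3 I nx nu np ng)
    ((contDiff_compOp hf).differentiable one_ne_zero) (costatePair z) (trajL I ⊤ nx nu np z.y)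
    (trajL I ⊤ nx nu np w) g s
  refine ((h1.add h2).add h3).congr_deriv ((add_assoc _ _ _).trans (congrArg (_ + ·) ?_))
  have e0 : trajL I ⊤ nx nu np z.y + s • trajL I ⊤ nx nu np w =
      trajL I ⊤ nx nu np (z + s • inY I nx nu np w).y :=
    ((congrArg _ (add_smul_inY_y z w s)).trans ((map_add _ _ _).trans
      (congrArg (_ + ·) (map_smul _ _ _)))).symm
  rw [e0]
  exact intL_add_costatePair hl hf (add_smul_inY_lam_val z w s) g w

theorem quadForm_trajFinal (M : Lp (YVec nx nu np →L[ℝ] YVec nx nu np →L[ℝ] ℝ) ⊤ I.μ)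
    (Q : (E nx × E np) →L[ℝ] (E nx × E np) →L[ℝ] ℝ) (w : YSp I ⊤ nx nu np) :
    quadForm I nx nu np M Q (trajFinal I nx nu np w) (trajFinal I nx nu np w) =
      Q (final w) (final w) + ∫ t, M t (traj w t) (traj w t) ∂I.μ := by
  have e1 : (trajFinal I nx nu np w).2 = final w := finalL_apply w
  refine (quadForm_apply M Q _ _).trans ((add_comm _ _).trans
    (congrArg₂ (· + ·) (congrArg₂ (fun a b => Q a b) e1 e1)
      (Eq.trans (pairL_apply _ _) (integral_congr_ae ?_))))
  filter_upwards [id_holderL_ae M (Lp.incl le_top (trajL I ⊤ nx nu np w)),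
    Lp.incl_ae (le_top : (2 : ℝ≥0∞) ≤ ⊤) (trajL I ⊤ nx nu np w), trajL_ae w] with t a1 a2 a3
  have a4 := a2.trans a3
  exact (congrArg _ a4).trans (DFunLike.congr_fun (a1.trans (congrArg (M t) a4)) _)

theorem fderiv_hamOp_inY_ae (hl : Smooth I P.l) (hf : Smooth I P.f) (z : ZSp I nx nu np)
    (g : G3 I nx nu np ng) (w : YSp I ⊤ nx nu np) : ∀ᵐ t ∂I.μ,
      fderiv ℝ (hamOp hl hf) (z, g) (inY I nx nu np w, 0) t (traj w t) =
        hessOp hl hf (z, g) t (traj w t) (traj w t) := by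
  filter_upwards [fderiv_hamOp_left_ae hl hf z (inY I nx nu np w) g, hessOp_ae hl hf (z, g)]
    with t a1 a2
  refine (a1 (traj w t)).trans (Eq.trans ?_ (congrArg (fun M => M (traj w t) (traj w t)) a2.symm))
  exact (congrArg (P.Hyy g z t (traj w t) (traj w t) + ·) (inner_zero_left _)).trans (add_zero _)

/-- The second derivative of `lagr` is the quadratic form of the Hessians. -/
theorem hasDerivAt_lagrDeriv (hφ : ContDiff ℝ 2 P.φ) (hl : Smooth I P.l) (hf : Smooth I P.f)
    (z : ZSp I nx nu np) (g : G3 I nx nu np ng) (w : YSp I ⊤ nx nu np) (s : ℝ) :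
    HasDerivAt (lagrDeriv hl hf z g w)
      (quadForm I nx nu np (hessOp hl hf (z + s • inY I nx nu np w, g))
        (fderiv ℝ (fderiv ℝ P.φ) (final (z + s • inY I nx nu np w).y))
        (trajFinal I nx nu np w) (trajFinal I nx nu np w)) s := by
  have h1 := hasDerivAt_fderiv_line hφ (final z.y) (final w) s
  have h2 := hasDerivAt_clm_line_left (A := ZSp I nx nu np) (X := G3 I nx nu np ng)
    ((contDiff_hamOp hl hf).differentiable one_ne_zero) (trajPair w) z (inY I nx nu np w) g s
  refine (h1.add h2).congr_deriv (Eq.trans ?_ (quadForm_trajFinal _ _ w).symm)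
  have e0 : final z.y + s • final w = final (z + s • inY I nx nu np w).y := rfl
  exact congrArg₂ (· + ·) (congrArg (fun b => fderiv ℝ (fderiv ℝ P.φ) b (final w) (final w)) e0)
    ((trajPair_apply w _).trans (integral_congr_ae (fderiv_hamOp_inY_ae hl hf _ g w)))

end OCP

end Lagrangian

end OCPSens

namespace OCPSens

/-! ### Continuity of the second-order data -/

attribute [local instance] W1.instNormed W1.instNormedSp

section Abstract

variable {M V W B : Type*} [NormedAddCommGroup M] [NormedSpace ℝ M] [NormedAddCommGroup V]
  [NormedSpace ℝ V] [NormedAddCommGroup W] [NormedSpace ℝ W] [NormedAddCommGroup B]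
  [NormedSpace ℝ B]

theorem exists_abs_comp_sub_le (S : W →L[ℝ] V →L[ℝ] ℝ) (T : M →L[ℝ] V →L[ℝ] W) :
    ∃ C, 0 ≤ C ∧ ∀ (m m' : M) (Q Q' : B →L[ℝ] B →L[ℝ] ℝ) (v : V × B),
      |S (T m v.1) v.1 + Q v.2 v.2 - (S (T m' v.1) v.1 + Q' v.2 v.2)| ≤
        (C * ‖m - m'‖ + ‖Q - Q'‖) * ‖v‖ ^ 2 := by
  refine ⟨‖S‖ * ‖T‖, by positivity, fun m m' Q Q' v => ?_⟩
  have h1 : ‖v.1‖ ≤ ‖v‖ := norm_fst_le v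
  have h2 : ‖v.2‖ ≤ ‖v‖ := norm_snd_le v
  have h3 : |S (T (m - m') v.1) v.1| ≤ ‖S‖ * (‖T‖ * ‖m - m'‖ * ‖v‖) * ‖v‖ :=
    (S.le_opNorm₂ _ _).trans (by gcongr; exact (T.le_opNorm₂ _ _).trans (by gcongr))
  have h4 : |(Q - Q') v.2 v.2| ≤ ‖Q - Q'‖ * ‖v‖ * ‖v‖ :=
    ((Q - Q').le_opNorm₂ _ _).trans (by gcongr)
  have h5 : S (T m v.1) v.1 + Q v.2 v.2 - (S (T m' v.1) v.1 + Q' v.2 v.2) =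
      S (T (m - m') v.1) v.1 + (Q - Q') v.2 v.2 := by
    simp only [map_sub, sub_apply]
    ring
  rw [h5]
  refine (abs_add_le _ _).trans ((add_le_add h3 h4).trans (le_of_eq ?_))
  ring

theorem exists_norm_sub_le_of_continuous {F : V → W} (hF : Continuous F) (a : V) {δ : ℝ}
    (hδ : 0 < δ) : ∃ r > 0, ∀ a', dist a' a < r → ‖F a' - F a‖ ≤ δ := by
  obtain ⟨r, hr, h⟩ := Metric.continuousAt_iff.1 (hF.continuousAt (x := a)) δ hδ
  exact ⟨r, hr, fun a' ha => (dist_eq_norm (F a') (F a)) ▸ (h ha).le⟩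

theorem continuous_of_norm_sub_le {F : V → W} (hF : Continuous F) {h : V → B}
    (hh : ∀ w w', ‖h w - h w'‖ ≤ ‖F w - F w'‖) : Continuous h :=
  continuous_iff_continuousAt.2 fun w => tendsto_iff_norm_sub_tendsto_zero.2
    (squeeze_zero (fun _ => norm_nonneg _) (fun w' => hh w' w)
      (tendsto_iff_norm_sub_tendsto_zero.1 (hF.tendsto w)))

end Abstract

section LocalOptimality

variable {I : TimeInterval} {nx nu np ng : ℕ} {P : OCP nx nu np ng}

/-- The quadratic form depends Lipschitz continuously on the Hessians. -/
theorem exists_quadForm_sub_le (I : TimeInterval) (nx nu np : ℕ) : ∃ C, 0 ≤ C ∧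
    ∀ (M M' : Lp (YVec nx nu np →L[ℝ] YVec nx nu np →L[ℝ] ℝ) ⊤ I.μ)
      (Q Q' : (E nx × E np) →L[ℝ] (E nx × E np) →L[ℝ] ℝ) (v : TrajSp I nx nu np),
      |quadForm I nx nu np M Q v v - quadForm I nx nu np M' Q' v v| ≤
        (C * ‖M - M'‖ + ‖Q - Q'‖) * ‖v‖ ^ 2 := by
  obtain ⟨C, hC, h⟩ := exists_abs_comp_sub_le (B := E nx × E np) (pairL I (YVec nx nu np))
    (hessL I (YVec nx nu np))
  exact ⟨C, hC, fun M M' Q Q' v => (congrArg abs (congrArg₂ (· - ·) (quadForm_apply M Q v v)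
    (quadForm_apply M' Q' v v))).trans_le (h M M' Q Q' v)⟩

/-- The action of essentially bounded coefficients on square integrable functions. -/
noncomputable def coeffL (I : TimeInterval) (nx nu np : ℕ) :
    Lp (YVec nx nu np →L[ℝ] E nx) ⊤ I.μ →L[ℝ] Lp (YVec nx nu np) 2 I.μ →L[ℝ] Lp (E nx) 2 I.μ :=
  (ContinuousLinearMap.id ℝ (YVec nx nu np →L[ℝ] E nx)).holderL I.μ ⊤ 2 2

namespace OCP

/-- The Hessian of the Hamiltonian depends continuously on the point. -/
theorem continuous_hessOp (hl : Smooth I P.l) (hf : Smooth I P.f) :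
    Continuous fun w : ZSp I nx nu np × G3 I nx nu np ng => hessOp hl hf w :=
  continuous_of_norm_sub_le (V := ZSp I nx nu np × G3 I nx nu np ng)
    (W := YVec nx nu np →L[ℝ] Lp (YVec nx nu np →L[ℝ] ℝ) ⊤ I.μ)
    (B := Lp (YVec nx nu np →L[ℝ] YVec nx nu np →L[ℝ] ℝ) ⊤ I.μ)
    (continuous_hessCol hl hf) (norm_hessOp_sub_le hl hf)

theorem continuous_totDOp_trajZ (hf : Smooth I P.f) :
    Continuous fun w : ZSp I nx nu np × G3 I nx nu np ng =>
      totDOp hf (trajL I ⊤ nx nu np w.1.y, w.2) :=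
  (contDiff_totDOp hf).continuous.comp (trajZ I nx nu np ng).continuous

theorem continuous_hessian_final (hφ : ContDiff ℝ 2 P.φ) :
    Continuous fun z : ZSp I nx nu np => fderiv ℝ (fderiv ℝ P.φ) (final z.y) := by
  have h1 : Continuous fun z : ZSp I nx nu np => final z.y := by
    have h2 := ((finalL I ⊤ nx nu np).comp (ZSp.yL I nx nu np)).continuous
    exact h2.congr fun z => finalL_apply z.y
  exact ((hφ.fderiv_right (m := 1) (by norm_num)).continuous_fderiv one_ne_zero).comp h1

/-- The coefficients and Hessians are close to those at `(z, g)`, uniformly on a ball. -/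
theorem exists_ball_close (hφ : ContDiff ℝ 2 P.φ) (hl : Smooth I P.l) (hf : Smooth I P.f)
    (z : ZSp I nx nu np) (g : G3 I nx nu np ng) {δ : ℝ} (hδ : 0 < δ) :
    ∃ ρ > 0, ∀ z' ∈ Metric.ball z ρ, ∀ g' ∈ Metric.ball g ρ,
      ‖hessOp hl hf (z', g') - hessOp hl hf (z, g)‖ ≤ δ ∧
      ‖totDOp hf (trajL I ⊤ nx nu np z'.y, g') - totDOp hf (trajL I ⊤ nx nu np z.y, g)‖ ≤ δ ∧
      ‖fderiv ℝ (fderiv ℝ P.φ) (final z'.y) - fderiv ℝ (fderiv ℝ P.φ) (final z.y)‖ ≤ δ := by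
  obtain ⟨r₁, hr₁, k₁⟩ := exists_norm_sub_le_of_continuous
    (V := ZSp I nx nu np × G3 I nx nu np ng)
    (W := Lp (YVec nx nu np →L[ℝ] YVec nx nu np →L[ℝ] ℝ) ⊤ I.μ)
    (continuous_hessOp hl hf) (z, g) hδ
  obtain ⟨r₂, hr₂, k₂⟩ := exists_norm_sub_le_of_continuous
    (V := ZSp I nx nu np × G3 I nx nu np ng) (W := Lp (YVec nx nu np →L[ℝ] E nx) ⊤ I.μ)
    (continuous_totDOp_trajZ hf) (z, g) hδ
  obtain ⟨r₃, hr₃, k₃⟩ := exists_norm_sub_le_of_continuous (V := ZSp I nx nu np)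
    (W := (E nx × E np) →L[ℝ] (E nx × E np) →L[ℝ] ℝ)
    (continuous_hessian_final (P := P) hφ) z hδ
  refine ⟨min r₁ (min r₂ r₃), lt_min hr₁ (lt_min hr₂ hr₃), fun z' hz g' hg => ?_⟩
  rw [Metric.mem_ball] at hz hg
  have h4 : dist (z', g') (z, g) < min r₁ (min r₂ r₃) := max_lt hz hg
  exact ⟨k₁ (z', g') (h4.trans_le (min_le_left _ _)),
    k₂ (z', g') (h4.trans_le ((min_le_right _ _).trans (min_le_left _ _))),
    k₃ z' (hz.trans_le ((min_le_right _ _).trans (min_le_right _ _)))⟩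

/-- At a point satisfying the optimality system, the derivative of `lagr` is `∫ ⟪λ, w'⟫`: it cancels
with the term of the Lagrangian that is linear in `x'`. -/
theorem lagrDeriv_zero (hl : Smooth I P.l) (hf : Smooth I P.f) {z : ZSp I nx nu np}
    {g : G3 I nx nu np ng} (hz : P.KKT g z) {w : YSp I ⊤ nx nu np} (hw : w.1.val I.t₀ = 0) :
    lagrDeriv hl hf z g w 0 = costatePair z (W1.derL I ⊤ nx w.1) := by
  set h := hamOp hl hf (z, g) with hh
  have hH := hamOp_ae hl hf z g
  have e1 : ⟪z.lam.val I.tf, w.1.val I.tf⟫ =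
      ∫ t, (⟪z.lam.val t, w.1.der t⟫ - h t (w.1.val t, 0, 0)) ∂I.μ := by
    have h1 := W1.integral_inner z.lam w.1
    rw [hw, inner_zero_right, sub_zero] at h1
    rw [← h1]
    refine integral_congr_ae ?_
    filter_upwards [hz.costate, hH] with t h2 h3
    rw [h2, h3]
    ring
  have e2 : costatePair z (W1.derL I ⊤ nx w.1) = ∫ t, ⟪z.lam.val t, w.1.der t⟫ ∂I.μ :=
    (intL_apply _).trans (integral_congr_ae (costatePair_ae z _))
  have i1 : Integrable (fun t => ⟪z.lam.val t, w.1.der t⟫) I.μ :=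
    (Lp.integrable _).congr (costatePair_ae z (W1.derL I ⊤ nx w.1))
  have i2 : Integrable (fun t => h t (traj w t)) I.μ := (Lp.integrable _).congr (trajPair_ae w h)
  have i3 : Integrable (fun t => h t (0, 0, w.2.2)) I.μ :=
    (Lp.integrable h).apply_continuousLinearMap _
  -- the control component does not contribute, by stationarity
  have e3 : ∀ᵐ t ∂I.μ, h t (w.1.val t, 0, 0) = h t (traj w t) - h t (0, 0, w.2.2) := by
    filter_upwards [hz.control, hH] with t h2 h3
    have h4 : h t (0, w.2.1 t, 0) = 0 := by rw [h3, ← h2]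
    have h5 : traj w t = (w.1.val t, 0, 0) + (0, w.2.1 t, 0) + ((0, 0, w.2.2) : YVec nx nu np) := by
      simp [traj]
    rw [h5, map_add, map_add, h4]
    ring
  have e4 : fderiv ℝ P.φ (final z.y) (0, w.2.2) + ∫ t, h t (0, 0, w.2.2) ∂I.μ = 0 := by
    rw [hz.param w.2.2]
    congr 1
    exact integral_congr_ae (hH.mono fun t h2 => h2 _)
  have e5 : ⟪z.lam.val I.tf, w.1.val I.tf⟫ =
      ∫ t, ⟪z.lam.val t, w.1.der t⟫ ∂I.μ - (∫ t, h t (traj w t) ∂I.μ -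
        ∫ t, h t (0, 0, w.2.2) ∂I.μ) := by
    rw [← integral_sub i2 i3]
    refine e1.trans (Eq.trans ?_ (integral_sub i1 (i2.sub i3)))
    refine integral_congr_ae ?_
    filter_upwards [e3] with t h1
    rw [h1]
  have e6 : fderiv ℝ P.φ (final z.y) (final w) = ⟪z.lam.val I.tf, w.1.val I.tf⟫ +
      fderiv ℝ P.φ (final z.y) (0, w.2.2) := by
    rw [hz.terminal, ← map_add]
    simp [final]
  rw [lagrDeriv, zero_smul, zero_smul, add_zero, add_zero, trajPair_apply, e2, e6]
  linarith

end OCP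

end LocalOptimality

end OCPSens

namespace OCPSens

attribute [local instance] W1.instNormed W1.instNormedSp

theorem exists_norm_apply₂_le {A B C : Type*} [NormedAddCommGroup A] [NormedSpace ℝ A]
    [NormedAddCommGroup B] [NormedSpace ℝ B] [NormedAddCommGroup C] [NormedSpace ℝ C]
    (T : A →L[ℝ] B →L[ℝ] C) : ∃ c, 0 ≤ c ∧ ∀ a b, ‖T a b‖ ≤ c * ‖a‖ * ‖b‖ :=
  ⟨‖T‖, norm_nonneg T, T.le_opNorm₂⟩

/-! ### Local optimality -/

section LocalMinimum

variable {I : TimeInterval} {nx nu np ng : ℕ} {P : OCP nx nu np ng}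

namespace OCP

/-- The derivative of the right-hand side of the state equation, as an element of `L²`. -/
theorem incl_fderiv_compOp (hf : Smooth I P.f) (z : ZSp I nx nu np) (g : G3 I nx nu np ng)
    (w : YSp I ⊤ nx nu np) :
    Lp.incl (le_top : (2 : ℝ≥0∞) ≤ ⊤)
      (fderiv ℝ (compOp hf) (trajL I ⊤ nx nu np z.y, g) (trajL I ⊤ nx nu np w, 0)) =
    coeffL I nx nu np (totDOp hf (trajL I ⊤ nx nu np z.y, g)) (trajFinal I nx nu np w).1 := by
  have e0 : (trajFinal I nx nu np w).1 = Lp.incl le_top (trajL I ⊤ nx nu np w) := rfl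
  rw [e0]
  refine Lp.ext ?_
  filter_upwards [Lp.incl_ae (le_top : (2 : ℝ≥0∞) ≤ ⊤)
      (fderiv ℝ (compOp hf) (trajL I ⊤ nx nu np z.y, g) (trajL I ⊤ nx nu np w, 0)),
    fderiv_compOp_left_ae hf z (inY I nx nu np w) g,
    id_holderL_ae (totDOp hf (trajL I ⊤ nx nu np z.y, g)) (Lp.incl le_top (trajL I ⊤ nx nu np w)),
    Lp.incl_ae (le_top : (2 : ℝ≥0∞) ≤ ⊤) (trajL I ⊤ nx nu np w), trajL_ae w,
    totDOp_ABC_ae hf g z] with t e1 e2 e3 e4 e5 e6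
  exact e1.trans (e2.trans (e3.trans (congrArg₂ (fun (K : YVec nx nu np →L[ℝ] E nx) v => K v) e6
    (e4.trans e5))).symm)

set_option maxHeartbeats 1000000 in
/-- The linearized state equation holds along the difference of two feasible points up to a
relatively small error `r`, measured in `L²`: a Lipschitz estimate in `L^∞` for the coefficients
gives a bound relative to the `L²` norm of the difference. -/
theorem exists_residual (hf : Smooth I P.f) {z : ZSp I nx nu np} {g : G3 I nx nu np ng}
    {y : YSp I ⊤ nx nu np} (hz : z.y ∈ P.feasible g) (hy : y ∈ P.feasible g)
    (K : Lp (YVec nx nu np →L[ℝ] E nx) ⊤ I.μ) {c δ : ℝ} (hc : 0 ≤ c)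
    (hcL : ∀ K v, ‖coeffL I nx nu np K v‖ ≤ c * ‖K‖ * ‖v‖)
    (hK : ∀ s ∈ Icc (0 : ℝ) 1, ‖totDOp hf
      (trajL I ⊤ nx nu np (z + s • inY I nx nu np (y - z.y)).y, g) - K‖ ≤ δ) :
    W1.derL I ⊤ nx (y - z.y).1 = compOp hf (trajL I ⊤ nx nu np y, g) -
      compOp hf (trajL I ⊤ nx nu np z.y, g) ∧
    ∃ r : Lp (E nx) 2 I.μ,
      (∀ᵐ t ∂I.μ, (y - z.y).1.der t = K t (traj (y - z.y) t) + r t) ∧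
      ‖r‖ ≤ c * δ * ‖trajFinal I nx nu np (y - z.y)‖ := by
  set w := y - z.y with hw
  have hsub : W1.derL I ⊤ nx w.1 = W1.derL I ⊤ nx y.1 - W1.derL I ⊤ nx z.y.1 := rfl
  have hder : ∀ y' : YSp I ⊤ nx nu np, y' ∈ P.feasible g →
      W1.derL I ⊤ nx y'.1 = compOp hf (trajL I ⊤ nx nu np y', g) := fun y' hy' => by
    refine Lp.ext ?_
    filter_upwards [hy'.1, compOp_traj_ae hf y' g] with t e1 e2
    rw [e2, ← e1]
    rfl
  have h1 : W1.derL I ⊤ nx w.1 = compOp hf (trajL I ⊤ nx nu np y, g) -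
      compOp hf (trajL I ⊤ nx nu np z.y, g) := by
    rw [hsub, hder y hy, hder z.y hz]
  refine ⟨h1, Lp.incl le_top (W1.derL I ⊤ nx w.1) -
    coeffL I nx nu np K (trajFinal I nx nu np w).1, ?_, ?_⟩
  · have e0 : (trajFinal I nx nu np w).1 = Lp.incl le_top (trajL I ⊤ nx nu np w) := rfl
    rw [e0]
    filter_upwards [Lp.coeFn_sub (Lp.incl (le_top : (2 : ℝ≥0∞) ≤ ⊤) (W1.derL I ⊤ nx w.1))
        (coeffL I nx nu np K (Lp.incl le_top (trajL I ⊤ nx nu np w))),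
      Lp.incl_ae (le_top : (2 : ℝ≥0∞) ≤ ⊤) (W1.derL I ⊤ nx w.1),
      id_holderL_ae K (Lp.incl le_top (trajL I ⊤ nx nu np w)),
      Lp.incl_ae (le_top : (2 : ℝ≥0∞) ≤ ⊤) (trajL I ⊤ nx nu np w), trajL_ae w]
      with t e1 e2 e3 e4 e5
    have e6 := e1.trans (congrArg₂ (· - ·) e2 (e3.trans (congrArg (K t) (e4.trans e5))))
    exact ((congrArg (K t (traj w t) + ·) e6).trans (add_sub_cancel _ _)).symm
  · have h2 := norm_sub_sub_le_of_line (A := Lp (YVec nx nu np) ⊤ I.μ) (X := G3 I nx nu np ng)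
      ((contDiff_compOp hf).differentiable one_ne_zero)
      (Lp.incl (le_top : (2 : ℝ≥0∞) ≤ ⊤)) (trajL I ⊤ nx nu np z.y)
      (trajL I ⊤ nx nu np w) g (coeffL I nx nu np K (trajFinal I nx nu np w).1)
      (κ := c * δ * ‖trajFinal I nx nu np w‖) fun s hs => by
        have e0 : trajL I ⊤ nx nu np z.y + s • trajL I ⊤ nx nu np w =
            trajL I ⊤ nx nu np (z + s • inY I nx nu np w).y := by
          rw [add_smul_inY_y, map_add, map_smul]
        rw [e0, incl_fderiv_compOp, ← sub_apply, ← map_sub]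
        refine (hcL _ _).trans ?_
        exact mul_le_mul (mul_le_mul_of_nonneg_left (hK s hs) hc) (norm_fst_le _) (norm_nonneg _)
          (mul_nonneg hc ((norm_nonneg _).trans (hK s hs)))
    have e1 : trajL I ⊤ nx nu np z.y + trajL I ⊤ nx nu np w = trajL I ⊤ nx nu np y := by
      rw [hw, map_sub, add_sub_cancel]
    have e2 : Lp.incl (le_top : (2 : ℝ≥0∞) ≤ ⊤) (W1.derL I ⊤ nx w.1) =
        Lp.incl le_top (compOp hf (trajL I ⊤ nx nu np y, g)) -
          Lp.incl le_top (compOp hf (trajL I ⊤ nx nu np z.y, g)) :=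
      (congrArg _ h1).trans (ContinuousLinearMap.map_sub _ _ _)
    rw [e1] at h2
    rw [e2]
    exact h2

/-- The increment of `lagr` consists of the cost difference and the increment of the dynamics,
paired with the costate. -/
theorem lagr_one_sub_lagr_zero (hl : Smooth I P.l) (hf : Smooth I P.f) (z : ZSp I nx nu np)
    (g : G3 I nx nu np ng) (y : YSp I ⊤ nx nu np) :
    lagr hl hf z g (y - z.y) 1 - lagr hl hf z g (y - z.y) 0 =
      bolza I P.φ P.l (y, g) - bolza I P.φ P.l (z.y, g) +
        costatePair z (compOp hf (trajL I ⊤ nx nu np y, g) -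
          compOp hf (trajL I ⊤ nx nu np z.y, g)) := by
  have e1 : trajL I ⊤ nx nu np z.y + trajL I ⊤ nx nu np (y - z.y) = trajL I ⊤ nx nu np y := by
    rw [map_sub, add_sub_cancel]
  have e2 : final z.y + final (y - z.y) = final y := by
    rw [← finalL_apply, ← finalL_apply, ← finalL_apply, map_sub, add_sub_cancel]
  have e3 : ∀ y' : YSp I ⊤ nx nu np, bolza I P.φ P.l (y', g) =
      P.φ (final y') + intL I ℝ (compOp hl (trajL I ⊤ nx nu np y', g)) := fun y' => by
    rw [bolza_eq hl, ← finalL_apply y']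
    rfl
  rw [lagr, lagr, one_smul, one_smul, zero_smul, zero_smul, add_zero, add_zero, e1, e2, e3, e3,
    map_sub]
  ring

/-- Points satisfying the optimality system near a point with the second-order sufficient condition
are minimizers on a uniform neighborhood. -/
theorem exists_ball_bolza_le (hφ : ContDiff ℝ 2 P.φ) (hl : Smooth I P.l) (hf : Smooth I P.f)
    {zbar : ZSp I nx nu np} {gbar : G3 I nx nu np ng} (hS : P.SSOC gbar zbar) :
    ∃ ρ > 0, ∀ g ∈ Metric.ball gbar ρ, ∀ z ∈ Metric.ball zbar ρ, P.KKT g z →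
      ∀ y ∈ P.feasible g, z + inY I nx nu np (y - z.y) ∈ Metric.ball zbar ρ →
        bolza I P.φ P.l (z.y, g) ≤ bolza I P.φ P.l (y, g) := by
  obtain ⟨ε, hε, θ, hθ, hcoer⟩ := (lqData hl hf hS).exists_coercive_near
  obtain ⟨C, hC, hquad⟩ := exists_quadForm_sub_le I nx nu np
  obtain ⟨c, hc, hcL⟩ := exists_norm_apply₂_le (coeffL I nx nu np)
  -- `δ` bounds the deviation of the coefficients and Hessians: `(C + 1) δ ≤ ε` keeps the quadratic
  -- form nonnegative, `c δ ≤ θ` makes the residual of the linearized state equation small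
  set δ := min (ε / (C + 1)) (θ / (c + 1)) with hδ
  have hδ0 : 0 < δ := lt_min (by positivity) (by positivity)
  have hδ1 : C * δ + δ ≤ ε := by
    have h := min_le_left (ε / (C + 1)) (θ / (c + 1))
    rw [← hδ, le_div_iff₀ (by positivity)] at h
    linarith
  have hδ2 : c * δ ≤ θ := by
    have h := min_le_right (ε / (C + 1)) (θ / (c + 1))
    rw [← hδ, le_div_iff₀ (by positivity)] at h
    linarith
  obtain ⟨ρ, hρ, hclose⟩ := exists_ball_close hφ hl hf zbar gbar hδ0
  refine ⟨ρ, hρ, fun g hg z hz hK y hy hzy => ?_⟩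
  have hzs : ∀ s ∈ Icc (0 : ℝ) 1, z + s • inY I nx nu np (y - z.y) ∈ Metric.ball zbar ρ :=
    fun s hs => (convex_ball zbar ρ).add_smul_mem hz hzy hs
  have hw0 : (y - z.y).1.val I.t₀ = 0 := by
    have h1 : (y - z.y).1.val I.t₀ = y.1.val I.t₀ - z.y.1.val I.t₀ := rfl
    rw [h1, hy.2, hK.init, sub_self]
  obtain ⟨hder, r, hr, hrle⟩ := exists_residual hf ⟨hK.state, hK.init⟩ hy (lqData hl hf hS).K hc hcL
    fun s hs => (hclose _ (hzs s hs) g hg).2.1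
  have hpos := hcoer (y - z.y) r hw0 hr
    (hrle.trans (mul_le_mul_of_nonneg_right hδ2 (norm_nonneg _)))
  have h1 := deriv_zero_le_sub_of_second_deriv_nonneg
    (hasDerivAt_lagr hφ hl hf z g (y - z.y)) (hasDerivAt_lagrDeriv hφ hl hf z g (y - z.y))
    fun s hs => by
      obtain ⟨k1, -, k3⟩ := hclose _ (hzs s hs) g hg
      have h2 := (abs_le.1 (hquad (hessOp hl hf (z + s • inY I nx nu np (y - z.y), g))
        (lqData hl hf hS).M (fderiv ℝ (fderiv ℝ P.φ)
          (final (z + s • inY I nx nu np (y - z.y)).y)) (lqData hl hf hS).Q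
        (trajFinal I nx nu np (y - z.y)))).1
      have h3 : C * ‖hessOp hl hf (z + s • inY I nx nu np (y - z.y), g) -
          (lqData hl hf hS).M‖ + ‖fderiv ℝ (fderiv ℝ P.φ)
          (final (z + s • inY I nx nu np (y - z.y)).y) - (lqData hl hf hS).Q‖ ≤ ε :=
        (add_le_add (mul_le_mul_of_nonneg_left k1 hC) k3).trans hδ1
      have h4 := mul_le_mul_of_nonneg_right h3 (sq_nonneg ‖trajFinal I nx nu np (y - z.y)‖)
      linarith
  rw [lagrDeriv_zero hl hf hK hw0, lagr_one_sub_lagr_zero, ← hder] at h1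
  linarith

end OCP

end LocalMinimum

end OCPSens

/-! ### Differentiability of the solution map and of reduced functionals -/

section Abstract

variable {Z Y X T : Type*} [NormedAddCommGroup Z] [NormedSpace ℝ Z] [NormedAddCommGroup Y]
  [NormedSpace ℝ Y] [NormedAddCommGroup X] [NormedSpace ℝ X] [NormedAddCommGroup T]
  [NormedSpace ℝ T]

theorem HasFDerivAt.fderiv_comp_inl_eq {Ψ : Z × X → T} {Ψ' : Z × X →L[ℝ] T} {w : Z × X}
    (h : HasFDerivAt Ψ Ψ' w) (e : Z ≃L[ℝ] T) (he : ∀ δz, e δz = Ψ' (δz, 0)) :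
    (fderiv ℝ Ψ w).comp (.inl ℝ Z X) = e := by
  rw [h.fderiv]
  exact ContinuousLinearMap.ext fun δz => (he δz).symm

/-- Differentiation of `Ψ (z x, x) = 0`. -/
theorem fderiv_solution_map {Ψ : Z × X → T} {Ψ' : Z × X →L[ℝ] T} {z : X → Z} {U : Set X} {x₀ : X}
    {z₀ : Z} (hU : IsOpen U) (hx : x₀ ∈ U) (hz₀ : z x₀ = z₀) (hz : ContDiffOn ℝ 1 z U)
    (hΨ : HasFDerivAt Ψ Ψ' (z₀, x₀)) (h0 : ∀ x ∈ U, Ψ (z x, x) = 0) (v : X) :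
    Ψ' (fderiv ℝ z x₀ v, v) = 0 := by
  subst hz₀
  have h1 : HasFDerivAt z (fderiv ℝ z x₀) x₀ :=
    ((hz.contDiffAt (hU.mem_nhds hx)).differentiableAt one_ne_zero).hasFDerivAt
  have h2 := HasFDerivAt.comp (f := fun x => (z x, x)) x₀ hΨ (h1.prodMk (hasFDerivAt_id x₀))
  have h3 : HasFDerivAt (fun x => Ψ (z x, x)) (0 : X →L[ℝ] T) x₀ :=
    (hasFDerivAt_const (0 : T) x₀).congr_of_eventuallyEq
      (Filter.eventually_of_mem (hU.mem_nhds hx) h0)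
  exact congrArg (fun L : X →L[ℝ] T => L v) (h2.unique h3)

theorem contDiffOn_reduced {b : Y × X → ℝ} {z : X → Z} {U : Set X} (hb : ContDiff ℝ 1 b)
    (L : Z →L[ℝ] Y) (hz : ContDiffOn ℝ 1 z U) : ContDiffOn ℝ 1 (fun x => b (L (z x), x)) U :=
  hb.comp_contDiffOn ((L.contDiff.comp_contDiffOn hz).prodMk contDiffOn_id)

theorem fderiv_reduced {b : Y × X → ℝ} {z : X → Z} {U : Set X} (hb : ContDiff ℝ 1 b)
    (L : Z →L[ℝ] Y) (hz : ContDiffOn ℝ 1 z U) (hU : IsOpen U) {x₀ : X} (hx : x₀ ∈ U) {z₀ : Z}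
    (hz₀ : z x₀ = z₀) (v : X) : fderiv ℝ (fun x => b (L (z x), x)) x₀ v =
      fderiv ℝ b (L z₀, x₀) (L (fderiv ℝ z x₀ v), v) := by
  subst hz₀
  have h1 : HasFDerivAt z (fderiv ℝ z x₀) x₀ :=
    ((hz.contDiffAt (hU.mem_nhds hx)).differentiableAt one_ne_zero).hasFDerivAt
  have h2 := HasFDerivAt.comp (f := fun x => (L (z x), x)) x₀
    (hb.differentiable one_ne_zero (L (z x₀), x₀)).hasFDerivAt
    ((L.hasFDerivAt.comp x₀ h1).prodMk (hasFDerivAt_id x₀))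
  exact congrArg (fun T : X →L[ℝ] ℝ => T v) h2.fderiv

end Abstract

namespace OCPSens

attribute [local instance] W1.instNormed W1.instNormedSp

section SolutionMap

variable {I : TimeInterval} {nx nu np ng : ℕ} {P : OCP nx nu np ng}

namespace OCP

/-- Minimality over the feasible points `y` for which `(y, λ)` lies in a ball around `zbar`, with the
costate `λ` of `z`, is local minimality. -/
theorem isLocalSolution_of_ball {g : G3 I nx nu np ng} {z zbar : ZSp I nx nu np} {ρ : ℝ}
    (hK : P.KKT g z) (hz : z ∈ Metric.ball zbar ρ)
    (h : ∀ y ∈ P.feasible g, z + inY I nx nu np (y - z.y) ∈ Metric.ball zbar ρ →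
      bolza I P.φ P.l (z.y, g) ≤ bolza I P.φ P.l (y, g)) : P.IsLocalSolution g z.y := by
  refine ⟨⟨hK.state, hK.init⟩, ?_⟩
  have hc : Continuous fun y : YSp I ⊤ nx nu np => z + inY I nx nu np (y - z.y) :=
    continuous_const.add ((inY I nx nu np).continuous.comp (continuous_id.sub continuous_const))
  have h1 : z + inY I nx nu np (z.y - z.y) ∈ Metric.ball zbar ρ := by
    rwa [sub_self, map_zero, add_zero]
  have h2 := hc.continuousAt.eventually (Metric.isOpen_ball.mem_nhds h1)
  filter_upwards [mem_nhdsWithin_of_mem_nhds h2, self_mem_nhdsWithin] with y h3 h4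
  exact h y h4 h3

/-- Uniqueness for the sensitivity system. -/
theorem eq_of_sensitivity (hφ : ContDiff ℝ 2 P.φ) (hl : Smooth I P.l) (hf : Smooth I P.f)
    {g δg : G3 I nx nu np ng} {z δz δz' : ZSp I nx nu np} (hS : P.SSOC g z)
    (h : P.Sensitivity g z δg δz) (h' : P.Sensitivity g z δg δz') : δz' = δz := by
  obtain ⟨e, he⟩ := exists_kktDeriv_equiv hφ hl hf hS
  rw [sensitivity_iff hφ hl hf] at h h'
  have h1 : ((δz' - δz, 0) : ZSp I nx nu np × G3 I nx nu np ng) = (δz', δg) - (δz, δg) :=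
    Prod.ext rfl (sub_self δg).symm
  have h2 : e (δz' - δz) = 0 := by
    rw [he, h1, ContinuousLinearMap.map_sub, h, h', sub_self]
  exact sub_eq_zero.1 (e.map_eq_zero_iff.1 h2)

/-- The solution map of the optimality system and its properties. -/
theorem exists_solution_map (hφ : ContDiff ℝ 2 P.φ) (hl : Smooth I P.l) (hf : Smooth I P.f)
    {zbar : ZSp I nx nu np} {gbar : G3 I nx nu np ng} (hK : P.KKT gbar zbar)
    (hS : P.SSOC gbar zbar) :
    ∃ (Ng : Set (G3 I nx nu np ng)) (Nz : Set (ZSp I nx nu np))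
      (z : G3 I nx nu np ng → ZSp I nx nu np),
      IsOpen Ng ∧ gbar ∈ Ng ∧ IsOpen Nz ∧ zbar ∈ Nz ∧ z gbar = zbar ∧ ContDiffOn ℝ 1 z Ng ∧
      (∀ g ∈ Ng, z g ∈ Nz ∧ P.KKT g (z g) ∧ (∀ z' ∈ Nz, P.KKT g z' → z' = z g) ∧
        P.IsLocalSolution g (z g).y) ∧
      ∀ δg, P.Sensitivity gbar zbar δg (fderiv ℝ z gbar δg) := by
  obtain ⟨ρ, hρ, hmin⟩ := exists_ball_bolza_le hφ hl hf hS
  obtain ⟨e, he⟩ := exists_kktDeriv_equiv hφ hl hf hS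
  have hc := completeSpace_ZSp (I := I) (nx := nx) (nu := nu) (np := np)
  have hd := hasFDerivAt_kktOp hφ hl hf (zbar, gbar)
  obtain ⟨Ng, Nz, z, h1, h2, h3, h4, h5, h6, h7, h8, h9⟩ := exists_implicit_function
    (Z := ZSp I nx nu np) (X := G3 I nx nu np ng) (contDiff_kktOp hφ hl hf)
    ((kkt_iff_kktOp_eq_zero hl hf zbar gbar).1 hK) e (hd.fderiv_comp_inl_eq e he) hρ
  refine ⟨Ng, Nz, z, h1, h2, h3, h4, h7, h8, fun g hg => ?_, fun δg => ?_⟩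
  · obtain ⟨k1, k2, k3⟩ := h9 g hg
    have hKg := (kkt_iff_kktOp_eq_zero hl hf (z g) g).2 k2
    exact ⟨k1, hKg, fun z' hz' hK' => k3 z' hz' ((kkt_iff_kktOp_eq_zero hl hf z' g).1 hK'),
      isLocalSolution_of_ball hKg (h6 k1) (hmin g (h5 hg) (z g) (h6 k1) hKg)⟩
  · rw [sensitivity_iff hφ hl hf]
    exact fderiv_solution_map (Z := ZSp I nx nu np) (X := G3 I nx nu np ng) h1 h2 h7 h8 hd
      (fun g hg => (h9 g hg).2.1) δg

end OCP

end SolutionMap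

end OCPSens

theorem mainTheorem3 {nx nu np ng : ℕ} (I : TimeInterval)
    (φ : E nx × E np → ℝ) (l : ℝ → YVec nx nu np × E ng → ℝ)
    (hφ : ContDiff ℝ 2 φ) (hl : Smooth I l) :
    -- the quantity of interest is well defined and continuously differentiable
    (∀ (y : YSp I ⊤ nx nu np) (g : G3 I nx nu np ng),
      Integrable (fun t => l t (traj y t, g.rep t (traj y t))) I.μ) ∧
    ContDiff ℝ 1 (bolza (ng := ng) I φ l) ∧
    -- its derivative
    (∀ (y : YSp I ⊤ nx nu np) (g : G3 I nx nu np ng)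
        (δy : YSp I ⊤ nx nu np) (δg : G3 I nx nu np ng),
      Integrable (bolzaDerivIntegrand l y g δy δg) I.μ ∧
      fderiv ℝ (bolza I φ l) (y, g) (δy, δg) =
        fderiv ℝ φ (final y) (δy.1.val I.tf, 0) + fderiv ℝ φ (final y) (0, δy.2.2)
          + ∫ t, bolzaDerivIntegrand l y g δy δg t ∂I.μ) ∧
    -- the reduced quantity of interest
    ∀ (P : OCP nx nu np ng), ContDiff ℝ 2 P.φ → Smooth I P.l → Smooth I P.f →
      ∀ (zbar : ZSp I nx nu np) (gbar : G3 I nx nu np ng),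
        P.KKT gbar zbar → P.SSOC gbar zbar →
        ∃ (Ng : Set (G3 I nx nu np ng)) (Nz : Set (ZSp I nx nu np))
          (z : G3 I nx nu np ng → ZSp I nx nu np),
          IsOpen Ng ∧ gbar ∈ Ng ∧ IsOpen Nz ∧ zbar ∈ Nz ∧
          -- `z` is the solution map of the optimal control problem
          z gbar = zbar ∧ ContDiffOn ℝ 1 z Ng ∧
          (∀ g ∈ Ng, z g ∈ Nz ∧ P.KKT g (z g) ∧ (∀ z' ∈ Nz, P.KKT g z' → z' = z g) ∧
            P.IsLocalSolution g (z g).y) ∧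
          -- the reduced quantity of interest is continuously differentiable
          ContDiffOn ℝ 1 (fun g => bolza I φ l ((z g).y, g)) Ng ∧
          -- its derivative at `gbar`
          ∀ δg : G3 I nx nu np ng, ∃ δz : ZSp I nx nu np,
            P.Sensitivity gbar zbar δg δz ∧
            (∀ δz', P.Sensitivity gbar zbar δg δz' → δz' = δz) ∧
            fderiv ℝ z gbar δg = δz ∧
            fderiv ℝ (fun g => bolza I φ l ((z g).y, g)) gbar δg =
              fderiv ℝ (bolza I φ l) (zbar.y, gbar) (δz.y, δg) := by
  have hb : ContDiff ℝ 1 (bolza (ng := ng) I φ l) := contDiff_bolza hφ hl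
  refine ⟨integrable_running hl, hb, fun y g δy δg => ?_, fun P hφP hlP hfP zbar gbar hK hS => ?_⟩
  · obtain ⟨h1, h2⟩ := fderiv_bolza hφ hl y δy g δg
    refine ⟨h1, ?_⟩
    rw [h2, ← map_add, Prod.mk_add_mk, add_zero, zero_add]
    rfl
  · obtain ⟨Ng, Nz, z, h1, h2, h3, h4, h5, h6, h7, h8⟩ :=
      OCP.exists_solution_map hφP hlP hfP hK hS
    exact ⟨Ng, Nz, z, h1, h2, h3, h4, h5, h6, h7,
      contDiffOn_reduced (Z := ZSp I nx nu np) (Y := YSp I ⊤ nx nu np) hb (ZSp.yL I nx nu np) h6,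
      fun δg => ⟨fderiv ℝ z gbar δg, h8 δg,
        fun δz' h' => OCP.eq_of_sensitivity hφP hlP hfP hS (h8 δg) h', rfl,
        fderiv_reduced (Z := ZSp I nx nu np) (Y := YSp I ⊤ nx nu np) hb (ZSp.yL I nx nu np) h6 h1
          h2 h5 δg⟩⟩
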